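/- Let $G$ be a split semisimple linear algebraic group with split maximal torus $T$, character lattice $T^*$, root system $\Sigma=\Sigma^+\amalg\Sigma^-$, simple roots $\Theta$ and Weyl group $W$. Let $F$ be a commutative one-dimensional formal group law over a commutative ring $R$, and let $S$ be the formal group algebra: the quotient of the completion of $R[x_\lambda]_{\lambda\in T^*}$ along the augmentation ideal by the closure of the ideal of relations $x_0=0$, $x_{\lambda+\mu}=F(x_\lambda,x_\mu)$; if $F(x,y)=x+y-\beta xy$ is additive or multiplicative, $S$ may also be the quotient of the polynomial ring $R[x_\lambda]_{\lambda\in T^*}$ by these relations. Assume that $S$ is $\Sigma$-regular, i.e. no $x_\alpha$, $\alpha\in\Sigma$, is a zero divisor. Let $\mathcal Q=S[1/x_\alpha,\ \alpha\in\Sigma]$ and let $\mathcal Q_W$ be the twisted group algebra, with $\mathcal Q$-basis $\delta_w$ $(w\in W)$ and $\delta_w q=w(q)\delta_w$. Let $\mathbf D_F\subseteq \mathcal Q_W$ be the formal affine Demazure algebra, i.e. the subalgebra generated by $S$ and by $\frac1{x_{-\alpha}}+\frac1{x_\alpha}\delta_{s_\alpha}$ for all simple roots $\alpha$. For a standard parabolic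 subgroup $P$ with set of simple roots $\Theta_P\subseteq\Theta$, let $W_P=\langle s_\alpha:\alpha\in\Theta_P\rangle$, let $\mathbb D_{F,P}$ be the image of $\mathbf D_F$ in the free module $\mathcal Q_{W/W_P}$ with basis $\delta_{\bar w}$, and let $\mathbb D_{F,P}^\star=\mathrm{Hom}_S(\mathbb D_{F,P},S)$, viewed inside $\mathcal Q_{W/W_P}^*=\{f\colon W/W_P\to \mathcal Q\}$ with dual basis $f_{\bar v}$. Write $\mathbf D_F^\star$ for the case $W_P=1$. Let $\mathcal Q_W$ act by $(p\delta_w)\odot(qf_{\bar v})=p\,w(q)f_{\overline{wv}}$, and on $\mathcal Q_W^*$ also by the Hecke action $(q\delta_w)\bullet(pf_v)=p\,vw^{-1}(q)f_{vw^{-1}}$. Let $P$, $Q$ be two standard parabolic subgroups. Put $x_Q=\prod_{\alpha\in\Sigma^-\setminus\Sigma_Q}x_\alpha$, where $\Sigma_Q$ is the root subsystem generated by $\Theta_Q$, and $[pt_Q]=x_Qf_{\bar e}$ and $[pt_{\bar w}]=\delta_w\odot[pt_Q]$ for $\bar w\in W/W_Q$ (the classes of the $T$-fixed points of $G/Q$).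 Then $\mathbb D^\star_{F,Q}$ and $\mathbb D^\star_{F,P}$ are $\mathbf D_F$-submodules for $\odot$; the classes $[pt_{u}]$, $u\in W/W_Q$, are well defined and lie in $\mathbb D_{F,Q}^\star$; and the set ${}^{W_Q}\mathbb D_{F,P}^\star$ of elements of $\mathbb D_{F,P}^\star$ fixed by $\delta_w\odot-$ for all $w\in W_Q$ is a ring under the pointwise operations, identified by pull-back along $W\to W/W_P$ with the set ${}^{W_Q}(\mathbf D_F^\star)^{W_P}$ of elements of $\mathbf D_F^\star$ that are invariant under $W_Q$ for $\odot$ and under $W_P$ for $\bullet$. The group $\mathrm{Hom}_{\mathbf D_F}(\mathbb D_{F,Q}^\star,\mathbb D_{F,P}^\star)$ is a commutative ring for the coordinatewise product, i.e. the one for which the map sending $\phi$ to the family $a_\phi(u,y)=\phi([pt_u])(y)$, $(u,y)\in W/W_Q\times W/W_P$, is an injective ring homomorphism into the ring of all such families of elements of $\mathcal Q$ with pointwise operations; here $\phi$ is recovered as the correspondence $\phi(f)(y)=\sum_{u}a_\phi(u,y)f(u)/[pt_u](u)$. With this ring structure, $$\mathrm{Hom}_{\mathbf D_F}(\mathbb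 D_{F,Q}^\star,\mathbb D_{F,P}^\star)\;\longrightarrow\;{}^{W_Q}\mathbb D_{F,P}^\star={}^{W_Q}(\mathbf D_F^\star)^{W_P},\qquad \phi\mapsto\phi([pt_Q]),$$ is an isomorphism of rings. -/

import Mathlib

noncomputable section

/-! ## Formal group algebras -/

namespace FormalGroupAlgebra

section Series

variable (R M : Type*) [CommRing R]

/-- The completion of the polynomial ring `R[x_l]`, `l ∈ M`, along the kernel of the augmentation
`x_l ↦ 0`, realised as the ring of those power series in the variables `x_l` that
have only finitely many terms in each degree. (For infinite `M` this is smaller than the ring of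
all power series.) -/
def completedPolynomials : Subring (MvPowerSeries M R) where
  carrier := {f | ∀ n : ℕ, {d : M →₀ ℕ | d.degree < n ∧ MvPowerSeries.coeff d f ≠ 0}.Finite}
  zero_mem' := by intro n; simp
  one_mem' := by
    classical
    intro n
    refine (Set.finite_singleton (0 : M →₀ ℕ)).subset ?_
    rintro d ⟨-, hd⟩
    by_contra h
    rw [Set.mem_singleton_iff] at h
    exact hd (by rw [MvPowerSeries.coeff_one, if_neg h])
  add_mem' := by
    intro f g hf hg n
    refine ((hf n).union (hg n)).subset ?_
    rintro d ⟨hn, hd⟩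
    by_cases h : MvPowerSeries.coeff d f = 0
    · exact Or.inr ⟨hn, fun h' => hd (by rw [map_add, h, h', add_zero])⟩
    · exact Or.inl ⟨hn, h⟩
  neg_mem' := by
    intro f hf n
    refine (hf n).subset ?_
    rintro d ⟨hn, hd⟩
    exact ⟨hn, fun h => hd (by rw [map_neg, h, neg_zero])⟩
  mul_mem' := by
    classical
    intro f g hf hg n
    refine (Set.Finite.image2 (fun a b : M →₀ ℕ => a + b) (hf n) (hg n)).subset ?_
    rintro d ⟨hn, hd⟩
    rw [MvPowerSeries.coeff_mul] at hd
    obtain ⟨⟨a, b⟩, hab, hne⟩ := Finset.exists_ne_zero_of_sum_ne_zero hd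
    rw [Finset.HasAntidiagonal.mem_antidiagonal] at hab
    have hdeg : a.degree + b.degree = d.degree := by rw [← hab, map_add]
    exact ⟨a, ⟨by omega, left_ne_zero_of_mul hne⟩, b, ⟨by omega, right_ne_zero_of_mul hne⟩, hab⟩

variable {R M}

theorem X_mem_completedPolynomials (l : M) :
    (MvPowerSeries.X l : MvPowerSeries M R) ∈ completedPolynomials R M := by
  classical
  intro n
  refine (Set.finite_singleton (Finsupp.single l 1)).subset ?_
  rintro d ⟨-, hd⟩
  by_contra h
  rw [Set.mem_singleton_iff] at h
  exact hd (by rw [MvPowerSeries.coeff_X, if_neg h])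

/-- The variable `x_l` of the completed polynomial ring. -/
def var (l : M) : completedPolynomials R M := ⟨MvPowerSeries.X l, X_mem_completedPolynomials l⟩

theorem hasSubst_pair (a b : M) :
    MvPowerSeries.HasSubst ![(MvPowerSeries.X a : MvPowerSeries M R), MvPowerSeries.X b] :=
  MvPowerSeries.hasSubst_of_constantCoeff_nilpotent fun s => by fin_cases s <;> simp

theorem subst_mem_completedPolynomials (F : MvPowerSeries (Fin 2) R) (a b : M) :
    F.subst ![(MvPowerSeries.X a : MvPowerSeries M R), MvPowerSeries.X b] ∈
      completedPolynomials R M := by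
  classical
  intro n
  have hfin : {p : ℕ × ℕ | p.1 < n ∧ p.2 < n}.Finite :=
    ((Set.finite_lt_nat n).prod (Set.finite_lt_nat n)).subset fun p hp => hp
  refine (hfin.image fun p => Finsupp.single a p.1 + Finsupp.single b p.2).subset ?_
  rintro e ⟨hn, he⟩
  rw [MvPowerSeries.coeff_subst (hasSubst_pair a b)] at he
  obtain ⟨d, hd⟩ : ∃ d, MvPowerSeries.coeff d F • MvPowerSeries.coeff e (d.prod fun s k =>
      (![(MvPowerSeries.X a : MvPowerSeries M R), MvPowerSeries.X b] s) ^ k) ≠ 0 := by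
    by_contra h
    push Not at h
    exact he (finsum_eq_zero_of_forall_eq_zero h)
  have h1 : MvPowerSeries.coeff e (d.prod fun s k =>
      (![(MvPowerSeries.X a : MvPowerSeries M R), MvPowerSeries.X b] s) ^ k) ≠ 0 :=
    fun h => hd (by rw [h, smul_zero])
  rw [Finsupp.prod_fintype _ _ (by simp), Fin.prod_univ_two] at h1
  simp only [Matrix.cons_val_zero, Matrix.cons_val_one, MvPowerSeries.X_pow_eq,
    MvPowerSeries.monomial_mul_monomial, MvPowerSeries.coeff_monomial] at h1
  have h2 : e = Finsupp.single a (d 0) + Finsupp.single b (d 1) := by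
    by_contra h
    exact h1 (by rw [if_neg h])
  have h3 : e.degree = d 0 + d 1 := by rw [h2, map_add]; simp
  exact ⟨(d 0, d 1), ⟨by simp only; omega, by simp only; omega⟩, h2.symm⟩

/-- The element `F(x_a, x_b)` of the completed polynomial ring. -/
def formalSum (F : FormalGroup R) (a b : M) : completedPolynomials R M :=
  ⟨F.toPowerSeries.subst ![MvPowerSeries.X a, MvPowerSeries.X b],
    subst_mem_completedPolynomials _ a b⟩

/-- The closure of an ideal of the completed polynomial ring in the topology of the completion,
a basis of neighbourhoods of zero being given by the series without terms of degree `< n`. -/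
def closure (J : Ideal (completedPolynomials R M)) : Ideal (completedPolynomials R M) where
  carrier := {f | ∀ n : ℕ, ∃ j ∈ J, ∀ d : M →₀ ℕ, d.degree < n →
    MvPowerSeries.coeff d (f : MvPowerSeries M R) = MvPowerSeries.coeff d (j : MvPowerSeries M R)}
  zero_mem' := fun _ => ⟨0, J.zero_mem, fun _ _ => rfl⟩
  add_mem' := by
    intro f g hf hg n
    obtain ⟨i, hi, hfi⟩ := hf n
    obtain ⟨j, hj, hgj⟩ := hg n
    refine ⟨i + j, J.add_mem hi hj, fun d hd => ?_⟩
    simp only [Subring.coe_add, map_add, hfi d hd, hgj d hd]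
  smul_mem' := by
    classical
    intro c f hf n
    obtain ⟨j, hj, hfj⟩ := hf n
    refine ⟨c * j, J.mul_mem_left c hj, fun d hd => ?_⟩
    simp only [smul_eq_mul, Subring.coe_mul, MvPowerSeries.coeff_mul]
    refine Finset.sum_congr rfl fun p hp => ?_
    rw [Finset.HasAntidiagonal.mem_antidiagonal] at hp
    have hdeg : p.1.degree + p.2.degree = d.degree := by rw [← hp, map_add]
    rw [hfj p.2 (by omega)]

end Series

section Action

variable {G R M : Type*} [Group G] [CommRing R]

theorem coeff_renameEquiv (e : M ≃ M) (f : MvPowerSeries M R) (d : M →₀ ℕ) :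
    MvPowerSeries.coeff d (MvPowerSeries.renameEquiv R e f) =
      MvPowerSeries.coeff (Finsupp.mapDomain e.symm d) f := by
  have h := MvPowerSeries.coeff_embDomain_rename e.toEmbedding f (Finsupp.mapDomain e.symm d)
  have h2 : Finsupp.embDomain e.toEmbedding (Finsupp.mapDomain e.symm d) = d := by
    rw [Finsupp.embDomain_eq_mapDomain, ← Finsupp.mapDomain_comp]
    have : (e.toEmbedding : M → M) ∘ e.symm = id := by ext; simp
    rw [this, Finsupp.mapDomain_id]
  rw [h2] at h
  exact h

theorem rename_mem_completedPolynomials (e : M ≃ M) {f : MvPowerSeries M R}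
    (hf : f ∈ completedPolynomials R M) :
    MvPowerSeries.renameEquiv R e f ∈ completedPolynomials R M := by
  classical
  intro n
  refine ((hf n).image (Finsupp.mapDomain e)).subset ?_
  rintro d ⟨hn, hd⟩
  refine ⟨Finsupp.mapDomain e.symm d, ⟨?_, ?_⟩, ?_⟩
  · rwa [Finsupp.degree_mapDomain]
  · rwa [← coeff_renameEquiv]
  · rw [← Finsupp.mapDomain_comp]
    simp

variable [AddCommGroup M] [DistribMulAction G M]

/-- A group acting on `M` acts on the completed polynomial ring by `g • x_l = x_{g • l}`. -/
instance : MulSemiringAction G (completedPolynomials R M) where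
  smul g f := ⟨MvPowerSeries.renameEquiv R (MulAction.toPerm g) f,
    rename_mem_completedPolynomials _ f.2⟩
  one_smul f := by
    refine Subtype.ext ?_
    change MvPowerSeries.renameEquiv R (MulAction.toPerm (1 : G)) (f : MvPowerSeries M R) = f
    have : MulAction.toPerm (1 : G) = Equiv.refl M := by ext; simp
    rw [this, MvPowerSeries.renameEquiv_refl]
    rfl
  mul_smul g h f := by
    refine Subtype.ext ?_
    change MvPowerSeries.renameEquiv R (MulAction.toPerm (g * h)) (f : MvPowerSeries M R) =
      MvPowerSeries.renameEquiv R (MulAction.toPerm g)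
        (MvPowerSeries.renameEquiv R (MulAction.toPerm h) (f : MvPowerSeries M R))
    have : MulAction.toPerm (g * h) =
        (MulAction.toPerm h : M ≃ M).trans (MulAction.toPerm g : M ≃ M) := by
      ext; simp [mul_smul]
    rw [this, ← MvPowerSeries.renameEquiv_trans]
    rfl
  smul_zero g := Subtype.ext (map_zero (MvPowerSeries.renameEquiv R (MulAction.toPerm g)))
  smul_one g := Subtype.ext (map_one (MvPowerSeries.renameEquiv R (MulAction.toPerm g)))
  smul_add g a b := Subtype.ext (map_add (MvPowerSeries.renameEquiv R (MulAction.toPerm g)) a.1 b.1)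
  smul_mul g a b := Subtype.ext (map_mul (MvPowerSeries.renameEquiv R (MulAction.toPerm g)) a.1 b.1)

theorem coe_smul (g : G) (f : completedPolynomials R M) :
    ((g • f : completedPolynomials R M) : MvPowerSeries M R) =
      MvPowerSeries.renameEquiv R (MulAction.toPerm g) (f : MvPowerSeries M R) := rfl

theorem smul_var (g : G) (l : M) : g • (var l : completedPolynomials R M) = var (g • l) :=
  Subtype.ext (MvPowerSeries.rename_X _ l)

theorem smul_formalSum (F : FormalGroup R) (g : G) (a b : M) :
    g • formalSum F a b = formalSum F (g • a) (g • b) := by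
  refine Subtype.ext ?_
  have h : MvPowerSeries.HasSubst
      ((MvPowerSeries.X : M → MvPowerSeries M R) ∘ (MulAction.toPerm g : M ≃ M)) :=
    MvPowerSeries.HasSubst.X_comp _
  change MvPowerSeries.rename (MulAction.toPerm g : M ≃ M) (F.toPowerSeries.subst _) =
    F.toPowerSeries.subst _
  rw [MvPowerSeries.rename_eq_subst, MvPowerSeries.subst_comp_subst_apply (hasSubst_pair a b) h]
  congr 1
  funext s
  fin_cases s <;> simp [MvPowerSeries.subst_X h]

theorem coeff_smul_series (g : G) (f : completedPolynomials R M) (d : M →₀ ℕ) :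
    MvPowerSeries.coeff d ((g • f : completedPolynomials R M) : MvPowerSeries M R) =
      MvPowerSeries.coeff (Finsupp.mapDomain (MulAction.toPerm g : M ≃ M).symm d)
        (f : MvPowerSeries M R) :=
  coeff_renameEquiv _ _ _

/-- The relations `x_0 = 0` and `x_{a + b} = F(x_a, x_b)`. -/
def relations (F : FormalGroup R) (M : Type*) [AddCommGroup M] :
    Ideal (completedPolynomials R M) :=
  Ideal.span ({var 0} ∪ {f | ∃ a b : M, f = var (a + b) - formalSum F a b})

theorem smul_mem_relations (F : FormalGroup R) (g : G) {f : completedPolynomials R M}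
    (hf : f ∈ relations F M) : g • f ∈ relations F M := by
  unfold relations at hf
  induction hf using Submodule.span_induction with
  | mem f hf =>
    refine Ideal.subset_span ?_
    rcases hf with hf | ⟨a, b, rfl⟩
    · rw [Set.mem_singleton_iff] at hf
      subst hf
      left
      rw [smul_var, smul_zero, Set.mem_singleton_iff]
    · right
      exact ⟨g • a, g • b, by rw [smul_sub, smul_var, smul_formalSum, smul_add]⟩
  | zero => rw [smul_zero]; exact Ideal.zero_mem _
  | add a b _ _ ha hb => rw [smul_add]; exact Ideal.add_mem _ ha hb
  | smul c a _ ha => rw [smul_eq_mul, smul_mul']; exact Ideal.mul_mem_left _ _ ha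

theorem smul_mem_closure (F : FormalGroup R) (g : G) {f : completedPolynomials R M}
    (hf : f ∈ closure (relations F M)) : g • f ∈ closure (relations F M) := by
  intro n
  obtain ⟨j, hj, hfj⟩ := hf n
  refine ⟨g • j, smul_mem_relations F g hj, fun d hd => ?_⟩
  rw [coeff_smul_series, coeff_smul_series]
  exact hfj _ (by rwa [Finsupp.degree_mapDomain])

/-- The polynomial relations `x_0 = 0` and `x_{a + b} = x_a + x_b - β x_a x_b`. -/
def polynomialRelations (β : R) (M : Type*) [AddCommGroup M] : Ideal (MvPolynomial M R) :=
  Ideal.span ({MvPolynomial.X 0} ∪ {f | ∃ a b : M, f = MvPolynomial.X (a + b) -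
    (MvPolynomial.X a + MvPolynomial.X b -
      MvPolynomial.C β * MvPolynomial.X a * MvPolynomial.X b)})

/-- A group acting on `M` acts on the polynomial ring by `g • x_l = x_{g • l}`. -/
@[reducible] def polynomialAction (G R M : Type*) [Group G] [CommRing R] [AddCommGroup M]
    [DistribMulAction G M] : MulSemiringAction G (MvPolynomial M R) where
  smul g f := MvPolynomial.rename (fun l => g • l) f
  one_smul f := by
    change MvPolynomial.rename (fun l => (1 : G) • l) f = f
    simp only [one_smul]
    exact MvPolynomial.rename_id_apply f
  mul_smul g h f := by
    change MvPolynomial.rename (fun l => (g * h) • l) f =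
      MvPolynomial.rename (fun l => g • l) (MvPolynomial.rename (fun l => h • l) f)
    rw [MvPolynomial.rename_rename]
    simp only [mul_smul]
    rfl
  smul_zero g := map_zero (MvPolynomial.rename (R := R) (fun l : M => g • l))
  smul_one g := map_one (MvPolynomial.rename (R := R) (fun l : M => g • l))
  smul_add g a b := map_add (MvPolynomial.rename (R := R) (fun l : M => g • l)) a b
  smul_mul g a b := map_mul (MvPolynomial.rename (R := R) (fun l : M => g • l)) a b

theorem rename_mem_polynomialRelations (β : R) (g : G) {f : MvPolynomial M R}
    (hf : f ∈ polynomialRelations β M) :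
    MvPolynomial.rename (fun l => g • l) f ∈ polynomialRelations β M := by
  unfold polynomialRelations at hf
  induction hf using Submodule.span_induction with
  | mem f hf =>
    refine Ideal.subset_span ?_
    rcases hf with hf | ⟨a, b, rfl⟩
    · rw [Set.mem_singleton_iff] at hf
      subst hf
      left
      simp
    · right
      exact ⟨g • a, g • b, by simp⟩
  | zero => rw [map_zero]; exact Ideal.zero_mem _
  | add a b _ _ ha hb => rw [map_add]; exact Ideal.add_mem _ ha hb
  | smul c a _ ha => rw [smul_eq_mul, map_mul]; exact Ideal.mul_mem_left _ _ ha

/-- The action on a quotient ring by a stable ideal. -/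
@[reducible] def quotientAction {A : Type*} [CommRing A] (m : MulSemiringAction G A) (I : Ideal A)
    (hI : ∀ (g : G) (a : A), a ∈ I → g • a ∈ I) : MulSemiringAction G (A ⧸ I) where
  smul g := Ideal.quotientMap I (MulSemiringAction.toRingHom G A g) (fun a ha => hI g a ha)
  one_smul := by
    rintro ⟨a⟩
    exact congrArg (Ideal.Quotient.mk I) (one_smul G a)
  mul_smul g h := by
    rintro ⟨a⟩
    exact congrArg (Ideal.Quotient.mk I) (mul_smul g h a)
  smul_zero g := map_zero (Ideal.quotientMap I (MulSemiringAction.toRingHom G A g) _)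
  smul_one g := map_one (Ideal.quotientMap I (MulSemiringAction.toRingHom G A g) _)
  smul_add g a b := map_add (Ideal.quotientMap I (MulSemiringAction.toRingHom G A g) _) a b
  smul_mul g a b := map_mul (Ideal.quotientMap I (MulSemiringAction.toRingHom G A g) _) a b

end Action

/-- The two versions of the formal group algebra: the completed one, for an arbitrary formal group
law, and the polynomial one, for the polynomial (additive or multiplicative) formal group laws
`F(x, y) = x + y - β x y`. -/
inductive Version {R : Type*} [CommRing R] (F : FormalGroup R)
  | completed : Version F
  | polynomial (β : R) (hF : F.toPowerSeries = MvPowerSeries.X 0 + MvPowerSeries.X 1 -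
      MvPowerSeries.C β * MvPowerSeries.X 0 * MvPowerSeries.X 1) : Version F

end FormalGroupAlgebra

open FormalGroupAlgebra in
/-- The formal group algebra `S` of the lattice `M` and the formal group law `F`: the quotient of
the completed polynomial ring in the variables `x_l`, `l ∈ M`, by the closure of the ideal of
relations `x_0 = 0`, `x_{a + b} = F(x_a, x_b)`; in the polynomial version, the quotient of the
polynomial ring by the ideal of these relations. -/
def FormalGroupAlgebra {R : Type*} [CommRing R] {F : FormalGroup R} (v : Version F)
    (M : Type*) [AddCommGroup M] : Type _ :=
  match v with
  | .completed => completedPolynomials R M ⧸ closure (relations F M)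
  | .polynomial β _ => MvPolynomial M R ⧸ polynomialRelations β M

namespace FormalGroupAlgebra

variable {G R M : Type*} [Group G] [CommRing R] {F : FormalGroup R} [AddCommGroup M]
  [DistribMulAction G M]

instance (v : Version F) : CommRing (FormalGroupAlgebra v M) :=
  match v with
  | .completed => inferInstanceAs (CommRing (completedPolynomials R M ⧸ closure (relations F M)))
  | .polynomial β _ => inferInstanceAs (CommRing (MvPolynomial M R ⧸ polynomialRelations β M))

variable (G M) in
/-- The action of a group of automorphisms of `M` on `S`, with `g • x_l = x_{g • l}`. -/
@[reducible] def action (v : Version F) : MulSemiringAction G (FormalGroupAlgebra v M) :=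
  match v with
  | .completed => quotientAction (A := completedPolynomials R M) inferInstance
      (closure (relations F M)) fun g _ hf => smul_mem_closure F g hf
  | .polynomial β _ => quotientAction (polynomialAction G R M)
      (polynomialRelations β M) fun g _ hf => rename_mem_polynomialRelations β g hf

/-- The generator `x_l` of the formal group algebra. -/
def x (v : Version F) (l : M) : FormalGroupAlgebra v M :=
  match v with
  | .completed => Ideal.Quotient.mk (closure (relations F M)) (var l)
  | .polynomial β _ => Ideal.Quotient.mk (polynomialRelations β M) (MvPolynomial.X l)

theorem smul_x (v : Version F) (g : G) (l : M) :
    letI := action G M v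
    g • x v l = x v (g • l) := by
  cases v with
  | completed => exact congrArg (Ideal.Quotient.mk (closure (relations F M))) (smul_var g l)
  | polynomial β _ =>
    exact congrArg (Ideal.Quotient.mk (polynomialRelations β M)) (MvPolynomial.rename_X _ l)

end FormalGroupAlgebra

/-! ## Twisted group algebras acting on localized fixed point rings -/

namespace TwistedGroupAlgebra

open SkewMonoidAlgebra

variable {W Q X : Type*} [Group W] [CommRing Q] [MulSemiringAction W Q] [MulAction W X]

/-- The operator `δ_w ⊙ -` on functions `X → Q`. -/
def translate : W →* AddMonoid.End (X → Q) where
  toFun w :=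
    { toFun := fun f y => w • f (w⁻¹ • y)
      map_zero' := by funext y; simp
      map_add' := fun f g => by funext y; simp }
  map_one' := AddMonoidHom.ext fun f => funext fun y => by
    change (1 : W) • f ((1 : W)⁻¹ • y) = f y
    simp
  map_mul' v w := AddMonoidHom.ext fun f => funext fun y => by
    change (v * w) • f ((v * w)⁻¹ • y) = v • w • f (w⁻¹ • v⁻¹ • y)
    simp [mul_smul]

/-- The operator of multiplication by a scalar on functions `X → Q`. -/
def multiply : Q →+* AddMonoid.End (X → Q) where
  toFun q :=
    { toFun := fun f y => q * f y
      map_zero' := by funext y; simp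
      map_add' := fun f g => by funext y; simp [mul_add] }
  map_one' := AddMonoidHom.ext fun f => funext fun y => one_mul (f y)
  map_zero' := AddMonoidHom.ext fun f => funext fun y => zero_mul (f y)
  map_add' p q := AddMonoidHom.ext fun f => funext fun y => add_mul p q (f y)
  map_mul' p q := AddMonoidHom.ext fun f => funext fun y => mul_assoc p q (f y)

theorem multiply_smul_mul_translate (q : Q) (w : W) :
    multiply (X := X) (w • q) * translate w = translate w * multiply q :=
  AddMonoidHom.ext fun f => funext fun y => (smul_mul' w q (f (w⁻¹ • y))).symm

/-- The `⊙`-action of the twisted group algebra `Q_W` (where `δ_w q = w(q) δ_w`) on the dual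
`X → Q` of the free `Q`-module with basis a `W`-set `X`: on the dual basis,
`(p δ_w) ⊙ (q f_y) = p w(q) f_{w y}`. -/
instance odot : Module (SkewMonoidAlgebra Q W) (X → Q) :=
  Module.compHom (X → Q) (liftNCRingHom (multiply (X := X)) (translate (W := W) (Q := Q) (X := X))
    fun {q w} => multiply_smul_mul_translate q w)

theorem odot_single (w : W) (p : Q) (f : X → Q) (y : X) :
    ((single w p : SkewMonoidAlgebra Q W) • f) y = p * w • f (w⁻¹ • y) := by
  have h : liftNCRingHom (multiply (X := X)) (translate (W := W) (Q := Q) (X := X))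
      (fun {q w} => multiply_smul_mul_translate q w) (single w p) =
      multiply p * translate w := by
    simp [liftNCRingHom]
  exact congrFun (congrArg (fun T : AddMonoid.End (X → Q) => T f) h) y

open Classical in
/-- Compatibility with the formula on the dual basis. -/
theorem odot_single_single (w : W) (p q : Q) (y : X) :
    (single w p : SkewMonoidAlgebra Q W) • (Pi.single y q : X → Q) =
      Pi.single (w • y) (p * w • q) := by
  funext z
  rw [odot_single]
  by_cases h : z = w • y
  · subst h; simp
  · have h' : w⁻¹ • z ≠ y := fun e => h (by rw [← e, smul_inv_smul])
    simp [h, h']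

/-- The Hecke action `•` of `Q_W` on `Q_W^* = (W → Q)`: on the dual basis,
`(q δ_w) • (p f_v) = p (v w⁻¹)(q) f_{v w⁻¹}`. -/
def hecke (z : SkewMonoidAlgebra Q W) (f : W → Q) : W → Q :=
  fun u => z.sum fun w q => u • q * f (u * w)

/-- The map `Q_W → Q_X`, `δ_w ↦ δ_{w o}`, from the twisted group algebra to the free `Q`-module on
a `W`-set `X` with base point `o`. -/
def project (o : X) : SkewMonoidAlgebra Q W →ₗ[Q] (X →₀ Q) :=
  (Finsupp.lmapDomain Q Q fun w : W => w • o).comp (coeffLinearEquiv (S := Q)).toLinearMap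

variable (S : Type*) [CommRing S] [Algebra S Q]

/-- The image of a subring `D ⊇ S` of `Q_W` in the free `Q`-module on `X` under
`δ_w ↦ δ_{w o}`, as the `S`-submodule it spans (it is already a submodule). -/
def imageModule (D : Subring (SkewMonoidAlgebra Q W)) (o : X) : Submodule S (X →₀ Q) :=
  Submodule.span S (project o '' (D : Set (SkewMonoidAlgebra Q W)))

/-- The pairing of `Q_X` with its dual `X → Q`. -/
def pair (f : X → Q) : (X →₀ Q) →ₗ[Q] Q :=
  Finsupp.lsum ℕ fun y => LinearMap.toSpanSingleton Q Q (f y)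

/-- The `S`-dual `Hom_S(D_X, S)` of the image `D_X` of `D` in `Q_X`, inside the dual `X → Q` of
`Q_X`: the functionals whose restriction to `D_X` is an `S`-linear functional `D_X → S`. -/
def dual (D : Subring (SkewMonoidAlgebra Q W)) (o : X) : Set (X → Q) :=
  {f | ∃ ψ : Module.Dual S (imageModule S D o), ∀ d : imageModule S D o,
    algebraMap S Q (ψ d) = pair f (d : X →₀ Q)}

end TwistedGroupAlgebra

/-! ## Formal affine Demazure algebras -/

namespace FormalGroupAlgebra

/-- The action of a group on a localization at a stable submonoid, `g • (a / t) = g • a / g • t`. -/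
@[reducible] def localizationAction {G A : Type*} [Group G] [CommRing A] [MulSemiringAction G A]
    (T : Submonoid A) (hT : ∀ (g : G) (a : A), a ∈ T → g • a ∈ T) :
    MulSemiringAction G (Localization T) :=
  letI φ (g : G) : Localization T →+* Localization T :=
    IsLocalization.map (Localization T) (MulSemiringAction.toRingHom G A g)
      (show T ≤ T.comap _ from fun a ha => hT g a ha)
  have hφ (g : G) (a : A) : φ g (algebraMap A _ a) = algebraMap A _ (g • a) :=
    IsLocalization.map_eq _ a
  { smul := fun g q => φ g q
    one_smul := fun q => by
      change φ 1 q = RingHom.id _ q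
      congr 1
      refine IsLocalization.ringHom_ext T (RingHom.ext fun a => ?_)
      simp [hφ]
    mul_smul := fun g h q => by
      change φ (g * h) q = (φ g).comp (φ h) q
      congr 1
      refine IsLocalization.ringHom_ext T (RingHom.ext fun a => ?_)
      simp [hφ, mul_smul]
    smul_zero := fun g => map_zero (φ g)
    smul_one := fun g => map_one (φ g)
    smul_add := fun g => map_add (φ g)
    smul_mul := fun g => map_mul (φ g) }

end FormalGroupAlgebra

namespace RootPairing

open FormalGroupAlgebra SkewMonoidAlgebra

variable {ι R M N : Type*} [CommRing R] [AddCommGroup M] [AddCommGroup N] {F : FormalGroup R}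
  (Φ : RootDatum ι M N) (v : Version F)

/-- The action of the Weyl group on the formal group algebra, `w • x_l = x_{w l}`. -/
instance : MulSemiringAction Φ.weylGroup (FormalGroupAlgebra v M) := action Φ.weylGroup M v

/-- The multiplicative set generated by the elements `x_α`, `α` a root. -/
def rootElements : Submonoid (FormalGroupAlgebra v M) :=
  Submonoid.closure (Set.range fun i => x v (Φ.root i))

theorem x_root_mem (i : ι) : x v (Φ.root i) ∈ Φ.rootElements v :=
  Submonoid.subset_closure ⟨i, rfl⟩

theorem smul_mem_rootElements (w : Φ.weylGroup) (a : FormalGroupAlgebra v M)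
    (ha : a ∈ Φ.rootElements v) : w • a ∈ Φ.rootElements v := by
  unfold rootElements at ha
  induction ha using Submonoid.closure_induction with
  | mem a ha =>
    obtain ⟨i, rfl⟩ := ha
    have h : w • x v (Φ.root i) = x v (w • Φ.root i) := smul_x v w (Φ.root i)
    rw [h, Φ.weylGroup_apply_root]
    exact Φ.x_root_mem v _
  | one => rw [smul_one]; exact one_mem _
  | mul a b _ _ ha hb => rw [smul_mul']; exact mul_mem ha hb

/-- The localization `Q = S[1 / x_α]` of the formal group algebra at all roots `α`. -/
abbrev RootLocalization : Type _ := Localization (Φ.rootElements v)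

instance : MulSemiringAction Φ.weylGroup (Φ.RootLocalization v) :=
  localizationAction (Φ.rootElements v) (Φ.smul_mem_rootElements v)

/-- The twisted group algebra `Q_W`. -/
abbrev TwistedAlgebra : Type _ := SkewMonoidAlgebra (Φ.RootLocalization v) Φ.weylGroup

/-- The element `1 / x_α` of `Q`. -/
def invX (i : ι) : Φ.RootLocalization v := Localization.mk 1 ⟨x v (Φ.root i), Φ.x_root_mem v i⟩

/-- The push-pull element `1 / x_{-α} + (1 / x_α) δ_{s_α}`. Here `Φ.reflectionPerm i i` is the index
of the root `-α`, where `α` is the root with index `i`. -/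
def pushPull (i : ι) : Φ.TwistedAlgebra v :=
  single 1 (Φ.invX v (Φ.reflectionPerm i i)) + single (weylGroup.ofIdx Φ i) (Φ.invX v i)

variable {Φ} (b : Φ.Base)

/-- The formal affine Demazure algebra: the subalgebra of `Q_W` generated by `S` and by the
push-pull elements of the simple roots. -/
def Base.demazureAlgebra : Subring (Φ.TwistedAlgebra v) :=
  Subring.closure
    ((Set.range fun s : FormalGroupAlgebra v M => single 1 (algebraMap _ (Φ.RootLocalization v) s)) ∪
      (Φ.pushPull v '' b.support))

variable (Φ) in
/-- The subgroup of the Weyl group generated by the reflections in the roots of `Θ`. -/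
def parabolicSubgroup (Θ : Set ι) : Subgroup Φ.weylGroup :=
  Subgroup.closure (weylGroup.ofIdx Φ '' Θ)

open TwistedGroupAlgebra in
/-- The `S`-dual of the image of the formal affine Demazure algebra in `Q_{W/W_Θ}`, as a set of
functions `W/W_Θ → Q`. -/
def Base.dualParabolic (Θ : Set ι) : Set (Φ.weylGroup ⧸ Φ.parabolicSubgroup Θ → Φ.RootLocalization v) :=
  dual (FormalGroupAlgebra v M) (b.demazureAlgebra v)
    ((1 : Φ.weylGroup) : Φ.weylGroup ⧸ Φ.parabolicSubgroup Θ)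

open TwistedGroupAlgebra in
/-- The `S`-dual of the formal affine Demazure algebra, as a set of functions `W → Q`. -/
def Base.dualFull : Set (Φ.weylGroup → Φ.RootLocalization v) :=
  dual (FormalGroupAlgebra v M) (b.demazureAlgebra v) (1 : Φ.weylGroup)

open Classical in
/-- The product of the `x_α` over the negative roots `α` that are not in the root subsystem
`Σ_Θ` generated by `Θ`. -/
def Base.pointFactor [Fintype ι] (Θ : Set ι) : FormalGroupAlgebra v M :=
  ∏ i with ¬ b.IsPos i ∧ Φ.root i ∉ Submodule.span ℤ (Φ.root '' Θ), x v (Φ.root i)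

open Classical in
/-- The class `x_Θ f_{ē}` of the torus-fixed base point. -/
def Base.pointClass [Fintype ι] (Θ : Set ι) :
    Φ.weylGroup ⧸ Φ.parabolicSubgroup Θ → Φ.RootLocalization v :=
  Pi.single ((1 : Φ.weylGroup) : Φ.weylGroup ⧸ Φ.parabolicSubgroup Θ)
    (algebraMap _ _ (b.pointFactor v Θ))

end RootPairing

end

/-! Write D for the formal affine Demazure algebra. The theorem rests on one fact: the dual for Q is
a cyclic D-module, generated by [pt_Q]. A homomorphism φ is then determined by φ([pt_Q]), which is
W_Q-invariant because [pt_Q] is. Conversely, [pt_Q] is supported at the base point with an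
invertible value there. So for an invariant a the function d ⊙ a can be computed from d ⊙ [pt_Q]
alone, by a sum over the fixed points (`odot_eq_sum`). Hence d ⊙ [pt_Q] ↦ d ⊙ a is well defined and
D-linear, and it is the correspondence whose kernel consists of the translates of a. Translation
acts by ring automorphisms on functions, so the coordinatewise product of kernels matches the
product of invariants (`IsGenerator.exists_ringEquiv`).

The duals are handled through `integralFunctions`, the functions on W that pair into S with every
word in push-pull elements; `groupPair_mem_iff` shows that testing on words is enough. Twisted
Leibniz rules give stability under ⊙ (`pushPullFun_mem`) and under products (`mul_mem_integral`).

Cyclicity (`mem_of_pointFun_mem`) is a triangularity argument for the length of cosets. At a coset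
of maximal length in its support, an invariant integral function has a value that is an S-multiple
of the value produced there by applying a reduced word to [pt_Q] (`exists_apply_eq`,
`wordOp_pointFun`). That multiple is subtracted, and one inducts.

The hardest point is that [pt_Q] lies in the dual: x_Q times the sum over W_Q of the coefficients of
a word must lie in S. These coefficients have at most a simple pole along each x_β, with opposite
residues at w and s_β w (`HasResidues`). Poles along roots of Σ_Q therefore cancel in the sum, and
the remaining ones are removed by x_Q. Absence of poles along each x_β gives integrality only if the
x_β are pairwise coprime, which is not assumed of S. So the identity is proved in a universal
situation and transported.

For the completed version, F is lifted along the surjection ℤ[R] → R from a polynomial ring with one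
variable for each element of R (`exists_formalGroup_map_eq`); the obstruction in each degree is
treated by Lazard's comparison lemma on symmetric cocycles (`IsSymmCocycle.exists_eq_smul`). Power
series over ℤ[R] in the simple roots then form a domain with pairwise coprime x_β and an equivariant
map to S. For the polynomial version, the polynomial formal group algebra of the root lattice, with
β replaced by a variable, plays the same role; it embeds into those power series. -/

noncomputable section

/-! ### Order filtration on power series; unit and inverse of a formal group law -/

namespace MvPowerSeries

section OrderIdeal

variable {σ τ R : Type*} [CommRing R]

/-- The ideal of power series without terms of degree less than `n`. -/
def orderIdeal (σ R : Type*) [CommRing R] (n : ℕ) : Ideal (MvPowerSeries σ R) where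
  carrier := {f | ∀ d : σ →₀ ℕ, d.degree < n → coeff d f = 0}
  zero_mem' := fun _ _ => by simp
  add_mem' := fun ha hb d hd => by rw [map_add, ha d hd, hb d hd, add_zero]
  smul_mem' := fun c f hf d hd => by
    classical
    rw [smul_eq_mul, coeff_mul]
    refine Finset.sum_eq_zero fun p hp => ?_
    rw [Finset.HasAntidiagonal.mem_antidiagonal] at hp
    have hdeg : p.1.degree + p.2.degree = d.degree := by rw [← hp, map_add]
    rw [hf p.2 (by omega), mul_zero]

theorem orderIdeal_anti {m n : ℕ} (h : m ≤ n) : orderIdeal σ R n ≤ orderIdeal σ R m :=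
  fun _ hf d hd => hf d (by omega)

@[simp] theorem mem_orderIdeal_zero (f : MvPowerSeries σ R) : f ∈ orderIdeal σ R 0 :=
  fun _ hd => absurd hd (Nat.not_lt_zero _)

theorem mul_mem_orderIdeal {m n : ℕ} {f g : MvPowerSeries σ R} (hf : f ∈ orderIdeal σ R m)
    (hg : g ∈ orderIdeal σ R n) : f * g ∈ orderIdeal σ R (m + n) := by
  classical
  intro d hd
  rw [coeff_mul]
  refine Finset.sum_eq_zero fun p hp => ?_
  rw [Finset.HasAntidiagonal.mem_antidiagonal] at hp
  have hdeg : p.1.degree + p.2.degree = d.degree := by rw [← hp, map_add]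
  by_cases h : p.1.degree < m
  · rw [hf _ h, zero_mul]
  · rw [hg _ (by omega), mul_zero]

theorem eq_zero_of_forall_mem_orderIdeal {f : MvPowerSeries σ R}
    (h : ∀ n, f ∈ orderIdeal σ R n) : f = 0 := by
  ext d
  rw [h (d.degree + 1) d (by omega), map_zero]

theorem mem_orderIdeal_one {f : MvPowerSeries σ R} :
    f ∈ orderIdeal σ R 1 ↔ constantCoeff f = 0 := by
  refine ⟨fun h => by simpa using h 0 (by simp), fun h d hd => ?_⟩
  have : d = 0 := by rw [← Finsupp.degree_eq_zero_iff]; omega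
  rw [this, coeff_zero_eq_constantCoeff_apply, h]

theorem X_mem_orderIdeal (s : σ) : (X s : MvPowerSeries σ R) ∈ orderIdeal σ R 1 :=
  mem_orderIdeal_one.2 (by simp)

theorem pow_mem_orderIdeal {f : MvPowerSeries σ R} (hf : f ∈ orderIdeal σ R 1) (n : ℕ) :
    f ^ n ∈ orderIdeal σ R n := by
  induction n with
  | zero => simp
  | succ n ih => rw [pow_succ]; exact mul_mem_orderIdeal ih hf

theorem prod_pow_mem_orderIdeal {a : σ → MvPowerSeries τ R} (ha : ∀ s, a s ∈ orderIdeal τ R 1)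
    (d : σ →₀ ℕ) : (d.prod fun s k => a s ^ k) ∈ orderIdeal τ R d.degree := by
  classical
  induction d using Finsupp.induction_linear with
  | zero => simp
  | add f g hf hg =>
    rw [Finsupp.prod_add_index' (by simp) (by simp [pow_add]), map_add]
    exact mul_mem_orderIdeal hf hg
  | single s n =>
    rw [Finsupp.prod_single_index (by simp), Finsupp.degree_single]
    exact pow_mem_orderIdeal (ha s) n

/-- Here `k` is a relative precision: it measures the error beyond the order of the factor itself.
Relative precision, unlike absolute precision, is preserved by products. -/
theorem mul_sub_mul_mem_orderIdeal {m n k : ℕ} {u v u' v' : MvPowerSeries σ R}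
    (hu' : u' ∈ orderIdeal σ R n) (hv : v ∈ orderIdeal σ R m)
    (h : u - v ∈ orderIdeal σ R (m + k)) (h' : u' - v' ∈ orderIdeal σ R (n + k)) :
    u * u' - v * v' ∈ orderIdeal σ R (m + n + k) := by
  have e : u * u' - v * v' = (u - v) * u' + v * (u' - v') := by ring
  rw [e]
  refine Ideal.add_mem _ ?_ ?_
  · have := mul_mem_orderIdeal h hu'
    rwa [show m + n + k = m + k + n by ring]
  · have := mul_mem_orderIdeal hv h'
    rwa [show m + n + k = m + (n + k) by ring]

theorem prod_pow_sub_mem_orderIdeal {a b : σ → MvPowerSeries τ R} {k : ℕ}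
    (ha : ∀ s, a s ∈ orderIdeal τ R 1) (hb : ∀ s, b s ∈ orderIdeal τ R 1)
    (hab : ∀ s, a s - b s ∈ orderIdeal τ R (1 + k)) (d : σ →₀ ℕ) :
    (d.prod fun s n => a s ^ n) - (d.prod fun s n => b s ^ n) ∈
      orderIdeal τ R (d.degree + k) := by
  classical
  induction d using Finsupp.induction_linear with
  | zero => simp
  | add f g hf hg =>
    rw [Finsupp.prod_add_index' (by simp) (by simp [pow_add]),
      Finsupp.prod_add_index' (by simp) (by simp [pow_add]), map_add]
    exact mul_sub_mul_mem_orderIdeal (prod_pow_mem_orderIdeal ha g)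
      (prod_pow_mem_orderIdeal hb f) hf hg
  | single s n =>
    rw [Finsupp.prod_single_index (by simp), Finsupp.prod_single_index (by simp),
      Finsupp.degree_single]
    induction n with
    | zero => simp
    | succ n ih =>
      rw [pow_succ, pow_succ]
      exact mul_sub_mul_mem_orderIdeal (ha s) (pow_mem_orderIdeal (hb s) n) ih (hab s)

theorem hasSubst_of_mem_orderIdeal [Finite σ] {a : σ → MvPowerSeries τ R}
    (ha : ∀ s, a s ∈ orderIdeal τ R 1) : HasSubst a :=
  hasSubst_of_constantCoeff_zero fun s => mem_orderIdeal_one.1 (ha s)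

theorem subst_mem_orderIdeal [Finite σ] {a : σ → MvPowerSeries τ R}
    (ha : ∀ s, a s ∈ orderIdeal τ R 1) {n : ℕ} {f : MvPowerSeries σ R}
    (hf : f ∈ orderIdeal σ R n) : f.subst a ∈ orderIdeal τ R n := by
  intro e he
  rw [coeff_subst (hasSubst_of_mem_orderIdeal ha)]
  refine finsum_eq_zero_of_forall_eq_zero fun d => ?_
  by_cases hd : d.degree < n
  · rw [hf d hd, zero_smul]
  · rw [prod_pow_mem_orderIdeal ha d e (by omega), smul_zero]

/-- If two families of arguments agree up to degree `k`, the values of a series of order `m` agree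
up to degree `m + k - 1`. -/
theorem subst_sub_subst_mem_orderIdeal [Finite σ] {a b : σ → MvPowerSeries τ R} {k m : ℕ}
    (ha : ∀ s, a s ∈ orderIdeal τ R 1) (hb : ∀ s, b s ∈ orderIdeal τ R 1)
    (hab : ∀ s, a s - b s ∈ orderIdeal τ R (1 + k)) {f : MvPowerSeries σ R}
    (hf : f ∈ orderIdeal σ R m) : f.subst a - f.subst b ∈ orderIdeal τ R (m + k) := by
  intro e he
  rw [map_sub, coeff_subst (hasSubst_of_mem_orderIdeal ha),
    coeff_subst (hasSubst_of_mem_orderIdeal hb), sub_eq_zero]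
  refine finsum_congr fun d => ?_
  by_cases hd : d.degree < m
  · rw [hf d hd, zero_smul, zero_smul]
  · have := prod_pow_sub_mem_orderIdeal ha hb hab d e (by omega)
    rw [map_sub, sub_eq_zero] at this
    rw [this]

theorem exists_coeff_eq (c : (σ →₀ ℕ) → R) : ∃ f : MvPowerSeries σ R, ∀ d, coeff d f = c d :=
  ⟨c, fun _ => rfl⟩

theorem exists_limit {g : ℕ → MvPowerSeries σ R}
    (hg : ∀ n, g (n + 1) - g n ∈ orderIdeal σ R n) :
    ∃ G : MvPowerSeries σ R, ∀ n, G - g n ∈ orderIdeal σ R n := by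
  have key : ∀ n k, g (n + k) - g n ∈ orderIdeal σ R n := by
    intro n k
    induction k with
    | zero => simp
    | succ k ih =>
      have := Ideal.add_mem _ (orderIdeal_anti (Nat.le_add_right n k) (hg (n + k))) ih
      rwa [sub_add_sub_cancel] at this
  -- The step from `g n` to `g (n + 1)` alters only coefficients of degree at least `n`, so the
  -- coefficient at `d` is final from the index `d.degree + 1` on.
  obtain ⟨G, hG⟩ := exists_coeff_eq fun d => coeff d (g (d.degree + 1))
  refine ⟨G, fun n d hd => ?_⟩
  obtain ⟨k, rfl⟩ : ∃ k, n = d.degree + 1 + k := ⟨n - (d.degree + 1), by omega⟩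
  have := key (d.degree + 1) k d (by omega)
  rw [map_sub, sub_eq_zero] at this
  rw [map_sub, hG, this, sub_self]

theorem map_mem_orderIdeal {S : Type*} [CommRing S] (φ : R →+* S) {n : ℕ}
    {f : MvPowerSeries σ R} (hf : f ∈ orderIdeal σ R n) : map φ f ∈ orderIdeal σ S n := by
  intro d hd
  rw [coeff_map, hf d hd, map_zero]

end OrderIdeal

section Pairs

variable {τ R : Type*} [CommRing R]

theorem pair_mem_orderIdeal {n : ℕ} {f g : MvPowerSeries τ R} (hf : f ∈ orderIdeal τ R n)
    (hg : g ∈ orderIdeal τ R n) (s : Fin 2) :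
    (![f, g] : Fin 2 → MvPowerSeries τ R) s ∈ orderIdeal τ R n := by
  fin_cases s
  · exact hf
  · exact hg

theorem pair_sub_mem_orderIdeal {n : ℕ} {f g f' g' : MvPowerSeries τ R}
    (hf : f - f' ∈ orderIdeal τ R n) (hg : g - g' ∈ orderIdeal τ R n) (s : Fin 2) :
    (![f, g] : Fin 2 → MvPowerSeries τ R) s - (![f', g'] : Fin 2 → MvPowerSeries τ R) s ∈
      orderIdeal τ R n := by
  fin_cases s
  · exact hf
  · exact hg

end Pairs

end MvPowerSeries

namespace FormalGroup

open MvPowerSeries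

variable {R τ : Type*} [CommRing R] (F : FormalGroup R)

/-- This is F(x, 0) = x, read off coefficient by coefficient. -/
theorem coeff_single_zero (n : ℕ) :
    F.toPowerSeries.coeff (Finsupp.single 0 n) = if n = 1 then 1 else 0 := by
  have h : PowerSeries.coeff n F.Xzero = if n = 1 then 1 else 0 := by
    rw [F.Xzero_eq_X, PowerSeries.coeff_X]
  rw [← h]
  refine Eq.trans ?_ (coeff_subst (HasSubst.X_zero (i := ()) (R := R)) F.toPowerSeries
    (Finsupp.single () n)).symm
  rw [finsum_eq_single _ (Finsupp.single 0 n)]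
  · simp [Finsupp.prod_fintype, X_pow_eq]
  · intro d hd
    rw [Finsupp.prod_fintype _ _ (by simp), Fin.prod_univ_two]
    by_cases h1 : d 1 = 0
    · have h0 : d 0 ≠ n := fun h0 => hd (by
        ext s; fin_cases s
        · simpa using h0
        · simpa using h1)
      have : coeff (Finsupp.single () n) ((X () : MvPowerSeries Unit R) ^ d 0) = 0 := by
        have := PowerSeries.coeff_X_pow (R := R) n (d 0)
        rw [if_neg (Ne.symm h0)] at this
        exact this
      simp [h1, this]
    · simp [h1]

theorem coeff_single_one (n : ℕ) :
    F.toPowerSeries.coeff (Finsupp.single 1 n) = if n = 1 then 1 else 0 := by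
  have h : PowerSeries.coeff n F.zeroX = if n = 1 then 1 else 0 := by
    rw [F.zeroX_eq_X, PowerSeries.coeff_X]
  rw [← h]
  refine Eq.trans ?_ (coeff_subst (HasSubst.zero_X (i := ()) (R := R)) F.toPowerSeries
    (Finsupp.single () n)).symm
  rw [finsum_eq_single _ (Finsupp.single 1 n)]
  · simp [Finsupp.prod_fintype, X_pow_eq]
  · intro d hd
    rw [Finsupp.prod_fintype _ _ (by simp), Fin.prod_univ_two]
    by_cases h1 : d 0 = 0
    · have h0 : d 1 ≠ n := fun h0 => hd (by
        ext s; fin_cases s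
        · simpa using h1
        · simpa using h0)
      have : coeff (Finsupp.single () n) ((X () : MvPowerSeries Unit R) ^ d 1) = 0 := by
        have := PowerSeries.coeff_X_pow (R := R) n (d 1)
        rw [if_neg (Ne.symm h0)] at this
        exact this
      simp [h1, this]
    · simp [h1]

/-- The series `H` with `F(X, Y) = X + Y + X Y H(X, Y)`. -/
def mixedPart : MvPowerSeries (Fin 2) R :=
  fun d => F.toPowerSeries.coeff (d + (Finsupp.single 0 1 + Finsupp.single 1 1))

theorem coeff_mixedPart (d : Fin 2 →₀ ℕ) : coeff d F.mixedPart =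
    F.toPowerSeries.coeff (d + (Finsupp.single 0 1 + Finsupp.single 1 1)) := rfl

/-- The monomials in a single variable are dictated by F(x, 0) = x and F(0, y) = y; every other
monomial is divisible by x y. -/
theorem toPowerSeries_eq :
    F.toPowerSeries = X 0 + X 1 + X 0 * X 1 * F.mixedPart := by
  classical
  ext d
  have hm : (X 0 * X 1 : MvPowerSeries (Fin 2) R) =
      monomial (Finsupp.single 0 1 + Finsupp.single 1 1) 1 := by
    rw [X, X, monomial_mul_monomial, one_mul]
  rw [map_add, map_add, hm, coeff_monomial_mul, coeff_X, coeff_X, one_mul]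
  by_cases h0 : d 0 = 0
  · have hd : d = Finsupp.single 1 (d 1) := by
      ext s; fin_cases s
      · simpa using h0
      · simp
    have hle : ¬ (Finsupp.single 0 1 + Finsupp.single 1 1 : Fin 2 →₀ ℕ) ≤ d := fun h => by
      have := h 0
      simp [h0] at this
    rw [if_neg hle, hd, F.coeff_single_one]
    have h1 : (Finsupp.single 1 (d 1) : Fin 2 →₀ ℕ) ≠ Finsupp.single 0 1 := fun h => by
      have := DFunLike.congr_fun h 0
      simp at this
    rw [if_neg h1, _root_.zero_add, _root_.add_zero]
    simp [Finsupp.single_eq_single_iff]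
  · by_cases h1 : d 1 = 0
    · have hd : d = Finsupp.single 0 (d 0) := by
        ext s; fin_cases s
        · simp
        · simpa using h1
      have hle : ¬ (Finsupp.single 0 1 + Finsupp.single 1 1 : Fin 2 →₀ ℕ) ≤ d := fun h => by
        have := h 1
        simp [h1] at this
      rw [if_neg hle, hd, F.coeff_single_zero]
      have h1 : (Finsupp.single 0 (d 0) : Fin 2 →₀ ℕ) ≠ Finsupp.single 1 1 := fun h => by
        have := DFunLike.congr_fun h 1
        simp at this
      rw [if_neg h1, _root_.add_zero, _root_.add_zero]
      simp [Finsupp.single_eq_single_iff]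
    · have hle : (Finsupp.single 0 1 + Finsupp.single 1 1 : Fin 2 →₀ ℕ) ≤ d := fun s => by
        fin_cases s
        · simpa using Nat.one_le_iff_ne_zero.2 h0
        · simpa using Nat.one_le_iff_ne_zero.2 h1
      have e0 : d ≠ Finsupp.single 0 1 := fun h => h1 (by simp [h])
      have e1 : d ≠ Finsupp.single 1 1 := fun h => h0 (by simp [h])
      rw [if_pos hle, if_neg e0, if_neg e1, _root_.zero_add, _root_.zero_add, coeff_mixedPart,
        tsub_add_cancel_of_le hle]

variable {F}

theorem subst_eq {f g : MvPowerSeries τ R} (hf : f ∈ orderIdeal τ R 1)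
    (hg : g ∈ orderIdeal τ R 1) :
    F.toPowerSeries.subst ![f, g] = f + g + f * g * F.mixedPart.subst ![f, g] := by
  have h := hasSubst_of_mem_orderIdeal (pair_mem_orderIdeal hf hg)
  conv_lhs => rw [F.toPowerSeries_eq]
  simp only [subst_add h, subst_mul h, subst_X h, Matrix.cons_val_zero, Matrix.cons_val_one]

theorem subst_mem {f g : MvPowerSeries τ R} (hf : f ∈ orderIdeal τ R 1)
    (hg : g ∈ orderIdeal τ R 1) : F.toPowerSeries.subst ![f, g] ∈ orderIdeal τ R 1 := by
  rw [subst_eq hf hg]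
  exact Ideal.add_mem _ (Ideal.add_mem _ hf hg)
    (Ideal.mul_mem_right _ _ (Ideal.mul_mem_right _ _ hf))

variable (F) in
/-- The formal inverse. -/
theorem exists_neg {f : MvPowerSeries τ R} (hf : f ∈ orderIdeal τ R 1) :
    ∃ g ∈ orderIdeal τ R 1, F.toPowerSeries.subst ![f, g] = 0 := by
  -- F(f, g) = f + g + f g H(f, g) vanishes exactly when g = Ψ(g). Since f has no constant term, Ψ
  -- gains one degree of precision (`hΨ`), so its iterates starting from 0 converge to a fixed
  -- point.
  let Ψ (g : MvPowerSeries τ R) : MvPowerSeries τ R :=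
    -f - f * (g * F.mixedPart.subst ![f, g])
  have hΨ1 (g) : Ψ g ∈ orderIdeal τ R 1 :=
    Ideal.sub_mem _ (neg_mem hf) (Ideal.mul_mem_right _ _ hf)
  have hΨ {g g' : MvPowerSeries τ R} (hg : g ∈ orderIdeal τ R 1) (hg' : g' ∈ orderIdeal τ R 1)
      {n : ℕ} (h : g - g' ∈ orderIdeal τ R n) : Ψ g - Ψ g' ∈ orderIdeal τ R (n + 1) := by
    have e : Ψ g - Ψ g' =
        -(f * (g * F.mixedPart.subst ![f, g] - g' * F.mixedPart.subst ![f, g'])) := by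
      simp only [Ψ]; ring
    rw [e, add_comm n 1]
    refine neg_mem (mul_mem_orderIdeal hf ?_)
    rcases n with _ | n
    · simp
    have h2 := subst_sub_subst_mem_orderIdeal (k := n) (pair_mem_orderIdeal hf hg)
      (pair_mem_orderIdeal hf hg') (pair_sub_mem_orderIdeal (by simp) (by rwa [add_comm]))
      (mem_orderIdeal_zero F.mixedPart)
    have := mul_sub_mul_mem_orderIdeal (m := 1) (n := 0) (k := n) (by simp) hg'
      (by rwa [add_comm]) h2
    rwa [show 1 + 0 + n = n + 1 by ring] at this
  let g : ℕ → MvPowerSeries τ R := fun n => Ψ^[n] 0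
  have hgs (n) : g (n + 1) = Ψ (g n) := Function.iterate_succ_apply' _ _ _
  have hg1 (n) : g n ∈ orderIdeal τ R 1 := by
    cases n with
    | zero => exact Ideal.zero_mem _
    | succ n => rw [hgs]; exact hΨ1 _
  have hg (n) : g (n + 1) - g n ∈ orderIdeal τ R n := by
    induction n with
    | zero => simp
    | succ n ih =>
      rw [hgs (n + 1), hgs n]
      exact hΨ (hgs n ▸ hg1 (n + 1)) (hg1 n) (by rw [hgs] at ih; exact ih)
  obtain ⟨G, hG⟩ := exists_limit hg
  have hG1 : G ∈ orderIdeal τ R 1 := by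
    have := Ideal.add_mem _ (hG 1) (hg1 1)
    rwa [sub_add_cancel] at this
  have hfix : G = Ψ G := by
    rw [← sub_eq_zero]
    refine eq_zero_of_forall_mem_orderIdeal fun n => ?_
    have h1 := orderIdeal_anti (Nat.le_succ n) (hG (n + 1))
    have h2 := orderIdeal_anti (Nat.le_succ n) (hΨ hG1 (hg1 n) (hG n))
    rw [hgs] at h1
    have := Ideal.sub_mem _ h1 h2
    rwa [sub_sub_sub_cancel_right] at this
  refine ⟨G, hG1, ?_⟩
  rw [subst_eq hf hG1]
  simp only [Ψ] at hfix
  linear_combination hfix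

end FormalGroup

end

noncomputable section

/-! ## Symmetric cocycles -/

/-- The coefficients `γ i`, `0 < i < n`, of a homogeneous symmetric `2`-cocycle of degree `n`. -/
structure IsSymmCocycle {A : Type*} [AddCommGroup A] (n : ℕ) (γ : ℕ → A) : Prop where
  symm : ∀ i, 0 < i → i < n → γ (n - i) = γ i
  rel : ∀ i j k, 0 < i → 0 < j → 0 < k → i + j + k = n →
    (i + j).choose i • γ (i + j) = (j + k).choose j • γ i

namespace IsSymmCocycle

variable {A B : Type*} [AddCommGroup A] [AddCommGroup B] {n : ℕ} {γ δ : ℕ → A}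

theorem map (h : IsSymmCocycle n γ) (f : A →+ B) : IsSymmCocycle n fun i => f (γ i) where
  symm i h0 h1 := by rw [h.symm i h0 h1]
  rel i j k hi hj hk hn := by rw [← map_nsmul, ← map_nsmul, h.rel i j k hi hj hk hn]

theorem sub (h : IsSymmCocycle n γ) (h' : IsSymmCocycle n δ) :
    IsSymmCocycle n fun i => γ i - δ i where
  symm i h0 h1 := by rw [h.symm i h0 h1, h'.symm i h0 h1]
  rel i j k hi hj hk hn := by
    rw [smul_sub, smul_sub, h.rel i j k hi hj hk hn, h'.rel i j k hi hj hk hn]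

theorem eq_zero_of_coprime {p m : ℕ} {a : A} (hp : p • a = 0) (hm : m • a = 0)
    (h : Nat.Coprime m p) : a = 0 := by
  have h1 := Nat.dvd_gcd (addOrderOf_dvd_of_nsmul_eq_zero hm) (addOrderOf_dvd_of_nsmul_eq_zero hp)
  rw [h] at h1
  exact AddMonoid.addOrderOf_eq_one_iff.1 (Nat.dvd_one.1 h1)

/-- The cocycle relation with first index 1. It expresses `γ m` through `γ 1` wherever `m` acts
invertibly. -/
theorem smul_eq (h : IsSymmCocycle n γ) {m : ℕ} (h0 : 0 < m) (h1 : m < n) :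
    m • γ m = (n - 1).choose (m - 1) • γ 1 := by
  rcases Nat.lt_or_ge 1 m with hm | hm
  · have := h.rel 1 (m - 1) (n - m) one_pos (by omega) (by omega) (by omega)
    rwa [show 1 + (m - 1) = m by omega, show m - 1 + (n - m) = n - 1 by omega,
      Nat.choose_one_right] at this
  · obtain rfl : m = 1 := by omega
    simp

/-- Modulo a prime, a symmetric cocycle of degree `n` is determined by one coefficient. -/
theorem exists_index {p : ℕ} (hp : p.Prime) (n : ℕ) (hn : 2 ≤ n) :
    ∃ t, 0 < t ∧ t < n ∧ ∀ {A : Type*} [AddCommGroup A] {γ : ℕ → A}, (∀ a : A, p • a = 0) →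
      IsSymmCocycle n γ → γ t = 0 → ∀ i, 0 < i → i < n → γ i = 0 := by
  induction n using Nat.strong_induction_on with
  | _ n ih =>
    -- If p ∤ n, or if n = p, the index 1 works: `smul_eq` handles every i prime to p, and when p ∣
    -- i but p ∤ n the symmetric index n - i is prime to p. If n = p m with m ≥ 2, the coefficients
    -- at indices prime to p vanish automatically, and by Lucas the coefficients at multiples of p
    -- form a cocycle of degree m, to which induction applies.
    by_cases hpn : p ∣ n
    · obtain ⟨m, rfl⟩ := hpn
      by_cases hm : m < 2
      · obtain rfl : m = 1 := by
          rcases m with _ | _ | m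
          · omega
          · rfl
          · omega
        refine ⟨1, one_pos, by omega, fun {A} _ γ hA h ht i h0 h1 => ?_⟩
        have := h.smul_eq h0 h1
        rw [ht, smul_zero] at this
        refine eq_zero_of_coprime (hA _) this (Nat.Coprime.symm ?_)
        exact (Nat.Prime.coprime_iff_not_dvd hp).2 fun hd => by
          have := Nat.le_of_dvd h0 hd
          omega
      · obtain ⟨t, ht0, ht1, ht⟩ := ih m (by have := hp.two_le; nlinarith) (by omega)
        refine ⟨p * t, Nat.mul_pos hp.pos ht0, Nat.mul_lt_mul_of_pos_left ht1 hp.pos,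
          fun {A} _ γ hA h hγ => ?_⟩
        have hpm : p < p * m := by have := hp.two_le; nlinarith
        -- By `smul_eq` at the index p, the binomial coefficient of (n - 1, p - 1) kills γ 1,
        -- because p kills γ p. By Lucas this coefficient is 1 modulo p.
        have h1 : γ 1 = 0 := by
          have := h.smul_eq hp.pos hpm
          rw [hA] at this
          refine eq_zero_of_coprime (hA _) this.symm (Nat.Coprime.symm ?_)
          refine (Nat.Prime.coprime_iff_not_dvd hp).2 fun hd => ?_
          have := Fact.mk hp
          have hl := Choose.choose_modEq_choose_mod_mul_choose_div_nat (n := p * m - 1)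
            (k := p - 1) (p := p)
          have e1 : p * m - 1 = (p - 1) + p * (m - 1) := by
            have := hp.pos
            obtain ⟨m', rfl⟩ : ∃ m', m = m' + 1 := ⟨m - 1, by omega⟩
            rw [Nat.add_sub_cancel, mul_add]; omega
          have hlt : p - 1 < p := by have := hp.pos; omega
          rw [e1, Nat.add_mul_mod_self_left, Nat.add_mul_div_left _ _ hp.pos,
            Nat.mod_eq_of_lt hlt, Nat.div_eq_of_lt hlt, Nat.choose_self, Nat.choose_zero_right,
            ← e1] at hl
          have h10 := hl.symm.trans ((Nat.modEq_zero_iff_dvd).2 hd)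
          exact hp.one_lt.ne' (Nat.dvd_one.1 ((Nat.modEq_zero_iff_dvd).1 h10))
        have h2 : ∀ i, 0 < i → i < p * m → ¬ p ∣ i → γ i = 0 := fun i h0 hi hd => by
          have := h.smul_eq h0 hi
          rw [h1, smul_zero] at this
          exact eq_zero_of_coprime (hA _) this
            (Nat.Coprime.symm ((Nat.Prime.coprime_iff_not_dvd hp).2 hd))
        have hl (a b : ℕ) (x : A) : (p * a).choose (p * b) • x = a.choose b • x := by
          have := Fact.mk hp
          have hl := Choose.choose_modEq_choose_mod_mul_choose_div_nat (n := p * a)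
            (k := p * b) (p := p)
          rw [Nat.mul_mod_right, Nat.mul_mod_right, Nat.mul_div_cancel_left _ hp.pos,
            Nat.mul_div_cancel_left _ hp.pos, Nat.choose_self, one_mul] at hl
          exact nsmul_eq_nsmul_of_modEq hl (hA x)
        have h3 : IsSymmCocycle m fun i => γ (p * i) :=
          { symm := fun i h0 hi => by
              rw [Nat.mul_sub]
              exact h.symm _ (Nat.mul_pos hp.pos h0) (Nat.mul_lt_mul_of_pos_left hi hp.pos)
            rel := fun i j k hi hj hk hn => by
              have := h.rel (p * i) (p * j) (p * k) (Nat.mul_pos hp.pos hi)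
                (Nat.mul_pos hp.pos hj) (Nat.mul_pos hp.pos hk) (by rw [← hn]; ring)
              rwa [← mul_add, ← mul_add, hl, hl] at this }
        intro i h0 hi
        by_cases hd : p ∣ i
        · obtain ⟨i, rfl⟩ := hd
          exact ht hA h3 hγ i (Nat.pos_of_mul_pos_left h0) (Nat.lt_of_mul_lt_mul_left hi)
        · exact h2 i h0 hi hd
    · refine ⟨1, one_pos, by omega, fun {A} _ γ hA h ht => ?_⟩
      have h2 : ∀ i, 0 < i → i < n → ¬ p ∣ i → γ i = 0 := fun i h0 hi hd => by
        have := h.smul_eq h0 hi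
        rw [ht, smul_zero] at this
        exact eq_zero_of_coprime (hA _) this
          (Nat.Coprime.symm ((Nat.Prime.coprime_iff_not_dvd hp).2 hd))
      intro i h0 hi
      by_cases hd : p ∣ i
      · rw [← h.symm i h0 hi]
        refine h2 _ (by omega) (by omega) fun hd' => hpn ?_
        have := Nat.dvd_add hd' hd
        rwa [Nat.sub_add_cancel hi.le] at this
      · exact h2 i h0 hi hd

/-- Nakayama over ℤ. If N were nonzero, its annihilator would lie in some maximal ideal (p); but N =
pN yields an element congruent to 1 modulo p that kills N. -/
theorem eq_bot_of_forall_le_smul {M : Type*} [AddCommGroup M] (N : Submodule ℤ M) (hN : N.FG)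
    (h : ∀ p : ℕ, p.Prime → N ≤ Ideal.span {(p : ℤ)} • N) : N = ⊥ := by
  by_contra hne
  have hann : N.annihilator ≠ ⊤ := fun h => hne (Submodule.annihilator_eq_top_iff.1 h)
  obtain ⟨𝔪, hm, hle⟩ := Ideal.exists_le_maximal _ hann
  obtain ⟨g, hg⟩ := (IsPrincipalIdealRing.principal 𝔪).principal
  have hgp : Prime g := by
    rw [← Ideal.span_singleton_prime]
    · rw [Ideal.span, ← hg]; exact hm.isPrime
    · rintro rfl
      have : 𝔪 = ⊥ := by rw [hg]; simp
      exact Ring.ne_bot_of_isMaximal_of_not_isField hm Int.not_isField this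
  have hmp : 𝔪 = Ideal.span {(g.natAbs : ℤ)} := by
    rw [hg]
    exact (Int.span_natAbs g).symm
  obtain ⟨r, hr, hr'⟩ := Submodule.exists_sub_one_mem_and_smul_eq_zero_of_fg_of_le_smul 𝔪 N hN
    (hmp ▸ h _ (Int.prime_iff_natAbs_prime.1 hgp))
  have : r ∈ 𝔪 := hle (Submodule.mem_annihilator.2 hr')
  refine hm.ne_top ((Ideal.eq_top_iff_one _).2 ?_)
  have := Ideal.sub_mem _ this hr
  rwa [sub_sub_cancel] at this

/-- Lazard's comparison lemma: a symmetric cocycle of degree `n` is a multiple of the cocycle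
`((x + y) ^ n - x ^ n - y ^ n) / d`, where `d` is the greatest common divisor of the
coefficients. -/
theorem exists_eq_smul (hn : 2 ≤ n) (h : IsSymmCocycle n γ) :
    ∃ (d : ℤ) (a : A), d ≠ 0 ∧ ∀ i, 0 < i → i < n → ∃ m : ℤ, m * d = n.choose i ∧
      γ i = m • a := by
  classical
  let s := Finset.Ioo 0 n
  let J : Ideal ℤ := Ideal.span ((fun i => (n.choose i : ℤ)) '' s)
  obtain ⟨d, hd⟩ := (IsPrincipalIdealRing.principal J).principal
  have hdvd : ∀ i ∈ s, ∃ m : ℤ, m * d = n.choose i := fun i hi => by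
    have : (n.choose i : ℤ) ∈ J := Ideal.subset_span ⟨i, hi, rfl⟩
    rw [hd] at this
    obtain ⟨m, hm⟩ := Submodule.mem_span_singleton.1 this
    exact ⟨m, hm⟩
  choose! m hm using hdvd
  have hd0 : d ≠ 0 := by
    rintro rfl
    have := hm 1 (Finset.mem_Ioo.2 ⟨one_pos, by omega⟩)
    rw [mul_zero, Nat.choose_one_right] at this
    have : n = 0 := by exact_mod_cast this.symm
    omega
  -- Bézout coefficients for the gcd of the binomial coefficients. After division by `d` they
  -- satisfy ∑ c_i m_i = 1.
  obtain ⟨c, hc⟩ : ∃ c : ℕ → ℤ, ∑ i ∈ s, c i * (n.choose i : ℤ) = d := by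
    have : d ∈ J := by rw [hd]; exact Submodule.mem_span_singleton_self d
    obtain ⟨c, -, rfl⟩ := (Submodule.mem_span_image_finset_iff_exists_fun ℤ).1 this
    refine ⟨fun i => if hi : i ∈ s then c ⟨i, hi⟩ else 0, ?_⟩
    rw [← Finset.sum_coe_sort s]
    simp
  have hcm : ∑ i ∈ s, c i * m i = 1 := by
    refine mul_right_cancel₀ hd0 ?_
    rw [one_mul, Finset.sum_mul]
    conv_rhs => rw [← hc]
    exact Finset.sum_congr rfl fun i hi => by rw [mul_assoc, hm i hi]
  have hmsymm : ∀ i, 0 < i → i < n → m (n - i) = m i := fun i h0 h1 => by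
    refine mul_right_cancel₀ hd0 ?_
    rw [hm _ (Finset.mem_Ioo.2 ⟨by omega, by omega⟩), hm _ (Finset.mem_Ioo.2 ⟨h0, h1⟩),
      Nat.choose_symm h1.le]
  have hmrel : ∀ i j k, 0 < i → 0 < j → 0 < k → i + j + k = n →
      ((i + j).choose i : ℤ) * m (i + j) = ((j + k).choose j : ℤ) * m i :=
    fun i j k hi hj hk hijk => by
      refine mul_right_cancel₀ hd0 ?_
      rw [mul_assoc, mul_assoc, hm _ (Finset.mem_Ioo.2 ⟨by omega, by omega⟩),
        hm _ (Finset.mem_Ioo.2 ⟨hi, by omega⟩)]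
      have := Nat.choose_mul (n := n) (k := i + j) (s := i) (by omega)
      rw [show n - i = j + k by omega, show i + j - i = j by omega] at this
      have h2 : ((n.choose (i + j) * (i + j).choose i : ℕ) : ℤ) =
        (n.choose i * (j + k).choose j : ℕ) := by rw [this]
      push_cast at h2
      linarith
  have hmA {B : Type _} [AddCommGroup B] (b : B) : IsSymmCocycle n fun i => m i • b :=
    { symm := fun i h0 h1 => by rw [hmsymm i h0 h1]
      rel := fun i j k hi hj hk hijk => by
        rw [← natCast_zsmul, ← natCast_zsmul, smul_smul, smul_smul, hmrel i j k hi hj hk hijk] }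
  -- The only possible choice: if γ_i = m_i a for all i, applying ∑ c_i gives back a.
  let a : A := ∑ i ∈ s, c i • γ i
  refine ⟨d, a, hd0, fun i h0 h1 => ⟨m i, hm i (Finset.mem_Ioo.2 ⟨h0, h1⟩), ?_⟩⟩
  let N : Submodule ℤ A := Submodule.span ℤ ((fun i => γ i - m i • a) '' s)
  suffices hN : N = ⊥ by
    have : γ i - m i • a ∈ N := Submodule.subset_span ⟨i, Finset.mem_Ioo.2 ⟨h0, h1⟩, rfl⟩
    rw [hN, Submodule.mem_bot, sub_eq_zero] at this
    exact this
  have hfg : N.FG := by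
    refine Submodule.fg_span ?_
    exact (s.finite_toSet).image _
  -- Modulo p the defects γ_i - m_i a form a cocycle with values in a group killed by p. Comparing
  -- it with (m_i) at the distinguished index t shows that it equals (m_i b) for some b. Applying ∑
  -- c_i gives 0 on the defects, by the choice of a, and b on (m_i b), so b = 0.
  refine eq_bot_of_forall_le_smul N hfg fun p hp => ?_
  obtain ⟨t, ht0, ht1, ht⟩ := exists_index hp n hn
  let f : A →+ A ⧸ (Ideal.span {(p : ℤ)} • N) := (Submodule.mkQ _).toAddMonoidHom
  let g : N →ₗ[ℤ] A ⧸ (Ideal.span {(p : ℤ)} • N) := (Submodule.mkQ _).comp N.subtype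
  have hg : ∀ b : g.range, p • b = 0 := by
    rintro ⟨_, ⟨b, hb⟩, rfl⟩
    refine Subtype.ext ?_
    change p • (Submodule.mkQ _ b) = 0
    rw [← map_nsmul, Submodule.mkQ_apply, Submodule.Quotient.mk_eq_zero, ← natCast_zsmul]
    exact Submodule.smul_mem_smul (Ideal.mem_span_singleton_self _) hb
  have hmem : ∀ i ∈ s, f (γ i - m i • a) ∈ g.range := fun i hi =>
    ⟨⟨γ i - m i • a, Submodule.subset_span ⟨i, hi, rfl⟩⟩, rfl⟩
  let γ' : ℕ → g.range := fun i => if hi : i ∈ s then ⟨_, hmem i hi⟩ else 0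
  have hγ' : ∀ i ∈ s, (γ' i : A ⧸ (Ideal.span {(p : ℤ)} • N)) = f (γ i - m i • a) :=
    fun i hi => by simp only [γ', dif_pos hi]
  have hco0 := ((h.sub (hmA a)).map f)
  have hco : IsSymmCocycle n γ' :=
    { symm := fun i h0 h1 => by
        refine Subtype.ext ?_
        rw [hγ' _ (Finset.mem_Ioo.2 ⟨by omega, by omega⟩), hγ' _ (Finset.mem_Ioo.2 ⟨h0, h1⟩)]
        exact hco0.symm i h0 h1
      rel := fun i j k hi hj hk hijk => by
        refine Subtype.ext ?_
        rw [Submodule.coe_smul_of_tower, Submodule.coe_smul_of_tower,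
          hγ' _ (Finset.mem_Ioo.2 ⟨by omega, by omega⟩),
          hγ' _ (Finset.mem_Ioo.2 ⟨by omega, by omega⟩)]
        exact hco0.rel i j k hi hj hk hijk }
  have hsum : ∑ i ∈ s, c i • γ' i = 0 := by
    refine Subtype.ext ?_
    have e : ∑ i ∈ s, c i • (γ i - m i • a) = 0 := by
      simp only [smul_sub, smul_smul, Finset.sum_sub_distrib]
      rw [← Finset.sum_smul, hcm, one_smul, sub_self]
    have e2 := congrArg f e
    rw [map_sum, map_zero] at e2
    rw [AddSubmonoidClass.coe_finsetSum]
    refine Eq.trans (Finset.sum_congr rfl fun i hi => ?_) e2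
    rw [Submodule.coe_smul_of_tower, hγ' i hi, map_zsmul]
  -- If p divided m_t, then all m_i would vanish modulo p, because (m_i) is itself a cocycle. This
  -- contradicts ∑ c_i m_i = 1. The `ULift` only adjusts the universe.
  have hmt : IsCoprime (m t) (p : ℤ) := by
    rw [isCoprime_comm, Prime.coprime_iff_not_dvd (Nat.prime_iff_prime_int.1 hp)]
    intro hd
    have hz := ht (A := ULift (ZMod p)) (γ := fun i => m i • ULift.up 1)
      (fun a => by ext; simp) (hmA _)
      (by
        ext
        simpa [ZMod.intCast_zmod_eq_zero_iff_dvd] using (ZMod.intCast_zmod_eq_zero_iff_dvd _ p).2 hd)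
    have h1 := congrArg (fun z : ℤ => (z : ZMod p)) hcm
    simp only [Int.cast_sum, Int.cast_mul, Int.cast_one] at h1
    rw [Finset.sum_eq_zero fun i hi => ?_] at h1
    · have := Fact.mk hp
      exact zero_ne_one h1
    · have := congrArg ULift.down (hz i (Finset.mem_Ioo.1 hi).1 (Finset.mem_Ioo.1 hi).2)
      change m i • (1 : ZMod p) = 0 at this
      rw [zsmul_one] at this
      rw [this, mul_zero]
  obtain ⟨u, v, huv⟩ := hmt
  let b := u • γ' t
  have hvan := ht hg (hco.sub (hmA b)) (by
    have : γ' t = (u * m t + v * p) • γ' t := by rw [huv, one_smul]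
    rw [sub_eq_zero]
    conv_lhs => rw [this]
    rw [add_smul, mul_smul v, natCast_zsmul, hg, smul_zero, add_zero, mul_comm, mul_smul])
  have hγb : ∀ i ∈ s, γ' i = m i • b := fun i hi =>
    sub_eq_zero.1 (hvan i (Finset.mem_Ioo.1 hi).1 (Finset.mem_Ioo.1 hi).2)
  have hb : b = 0 := by
    rw [Finset.sum_congr rfl fun i hi => by rw [hγb i hi, smul_smul], ← Finset.sum_smul, hcm,
      one_smul] at hsum
    exact hsum
  refine Submodule.span_le.2 ?_
  rintro _ ⟨i, hi, rfl⟩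
  have h1 := hγ' i hi
  rw [hγb i hi, hb, smul_zero] at h1
  exact (Submodule.Quotient.mk_eq_zero _).1 h1.symm

end IsSymmCocycle

end

noncomputable section

/-! ## Lifting formal group laws to characteristic zero -/

namespace MvPowerSeries

section Subst

variable {τ υ R : Type*} [CommRing R]

theorem subst_pair_subst {a b : MvPowerSeries τ R} (ha : a ∈ orderIdeal τ R 1)
    (hb : b ∈ orderIdeal τ R 1) {c : τ → MvPowerSeries υ R} (hc : HasSubst c)
    (f : MvPowerSeries (Fin 2) R) :
    (f.subst ![a, b]).subst c = f.subst ![a.subst c, b.subst c] := by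
  rw [subst_comp_subst_apply (hasSubst_of_mem_orderIdeal (pair_mem_orderIdeal ha hb)) hc]
  congr 1
  funext s
  fin_cases s <;> rfl

theorem subst_unit_subst {a : MvPowerSeries τ R} (ha : a ∈ orderIdeal τ R 1)
    {c : τ → MvPowerSeries υ R} (hc : HasSubst c) (f : MvPowerSeries Unit R) :
    (f.subst fun _ => a).subst c = f.subst fun _ => a.subst c :=
  subst_comp_subst_apply (hasSubst_of_mem_orderIdeal fun _ => ha) hc f

theorem map_subst_pair {S : Type*} [CommRing S] (φ : R →+* S) {a b : MvPowerSeries τ R}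
    (ha : a ∈ orderIdeal τ R 1) (hb : b ∈ orderIdeal τ R 1) (f : MvPowerSeries (Fin 2) R) :
    (f.subst ![a, b]).map φ = (f.map φ).subst ![a.map φ, b.map φ] := by
  rw [map_subst (hasSubst_of_mem_orderIdeal (pair_mem_orderIdeal ha hb))]
  congr 1
  funext s
  fin_cases s <;> rfl

/-- The associator of a series in two variables. -/
def associator (f : MvPowerSeries (Fin 2) R) : MvPowerSeries (Fin 3) R :=
  f.subst ![f.subst ![X 0, X 1], X 2] - f.subst ![X 0, f.subst ![X 1, X 2]]

/-- The coboundary of a series in two variables. -/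
def coboundary (f : MvPowerSeries (Fin 2) R) : MvPowerSeries (Fin 3) R :=
  f.subst ![X 0, X 1] + f.subst ![X 0 + X 1, X 2] - f.subst ![X 1, X 2] -
    f.subst ![X 0, X 1 + X 2]

theorem hasSubst_pair' {f g : MvPowerSeries τ R} (hf : f ∈ orderIdeal τ R 1)
    (hg : g ∈ orderIdeal τ R 1) : HasSubst ![f, g] :=
  hasSubst_of_mem_orderIdeal (pair_mem_orderIdeal hf hg)

/-- Telescoping over the outer and the inner occurrence of the series. No precision is lost, since
all arguments have order at least 1. -/
theorem associator_sub_mem {f g : MvPowerSeries (Fin 2) R} (hf : f ∈ orderIdeal _ R 1)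
    (hg : g ∈ orderIdeal _ R 1) {n : ℕ} (h : f - g ∈ orderIdeal _ R (n + 1)) :
    associator f - associator g ∈ orderIdeal _ R (n + 1) := by
  have hX (i : Fin 3) : (X i : MvPowerSeries (Fin 3) R) ∈ orderIdeal _ R 1 := X_mem_orderIdeal i
  have h1 {a b : MvPowerSeries (Fin 3) R} (ha : a ∈ orderIdeal _ R 1)
      (hb : b ∈ orderIdeal _ R 1) : f.subst ![a, b] - g.subst ![a, b] ∈ orderIdeal _ R (n + 1) := by
    rw [← subst_sub (hasSubst_pair' ha hb)]
    exact subst_mem_orderIdeal (pair_mem_orderIdeal ha hb) h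
  have hf1 {a b : MvPowerSeries (Fin 3) R} (ha : a ∈ orderIdeal _ R 1)
      (hb : b ∈ orderIdeal _ R 1) : f.subst ![a, b] ∈ orderIdeal _ R 1 :=
    subst_mem_orderIdeal (pair_mem_orderIdeal ha hb) hf
  have hg1 {a b : MvPowerSeries (Fin 3) R} (ha : a ∈ orderIdeal _ R 1)
      (hb : b ∈ orderIdeal _ R 1) : g.subst ![a, b] ∈ orderIdeal _ R 1 :=
    subst_mem_orderIdeal (pair_mem_orderIdeal ha hb) hg
  have h2 {a b a' b' : MvPowerSeries (Fin 3) R} (ha : a ∈ orderIdeal _ R 1)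
      (hb : b ∈ orderIdeal _ R 1) (ha' : a' ∈ orderIdeal _ R 1) (hb' : b' ∈ orderIdeal _ R 1)
      (haa : a - a' ∈ orderIdeal _ R (n + 1)) (hbb : b - b' ∈ orderIdeal _ R (n + 1)) :
      g.subst ![a, b] - g.subst ![a', b'] ∈ orderIdeal _ R (n + 1) := by
    have := subst_sub_subst_mem_orderIdeal (k := n) (pair_mem_orderIdeal ha hb)
      (pair_mem_orderIdeal ha' hb')
      (pair_sub_mem_orderIdeal (by rwa [add_comm]) (by rwa [add_comm])) hg
    rwa [add_comm] at this
  have e : associator f - associator g =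
      ((f.subst ![f.subst ![X 0, X 1], X 2] - g.subst ![f.subst ![X 0, X 1], X 2]) +
        (g.subst ![f.subst ![X 0, X 1], X 2] - g.subst ![g.subst ![X 0, X 1], X 2])) -
      ((f.subst ![X 0, f.subst ![X 1, X 2]] - g.subst ![X 0, f.subst ![X 1, X 2]]) +
        (g.subst ![X 0, f.subst ![X 1, X 2]] - g.subst ![X 0, g.subst ![X 1, X 2]])) := by
    simp only [associator]; ring
  rw [e]
  refine Ideal.sub_mem _ (Ideal.add_mem _ ?_ ?_) (Ideal.add_mem _ ?_ ?_)
  · exact h1 (hf1 (hX _) (hX _)) (hX _)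
  · exact h2 (hf1 (hX _) (hX _)) (hX _) (hg1 (hX _) (hX _)) (hX _) (h1 (hX _) (hX _)) (by simp)
  · exact h1 (hX _) (hf1 (hX _) (hX _))
  · exact h2 (hX _) (hf1 (hX _) (hX _)) (hX _) (hg1 (hX _) (hX _)) (by simp) (h1 (hX _) (hX _))

/-- The effect of a change in degree `n` on the associator. -/
theorem associator_add_sub_mem {g Δ : MvPowerSeries (Fin 2) R} {n : ℕ}
    (hg : g - (X 0 + X 1) ∈ orderIdeal _ R 2) (hΔ : Δ ∈ orderIdeal _ R (n + 2)) :
    associator (g + Δ) - associator g - coboundary Δ ∈ orderIdeal _ R (n + 3) := by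
  have hX (i : Fin 3) : (X i : MvPowerSeries (Fin 3) R) ∈ orderIdeal _ R 1 := X_mem_orderIdeal i
  set f := g + Δ with hfdef
  have hf : f - (X 0 + X 1) ∈ orderIdeal _ R 2 := by
    have : f - (X 0 + X 1) = (g - (X 0 + X 1)) + Δ := by rw [hfdef]; ring
    rw [this]
    exact Ideal.add_mem _ hg (orderIdeal_anti (by omega) hΔ)
  have hsum {a b : MvPowerSeries (Fin 3) R} (ha : a ∈ orderIdeal _ R 1)
      (hb : b ∈ orderIdeal _ R 1) {u : MvPowerSeries (Fin 2) R}
      (hu : u - (X 0 + X 1) ∈ orderIdeal _ R 2) :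
      u.subst ![a, b] - (a + b) ∈ orderIdeal _ R 2 := by
    have := subst_mem_orderIdeal (pair_mem_orderIdeal ha hb) hu
    rw [subst_sub (hasSubst_pair' ha hb), subst_add (hasSubst_pair' ha hb),
      subst_X (hasSubst_pair' ha hb), subst_X (hasSubst_pair' ha hb)] at this
    exact this
  have h1 {a b : MvPowerSeries (Fin 3) R} (ha : a ∈ orderIdeal _ R 1)
      (hb : b ∈ orderIdeal _ R 1) {u : MvPowerSeries (Fin 2) R}
      (hu : u - (X 0 + X 1) ∈ orderIdeal _ R 2) : u.subst ![a, b] ∈ orderIdeal _ R 1 := by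
    have := Ideal.add_mem _ (orderIdeal_anti one_le_two (hsum ha hb hu)) (Ideal.add_mem _ ha hb)
    rwa [sub_add_cancel] at this
  have hfg {a b : MvPowerSeries (Fin 3) R} (ha : a ∈ orderIdeal _ R 1)
      (hb : b ∈ orderIdeal _ R 1) : f.subst ![a, b] = g.subst ![a, b] + Δ.subst ![a, b] := by
    rw [hfdef, subst_add (hasSubst_pair' ha hb)]
  have hΔa {a b : MvPowerSeries (Fin 3) R} (ha : a ∈ orderIdeal _ R 1)
      (hb : b ∈ orderIdeal _ R 1) : Δ.subst ![a, b] ∈ orderIdeal _ R (n + 2) :=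
    subst_mem_orderIdeal (pair_mem_orderIdeal ha hb) hΔ
  have hg2 {a b a' b' : MvPowerSeries (Fin 3) R} (ha : a ∈ orderIdeal _ R 1)
      (hb : b ∈ orderIdeal _ R 1) (ha' : a' ∈ orderIdeal _ R 1) (hb' : b' ∈ orderIdeal _ R 1)
      (haa : a - a' ∈ orderIdeal _ R (n + 2)) (hbb : b - b' ∈ orderIdeal _ R (n + 2)) :
      g.subst ![a, b] - g.subst ![a', b'] - (a - a') - (b - b') ∈ orderIdeal _ R (n + 3) := by
    have := subst_sub_subst_mem_orderIdeal (k := n + 1) (pair_mem_orderIdeal ha hb)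
      (pair_mem_orderIdeal ha' hb') (pair_sub_mem_orderIdeal
        (by rwa [show 1 + (n + 1) = n + 2 by ring]) (by rwa [show 1 + (n + 1) = n + 2 by ring])) hg
    rw [show 2 + (n + 1) = n + 3 by ring, subst_sub (hasSubst_pair' ha hb),
      subst_sub (hasSubst_pair' ha' hb'), subst_add (hasSubst_pair' ha hb),
      subst_add (hasSubst_pair' ha' hb'), subst_X (hasSubst_pair' ha hb),
      subst_X (hasSubst_pair' ha hb), subst_X (hasSubst_pair' ha' hb'),
      subst_X (hasSubst_pair' ha' hb')] at this
    simp only [Matrix.cons_val_zero, Matrix.cons_val_one] at this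
    convert this using 1
    ring
  have hΔ2 {a b a' b' : MvPowerSeries (Fin 3) R} (ha : a ∈ orderIdeal _ R 1)
      (hb : b ∈ orderIdeal _ R 1) (ha' : a' ∈ orderIdeal _ R 1) (hb' : b' ∈ orderIdeal _ R 1)
      (haa : a - a' ∈ orderIdeal _ R 2) (hbb : b - b' ∈ orderIdeal _ R 2) :
      Δ.subst ![a, b] - Δ.subst ![a', b'] ∈ orderIdeal _ R (n + 3) :=
    subst_sub_subst_mem_orderIdeal (k := 1) (pair_mem_orderIdeal ha hb)
      (pair_mem_orderIdeal ha' hb') (pair_sub_mem_orderIdeal haa hbb) hΔ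
  -- To leading order, Δ sees its inner argument only through the sum of the variables (`A1`, `B1`),
  -- and `g` passes a change of its inner argument on unchanged (`A2`, `B2`). What is left is the
  -- coboundary of Δ.
  have A1 := hΔ2 (h1 (hX 0) (hX 1) hf) (hX 2) (Ideal.add_mem _ (hX 0) (hX 1)) (hX 2)
    (hsum (hX 0) (hX 1) hf) (by simp)
  have A2 := hg2 (h1 (hX 0) (hX 1) hf) (hX 2) (h1 (hX 0) (hX 1) hg) (hX 2)
    (by rw [hfg (hX 0) (hX 1), add_sub_cancel_left]; exact hΔa (hX 0) (hX 1)) (by simp)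
  have B1 := hΔ2 (hX 0) (h1 (hX 1) (hX 2) hf) (hX 0) (Ideal.add_mem _ (hX 1) (hX 2))
    (by simp) (hsum (hX 1) (hX 2) hf)
  have B2 := hg2 (hX 0) (h1 (hX 1) (hX 2) hf) (hX 0) (h1 (hX 1) (hX 2) hg)
    (by simp) (by rw [hfg (hX 1) (hX 2), add_sub_cancel_left]; exact hΔa (hX 1) (hX 2))
  have := Ideal.sub_mem _ (Ideal.add_mem _ A1 A2) (Ideal.add_mem _ B1 B2)
  convert this using 1
  simp only [associator, coboundary]
  rw [hfg (h1 (hX 0) (hX 1) hf) (hX 2), hfg (hX 0) (h1 (hX 1) (hX 2) hf)]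
  have e1 := hfg (hX 0) (hX 1)
  have e2 := hfg (hX 1) (hX 2)
  linear_combination e1 - e2

theorem coeff_X_pow_fin_two (a b : ℕ) (e : Fin 2 →₀ ℕ) :
    coeff e (X 0 ^ a * X 1 ^ b : MvPowerSeries (Fin 2) R) =
      if e 0 = a ∧ e 1 = b then 1 else 0 := by
  classical
  rw [X_pow_eq, X_pow_eq, monomial_mul_monomial, one_mul, coeff_monomial]
  congr 1
  rw [eq_iff_iff, DFunLike.ext_iff]
  simp [Fin.forall_fin_two]

theorem coeff_X_pow_fin_three (a b c : ℕ) (e : Fin 3 →₀ ℕ) :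
    coeff e (X 0 ^ a * X 1 ^ b * X 2 ^ c : MvPowerSeries (Fin 3) R) =
      if e 0 = a ∧ e 1 = b ∧ e 2 = c then 1 else 0 := by
  classical
  rw [X_pow_eq, X_pow_eq, X_pow_eq, monomial_mul_monomial, monomial_mul_monomial, one_mul,
    one_mul, coeff_monomial]
  congr 1
  rw [eq_iff_iff, DFunLike.ext_iff]
  simp [Fin.forall_fin_succ]

theorem degree_fin_two (d : Fin 2 →₀ ℕ) : d.degree = d 0 + d 1 := by
  rw [Finsupp.degree_eq_sum, Fin.sum_univ_two]

theorem degree_fin_three (d : Fin 3 →₀ ℕ) : d.degree = d 0 + d 1 + d 2 := by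
  rw [Finsupp.degree_eq_sum, Fin.sum_univ_three]

/-- The exponent `(i, j)`. -/
def biexp (i j : ℕ) : Fin 2 →₀ ℕ := Finsupp.single 0 i + Finsupp.single 1 j

@[simp] theorem biexp_zero (i j : ℕ) : biexp i j 0 = i := by simp [biexp]

@[simp] theorem biexp_one (i j : ℕ) : biexp i j 1 = j := by simp [biexp]

theorem eq_biexp (d : Fin 2 →₀ ℕ) : d = biexp (d 0) (d 1) := by
  ext s; fin_cases s <;> simp

theorem sub_sum_mem_orderIdeal {Δ : MvPowerSeries (Fin 2) R} {n : ℕ}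
    (hΔ : Δ ∈ orderIdeal _ R n) :
    Δ - ∑ m ∈ Finset.range (n + 1), C (coeff (biexp m (n - m)) Δ) * (X 0 ^ m * X 1 ^ (n - m)) ∈
      orderIdeal _ R (n + 1) := by
  intro d hd
  rw [map_sub, map_sum]
  simp only [coeff_C_mul, coeff_X_pow_fin_two]
  rw [degree_fin_two] at hd
  by_cases h : d 0 + d 1 = n
  · rw [Finset.sum_eq_single (d 0), if_pos ⟨rfl, by omega⟩, mul_one,
      show n - d 0 = d 1 by omega, ← eq_biexp, sub_self]
    · intro m _ hm
      rw [if_neg fun h => hm h.1.symm, mul_zero]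
    · intro hn
      exact absurd (Finset.mem_range.2 (by omega)) hn
  · rw [hΔ d (by rw [degree_fin_two]; omega), Finset.sum_eq_zero, sub_zero]
    intro m hm
    rw [Finset.mem_range] at hm
    rw [if_neg fun h' => h (by omega), mul_zero]

/-- With positive exponents in the first and last variable, the terms Δ(x, y) and Δ(y, z) do not
contribute; the other two are expanded by the binomial theorem. This is the source of the relation
in `IsSymmCocycle`. -/
theorem coeff_coboundary {Δ : MvPowerSeries (Fin 2) R} {n : ℕ} (hΔ : Δ ∈ orderIdeal _ R n)
    {e : Fin 3 →₀ ℕ} (he : e.degree = n) (h0 : 0 < e 0) (h2 : 0 < e 2) :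
    coeff e (coboundary Δ) = (e 0 + e 1).choose (e 0) • coeff (biexp (e 0 + e 1) (e 2)) Δ -
      (e 1 + e 2).choose (e 1) • coeff (biexp (e 0) (e 1 + e 2)) Δ := by
  have hX (i : Fin 3) : (X i : MvPowerSeries (Fin 3) R) ∈ orderIdeal _ R 1 := X_mem_orderIdeal i
  have he' := degree_fin_three e
  -- In degree `n` only the homogeneous part of Δ of degree `n` matters, so the substitution becomes
  -- a finite sum.
  have key {a b : MvPowerSeries (Fin 3) R} (ha : a ∈ orderIdeal _ R 1)
      (hb : b ∈ orderIdeal _ R 1) : coeff e (Δ.subst ![a, b]) =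
        ∑ m ∈ Finset.range (n + 1), coeff (biexp m (n - m)) Δ * coeff e (a ^ m * b ^ (n - m)) := by
    have hs := hasSubst_pair' ha hb
    have := subst_mem_orderIdeal (pair_mem_orderIdeal ha hb) (sub_sum_mem_orderIdeal hΔ) e
      (by omega)
    rw [subst_sub hs, map_sub, sub_eq_zero] at this
    rw [this, ← coe_substAlgHom hs, map_sum, map_sum]
    refine Finset.sum_congr rfl fun m _ => ?_
    rw [coe_substAlgHom hs, subst_mul hs, subst_mul hs, subst_pow hs, subst_pow hs, subst_X hs,
      subst_X hs, subst_C, coeff_C_mul]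
    rfl
  have c01 : coeff e (Δ.subst ![(X 0 : MvPowerSeries (Fin 3) R), X 1]) = 0 := by
    rw [key (hX 0) (hX 1)]
    refine Finset.sum_eq_zero fun m _ => ?_
    have := coeff_X_pow_fin_three (R := R) m (n - m) 0 e
    rw [pow_zero, mul_one, if_neg fun h => h2.ne' h.2.2] at this
    rw [this, mul_zero]
  have c12 : coeff e (Δ.subst ![(X 1 : MvPowerSeries (Fin 3) R), X 2]) = 0 := by
    rw [key (hX 1) (hX 2)]
    refine Finset.sum_eq_zero fun m _ => ?_
    have := coeff_X_pow_fin_three (R := R) 0 m (n - m) e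
    rw [pow_zero, one_mul, if_neg fun h => h0.ne' h.1] at this
    rw [this, mul_zero]
  have d1 : coeff e (Δ.subst ![(X 0 + X 1 : MvPowerSeries (Fin 3) R), X 2]) =
      (e 0 + e 1).choose (e 0) • coeff (biexp (e 0 + e 1) (e 2)) Δ := by
    rw [key (Ideal.add_mem _ (hX 0) (hX 1)) (hX 2)]
    have hc (m : ℕ) : coeff e ((X 0 + X 1) ^ m * X 2 ^ (n - m) : MvPowerSeries (Fin 3) R) =
        if m = e 0 + e 1 then ((e 0 + e 1).choose (e 0) : R) else 0 := by
      have ex : ((X 0 + X 1) ^ m * X 2 ^ (n - m) : MvPowerSeries (Fin 3) R) =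
          ∑ r ∈ Finset.range (m + 1),
            C ((m.choose r : ℕ) : R) * (X 0 ^ r * X 1 ^ (m - r) * X 2 ^ (n - m)) := by
        rw [add_pow, Finset.sum_mul]
        refine Finset.sum_congr rfl fun r _ => ?_
        rw [map_natCast]; ring
      rw [ex, map_sum]
      simp only [coeff_C_mul, coeff_X_pow_fin_three]
      by_cases hm : m = e 0 + e 1
      · rw [if_pos hm, Finset.sum_eq_single (e 0), if_pos ⟨rfl, by omega, by omega⟩, mul_one, hm]
        · intro r _ hr
          rw [if_neg fun h => hr h.1.symm, mul_zero]
        · intro hr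
          exact absurd (Finset.mem_range.2 (by omega)) hr
      · rw [if_neg hm]
        refine Finset.sum_eq_zero fun r hr => ?_
        rw [Finset.mem_range] at hr
        rw [if_neg fun h => hm (by omega), mul_zero]
    rw [Finset.sum_eq_single (e 0 + e 1), hc, if_pos rfl, nsmul_eq_mul, mul_comm,
      show n - (e 0 + e 1) = e 2 by omega]
    · intro m _ hm
      rw [hc, if_neg hm, mul_zero]
    · intro hm
      exact absurd (Finset.mem_range.2 (by omega)) hm
  have d2 : coeff e (Δ.subst ![(X 0 : MvPowerSeries (Fin 3) R), X 1 + X 2]) =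
      (e 1 + e 2).choose (e 1) • coeff (biexp (e 0) (e 1 + e 2)) Δ := by
    rw [key (hX 0) (Ideal.add_mem _ (hX 1) (hX 2))]
    have hc (m : ℕ) (hmn : m ≤ n) :
        coeff e (X 0 ^ m * (X 1 + X 2) ^ (n - m) : MvPowerSeries (Fin 3) R) =
        if m = e 0 then ((e 1 + e 2).choose (e 1) : R) else 0 := by
      have ex : (X 0 ^ m * (X 1 + X 2) ^ (n - m) : MvPowerSeries (Fin 3) R) =
          ∑ r ∈ Finset.range (n - m + 1),
            C (((n - m).choose r : ℕ) : R) * (X 0 ^ m * X 1 ^ r * X 2 ^ (n - m - r)) := by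
        rw [add_pow, Finset.mul_sum]
        refine Finset.sum_congr rfl fun r _ => ?_
        rw [map_natCast]; ring
      rw [ex, map_sum]
      simp only [coeff_C_mul, coeff_X_pow_fin_three]
      by_cases hm : m = e 0
      · rw [if_pos hm, Finset.sum_eq_single (e 1), if_pos ⟨hm.symm, rfl, by omega⟩, mul_one,
          show n - m = e 1 + e 2 by omega]
        · intro r _ hr
          rw [if_neg fun h => hr h.2.1.symm, mul_zero]
        · intro hr
          exact absurd (Finset.mem_range.2 (by omega)) hr
      · rw [if_neg hm]
        refine Finset.sum_eq_zero fun r hr => ?_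
        rw [if_neg fun h => hm h.1.symm, mul_zero]
    rw [Finset.sum_eq_single (e 0), hc _ (by omega), if_pos rfl, nsmul_eq_mul, mul_comm,
      show n - e 0 = e 1 + e 2 by omega]
    · intro m hmr hm
      rw [Finset.mem_range] at hmr
      rw [hc _ (by omega), if_neg hm, mul_zero]
    · intro hm
      exact absurd (Finset.mem_range.2 (by omega)) hm
  simp only [coboundary, map_sub, map_add, c01, c12, d1, d2, zero_add, sub_zero]

end Subst

section Logarithm

variable {τ R : Type*} [CommRing R]

theorem exists_inverse {ℓ : MvPowerSeries Unit R} (hℓ : ℓ - X () ∈ orderIdeal _ R 2) :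
    ∃ e ∈ orderIdeal Unit R 1, ℓ.subst (fun _ => e) = X () := by
  have hc : ∀ n, n < 2 → PowerSeries.coeff n ℓ = PowerSeries.coeff n (PowerSeries.X : PowerSeries R) :=
    fun n hn => by
      have := hℓ (Finsupp.single () n) (by simpa using hn)
      rw [map_sub, sub_eq_zero] at this
      exact this
  have h1 : PowerSeries.coeff 1 ℓ = 1 := by rw [hc 1 one_lt_two, PowerSeries.coeff_one_X]
  have h0 : PowerSeries.constantCoeff ℓ = 0 := by
    rw [← PowerSeries.coeff_zero_eq_constantCoeff_apply, hc 0 two_pos, PowerSeries.coeff_zero_X]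
  let _ : Invertible (PowerSeries.coeff 1 ℓ) := h1 ▸ invertibleOne
  exact ⟨PowerSeries.substInv ℓ, mem_orderIdeal_one.2 (PowerSeries.constantCoeff_substInv ℓ),
    PowerSeries.subst_substInv_right ℓ h0⟩

theorem log_sub_log_sub_mem {ℓ : MvPowerSeries Unit R} (hℓ : ℓ - X () ∈ orderIdeal _ R 2)
    {a b : MvPowerSeries τ R} (ha : a ∈ orderIdeal _ R 1) (hb : b ∈ orderIdeal _ R 1) {n : ℕ}
    (hab : a - b ∈ orderIdeal _ R (n + 1)) :
    (ℓ.subst fun _ => a) - (ℓ.subst fun _ => b) - (a - b) ∈ orderIdeal _ R (n + 2) := by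
  have hsa : HasSubst (fun _ : Unit => a) := hasSubst_of_mem_orderIdeal fun _ => ha
  have hsb : HasSubst (fun _ : Unit => b) := hasSubst_of_mem_orderIdeal fun _ => hb
  have := subst_sub_subst_mem_orderIdeal (k := n) (fun _ => ha) (fun _ => hb)
    (fun _ => by rwa [add_comm]) hℓ
  rw [subst_sub hsa, subst_sub hsb, subst_X hsa, subst_X hsb, add_comm] at this
  convert this using 1
  ring

/-- Bootstrapping: as ℓ - X has order 2, the difference of the logarithms equals `a - b` one degree
further than `a` and `b` are already known to agree. -/
theorem sub_mem_of_log_sub_log_mem {ℓ : MvPowerSeries Unit R} (hℓ : ℓ - X () ∈ orderIdeal _ R 2)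
    {a b : MvPowerSeries τ R} (ha : a ∈ orderIdeal _ R 1) (hb : b ∈ orderIdeal _ R 1) {n : ℕ}
    (h : (ℓ.subst fun _ => a) - (ℓ.subst fun _ => b) ∈ orderIdeal _ R n) :
    a - b ∈ orderIdeal _ R n := by
  induction n with
  | zero => simp
  | succ n ih =>
    rcases n with _ | n
    · exact Ideal.sub_mem _ ha hb
    · have h1 := ih (orderIdeal_anti (Nat.le_succ _) h)
      have := Ideal.sub_mem _ h (log_sub_log_sub_mem hℓ ha hb h1)
      rwa [sub_sub_cancel] at this

theorem log_injective {ℓ : MvPowerSeries Unit R} (hℓ : ℓ - X () ∈ orderIdeal _ R 2)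
    {a b : MvPowerSeries τ R} (ha : a ∈ orderIdeal _ R 1) (hb : b ∈ orderIdeal _ R 1)
    (h : (ℓ.subst fun _ => a) = ℓ.subst fun _ => b) : a = b :=
  sub_eq_zero.1 (eq_zero_of_forall_mem_orderIdeal fun n =>
    sub_mem_of_log_sub_log_mem hℓ ha hb (by rw [h, sub_self]; exact Ideal.zero_mem _))

/-- `ℓ` is a logarithm of the series `H`. -/
structure IsLogarithm (ℓ : MvPowerSeries Unit R) (H : MvPowerSeries (Fin 2) R) : Prop where
  normalized : ℓ - X () ∈ orderIdeal _ R 2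
  mem : H ∈ orderIdeal _ R 1
  log : (ℓ.subst fun _ => H) = (ℓ.subst fun _ => X 0) + ℓ.subst fun _ => X 1

/-- The law is ℓ⁻¹(ℓ(x) + ℓ(y)). -/
theorem exists_isLogarithm {ℓ : MvPowerSeries Unit R} (hℓ : ℓ - X () ∈ orderIdeal _ R 2) :
    ∃ H, IsLogarithm ℓ H := by
  obtain ⟨e, he, hℓe⟩ := exists_inverse hℓ
  have hℓ1 : ℓ ∈ orderIdeal _ R 1 := by
    have := Ideal.add_mem _ (orderIdeal_anti one_le_two hℓ) (X_mem_orderIdeal ())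
    rwa [sub_add_cancel] at this
  set L : MvPowerSeries (Fin 2) R := (ℓ.subst fun _ => X 0) + ℓ.subst fun _ => X 1 with hL
  have hL1 : L ∈ orderIdeal _ R 1 := Ideal.add_mem _
    (subst_mem_orderIdeal (fun _ => X_mem_orderIdeal _) hℓ1)
    (subst_mem_orderIdeal (fun _ => X_mem_orderIdeal _) hℓ1)
  have hs : HasSubst (fun _ : Unit => L) := hasSubst_of_mem_orderIdeal fun _ => hL1
  refine ⟨e.subst fun _ => L, hℓ, subst_mem_orderIdeal (fun _ => hL1) he, ?_⟩
  rw [← subst_unit_subst he hs, hℓe, subst_X hs]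

namespace IsLogarithm

variable {ℓ : MvPowerSeries Unit R} {H : MvPowerSeries (Fin 2) R}

theorem log_subst (h : IsLogarithm ℓ H) {a b : MvPowerSeries τ R} (ha : a ∈ orderIdeal _ R 1)
    (hb : b ∈ orderIdeal _ R 1) : (ℓ.subst fun _ => H.subst ![a, b]) =
      (ℓ.subst fun _ => a) + ℓ.subst fun _ => b := by
  have hs := hasSubst_pair' ha hb
  rw [← subst_unit_subst h.mem hs, h.log, subst_add hs,
    subst_unit_subst (X_mem_orderIdeal _) hs, subst_unit_subst (X_mem_orderIdeal _) hs,
    subst_X hs, subst_X hs]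
  rfl

theorem subst_mem (h : IsLogarithm ℓ H) {a b : MvPowerSeries τ R} (ha : a ∈ orderIdeal _ R 1)
    (hb : b ∈ orderIdeal _ R 1) : H.subst ![a, b] ∈ orderIdeal _ R 1 :=
  subst_mem_orderIdeal (pair_mem_orderIdeal ha hb) h.mem

/-- Both bracketings have the logarithm ℓ(x) + ℓ(y) + ℓ(z), and a logarithm is injective on series
without constant term. -/
theorem associator_eq_zero (h : IsLogarithm ℓ H) : associator H = 0 := by
  have hX (i : Fin 3) : (X i : MvPowerSeries (Fin 3) R) ∈ orderIdeal _ R 1 := X_mem_orderIdeal i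
  refine sub_eq_zero.2 (log_injective h.normalized
    (h.subst_mem (h.subst_mem (hX 0) (hX 1)) (hX 2))
    (h.subst_mem (hX 0) (h.subst_mem (hX 1) (hX 2))) ?_)
  rw [h.log_subst (h.subst_mem (hX 0) (hX 1)) (hX 2), h.log_subst (hX 0) (hX 1),
    h.log_subst (hX 0) (h.subst_mem (hX 1) (hX 2)), h.log_subst (hX 1) (hX 2), add_assoc]

theorem swap (h : IsLogarithm ℓ H) : H.subst ![X 1, X 0] = H := by
  refine log_injective h.normalized (h.subst_mem (X_mem_orderIdeal _) (X_mem_orderIdeal _))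
    h.mem ?_
  rw [h.log_subst (X_mem_orderIdeal _) (X_mem_orderIdeal _), h.log, add_comm]

theorem sub_mem (h : IsLogarithm ℓ H) : H - (X 0 + X 1) ∈ orderIdeal _ R 2 := by
  have hℓX (a : MvPowerSeries (Fin 2) R) (ha : a ∈ orderIdeal _ R 1) :
      (ℓ.subst fun _ => a) - a ∈ orderIdeal _ R 2 := by
    have hs : HasSubst (fun _ : Unit => a) := hasSubst_of_mem_orderIdeal fun _ => ha
    have := subst_mem_orderIdeal (fun _ => ha) h.normalized
    rwa [subst_sub hs, subst_X hs] at this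
  have h0 := hℓX H h.mem
  have h1 := hℓX (X 0) (X_mem_orderIdeal 0)
  have h2 := hℓX (X 1) (X_mem_orderIdeal 1)
  rw [h.log] at h0
  have := Ideal.sub_mem _ (Ideal.add_mem _ h1 h2) h0
  convert this using 1
  ring

/-- The effect of a change of the logarithm in degree `n`. -/
theorem exists_change (h : IsLogarithm ℓ H) (c : R) {n : ℕ} (hn : 2 ≤ n) :
    ∃ ℓ' H', IsLogarithm ℓ' H' ∧
      H' - (H - C c * ((X 0 + X 1) ^ n - X 0 ^ n - X 1 ^ n)) ∈ orderIdeal _ R (n + 1) := by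
  obtain ⟨n, rfl⟩ : ∃ m, n = m + 2 := ⟨n - 2, by omega⟩
  set ℓ' : MvPowerSeries Unit R := ℓ + C c * X () ^ (n + 2) with hℓ'
  have hXn : (X () ^ (n + 2) : MvPowerSeries Unit R) ∈ orderIdeal _ R (n + 2) :=
    pow_mem_orderIdeal (X_mem_orderIdeal _) _
  have hnorm : ℓ' - X () ∈ orderIdeal _ R 2 := by
    have : ℓ' - X () = (ℓ - X ()) + C c * X () ^ (n + 2) := by rw [hℓ']; ring
    rw [this]
    exact Ideal.add_mem _ h.normalized
      (Ideal.mul_mem_left _ _ (orderIdeal_anti (by omega) hXn))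
  obtain ⟨H', h'⟩ := exists_isLogarithm hnorm
  refine ⟨ℓ', H', h', ?_⟩
  have hsub (a : MvPowerSeries (Fin 2) R) (ha : a ∈ orderIdeal _ R 1) :
      (ℓ'.subst fun _ => a) = (ℓ.subst fun _ => a) + C c * a ^ (n + 2) := by
    have hs : HasSubst (fun _ : Unit => a) := hasSubst_of_mem_orderIdeal fun _ => ha
    rw [hℓ', subst_add hs, subst_mul hs, subst_pow hs, subst_X hs, subst_C]
  -- The difference of the functional equations for ℓ and ℓ'. To leading order the left side is H' -
  -- H, and on the right H' may be replaced by x + y (`e3`).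
  have e : (ℓ.subst fun _ => H') - (ℓ.subst fun _ => H) =
      C c * (X 0 ^ (n + 2) + X 1 ^ (n + 2) - H' ^ (n + 2)) := by
    have h1 := h'.log
    rw [hsub _ h'.mem, hsub _ (X_mem_orderIdeal 0), hsub _ (X_mem_orderIdeal 1)] at h1
    rw [h.log]
    linear_combination h1
  have hp (a : MvPowerSeries (Fin 2) R) (ha : a ∈ orderIdeal _ R 1) :
      a ^ (n + 2) ∈ orderIdeal _ R (n + 2) := pow_mem_orderIdeal ha _
  have e1 : (ℓ.subst fun _ => H') - (ℓ.subst fun _ => H) ∈ orderIdeal _ R (n + 2) := by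
    rw [e]
    exact Ideal.mul_mem_left _ _ (Ideal.sub_mem _ (Ideal.add_mem _ (hp _ (X_mem_orderIdeal _))
      (hp _ (X_mem_orderIdeal _))) (hp _ h'.mem))
  have e2 := log_sub_log_sub_mem h.normalized h'.mem h.mem
    (sub_mem_of_log_sub_log_mem h.normalized h'.mem h.mem e1)
  have e3 : H' ^ (n + 2) - (X 0 + X 1) ^ (n + 2) ∈ orderIdeal _ R (n + 3) := by
    have hX01 := Ideal.add_mem _ (X_mem_orderIdeal (R := R) (0 : Fin 2)) (X_mem_orderIdeal 1)
    have := subst_sub_subst_mem_orderIdeal (k := 1) (fun _ => h'.mem) (fun _ => hX01)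
      (fun _ => h'.sub_mem) hXn
    rwa [subst_pow (hasSubst_of_mem_orderIdeal fun _ => h'.mem),
      subst_pow (hasSubst_of_mem_orderIdeal fun _ => hX01),
      subst_X (hasSubst_of_mem_orderIdeal fun _ => h'.mem),
      subst_X (hasSubst_of_mem_orderIdeal fun _ => hX01)] at this
  rw [e] at e2
  have := Ideal.add_mem _ (neg_mem e2) (Ideal.mul_mem_left _ (C (-c)) e3)
  convert this using 1
  rw [map_neg]
  ring

end IsLogarithm

end Logarithm

end MvPowerSeries

end

/-! ### The inductive construction of the lift -/

noncomputable section

namespace MvPowerSeries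

section Swap

variable {R : Type*} [CommRing R]

theorem coeff_subst_swap (f : MvPowerSeries (Fin 2) R) (i j : ℕ) :
    coeff (biexp i j) (f.subst ![(X 1 : MvPowerSeries (Fin 2) R), X 0]) =
      coeff (biexp j i) f := by
  have h := FormalGroupAlgebra.coeff_renameEquiv (Equiv.swap (0 : Fin 2) 1) f (biexp i j)
  have e : (![X 1, X 0] : Fin 2 → MvPowerSeries (Fin 2) R) = X ∘ Equiv.swap (0 : Fin 2) 1 := by
    funext s; fin_cases s <;> simp
  have e2 : renameEquiv R (Equiv.swap (0 : Fin 2) 1) f =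
      f.subst ![(X 1 : MvPowerSeries (Fin 2) R), X 0] := by
    rw [e]
    change rename (Equiv.swap (0 : Fin 2) 1) f = _
    rw [rename_eq_subst]
  rw [← e2, h]
  congr 1
  simp [biexp, Finsupp.mapDomain_add, Finsupp.mapDomain_single, add_comm]

theorem coeff_binomial_sub {n i : ℕ} (hi : i ≤ n) :
    coeff (biexp i (n - i)) ((X 0 + X 1) ^ n - X 0 ^ n - X 1 ^ n : MvPowerSeries (Fin 2) R) =
      (n.choose i : R) - (if i = n then 1 else 0) - (if i = 0 then 1 else 0) := by
  have h0 := coeff_X_pow_fin_two (R := R) n 0 (biexp i (n - i))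
  have h1 := coeff_X_pow_fin_two (R := R) 0 n (biexp i (n - i))
  rw [pow_zero, mul_one] at h0
  rw [pow_zero, one_mul] at h1
  rw [map_sub, map_sub, h0, h1]
  congr 1
  · congr 1
    · rw [add_pow, map_sum]
      have e (m : ℕ) : (X 0 ^ m * X 1 ^ (n - m) * (n.choose m : MvPowerSeries (Fin 2) R)) =
          C ((n.choose m : ℕ) : R) * (X 0 ^ m * X 1 ^ (n - m)) := by
        rw [map_natCast]; ring
      simp only [e, coeff_C_mul, coeff_X_pow_fin_two, biexp_zero, biexp_one]
      rw [Finset.sum_eq_single i, if_pos ⟨rfl, rfl⟩, mul_one]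
      · intro m _ hm
        rw [if_neg fun h => hm h.1.symm, mul_zero]
      · intro hm
        exact absurd (Finset.mem_range.2 (by omega)) hm
    · simp only [biexp_zero, biexp_one]
      congr 1
      rw [eq_iff_iff]; omega
  · simp only [biexp_zero, biexp_one]
    congr 1
    rw [eq_iff_iff]; omega

theorem binomial_sub_mem {n : ℕ} :
    ((X 0 + X 1) ^ n - X 0 ^ n - X 1 ^ n : MvPowerSeries (Fin 2) R) ∈ orderIdeal _ R n :=
  Ideal.sub_mem _ (Ideal.sub_mem _
    (pow_mem_orderIdeal (Ideal.add_mem _ (X_mem_orderIdeal _) (X_mem_orderIdeal _)) _)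
    (pow_mem_orderIdeal (X_mem_orderIdeal _) _)) (pow_mem_orderIdeal (X_mem_orderIdeal _) _)

theorem map_associator {S : Type*} [CommRing S] (φ : R →+* S) {f : MvPowerSeries (Fin 2) R}
    (hf : f ∈ orderIdeal _ R 1) : (associator f).map φ = associator (f.map φ) := by
  have hX (i : Fin 3) : (X i : MvPowerSeries (Fin 3) R) ∈ orderIdeal _ R 1 := X_mem_orderIdeal i
  have hf1 {a b : MvPowerSeries (Fin 3) R} (ha : a ∈ orderIdeal _ R 1)
      (hb : b ∈ orderIdeal _ R 1) : f.subst ![a, b] ∈ orderIdeal _ R 1 :=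
    subst_mem_orderIdeal (pair_mem_orderIdeal ha hb) hf
  simp only [associator, map_sub]
  rw [map_subst_pair φ (hf1 (hX 0) (hX 1)) (hX 2), map_subst_pair φ (hX 0) (hX 1),
    map_subst_pair φ (hX 0) (hf1 (hX 1) (hX 2)), map_subst_pair φ (hX 1) (hX 2)]
  simp only [map_X]

/-- The formal group law of an associative series. -/
def formalGroupOfAssociator (f : MvPowerSeries (Fin 2) R)
    (hf : f - (X 0 + X 1) ∈ orderIdeal _ R 2) (h : associator f = 0) : FormalGroup R where
  toPowerSeries := f
  zero_constantCoeff := by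
    have := hf 0 (by simp)
    rw [map_sub, sub_eq_zero] at this
    simpa using this
  lin_coeff_X := by
    have := hf (Finsupp.single 0 1) (by simp)
    rw [map_sub, sub_eq_zero] at this
    rw [this]; simp [coeff_X, Finsupp.single_left_inj]
  lin_coeff_Y := by
    have := hf (Finsupp.single 1 1) (by simp)
    rw [map_sub, sub_eq_zero] at this
    rw [this]; simp [coeff_X, Finsupp.single_left_inj]
  assoc := sub_eq_zero.1 h

theorem _root_.FormalGroup.associator_eq_zero (F : FormalGroup R) :
    associator F.toPowerSeries = 0 := sub_eq_zero.2 F.assoc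

theorem _root_.FormalGroup.sub_mem_orderIdeal (F : FormalGroup R) :
    F.toPowerSeries - (X 0 + X 1) ∈ orderIdeal _ R 2 := by
  rw [F.toPowerSeries_eq, add_sub_cancel_left]
  exact Ideal.mul_mem_right _ _ (mul_mem_orderIdeal (X_mem_orderIdeal 0) (X_mem_orderIdeal 1))

end Swap

section Lift

variable {A R K : Type*} [CommRing A] [CommRing R] [CommRing K] [Algebra ℚ K]

/-- Let Δ be the discrepancy between the law H over K and the image of the lift G. Its coefficients
in degree `n` matter only modulo the image of the kernel of π. There they form a symmetric cocycle,
because H and F are both associative and commutative. By the comparison lemma this cocycle is a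
multiple of the standard one, and a change of the logarithm by c X^n removes it up to elements
coming from ker π. Those are absorbed into G without changing its reduction. -/
theorem exists_lift_step (j : A →+* K) (π : A →+* R) {F : FormalGroup R} [F.IsComm] {n : ℕ}
    (hn : 2 ≤ n) {ℓ : MvPowerSeries Unit K} {H : MvPowerSeries (Fin 2) K}
    {G : MvPowerSeries (Fin 2) A} (hH : IsLogarithm ℓ H) (hG : G.map π = F.toPowerSeries)
    (hG1 : G ∈ orderIdeal _ A 1) (hGH : G.map j - H ∈ orderIdeal _ K n) :
    ∃ ℓ' H' G', IsLogarithm ℓ' H' ∧ G'.map π = F.toPowerSeries ∧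
      G'.map j - H' ∈ orderIdeal _ K (n + 1) ∧ G' - G ∈ orderIdeal _ A n := by
  classical
  set Δ := H - G.map j with hΔ
  have hΔn : Δ ∈ orderIdeal _ K n := by rw [hΔ, ← neg_sub]; exact neg_mem hGH
  -- The indeterminacy of the coefficients of G: adding elements of ker π to them does not affect
  -- the condition that G reduces to F.
  set E : AddSubgroup K := (RingHom.ker π).toAddSubgroup.map j.toAddMonoidHom with hE
  have hEmem {r : A} (hr : π r = 0) : j r ∈ E := ⟨r, hr, rfl⟩
  set γ : ℕ → K ⧸ E := fun i => QuotientAddGroup.mk (coeff (biexp i (n - i)) Δ) with hγ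
  let FH := formalGroupOfAssociator H hH.sub_mem hH.associator_eq_zero
  have hend (d : Fin 2 →₀ ℕ) (hF : coeff d F.toPowerSeries = 0) (hH0 : coeff d H = 0) :
      coeff d Δ ∈ E := by
    rw [hΔ, map_sub, hH0, _root_.zero_sub, coeff_map]
    exact neg_mem (hEmem (by rw [← coeff_map, hG, hF]))
  have hsymm : IsSymmCocycle n γ := by
    constructor
    · intro i h0 h1
      refine QuotientAddGroup.eq.2 ?_
      rw [show n - (n - i) = i by omega, hΔ, map_sub, map_sub]
      have h2 : coeff (biexp (n - i) i) H = coeff (biexp i (n - i)) H := by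
        conv_rhs => rw [← hH.swap, coeff_subst_swap]
      have h3 : coeff (biexp (n - i) i) F.toPowerSeries =
          coeff (biexp i (n - i)) F.toPowerSeries := by
        conv_rhs => rw [FormalGroup.IsComm.comm (F := F)]
        exact (coeff_subst_swap _ _ _).symm
      have : -(coeff (biexp (n - i) i) H - coeff (biexp (n - i) i) (G.map j)) +
          (coeff (biexp i (n - i)) H - coeff (biexp i (n - i)) (G.map j)) =
          j (coeff (biexp (n - i) i) G - coeff (biexp i (n - i)) G) := by
        rw [h2, map_sub, coeff_map, coeff_map]; ring
      rw [this]
      refine hEmem ?_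
      rw [map_sub, ← coeff_map, ← coeff_map, hG, h3, sub_self]
    · intro i k l hi hk hl hikl
      let e : Fin 3 →₀ ℕ := Finsupp.equivFunOnFinite.symm ![i, k, l]
      have he0 : e 0 = i := rfl
      have he1 : e 1 = k := rfl
      have he2 : e 2 = l := rfl
      have hed : e.degree = n := by rw [degree_fin_three, he0, he1, he2, hikl]
      have hcob := coeff_coboundary hΔn hed (by omega) (by omega)
      have hg2 : G.map j - (X 0 + X 1) ∈ orderIdeal _ K 2 := by
        have := Ideal.add_mem _ (orderIdeal_anti hn hGH) hH.sub_mem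
        rwa [sub_add_sub_cancel] at this
      obtain ⟨m, rfl⟩ : ∃ m, n = m + 2 := ⟨n - 2, by omega⟩
      -- As H is associative, the coboundary of Δ is minus the associator of the image of G in
      -- degree `n`. The latter comes from ker π, because F is associative.
      have h1 := associator_add_sub_mem hg2 hΔn e (by omega)
      rw [hΔ, add_sub_cancel, hH.associator_eq_zero, ← hΔ, ← map_associator j hG1, _root_.zero_sub,
        map_sub, map_neg, coeff_map] at h1
      have h2 : π (coeff e (associator G)) = 0 := by
        rw [← coeff_map, map_associator π hG1, hG, F.associator_eq_zero, map_zero]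
      have h3 : coeff e (coboundary Δ) = j (-coeff e (associator G)) := by
        rw [map_neg]; linear_combination -h1
      rw [h3, he0, he1, he2] at hcob
      rw [hγ]
      simp only
      rw [← QuotientAddGroup.mk_nsmul, ← QuotientAddGroup.mk_nsmul]
      refine (QuotientAddGroup.eq.2 ?_)
      rw [show m + 2 - (i + k) = l by omega, show m + 2 - i = k + l by omega]
      have : -((i + k).choose i • coeff (biexp (i + k) l) Δ) +
          (k + l).choose k • coeff (biexp i (k + l)) Δ = j (coeff e (associator G)) := by
        rw [map_neg] at hcob
        linear_combination hcob
      rw [this]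
      exact hEmem h2
  obtain ⟨d, a, hd, ha⟩ := hsymm.exists_eq_smul hn
  obtain ⟨a, rfl⟩ := QuotientAddGroup.mk_surjective a
  -- Chosen so that c times the binomial coefficient m_i d is m_i a. Division by `d` is where K has
  -- to be a ℚ-algebra.
  set c : K := (d : ℚ)⁻¹ • a with hc
  set B : MvPowerSeries (Fin 2) K := (X 0 + X 1) ^ n - X 0 ^ n - X 1 ^ n with hB
  have hcoef (i : ℕ) (hi : i ≤ n) : coeff (biexp i (n - i)) (Δ - C c * B) ∈ E := by
    rw [map_sub, coeff_C_mul, coeff_binomial_sub hi]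
    by_cases h0 : i = 0
    · subst h0
      rw [if_neg (by omega), if_pos rfl, Nat.choose_zero_right]
      have hb : biexp 0 (n - 0) = Finsupp.single 1 n := by simp [biexp]
      simp only [Nat.cast_one, sub_zero, sub_self, mul_zero]
      rw [hb]
      refine hend _ ?_ ?_
      · rw [F.coeff_single_one, if_neg (by omega)]
      · exact (FH.coeff_single_one n).trans (if_neg (by omega))
    by_cases hin : i = n
    · subst hin
      rw [if_pos rfl, if_neg h0, Nat.choose_self]
      have hb : biexp i (i - i) = Finsupp.single 0 i := by simp [biexp]
      simp only [Nat.cast_one, sub_zero, sub_self, mul_zero]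
      rw [hb]
      refine hend _ ?_ ?_
      · rw [F.coeff_single_zero, if_neg (by omega)]
      · exact (FH.coeff_single_zero i).trans (if_neg (by omega))
    rw [if_neg h0, if_neg hin, sub_zero, sub_zero]
    obtain ⟨m, hm, hmγ⟩ := ha i (by omega) (by omega)
    have e : c * (n.choose i : K) = m • a := by
      have : ((n.choose i : ℕ) : K) = (((m * d : ℤ) : ℚ)) • (1 : K) := by
        rw [hm, Algebra.smul_def, mul_one]; simp
      rw [this, hc, Int.cast_mul, mul_smul_comm, mul_one, smul_smul, mul_assoc,
        mul_inv_cancel₀ (by exact_mod_cast hd), mul_one, Int.cast_smul_eq_zsmul]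
    rw [e]
    have := QuotientAddGroup.eq.1 ((QuotientAddGroup.mk_zsmul E a m).trans hmγ.symm)
    rwa [neg_add_eq_sub] at this
  choose! r hr hjr using hcoef
  obtain ⟨ℓ', H', hH', hc'⟩ := hH.exists_change c hn
  set D : MvPowerSeries (Fin 2) A :=
    ∑ i ∈ Finset.range (n + 1), C (r i) * (X 0 ^ i * X 1 ^ (n - i)) with hD
  refine ⟨ℓ', H', G + D, hH', ?_, ?_, ?_⟩
  · rw [map_add, hG, hD, map_sum, Finset.sum_eq_zero, _root_.add_zero]
    intro i hi
    have : π (r i) = 0 := hr i (by rw [Finset.mem_range] at hi; omega)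
    rw [map_mul, map_C, this, map_zero, zero_mul]
  · have hDj : D.map j = ∑ i ∈ Finset.range (n + 1),
        C (coeff (biexp i (n - i)) (Δ - C c * B)) * (X 0 ^ i * X 1 ^ (n - i)) := by
      rw [hD, map_sum]
      refine Finset.sum_congr rfl fun i hi => ?_
      rw [map_mul, map_C, map_mul, map_pow, map_pow, map_X, map_X]
      congr 2
      exact hjr i (by rw [Finset.mem_range] at hi; omega)
    have h1 := sub_sum_mem_orderIdeal (Δ := Δ - C c * B) (n := n)
      (Ideal.sub_mem _ hΔn (Ideal.mul_mem_left _ _ binomial_sub_mem))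
    rw [← hDj] at h1
    have := neg_mem (Ideal.add_mem _ h1 hc')
    convert this using 1
    rw [map_add, hΔ]
    ring
  · rw [add_sub_cancel_left, hD]
    refine Ideal.sum_mem _ fun i hi => Ideal.mul_mem_left _ _ ?_
    have := mul_mem_orderIdeal (R := A) (pow_mem_orderIdeal (X_mem_orderIdeal (0 : Fin 2)) i)
      (pow_mem_orderIdeal (X_mem_orderIdeal 1) (n - i))
    rw [Finset.mem_range] at hi
    rwa [show i + (n - i) = n by omega] at this

/-- Commutative formal group laws lift along surjections from subrings of `ℚ`-algebras. -/
theorem exists_formalGroup_map_eq {j : A →+* K} (hj : Function.Injective j) {π : A →+* R}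
    (hπ : Function.Surjective π) (F : FormalGroup R) [F.IsComm] :
    ∃ F' : FormalGroup A, F'.IsComm ∧ F'.map π = F := by
  classical
  -- Since j is injective, vanishing of coefficients over A can be tested over K.
  have hmem {m : ℕ} {τ : Type} {f : MvPowerSeries τ A} (h : f.map j ∈ orderIdeal τ K m) :
      f ∈ orderIdeal τ A m := fun d hd => hj (by rw [← coeff_map, h d hd, map_zero])
  let P (n : ℕ) (p : MvPowerSeries (Fin 2) K × MvPowerSeries (Fin 2) A) : Prop :=
    (∃ ℓ, IsLogarithm ℓ p.1) ∧ p.2.map π = F.toPowerSeries ∧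
      p.2.map j - p.1 ∈ orderIdeal _ K (n + 2)
  have hP1 {n p} (h : P n p) : p.2.map j - (X 0 + X 1) ∈ orderIdeal _ K 2 := by
    obtain ⟨⟨ℓ, hℓ⟩, -, h⟩ := h
    have := Ideal.add_mem _ (orderIdeal_anti (by omega) h) hℓ.sub_mem
    rwa [sub_add_sub_cancel] at this
  have hP2 {n p} (h : P n p) : p.2 - (X 0 + X 1) ∈ orderIdeal _ A 2 :=
    hmem (by rw [map_sub, map_add, map_X, map_X]; exact hP1 h)
  have hlin {f : MvPowerSeries (Fin 2) A} (h : f - (X 0 + X 1) ∈ orderIdeal _ A 2) :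
      f ∈ orderIdeal _ A 1 := by
    have := Ideal.add_mem _ (orderIdeal_anti one_le_two h)
      (Ideal.add_mem _ (X_mem_orderIdeal 0) (X_mem_orderIdeal 1))
    rwa [sub_add_cancel] at this
  -- The additive law, with logarithm X, and a coefficientwise lift of F corrected to x + y in
  -- degree less than 2. The index in `P` is shifted by 2, so this is the stage `P 0`.
  have start : ∃ p, P 0 p := by
    obtain ⟨H, hH⟩ := exists_isLogarithm (R := K) (ℓ := X ()) (by simp)
    obtain ⟨G, hG⟩ := exists_coeff_eq (σ := Fin 2) (R := A) fun d =>
      if d.degree < 2 then coeff d (X 0 + X 1) else (hπ (coeff d F.toPowerSeries)).choose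
    have hG2 : G - (X 0 + X 1) ∈ orderIdeal _ A 2 := fun d hd => by
      rw [map_sub, hG, if_pos hd, sub_self]
    refine ⟨(H, G), ⟨_, hH⟩, ?_, ?_⟩
    · ext d
      rw [coeff_map, hG]
      split_ifs with hd
      · have := F.sub_mem_orderIdeal d hd
        rw [map_sub, sub_eq_zero] at this
        rw [this, ← coeff_map, map_add, map_X, map_X]
      · exact (hπ _).choose_spec
    · have := Ideal.sub_mem _ (map_mem_orderIdeal j hG2) hH.sub_mem
      rw [map_sub, map_add, map_X, map_X, sub_sub_sub_cancel_right] at this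
      exact this
  have step (n : ℕ) (p) (hp : P n p) : ∃ q, P (n + 1) q ∧ q.2 - p.2 ∈ orderIdeal _ A (n + 2) := by
    have h1 := hlin (hP2 hp)
    obtain ⟨⟨ℓ, hℓ⟩, hπ', h⟩ := hp
    obtain ⟨ℓ', H', G', h1, h2, h3, h4⟩ := exists_lift_step j π (by omega) hℓ hπ' h1 h
    exact ⟨(H', G'), ⟨⟨ℓ', h1⟩, h2, h3⟩, h4⟩
  choose p0 hp0 using start
  choose! nx hnx1 hnx2 using step
  let s : ℕ → MvPowerSeries (Fin 2) K × MvPowerSeries (Fin 2) A := fun n => Nat.rec p0 nx n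
  have hs (n : ℕ) : P n (s n) := by
    induction n with
    | zero => exact hp0
    | succ n ih => exact hnx1 n _ ih
  obtain ⟨G, hG⟩ := exists_limit (g := fun n => (s n).2) fun n =>
    orderIdeal_anti (by omega) (hnx2 n _ (hs n))
  have hGH (n : ℕ) : G.map j - (s n).1 ∈ orderIdeal _ K n := by
    have := Ideal.add_mem _ (map_mem_orderIdeal j (hG n)) (orderIdeal_anti (by omega) (hs n).2.2)
    rwa [map_sub, sub_add_sub_cancel] at this
  have hG2 : G - (X 0 + X 1) ∈ orderIdeal _ A 2 := by
    have := Ideal.add_mem _ (hG 2) (hP2 (hs 2))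
    rwa [sub_add_sub_cancel] at this
  have hGj := map_mem_orderIdeal j (hlin hG2)
  -- The image of G over K agrees to any order with a law that has a logarithm, hence with an
  -- associative one. Commutativity of G is obtained below in the same way.
  have hassoc : associator G = 0 := by
    refine eq_zero_of_forall_mem_orderIdeal fun n => orderIdeal_anti (Nat.le_succ n) (hmem ?_)
    obtain ⟨ℓ, hℓ⟩ := (hs (n + 1)).1
    have := associator_sub_mem hGj hℓ.mem (hGH (n + 1))
    rwa [hℓ.associator_eq_zero, sub_zero, ← map_associator j (hlin hG2)] at this
  refine ⟨formalGroupOfAssociator G hG2 hassoc, ⟨?_⟩, ?_⟩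
  · change G = G.subst ![(X 1 : MvPowerSeries (Fin 2) A), X 0]
    ext d
    rw [eq_biexp d, coeff_subst_swap]
    refine hj ?_
    obtain ⟨ℓ, hℓ⟩ := (hs (d.degree + 1)).1
    have key (i k : ℕ) (h : i + k = d.degree) :
        j (coeff (biexp i k) G) = coeff (biexp i k) (s (d.degree + 1)).1 := by
      have := hGH (d.degree + 1) (biexp i k) (by rw [degree_fin_two]; simp; omega)
      rwa [map_sub, sub_eq_zero, coeff_map] at this
    rw [key _ _ (degree_fin_two d).symm, key _ _ (by rw [degree_fin_two]; omega)]
    conv_lhs => rw [← hℓ.swap, coeff_subst_swap]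
  · have : (formalGroupOfAssociator G hG2 hassoc).toPowerSeries.map π = F.toPowerSeries := by
      change G.map π = _
      ext d
      have := map_mem_orderIdeal π (hG (d.degree + 1)) d (by omega)
      rwa [map_sub, map_sub, (hs (d.degree + 1)).2.1, sub_eq_zero] at this
    cases F
    simp only [FormalGroup.map, FormalGroup.mk.injEq]
    exact this

end Lift

end MvPowerSeries

end

noncomputable section

/-! ## Weyl groups -/

namespace RootPairing

section WeylGroup

variable {ι M N : Type*} [AddCommGroup M] [AddCommGroup N] {Φ : RootDatum ι M N}

instance : Φ.IsCrystallographic := ⟨fun i j => ⟨Φ.pairing i j, rfl⟩⟩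

@[simp] theorem weylGroupToPerm_ofIdx (i : ι) :
    Φ.weylGroupToPerm (weylGroup.ofIdx Φ i) = Φ.reflectionPerm i :=
  Equiv.reflection_indexEquiv Φ i

@[simp] theorem ofIdx_mul_self (i : ι) : weylGroup.ofIdx Φ i * weylGroup.ofIdx Φ i = 1 := by
  refine Subtype.ext ?_
  change Equiv.reflection Φ i * Equiv.reflection Φ i = 1
  rw [mul_eq_one_iff_inv_eq, Equiv.reflection_inv Φ i]

@[simp] theorem ofIdx_inv (i : ι) : (weylGroup.ofIdx Φ i)⁻¹ = weylGroup.ofIdx Φ i :=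
  inv_eq_of_mul_eq_one_left (ofIdx_mul_self i)

theorem ofIdx_smul_eq (i : ι) (m : M) : weylGroup.ofIdx Φ i • m = Φ.reflection i m := by
  rw [weylGroup.ofIdx_smul, ← Equiv.reflection_weightEquiv Φ i]
  rfl

theorem weylGroup_ext {v w : Φ.weylGroup} (h : ∀ m : M, v • m = w • m) : v = w :=
  Subtype.ext (Equiv.weightHom_injective Φ (LinearEquiv.ext h))

theorem weylGroup_smul_zsmul (w : Φ.weylGroup) (n : ℤ) (m : M) : w • (n • m) = n • w • m :=
  map_zsmul (DistribSMul.toAddMonoidHom M w) n m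

theorem root_neg (i : ι) : Φ.root (Φ.reflectionPerm i i) = -Φ.root i := by
  rw [root_reflectionPerm, reflection_apply_self]

@[simp] theorem neg_neg_index (i : ι) :
    Φ.reflectionPerm (Φ.reflectionPerm i i) (Φ.reflectionPerm i i) = i :=
  Φ.root.injective (by rw [root_neg, root_neg, neg_neg])

theorem weylGroupToPerm_neg (w : Φ.weylGroup) (i : ι) :
    Φ.weylGroupToPerm w (Φ.reflectionPerm i i) =
      Φ.reflectionPerm (Φ.weylGroupToPerm w i) (Φ.weylGroupToPerm w i) :=
  Φ.root.injective (by
    rw [root_neg, ← weylGroup_apply_root, ← weylGroup_apply_root, root_neg, smul_neg])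

theorem weylGroupToPerm_mul (v w : Φ.weylGroup) (i : ι) :
    Φ.weylGroupToPerm (v * w) i = Φ.weylGroupToPerm v (Φ.weylGroupToPerm w i) := by
  rw [map_mul, Equiv.Perm.mul_apply]

theorem weylGroupToPerm_one (i : ι) : Φ.weylGroupToPerm 1 i = i := by
  rw [map_one, Equiv.Perm.one_apply]

theorem weylGroupToPerm_inv_apply (w : Φ.weylGroup) (i : ι) :
    Φ.weylGroupToPerm w⁻¹ (Φ.weylGroupToPerm w i) = i := by
  rw [← weylGroupToPerm_mul, inv_mul_cancel, weylGroupToPerm_one]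

theorem weylGroupToPerm_apply_inv (w : Φ.weylGroup) (i : ι) :
    Φ.weylGroupToPerm w (Φ.weylGroupToPerm w⁻¹ i) = i := by
  rw [← weylGroupToPerm_mul, mul_inv_cancel, weylGroupToPerm_one]

theorem toLinearMap_smul_coroot (w : Φ.weylGroup) (i : ι) (m : M) :
    Φ.toLinearMap (w • m) (Φ.coroot (Φ.weylGroupToPerm w i)) =
      Φ.toLinearMap m (Φ.coroot i) := by
  have h1 : ∀ n : N, Φ.toLinearMap (w • m) n =
      Φ.toLinearMap m (w.1.toHom.coweightMap n) := fun n => by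
    exact (congrArg (fun f : N →ₗ[ℤ] Module.Dual ℤ M => f n m)
      w.1.toHom.weight_coweight_transpose).symm ▸ rfl
  rw [h1]
  congr 1
  have := congrFun w.1.toHom.coroot_coweightMap (Φ.weylGroupToPerm w i)
  refine this.trans ?_
  simp [weylGroupToPerm]

theorem conj_ofIdx (w : Φ.weylGroup) (i : ι) :
    w * weylGroup.ofIdx Φ i * w⁻¹ = weylGroup.ofIdx Φ (Φ.weylGroupToPerm w i) := by
  refine weylGroup_ext fun m => ?_
  rw [mul_smul, mul_smul, ofIdx_smul_eq, ofIdx_smul_eq, reflection_apply, reflection_apply,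
    smul_sub, smul_inv_smul, weylGroup_smul_zsmul, weylGroup_apply_root]
  congr 2
  have := toLinearMap_smul_coroot w i (w⁻¹ • m)
  rw [smul_inv_smul] at this
  exact this.symm

theorem ofIdx_neg (i : ι) :
    weylGroup.ofIdx Φ (Φ.reflectionPerm i i) = weylGroup.ofIdx Φ i := by
  have := conj_ofIdx (weylGroup.ofIdx Φ i) i
  rw [ofIdx_mul_self, one_mul, ofIdx_inv, weylGroupToPerm_ofIdx] at this
  exact this.symm

end WeylGroup

end RootPairing

end

/-! ### Positive roots and parabolic subgroups -/

noncomputable section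

namespace RootPairing

namespace Base

open Classical

variable {ι M N : Type*} [AddCommGroup M] [AddCommGroup N] {Φ : RootDatum ι M N}
  (b : Φ.Base)

section Signs

theorem isPos_neg {i : ι} : b.IsPos (Φ.reflectionPerm i i) ↔ ¬ b.IsPos i := IsPos.neg_iff_not b i

theorem isPos_perm_neg {w : Φ.weylGroup} {i : ι} :
    b.IsPos (Φ.weylGroupToPerm w (Φ.reflectionPerm i i)) ↔ ¬ b.IsPos (Φ.weylGroupToPerm w i) := by
  rw [weylGroupToPerm_neg, isPos_neg]

theorem sum_smul_root_unique {f g : ι → ℤ}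
    (h : ∑ j ∈ b.support, f j • Φ.root j = ∑ j ∈ b.support, g j • Φ.root j) {j : ι}
    (hj : j ∈ b.support) : f j = g j := by
  have := linearIndepOn_finset_iff.1 b.linearIndepOn_root (fun j => f j - g j) (by
    simp only [sub_smul, Finset.sum_sub_distrib, h, sub_self]) j hj
  exact sub_eq_zero.1 this

theorem height_sum {s : Finset ι} {k : ι} {f : ι → ℤ} {g : ι → ι}
    (h : Φ.root k = ∑ j ∈ s, f j • Φ.root (g j)) : b.height k = ∑ j ∈ s, f j * b.height (g j) := by
  choose c hc0 hc1 hc using b.exists_root_eq_sum_int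
  have h1 : Φ.root k = ∑ l ∈ b.support, (∑ j ∈ s, f j * c (g j) l) • Φ.root l := by
    rw [h]
    simp only [Finset.sum_smul]
    rw [Finset.sum_comm]
    refine Finset.sum_congr rfl fun j _ => ?_
    conv_lhs => rw [hc (g j)]
    rw [Finset.smul_sum]
    exact Finset.sum_congr rfl fun l _ => smul_smul _ _ _
  rw [height_eq_sum h1, Finset.sum_comm]
  refine Finset.sum_congr rfl fun j _ => ?_
  rw [height_eq_sum (hc (g j)), Finset.mul_sum]

/-- A positive root in the span of some simple roots is a nonnegative combination of them. -/
theorem exists_sum_of_mem_span {Θ : Set ι} (hΘ : Θ ⊆ b.support) {i : ι} (hi : b.IsPos i)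
    (hs : Φ.root i ∈ Submodule.span ℤ (Φ.root '' Θ)) :
    ∃ f : ι → ℤ, (∀ j, 0 ≤ f j) ∧ (∀ j ∈ b.support, j ∉ Θ → f j = 0) ∧
      Φ.root i = ∑ j ∈ b.support, f j • Φ.root j := by
  obtain ⟨f, -, hf, hfi⟩ := b.exists_root_eq_sum_int i
  refine ⟨f, ?_, ?_, hfi⟩
  · rcases hf with hf | hf
    · exact hf.le
    · rw [isPos_iff, height_eq_sum hfi] at hi
      exact absurd hi (not_lt.2 (Finset.sum_nonpos fun j _ => hf.le j))
  · obtain ⟨g, hg⟩ : ∃ g : ι → ℤ, (∀ j, j ∉ Θ → g j = 0) ∧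
        Φ.root i = ∑ j ∈ b.support, g j • Φ.root j := by
      obtain ⟨l, hl, hli⟩ := (Finsupp.mem_span_image_iff_linearCombination ℤ).1 hs
      rw [Finsupp.mem_supported] at hl
      refine ⟨l, fun j hj => Finsupp.notMem_support_iff.1 fun h => hj (hl h), ?_⟩
      rw [← hli, Finsupp.linearCombination_apply, Finsupp.sum_of_support_subset _
        (fun j hj => by simpa using hΘ (hl hj))]
      simp
    intro j hj hjΘ
    rw [b.sum_smul_root_unique (hfi.symm.trans hg.2) hj, hg.1 j hjΘ]

/-- Height is additive and nonzero on roots, so a combination of positive roots with nonnegative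
coefficients that is again a root is positive. The companion `perm_isNeg_of_simple` is the same with
signs reversed. -/
theorem perm_isPos_of_simple {Θ : Set ι} (hΘ : Θ ⊆ b.support) {w : Φ.weylGroup}
    (hw : ∀ j ∈ Θ, b.IsPos (Φ.weylGroupToPerm w j)) {i : ι} (hi : b.IsPos i)
    (hs : Φ.root i ∈ Submodule.span ℤ (Φ.root '' Θ)) : b.IsPos (Φ.weylGroupToPerm w i) := by
  obtain ⟨f, hf0, hf, hfi⟩ := b.exists_sum_of_mem_span hΘ hi hs
  have h1 : Φ.root (Φ.weylGroupToPerm w i) =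
      ∑ j ∈ b.support, f j • Φ.root (Φ.weylGroupToPerm w j) := by
    rw [← weylGroup_apply_root, hfi, Finset.smul_sum]
    exact Finset.sum_congr rfl fun j _ => by rw [weylGroup_smul_zsmul, weylGroup_apply_root]
  rw [isPos_iff', b.height_sum h1]
  refine Finset.sum_nonneg fun j hj => ?_
  by_cases hjΘ : j ∈ Θ
  · exact mul_nonneg (hf0 j) ((b.isPos_iff).1 (hw j hjΘ)).le
  · rw [hf j hj hjΘ, zero_mul]

theorem perm_isNeg_of_simple {Θ : Set ι} (hΘ : Θ ⊆ b.support) {w : Φ.weylGroup}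
    (hw : ∀ j ∈ Θ, ¬ b.IsPos (Φ.weylGroupToPerm w j)) {i : ι} (hi : b.IsPos i)
    (hs : Φ.root i ∈ Submodule.span ℤ (Φ.root '' Θ)) : ¬ b.IsPos (Φ.weylGroupToPerm w i) := by
  obtain ⟨f, hf0, hf, hfi⟩ := b.exists_sum_of_mem_span hΘ hi hs
  have h1 : Φ.root (Φ.weylGroupToPerm w i) =
      ∑ j ∈ b.support, f j • Φ.root (Φ.weylGroupToPerm w j) := by
    rw [← weylGroup_apply_root, hfi, Finset.smul_sum]
    exact Finset.sum_congr rfl fun j _ => by rw [weylGroup_smul_zsmul, weylGroup_apply_root]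
  rw [isPos_iff, b.height_sum h1, not_lt]
  refine Finset.sum_nonpos fun j hj => ?_
  by_cases hjΘ : j ∈ Θ
  · exact mul_nonpos_of_nonneg_of_nonpos (hf0 j) (not_lt.1 (hw j hjΘ))
  · rw [hf j hj hjΘ, zero_mul]

theorem root_mem_span_support (i : ι) :
    Φ.root i ∈ Submodule.span ℤ (Φ.root '' (b.support : Set ι)) := b.root_mem_span_int i

end Signs

section Parabolic

theorem ofIdx_mem_parabolicSubgroup {Θ : Set ι} {i : ι} (hi : i ∈ Θ) :
    weylGroup.ofIdx Φ i ∈ Φ.parabolicSubgroup Θ := Subgroup.subset_closure ⟨i, hi, rfl⟩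

/-- The elements of a parabolic subgroup preserve the span of the corresponding simple roots. -/
theorem smul_sub_mem_span {Θ : Set ι} {w : Φ.weylGroup} (hw : w ∈ Φ.parabolicSubgroup Θ) (m : M) :
    w • m - m ∈ Submodule.span ℤ (Φ.root '' Θ) := by
  unfold parabolicSubgroup at hw
  have hs (i : ι) (hi : i ∈ Θ) (m : M) :
      weylGroup.ofIdx Φ i • m - m ∈ Submodule.span ℤ (Φ.root '' Θ) := by
    rw [ofIdx_smul_eq, reflection_apply, sub_sub_cancel_left]
    exact neg_mem (Submodule.smul_mem _ _ (Submodule.subset_span ⟨i, hi, rfl⟩))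
  induction hw using Subgroup.closure_induction'' generalizing m with
  | one => simp
  | mem _ h => obtain ⟨i, hi, rfl⟩ := h; exact hs i hi m
  | inv_mem _ h => obtain ⟨i, hi, rfl⟩ := h; rw [ofIdx_inv]; exact hs i hi m
  | mul v w _ _ hv hw =>
    rw [mul_smul, ← sub_add_sub_cancel _ (w • m)]
    exact add_mem (hv _) (hw _)

theorem perm_mem_span_iff {Θ : Set ι} {w : Φ.weylGroup} (hw : w ∈ Φ.parabolicSubgroup Θ) (i : ι) :
    Φ.root (Φ.weylGroupToPerm w i) ∈ Submodule.span ℤ (Φ.root '' Θ) ↔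
      Φ.root i ∈ Submodule.span ℤ (Φ.root '' Θ) := by
  have h := smul_sub_mem_span hw (Φ.root i)
  rw [weylGroup_apply_root] at h
  exact ⟨fun h' => by simpa using sub_mem h' h, fun h' => by simpa using add_mem h h'⟩

variable [Finite ι] [Φ.IsReduced]

/-- A simple reflection of the parabolic subgroup preserves the positive roots outside of the
parabolic subsystem. -/
theorem perm_isPos_of_notMem_span {Θ : Set ι} (hΘ : Θ ⊆ b.support) {w : Φ.weylGroup}
    (hw : w ∈ Φ.parabolicSubgroup Θ) {i : ι}
    (hs : Φ.root i ∉ Submodule.span ℤ (Φ.root '' Θ)) :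
    b.IsPos (Φ.weylGroupToPerm w i) ↔ b.IsPos i := by
  have hs1 (j : ι) (hj : j ∈ Θ) (i : ι) (hs : Φ.root i ∉ Submodule.span ℤ (Φ.root '' Θ))
      (hi : b.IsPos i) : b.IsPos (Φ.weylGroupToPerm (weylGroup.ofIdx Φ j) i) := by
    rw [weylGroupToPerm_ofIdx]
    refine hi.reflectionPerm (hΘ hj) ?_
    rintro rfl
    exact hs (Submodule.subset_span ⟨i, hj, rfl⟩)
  have hs2 (j : ι) (hj : j ∈ Θ) (i : ι) (hs : Φ.root i ∉ Submodule.span ℤ (Φ.root '' Θ)) :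
      b.IsPos (Φ.weylGroupToPerm (weylGroup.ofIdx Φ j) i) ↔ b.IsPos i := by
    refine ⟨fun h => ?_, hs1 j hj i hs⟩
    have := hs1 j hj _ ((perm_mem_span_iff (ofIdx_mem_parabolicSubgroup hj) i).not.2 hs) h
    rwa [← Equiv.Perm.mul_apply, ← map_mul, ofIdx_mul_self, map_one] at this
  have hmem := hw
  unfold parabolicSubgroup at hw
  clear hmem
  induction hw using Subgroup.closure_induction'' generalizing i with
  | one => simp
  | mem _ h => obtain ⟨j, hj, rfl⟩ := h; exact hs2 j hj i hs
  | inv_mem _ h => obtain ⟨j, hj, rfl⟩ := h; rw [ofIdx_inv]; exact hs2 j hj i hs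
  | mul v w hvm hwm hv hw =>
    rw [map_mul, Equiv.Perm.mul_apply]
    exact (hv ((perm_mem_span_iff hwm i).not.2 hs)).trans (hw hs)

/-- A root in the span of some simple roots is conjugate to one of them. -/
theorem exists_perm_eq_of_mem_span {Θ : Set ι} (hΘ : Θ ⊆ b.support) {i : ι}
    (hs : Φ.root i ∈ Submodule.span ℤ (Φ.root '' Θ)) :
    ∃ w ∈ Φ.parabolicSubgroup Θ, ∃ j ∈ Θ, i = Φ.weylGroupToPerm w j := by
  have hpos : ∀ (n : ℕ) (i : ι), b.IsPos i → b.height i = n →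
      Φ.root i ∈ Submodule.span ℤ (Φ.root '' Θ) →
      ∃ w ∈ Φ.parabolicSubgroup Θ, ∃ j ∈ Θ, i = Φ.weylGroupToPerm w j := by
    intro n
    induction n using Nat.strong_induction_on with
    | _ n ih =>
      intro i hi hn hs
      by_cases hiΘ : i ∈ Θ
      · exact ⟨1, one_mem _, i, hiΘ, by simp⟩
      -- Induction on height: some simple root pairs positively with a positive root, and the
      -- reflection in it lowers the height. This simple root lies in Θ, because any other one pairs
      -- nonpositively with every summand of the root.
      obtain ⟨j, hj, hji⟩ := hi.exists_mem_support_pos_pairingIn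
      have hjΘ : j ∈ Θ := by
        by_contra hjΘ
        obtain ⟨f, hf0, hf, hfi⟩ := b.exists_sum_of_mem_span hΘ hi hs
        rw [Φ.zero_lt_pairingIn_iff'] at hji
        have e : Φ.pairingIn ℤ i j = ∑ l ∈ b.support, f l * Φ.pairingIn ℤ l j := by
          have := congrArg (fun m => Φ.toLinearMap m (Φ.coroot j)) hfi
          simp only [map_sum, map_zsmul, LinearMap.sum_apply, LinearMap.smul_apply,
            root_coroot_eq_pairing] at this
          have hp (k l : ι) : Φ.pairingIn ℤ k l = Φ.pairing k l := Φ.algebraMap_pairingIn ℤ k l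
          simp only [hp]
          exact this
        rw [e] at hji
        refine absurd hji (not_lt.2 (Finset.sum_nonpos fun l hl => ?_))
        by_cases hlj : l = j
        · rw [hlj, hf j hj hjΘ, zero_mul]
        · exact mul_nonpos_of_nonneg_of_nonpos (hf0 l) (b.pairingIn_le_zero_of_ne hlj hl hj)
      rw [Φ.zero_lt_pairingIn_iff'] at hji
      have hij : i ≠ j := fun h => hiΘ (h ▸ hjΘ)
      have hk := hi.reflectionPerm hj hij
      have e := Φ.reflection_apply_root' ℤ (i := j) (j := i)
      rw [← root_reflectionPerm, sub_eq_add_neg, ← neg_smul] at e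
      have hlt : b.height (Φ.reflectionPerm j i) < n := by
        rw [b.height_add_zsmul e, height_one_of_mem_support hj, hn]
        simp only [smul_eq_mul, mul_one]
        omega
      have hpos' : 0 < b.height (Φ.reflectionPerm j i) := hk
      obtain ⟨w, hw, l, hl, hwl⟩ := ih (b.height (Φ.reflectionPerm j i)).toNat (by omega)
        (Φ.reflectionPerm j i) hk (by omega) (by
          rw [← weylGroupToPerm_ofIdx]
          exact (perm_mem_span_iff (ofIdx_mem_parabolicSubgroup hjΘ) i).2 hs)
      refine ⟨weylGroup.ofIdx Φ j * w, mul_mem (ofIdx_mem_parabolicSubgroup hjΘ) hw, l, hl, ?_⟩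
      rw [map_mul, Equiv.Perm.mul_apply, ← hwl, weylGroupToPerm_ofIdx, reflectionPerm_self]
  by_cases hi : b.IsPos i
  · have h0 : 0 < b.height i := hi
    exact hpos (b.height i).toNat i hi (by omega) hs
  -- For a negative root, treat its negative and insert the reflection in the resulting simple root
  -- to change the sign.
  · have hi' := b.isPos_neg.2 hi
    have h0 : 0 < b.height (Φ.reflectionPerm i i) := hi'
    obtain ⟨w, hw, j, hj, e⟩ := hpos (b.height (Φ.reflectionPerm i i)).toNat _ hi' (by omega)
      (by rw [root_neg]; exact neg_mem hs)
    refine ⟨w * weylGroup.ofIdx Φ j, mul_mem hw (ofIdx_mem_parabolicSubgroup hj), j, hj, ?_⟩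
    rw [map_mul, Equiv.Perm.mul_apply, weylGroupToPerm_ofIdx, weylGroupToPerm_neg, ← e,
      neg_neg_index]

theorem exists_perm_eq (i : ι) :
    ∃ w : Φ.weylGroup, ∃ j ∈ b.support, i = Φ.weylGroupToPerm w j := by
  obtain ⟨w, -, j, hj, h⟩ := b.exists_perm_eq_of_mem_span (Set.Subset.refl _)
    (b.root_mem_span_support i)
  exact ⟨w, j, hj, h⟩

theorem ofIdx_mem_parabolicSubgroup_of_mem_span {Θ : Set ι} (hΘ : Θ ⊆ b.support) {i : ι}
    (hs : Φ.root i ∈ Submodule.span ℤ (Φ.root '' Θ)) :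
    weylGroup.ofIdx Φ i ∈ Φ.parabolicSubgroup Θ := by
  obtain ⟨w, hw, j, hj, rfl⟩ := b.exists_perm_eq_of_mem_span hΘ hs
  rw [← conj_ofIdx]
  exact mul_mem (mul_mem hw (ofIdx_mem_parabolicSubgroup hj)) (inv_mem hw)

/-- Every root is conjugate to a simple one by simple reflections, so every reflection is a product
of simple ones. -/
theorem parabolicSubgroup_support : Φ.parabolicSubgroup b.support = ⊤ := by
  refine eq_top_iff.2 ?_
  rintro ⟨w, hw⟩ -
  induction hw using weylGroup.induction with
  | mem i =>
    exact b.ofIdx_mem_parabolicSubgroup_of_mem_span (Set.Subset.refl _)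
      (b.root_mem_span_support i)
  | one => exact one_mem _
  | mul v w hv hw hv' hw' => exact mul_mem hv' hw'

end Parabolic

end Base

end RootPairing

end

/-! ### Words, inversions and lengths of cosets -/

noncomputable section

namespace RootPairing

namespace Base

open Classical

variable {ι M N : Type*} [AddCommGroup M] [AddCommGroup N] {Φ : RootDatum ι M N}
  (b : Φ.Base)

/-- The element of the Weyl group given by a word in the simple reflections. -/
def wordProd (I : List b.support) : Φ.weylGroup := (I.map fun i => weylGroup.ofIdx Φ i).prod

@[simp] theorem wordProd_nil : b.wordProd [] = 1 := rfl

@[simp] theorem wordProd_cons (i : b.support) (I : List b.support) :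
    b.wordProd (i :: I) = weylGroup.ofIdx Φ i * b.wordProd I := List.prod_cons

theorem wordProd_append (I J : List b.support) :
    b.wordProd (I ++ J) = b.wordProd I * b.wordProd J := by
  simp [wordProd]

theorem wordProd_reverse (I : List b.support) : b.wordProd I.reverse = (b.wordProd I)⁻¹ := by
  induction I with
  | nil => simp
  | cons i I ih => rw [List.reverse_cons, wordProd_append, ih]; simp

section Length

variable [Fintype ι]

/-- The positive roots made negative by the inverse of `w`. -/
def inversions (w : Φ.weylGroup) : Finset ι :=
  {i | b.IsPos i ∧ ¬ b.IsPos (Φ.weylGroupToPerm w⁻¹ i)}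

/-- The number of positive roots made negative by `w`. -/
def length (w : Φ.weylGroup) : ℕ := (b.inversions w).card

theorem mem_inversions {w : Φ.weylGroup} {i : ι} :
    i ∈ b.inversions w ↔ b.IsPos i ∧ ¬ b.IsPos (Φ.weylGroupToPerm w⁻¹ i) := by
  simp [inversions]

/-- The map α ↦ -wα injects the inversions of w⁻¹ into those of w. -/
theorem length_inv (w : Φ.weylGroup) : b.length w⁻¹ = b.length w := by
  have key (w : Φ.weylGroup) : b.length w⁻¹ ≤ b.length w := by
    refine Finset.card_le_card_of_injOn
      (fun i => Φ.reflectionPerm (Φ.weylGroupToPerm w i) (Φ.weylGroupToPerm w i)) ?_ ?_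
    · intro i hi
      have hi := b.mem_inversions.1 hi
      rw [inv_inv] at hi
      refine b.mem_inversions.2 ⟨b.isPos_neg.2 hi.2, ?_⟩
      rw [isPos_perm_neg, weylGroupToPerm_inv_apply, not_not]
      exact hi.1
    · intro i _ j _ h
      have h' := congrArg (fun k => Φ.reflectionPerm k k) h
      simp only [neg_neg_index] at h'
      exact (Φ.weylGroupToPerm w).injective h'
  exact le_antisymm (key w) (by simpa using key w⁻¹)

theorem length_eq_card (w : Φ.weylGroup) : b.length w =
    ({i | b.IsPos i ∧ ¬ b.IsPos (Φ.weylGroupToPerm w i)} : Finset ι).card := by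
  rw [← length_inv, length]
  congr 1

theorem notMem_map_inversions {w : Φ.weylGroup} {j : ι} (hj : j ∈ b.support) :
    j ∉ (b.inversions w).map (Φ.reflectionPerm j).toEmbedding := by
  rw [Finset.mem_map_equiv]
  have hsymm : (Φ.reflectionPerm j).symm j = Φ.reflectionPerm j j := by
    rw [Equiv.symm_apply_eq, reflectionPerm_self]
  rw [hsymm, mem_inversions, isPos_neg]
  exact fun h => h.1 (isPos_of_mem_support hj)

/-- The number of positive roots outside of a parabolic subsystem made negative by `w`; this is
the minimal length of an element of the coset of `w`. -/
def cosetLength (Θ : Set ι) (w : Φ.weylGroup) : ℕ :=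
  ({i | b.IsPos i ∧ Φ.root i ∉ Submodule.span ℤ (Φ.root '' Θ) ∧
    ¬ b.IsPos (Φ.weylGroupToPerm w i)} : Finset ι).card

theorem length_eq_cosetLength_add (Θ : Set ι) (w : Φ.weylGroup) :
    b.length w = b.cosetLength Θ w +
      ({i | b.IsPos i ∧ Φ.root i ∈ Submodule.span ℤ (Φ.root '' Θ) ∧
        ¬ b.IsPos (Φ.weylGroupToPerm w i)} : Finset ι).card := by
  rw [length_eq_card, cosetLength, ← Finset.card_union_of_disjoint]
  · congr 1
    ext i
    simp only [Finset.mem_union, Finset.mem_filter, Finset.mem_univ, true_and]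
    tauto
  · rw [Finset.disjoint_left]
    intro i h1 h2
    simp only [Finset.mem_filter] at h1 h2
    exact h1.2.2.1 h2.2.2.1

variable [Φ.IsReduced]

theorem reflectionPerm_isPos_iff {i j : ι} (hj : j ∈ b.support) (h1 : i ≠ j)
    (h2 : i ≠ Φ.reflectionPerm j j) : b.IsPos (Φ.reflectionPerm j i) ↔ b.IsPos i := by
  refine ⟨fun h => ?_, fun h => h.reflectionPerm hj h1⟩
  have := h.reflectionPerm hj (fun h' => h2 (by rw [← Φ.reflectionPerm_self j i, h']))
  rwa [reflectionPerm_self] at this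

/-- If `s_j w` is longer than `w`, its inversions are `α_j` and the reflections of those of `w`. -/
theorem inversions_ofIdx_mul {w : Φ.weylGroup} {j : ι} (hj : j ∈ b.support)
    (hw : b.IsPos (Φ.weylGroupToPerm w⁻¹ j)) :
    b.inversions (weylGroup.ofIdx Φ j * w) =
      insert j ((b.inversions w).map (Φ.reflectionPerm j).toEmbedding) := by
  have hjpos := isPos_of_mem_support hj
  ext i
  rw [Finset.mem_insert, Finset.mem_map_equiv, mem_inversions, mem_inversions, mul_inv_rev,
    ofIdx_inv, map_mul, Equiv.Perm.mul_apply, weylGroupToPerm_ofIdx]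
  have hsymm : (Φ.reflectionPerm j).symm i = Φ.reflectionPerm j i := by
    rw [Equiv.symm_apply_eq, reflectionPerm_self]
  rw [hsymm]
  by_cases h1 : i = j
  · subst h1
    simp only [hjpos, true_and, true_or, iff_true]
    rwa [isPos_perm_neg, not_not]
  · by_cases h2 : i = Φ.reflectionPerm j j
    · subst h2
      rw [isPos_neg, reflectionPerm_self]
      exact iff_of_false (fun h => h.1 hjpos) (fun h => h.elim h1 fun h => h.2 hw)
    · rw [b.reflectionPerm_isPos_iff hj h1 h2]
      simp [h1]

theorem length_ofIdx_mul {w : Φ.weylGroup} {j : ι} (hj : j ∈ b.support)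
    (hw : b.IsPos (Φ.weylGroupToPerm w⁻¹ j)) :
    b.length (weylGroup.ofIdx Φ j * w) = b.length w + 1 := by
  rw [length, b.inversions_ofIdx_mul hj hw, Finset.card_insert_of_notMem
    (b.notMem_map_inversions hj), Finset.card_map]
  rfl

theorem length_ofIdx_mul_of_not {w : Φ.weylGroup} {j : ι} (hj : j ∈ b.support)
    (hw : ¬ b.IsPos (Φ.weylGroupToPerm w⁻¹ j)) :
    b.length (weylGroup.ofIdx Φ j * w) + 1 = b.length w := by
  have := b.length_ofIdx_mul (w := weylGroup.ofIdx Φ j * w) hj (by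
    rw [mul_inv_rev, ofIdx_inv, map_mul, Equiv.Perm.mul_apply, weylGroupToPerm_ofIdx,
      isPos_perm_neg]
    exact hw)
  rw [← this, ← mul_assoc, ofIdx_mul_self, one_mul]

theorem length_ofIdx_mul_le (w : Φ.weylGroup) {j : ι} (hj : j ∈ b.support) :
    b.length (weylGroup.ofIdx Φ j * w) ≤ b.length w + 1 := by
  by_cases hw : b.IsPos (Φ.weylGroupToPerm w⁻¹ j)
  · exact (b.length_ofIdx_mul hj hw).le
  · have := b.length_ofIdx_mul_of_not hj hw
    omega

theorem length_mul_ofIdx {w : Φ.weylGroup} {j : ι} (hj : j ∈ b.support)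
    (hw : b.IsPos (Φ.weylGroupToPerm w j)) :
    b.length (w * weylGroup.ofIdx Φ j) = b.length w + 1 := by
  rw [← length_inv, mul_inv_rev, ofIdx_inv, b.length_ofIdx_mul hj (by rwa [inv_inv]), length_inv]

/-- The exchange property. -/
theorem exists_exchange {j : ι} (hj : j ∈ b.support) (I : List b.support)
    (h : ¬ b.IsPos (Φ.weylGroupToPerm (b.wordProd I) j)) :
    ∃ J : List b.support, J.length + 1 = I.length ∧
      b.wordProd J = b.wordProd I * weylGroup.ofIdx Φ j := by
  induction I with
  | nil => exact absurd (isPos_of_mem_support hj) (by simpa using h)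
  | cons i I ih =>
    -- Apply the letters to α_j from right to left. The letter that first makes the root negative
    -- reflects in that very root, since a simple reflection makes only its own positive root
    -- negative. By conjugation this letter can be deleted against s_j.
    by_cases h1 : b.IsPos (Φ.weylGroupToPerm (b.wordProd I) j)
    · refine ⟨I, rfl, ?_⟩
      rw [wordProd_cons, map_mul, Equiv.Perm.mul_apply, weylGroupToPerm_ofIdx] at h
      have e : Φ.weylGroupToPerm (b.wordProd I) j = i := by
        by_contra hne
        exact h (h1.reflectionPerm i.2 hne)
      rw [wordProd_cons, ← e, ← conj_ofIdx]
      rw [inv_mul_cancel_right, mul_assoc, ofIdx_mul_self, mul_one]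
    · obtain ⟨J, hJ, e⟩ := ih h1
      exact ⟨i :: J, by simp [hJ], by rw [wordProd_cons, wordProd_cons, e, mul_assoc]⟩

theorem exists_wordProd_eq (w : Φ.weylGroup) : ∃ I, b.wordProd I = w := by
  have hw : w ∈ Φ.parabolicSubgroup b.support := by
    rw [parabolicSubgroup_support]; exact Subgroup.mem_top w
  unfold parabolicSubgroup at hw
  induction hw using Subgroup.closure_induction with
  | one => exact ⟨[], rfl⟩
  | mem _ h => obtain ⟨i, hi, rfl⟩ := h; exact ⟨[⟨i, hi⟩], by simp⟩
  | inv _ _ h => obtain ⟨I, rfl⟩ := h; exact ⟨I.reverse, b.wordProd_reverse I⟩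
  | mul _ _ _ _ hv hw =>
    obtain ⟨I, rfl⟩ := hv
    obtain ⟨J, rfl⟩ := hw
    exact ⟨I ++ J, b.wordProd_append I J⟩

/-- Any nonempty word for such a w can be shortened by two letters. Without its last letter j it
represents w s_j, which makes α_j negative, and the exchange property deletes one more letter while
restoring s_j. -/
theorem eq_one_of_length_eq_zero {w : Φ.weylGroup} (hw : b.length w = 0) : w = 1 := by
  have hpos {i : ι} (hi : b.IsPos i) : b.IsPos (Φ.weylGroupToPerm w i) := by
    by_contra h
    rw [length_eq_card, Finset.card_eq_zero] at hw
    exact Finset.eq_empty_iff_forall_notMem.1 hw i (Finset.mem_filter_univ _ |>.2 ⟨hi, h⟩)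
  have key : ∀ (n : ℕ) (I : List b.support), I.length = n → b.wordProd I = w → w = 1 := by
    intro n
    induction n using Nat.strong_induction_on with
    | _ n ih =>
      intro I hI hIw
      rcases I.eq_nil_or_concat with rfl | ⟨J, j, rfl⟩
      · exact hIw.symm
      · rw [List.concat_eq_append] at hI hIw
        have e : b.wordProd J = w * weylGroup.ofIdx Φ j := by
          rw [← hIw, wordProd_append]
          simp [mul_assoc]
        obtain ⟨J', hJ', e'⟩ := b.exists_exchange j.2 J (by
          rw [e, map_mul, Equiv.Perm.mul_apply, weylGroupToPerm_ofIdx, isPos_perm_neg, not_not]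
          exact hpos (isPos_of_mem_support j.2))
        refine ih J'.length ?_ J' rfl ?_
        · rw [List.length_append, List.length_singleton] at hI
          omega
        · rw [e', e, mul_assoc, ofIdx_mul_self, mul_one]
  obtain ⟨I, hI⟩ := b.exists_wordProd_eq w
  exact key _ I rfl hI

include b in
theorem weylGroupToPerm_injective : Function.Injective Φ.weylGroupToPerm := by
  refine (injective_iff_map_eq_one _).2 fun w hw => b.eq_one_of_length_eq_zero ?_
  rw [length_eq_card, hw]
  simp

include b in
theorem finite_weylGroup : Finite Φ.weylGroup :=
  Finite.of_injective _ b.weylGroupToPerm_injective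

/-- Every element of the Weyl group has a reduced word. -/
theorem exists_reduced_word (w : Φ.weylGroup) :
    ∃ I, b.wordProd I = w ∧ I.length = b.length w := by
  generalize hn : b.length w = n
  induction n generalizing w with
  | zero => exact ⟨[], (b.eq_one_of_length_eq_zero hn).symm, rfl⟩
  | succ n ih =>
    obtain ⟨j, hj, hjw⟩ : ∃ j ∈ b.support, ¬ b.IsPos (Φ.weylGroupToPerm w⁻¹ j) := by
      by_contra! h
      have : b.length w = 0 := by
        refine Finset.card_eq_zero.2 (Finset.eq_empty_iff_forall_notMem.2 fun i hi => ?_)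
        rw [mem_inversions] at hi
        exact hi.2 (b.perm_isPos_of_simple (Set.Subset.refl _) h hi.1 (b.root_mem_span_support i))
      omega
    have := b.length_ofIdx_mul_of_not hj hjw
    obtain ⟨I, hI, hIn⟩ := ih (weylGroup.ofIdx Φ j * w) (by omega)
    refine ⟨⟨j, hj⟩ :: I, ?_, by simp [hIn]⟩
    rw [wordProd_cons, hI, ← mul_assoc, ofIdx_mul_self, one_mul]

/-- In every right coset of a parabolic subgroup there is an element that makes the positive roots
of the parabolic subsystem negative. -/
theorem exists_mul_mem_isNeg {Θ : Set ι} (hΘ : Θ ⊆ b.support) (w : Φ.weylGroup) :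
    ∃ u ∈ Φ.parabolicSubgroup Θ, ∀ i, b.IsPos i → Φ.root i ∈ Submodule.span ℤ (Φ.root '' Θ) →
      ¬ b.IsPos (Φ.weylGroupToPerm (w * u) i) := by
  have := b.finite_weylGroup
  -- A longest element of the coset: if it kept a simple root of Θ positive, multiplication by that
  -- reflection would lengthen it. A shortest element serves in the same way for
  -- `exists_mul_mem_isPos`.
  obtain ⟨u, hu⟩ := Finite.exists_max fun u : Φ.parabolicSubgroup Θ => b.length (w * u)
  refine ⟨u, u.2, fun i hi hs => b.perm_isNeg_of_simple hΘ (fun j hj h => ?_) hi hs⟩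
  have h1 := hu (u * ⟨_, ofIdx_mem_parabolicSubgroup hj⟩)
  rw [Subgroup.coe_mul, ← mul_assoc, b.length_mul_ofIdx (hΘ hj) h] at h1
  omega

/-- In every right coset of a parabolic subgroup there is an element that keeps the positive roots
of the parabolic subsystem positive. -/
theorem exists_mul_mem_isPos {Θ : Set ι} (hΘ : Θ ⊆ b.support) (w : Φ.weylGroup) :
    ∃ u ∈ Φ.parabolicSubgroup Θ, ∀ i, b.IsPos i → Φ.root i ∈ Submodule.span ℤ (Φ.root '' Θ) →
      b.IsPos (Φ.weylGroupToPerm (w * u) i) := by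
  have := b.finite_weylGroup
  obtain ⟨u, hu⟩ := Finite.exists_min fun u : Φ.parabolicSubgroup Θ => b.length (w * u)
  refine ⟨u, u.2, fun i hi hs => b.perm_isPos_of_simple hΘ (fun j hj => ?_) hi hs⟩
  by_contra h
  have h1 := hu (u * ⟨_, ofIdx_mem_parabolicSubgroup hj⟩)
  rw [Subgroup.coe_mul, ← mul_assoc] at h1
  change b.length (w * u) ≤ b.length (w * u * weylGroup.ofIdx Φ j) at h1
  have h2 := b.length_mul_ofIdx (w := w * u * weylGroup.ofIdx Φ j) (hΘ hj) (by
    rw [map_mul, Equiv.Perm.mul_apply, weylGroupToPerm_ofIdx, isPos_perm_neg]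
    exact h)
  rw [mul_assoc, ofIdx_mul_self, mul_one] at h2
  omega

theorem exists_longest : ∃ w : Φ.weylGroup, ∀ i, b.IsPos (Φ.weylGroupToPerm w i) ↔ ¬ b.IsPos i := by
  obtain ⟨w, -, hw⟩ := b.exists_mul_mem_isNeg (Set.Subset.refl _) 1
  rw [one_mul] at hw
  refine ⟨w, fun i => ?_⟩
  by_cases hi : b.IsPos i
  · exact iff_of_false (hw i hi (b.root_mem_span_support i)) (not_not.2 hi)
  · refine iff_of_true ?_ hi
    have := hw _ (b.isPos_neg.2 hi) (b.root_mem_span_support _)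
    rwa [isPos_perm_neg, not_not] at this

omit [Φ.IsReduced] in
-- The map α ↦ -w₀α permutes the positive roots and exchanges the inverted with the non-inverted
-- ones.
theorem length_mul_longest {w₀ : Φ.weylGroup}
    (h₀ : ∀ i, b.IsPos (Φ.weylGroupToPerm w₀ i) ↔ ¬ b.IsPos i) (w : Φ.weylGroup) :
    b.length (w * w₀) + b.length w = ({i | b.IsPos i} : Finset ι).card := by
  have h1 : b.length (w * w₀) =
      ({i | b.IsPos i ∧ b.IsPos (Φ.weylGroupToPerm w i)} : Finset ι).card := by
    rw [length_eq_card]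
    refine Finset.card_bij (fun i _ => Φ.reflectionPerm (Φ.weylGroupToPerm w₀ i)
      (Φ.weylGroupToPerm w₀ i)) ?_ ?_ ?_
    · intro i hi
      simp only [Finset.mem_filter, Finset.mem_univ, true_and, map_mul,
        Equiv.Perm.mul_apply] at hi ⊢
      rw [isPos_neg, isPos_perm_neg, h₀, not_not]
      exact hi
    · intro i _ j _ h
      have h' := congrArg (fun k => Φ.reflectionPerm k k) h
      simp only [neg_neg_index] at h'
      exact (Φ.weylGroupToPerm w₀).injective h'
    · intro i hi
      simp only [Finset.mem_filter, Finset.mem_univ, true_and] at hi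
      have e : Φ.weylGroupToPerm w₀ (Φ.weylGroupToPerm w₀⁻¹ (Φ.reflectionPerm i i)) =
          Φ.reflectionPerm i i := by
        rw [← Equiv.Perm.mul_apply, ← map_mul, mul_inv_cancel, map_one, Equiv.Perm.one_apply]
      refine ⟨Φ.weylGroupToPerm w₀⁻¹ (Φ.reflectionPerm i i), ?_, by rw [e, neg_neg_index]⟩
      simp only [Finset.mem_filter, Finset.mem_univ, true_and, map_mul,
        Equiv.Perm.mul_apply]
      rw [e]
      refine ⟨?_, fun h => b.isPos_perm_neg.1 h hi.2⟩
      have := h₀ (Φ.weylGroupToPerm w₀⁻¹ (Φ.reflectionPerm i i))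
      rw [e, isPos_neg] at this
      by_contra h
      exact this.2 h hi.1
  rw [h1, b.length_eq_card w, ← Finset.card_union_of_disjoint]
  · congr 1
    ext i
    simp only [Finset.mem_union, Finset.mem_filter, Finset.mem_univ, true_and]
    tauto
  · rw [Finset.disjoint_left]
    intro i h1 h2
    simp only [Finset.mem_filter] at h1 h2
    exact h2.2.2 h1.2.2

/-- The parabolic subgroup permutes the positive roots outside of its subsystem. -/
theorem cosetLength_mul {Θ : Set ι} (hΘ : Θ ⊆ b.support) (w : Φ.weylGroup) {u : Φ.weylGroup}
    (hu : u ∈ Φ.parabolicSubgroup Θ) : b.cosetLength Θ (w * u) = b.cosetLength Θ w := by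
  refine Finset.card_equiv (Φ.weylGroupToPerm u) fun i => ?_
  simp only [Finset.mem_filter, Finset.mem_univ, true_and, map_mul, Equiv.Perm.mul_apply]
  by_cases hs : Φ.root i ∈ Submodule.span ℤ (Φ.root '' Θ)
  · exact iff_of_false (fun h => h.2.1 hs) (fun h => h.2.1 ((perm_mem_span_iff hu i).2 hs))
  · rw [b.perm_isPos_of_notMem_span hΘ hu hs, perm_mem_span_iff hu]

omit [Φ.IsReduced] in
theorem cosetLength_le (Θ : Set ι) (w : Φ.weylGroup) : b.cosetLength Θ w ≤ b.length w := by
  rw [b.length_eq_cosetLength_add Θ]; omega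

omit [Φ.IsReduced] in
theorem length_eq_cosetLength {Θ : Set ι} {w : Φ.weylGroup}
    (h : ∀ i, b.IsPos i → Φ.root i ∈ Submodule.span ℤ (Φ.root '' Θ) →
      b.IsPos (Φ.weylGroupToPerm w i)) : b.length w = b.cosetLength Θ w := by
  rw [b.length_eq_cosetLength_add Θ, Nat.add_eq_left, Finset.card_eq_zero,
    Finset.filter_eq_empty_iff]
  exact fun i _ hi => hi.2.2 (h i hi.1 hi.2.1)

omit [Φ.IsReduced] in
/-- An element that makes the positive roots of the parabolic subsystem negative is at least as
long as all elements with smaller coset length. -/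
theorem length_le_of_cosetLength_le {Θ : Set ι} {w t : Φ.weylGroup}
    (ht : ∀ i, b.IsPos i → Φ.root i ∈ Submodule.span ℤ (Φ.root '' Θ) →
      ¬ b.IsPos (Φ.weylGroupToPerm t i)) (h : b.cosetLength Θ w ≤ b.cosetLength Θ t) :
    b.length w ≤ b.length t := by
  rw [b.length_eq_cosetLength_add Θ, b.length_eq_cosetLength_add Θ t]
  refine Nat.add_le_add h (Finset.card_le_card fun i hi => ?_)
  simp only [Finset.mem_filter, Finset.mem_univ, true_and] at hi ⊢
  exact ⟨hi.1, hi.2.1, ht i hi.1 hi.2.1⟩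

end Length

end Base

end RootPairing

end

noncomputable section

/-! ## Words in push-pull elements -/

namespace RootPairing

open Classical

variable {ι M N : Type*} [AddCommGroup M] [AddCommGroup N] {Φ : RootDatum ι M N}

section

variable (Φ) {S : Type*} (Q : Type*) [CommRing S] [CommRing Q] [Algebra S Q]
  [MulSemiringAction Φ.weylGroup S] [MulSemiringAction Φ.weylGroup Q]

/-- The properties of the elements `x_α` of a formal group algebra, and of the localization at
them, that are used in the study of push-pull elements. -/
structure IsRootRing (X : ι → S) : Prop where
  smul_X : ∀ (w : Φ.weylGroup) (i : ι), w • X i = X (Φ.weylGroupToPerm w i)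
  exists_add_neg : ∀ i, ∃ h, X i + X (Φ.reflectionPerm i i) = X i * X (Φ.reflectionPerm i i) * h
  dvd_smul_sub : ∀ (i : ι) (s : S), X i ∣ weylGroup.ofIdx Φ i • s - s
  regular : ∀ i, X i ∈ nonZeroDivisors S
  smul_algebraMap : ∀ (w : Φ.weylGroup) (s : S), w • algebraMap S Q s = algebraMap S Q (w • s)
  isLocalization : IsLocalization (Submonoid.closure (Set.range X)) Q

end

namespace IsRootRing

variable {S Q : Type*} [CommRing S] [CommRing Q] [Algebra S Q]
  [MulSemiringAction Φ.weylGroup S] [MulSemiringAction Φ.weylGroup Q] {X : ι → S}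

theorem closure_le (h : IsRootRing Φ Q X) :
    Submonoid.closure (Set.range X) ≤ nonZeroDivisors S :=
  Submonoid.closure_le.2 (by rintro _ ⟨i, rfl⟩; exact h.regular i)

theorem injective (h : IsRootRing Φ Q X) : Function.Injective (algebraMap S Q) :=
  have := h.isLocalization
  IsLocalization.injective Q h.closure_le

variable (Q) in
/-- The inverse of `x_α`. -/
def inv (X : ι → S) (i : ι) : Q := Ring.inverse (algebraMap S Q (X i))

theorem isUnit (h : IsRootRing Φ Q X) (i : ι) : IsUnit (algebraMap S Q (X i)) :=
  have := h.isLocalization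
  IsLocalization.map_units Q (⟨X i, Submonoid.subset_closure ⟨i, rfl⟩⟩ :
    Submonoid.closure (Set.range X))

theorem inv_mul (h : IsRootRing Φ Q X) (i : ι) : inv Q X i * algebraMap S Q (X i) = 1 :=
  Ring.inverse_mul_cancel _ (h.isUnit i)

theorem mul_inv (h : IsRootRing Φ Q X) (i : ι) : algebraMap S Q (X i) * inv Q X i = 1 :=
  Ring.mul_inverse_cancel _ (h.isUnit i)

theorem eq_inv (h : IsRootRing Φ Q X) {i : ι} {q : Q} (hq : q * algebraMap S Q (X i) = 1) :
    q = inv Q X i := by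
  rw [← mul_one q, ← h.mul_inv i, ← mul_assoc, hq, one_mul]

theorem smul_inv (h : IsRootRing Φ Q X) (w : Φ.weylGroup) (i : ι) :
    w • inv Q X i = inv Q X (Φ.weylGroupToPerm w i) :=
  h.eq_inv (by rw [← h.smul_X, ← h.smul_algebraMap, ← smul_mul', h.inv_mul, smul_one])

/-- Divide the relation x_α + x_{-α} = x_α x_{-α} h by x_α x_{-α}. -/
theorem exists_inv_add_inv (h : IsRootRing Φ Q X) (i : ι) :
    ∃ s, inv Q X i + inv Q X (Φ.reflectionPerm i i) = algebraMap S Q s := by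
  obtain ⟨s, hs⟩ := h.exists_add_neg i
  refine ⟨s, ?_⟩
  have hs' := congrArg (algebraMap S Q) hs
  simp only [map_add, map_mul] at hs'
  have h1 := h.mul_inv i
  have h2 := h.mul_inv (Φ.reflectionPerm i i)
  set x := algebraMap S Q (X i)
  set y := algebraMap S Q (X (Φ.reflectionPerm i i))
  set u := inv Q X i
  set v := inv Q X (Φ.reflectionPerm i i)
  set t := algebraMap S Q s
  linear_combination (u * v) * hs' + (v * y * t - v) * h1 + (t - u) * h2

theorem dvd_neg (h : IsRootRing Φ Q X) (i : ι) : X i ∣ X (Φ.reflectionPerm i i) := by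
  obtain ⟨s, hs⟩ := h.exists_add_neg i
  exact ⟨X (Φ.reflectionPerm i i) * s - 1, by linear_combination hs⟩

theorem neg_dvd (h : IsRootRing Φ Q X) (i : ι) : X (Φ.reflectionPerm i i) ∣ X i := by
  have := h.dvd_neg (Φ.reflectionPerm i i)
  rwa [neg_neg_index] at this

end IsRootRing

section PushPull

variable {S : Type*} (Q : Type*) [CommRing S] [CommRing Q] [Algebra S Q]
  [MulSemiringAction Φ.weylGroup S] [MulSemiringAction Φ.weylGroup Q] (X : ι → S)

/-- Left multiplication by a push-pull element, on coefficients. -/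
def pushPullFun (i : ι) (z : Φ.weylGroup → Q) : Φ.weylGroup → Q := fun w =>
  IsRootRing.inv Q X (Φ.reflectionPerm i i) * z w +
    IsRootRing.inv Q X i * weylGroup.ofIdx Φ i • z (weylGroup.ofIdx Φ i * w)

variable {Q X}

/-- The ring of fractions with denominators prime to `x_β`. -/
def primeTo (Φ : RootDatum ι M N) (Q : Type*) [CommRing Q] [Algebra S Q] (X : ι → S) (β : ι) :
    Subring Q where
  carrier := {q | ∃ n ∈ Submonoid.closure {a | ∃ i, i ≠ β ∧ i ≠ Φ.reflectionPerm β β ∧ a = X i},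
    ∃ s, algebraMap S Q n * q = algebraMap S Q s}
  zero_mem' := ⟨1, one_mem _, 0, by simp⟩
  one_mem' := ⟨1, one_mem _, 1, by simp⟩
  add_mem' := by
    rintro p q ⟨m, hm, s, hs⟩ ⟨n, hn, t, ht⟩
    refine ⟨m * n, mul_mem hm hn, n * s + m * t, ?_⟩
    simp only [map_mul, map_add, ← hs, ← ht]; ring
  neg_mem' := by
    rintro p ⟨m, hm, s, hs⟩
    exact ⟨m, hm, -s, by rw [mul_neg, hs, map_neg]⟩
  mul_mem' := by
    rintro p q ⟨m, hm, s, hs⟩ ⟨n, hn, t, ht⟩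
    refine ⟨m * n, mul_mem hm hn, s * t, ?_⟩
    simp only [map_mul, ← hs, ← ht]; ring

omit [MulSemiringAction Φ.weylGroup S] [MulSemiringAction Φ.weylGroup Q] in
theorem algebraMap_mem_primeTo (β : ι) (s : S) : algebraMap S Q s ∈ primeTo Φ Q X β :=
  ⟨1, one_mem _, s, by simp⟩

omit [MulSemiringAction Φ.weylGroup S] [MulSemiringAction Φ.weylGroup Q] in
theorem primeTo_neg (β : ι) : primeTo Φ Q X (Φ.reflectionPerm β β) = primeTo Φ Q X β := by
  refine Subring.ext fun q => ?_
  change (∃ n ∈ _, _) ↔ (∃ n ∈ _, _)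
  have : {a | ∃ i, i ≠ Φ.reflectionPerm β β ∧ i ≠ Φ.reflectionPerm (Φ.reflectionPerm β β)
      (Φ.reflectionPerm β β) ∧ a = X i} = {a | ∃ i, i ≠ β ∧ i ≠ Φ.reflectionPerm β β ∧ a = X i} := by
    ext a
    simp only [neg_neg_index, Set.mem_ofPred_eq]
    exact exists_congr fun i => by tauto
  rw [this]

variable (h : IsRootRing Φ Q X)

include h

theorem IsRootRing.inv_mem_primeTo {β i : ι} (h1 : i ≠ β) (h2 : i ≠ Φ.reflectionPerm β β) :
    IsRootRing.inv Q X i ∈ primeTo Φ Q X β :=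
  ⟨X i, Submonoid.subset_closure ⟨i, h1, h2, rfl⟩, 1, by rw [h.mul_inv, map_one]⟩

theorem IsRootRing.smul_closure (w : Φ.weylGroup) {β : ι} {n : S}
    (hn : n ∈ Submonoid.closure {a | ∃ i, i ≠ β ∧ i ≠ Φ.reflectionPerm β β ∧ a = X i}) :
    w • n ∈ Submonoid.closure {a | ∃ i, i ≠ Φ.weylGroupToPerm w β ∧
      i ≠ Φ.reflectionPerm (Φ.weylGroupToPerm w β) (Φ.weylGroupToPerm w β) ∧ a = X i} := by
  induction hn using Submonoid.closure_induction with
  | mem a ha =>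
    obtain ⟨i, h1, h2, rfl⟩ := ha
    refine Submonoid.subset_closure ⟨Φ.weylGroupToPerm w i, ?_, ?_, h.smul_X w i⟩
    · exact (Φ.weylGroupToPerm w).injective.ne h1
    · rw [← weylGroupToPerm_neg]
      exact (Φ.weylGroupToPerm w).injective.ne h2
  | one => rw [smul_one]; exact one_mem _
  | mul a b _ _ ha hb => rw [smul_mul']; exact mul_mem ha hb

theorem IsRootRing.smul_mem_primeTo (w : Φ.weylGroup) {β : ι} {q : Q}
    (hq : q ∈ primeTo Φ Q X β) : w • q ∈ primeTo Φ Q X (Φ.weylGroupToPerm w β) := by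
  obtain ⟨n, hn, s, hs⟩ := hq
  exact ⟨w • n, h.smul_closure w hn, w • s,
    by rw [← h.smul_algebraMap, ← smul_mul', hs, h.smul_algebraMap]⟩

theorem IsRootRing.ofIdx_smul_mem_primeTo {β : ι} {q : Q} (hq : q ∈ primeTo Φ Q X β) :
    weylGroup.ofIdx Φ β • q ∈ primeTo Φ Q X β := by
  have := h.smul_mem_primeTo (weylGroup.ofIdx Φ β) hq
  rwa [weylGroupToPerm_ofIdx, primeTo_neg] at this

/-- Reflections are trivial modulo the corresponding `x_β`. -/
theorem IsRootRing.exists_smul_sub_eq {β : ι} {q : Q} (hq : q ∈ primeTo Φ Q X β) :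
    ∃ p ∈ primeTo Φ Q X β, weylGroup.ofIdx Φ β • q - q = algebraMap S Q (X β) * p := by
  obtain ⟨n, hn, s, hs⟩ := hq
  have hn' := h.smul_closure (weylGroup.ofIdx Φ β) hn
  rw [weylGroupToPerm_ofIdx] at hn'
  have hn'' : weylGroup.ofIdx Φ β • n ∈
      Submonoid.closure {a | ∃ i, i ≠ β ∧ i ≠ Φ.reflectionPerm β β ∧ a = X i} := by
    convert hn' using 3
    ext a
    simp only [neg_neg_index]
    exact exists_congr fun i => by tauto
  obtain ⟨c, hc⟩ := h.dvd_smul_sub β n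
  obtain ⟨d, hd⟩ := h.dvd_smul_sub β s
  refine ⟨IsRootRing.inv Q X β * (weylGroup.ofIdx Φ β • q - q), ?_, by
    rw [← mul_assoc, h.mul_inv, one_mul]⟩
  -- The quotient rule: for q = s / n the difference has the denominator n s_β(n), still prime to
  -- x_β, and x_β divides the variation of both s and n.
  refine ⟨n * (weylGroup.ofIdx Φ β • n), mul_mem hn hn'', n * d - c * s, ?_⟩
  have hs' : algebraMap S Q (weylGroup.ofIdx Φ β • n) * weylGroup.ofIdx Φ β • q =
      algebraMap S Q (weylGroup.ofIdx Φ β • s) := by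
    rw [← h.smul_algebraMap, ← smul_mul', hs, h.smul_algebraMap]
  have hc' := congrArg (algebraMap S Q) hc
  have hd' := congrArg (algebraMap S Q) hd
  simp only [map_mul, map_sub] at hc' hd' ⊢
  have hu := h.mul_inv β
  generalize weylGroup.ofIdx Φ β • q = sq at *
  generalize algebraMap S Q (weylGroup.ofIdx Φ β • n) = sn at *
  generalize algebraMap S Q (weylGroup.ofIdx Φ β • s) = ss at *
  generalize algebraMap S Q n = n at *
  generalize algebraMap S Q s = s at *
  generalize algebraMap S Q c = c at *
  generalize algebraMap S Q d = d at *
  generalize algebraMap S Q (X β) = x at *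
  generalize IsRootRing.inv Q X β = u at *
  linear_combination (n * u) * hs' - (u * sn) * hs + u * n * hd' - u * s * hc' +
    (n * d - c * s) * hu

/-- Fractions with denominators prime to all `x_β` are integral, if the `x_β` are
pairwise coprime. -/
theorem IsRootRing.exists_eq_of_forall_mem_primeTo
    (hcop : ∀ i j f, j ≠ i → j ≠ Φ.reflectionPerm i i → X i ∣ X j * f → X i ∣ f) {q : Q}
    (hq : ∀ β, q ∈ primeTo Φ Q X β) : ∃ s, q = algebraMap S Q s := by
  have hcop' (β : ι) {n : S}
      (hn : n ∈ Submonoid.closure {a | ∃ i, i ≠ β ∧ i ≠ Φ.reflectionPerm β β ∧ a = X i}) :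
      ∀ f, X β ∣ n * f → X β ∣ f := by
    induction hn using Submonoid.closure_induction with
    | mem a ha => obtain ⟨i, h1, h2, rfl⟩ := ha; exact fun f => hcop β i f h1 h2
    | one => intro f; rw [one_mul]; exact id
    | mul a b _ _ ha hb => intro f hf; rw [mul_assoc] at hf; exact hb f (ha _ hf)
  -- Clears the denominator one factor x_i at a time. As q also has a denominator prime to x_i,
  -- coprimality shows that x_i divides the numerator.
  have key {n : S} (hn : n ∈ Submonoid.closure (Set.range X)) :
      ∀ q : Q, (∀ β, q ∈ primeTo Φ Q X β) → (∃ s, algebraMap S Q n * q = algebraMap S Q s) →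
        ∃ s, q = algebraMap S Q s := by
    induction hn using Submonoid.closure_induction with
    | mem a ha =>
      obtain ⟨i, rfl⟩ := ha
      rintro q hq ⟨s, hs⟩
      obtain ⟨m, hm, c, hc⟩ := hq i
      have e : m * s = X i * c := h.injective (by
        rw [map_mul, map_mul, ← hs, ← hc]; ring)
      obtain ⟨t, rfl⟩ := hcop' i hm s ⟨c, e⟩
      refine ⟨t, ?_⟩
      rw [← one_mul q, ← h.inv_mul i, mul_assoc, hs, map_mul, ← mul_assoc, h.inv_mul, one_mul]
    | one => rintro q - ⟨s, hs⟩; exact ⟨s, by rw [← hs, map_one, one_mul]⟩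
    | mul a b _ _ ha hb =>
      rintro q hq ⟨s, hs⟩
      refine hb q hq (ha _ (fun β => mul_mem (algebraMap_mem_primeTo β b) (hq β)) ⟨s, ?_⟩)
      rw [← hs, map_mul, mul_assoc]
  have := h.isLocalization
  obtain ⟨⟨s, n⟩, e⟩ := IsLocalization.surj (Submonoid.closure (Set.range X)) q
  exact key n.2 q hq ⟨s, by rw [← e, mul_comm]⟩

omit h

/-- Residue conditions along `x_β` satisfied by the coefficients of the elements of the formal
affine Demazure algebra. -/
structure HasResidues (X : ι → S) (β : ι) (z : Φ.weylGroup → Q) : Prop where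
  mul_mem : ∀ w, algebraMap S Q (X β) * z w ∈ primeTo Φ Q X β
  add_mem : ∀ w, z w + z (weylGroup.ofIdx Φ β * w) ∈ primeTo Φ Q X β

include h

theorem HasResidues.neg {β : ι} {z : Φ.weylGroup → Q} (hz : HasResidues X β z) :
    HasResidues X (Φ.reflectionPerm β β) z where
  mul_mem w := by
    obtain ⟨c, hc⟩ := h.dvd_neg β
    rw [primeTo_neg, hc, mul_comm (X β), map_mul, mul_assoc]
    exact Subring.mul_mem _ (algebraMap_mem_primeTo β c) (hz.mul_mem w)
  add_mem w := by
    rw [primeTo_neg, ofIdx_neg]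
    exact hz.add_mem w

/-- With t = 1/x_β + 1/x_{-β} in S, replace 1/x_{-β} by t - 1/x_β. The potential double pole cancels
because the residues at w and s_β w are opposite and s_β acts trivially modulo x_β. For the sum of
the values at w and s_β w, the simple pole cancels by the same triviality. -/
theorem hasResidues_pushPullFun_self {i : ι} {z : Φ.weylGroup → Q} (hz : HasResidues X i z) :
    HasResidues X i (pushPullFun Q X i z) := by
  obtain ⟨t, ht⟩ := h.exists_inv_add_inv i
  have hu := h.mul_inv i
  have ht' := algebraMap_mem_primeTo (Φ := Φ) (Q := Q) (X := X) i t
  constructor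
  · intro w
    have hc := h.ofIdx_smul_mem_primeTo (hz.add_mem w)
    obtain ⟨p, hp, e⟩ := h.exists_smul_sub_eq (hz.mul_mem w)
    have hsp := h.ofIdx_smul_mem_primeTo (hz.mul_mem w)
    rw [smul_mul', h.smul_algebraMap, h.smul_X, weylGroupToPerm_ofIdx] at hsp e
    rw [smul_add] at hc
    have hv := h.mul_inv (Φ.reflectionPerm i i)
    have := Subring.add_mem _ (Subring.add_mem _ (Subring.sub_mem _
      (Subring.mul_mem _ ht' (hz.mul_mem w)) (Subring.mul_mem _ ht' hsp)) hp) hc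
    convert this using 1
    simp only [pushPullFun]
    generalize weylGroup.ofIdx Φ i • z (weylGroup.ofIdx Φ i * w) = sb at *
    generalize weylGroup.ofIdx Φ i • z w = sa at *
    generalize z w = a at *
    generalize algebraMap S Q (X (Φ.reflectionPerm i i)) = y at *
    generalize algebraMap S Q (X i) = x at *
    generalize IsRootRing.inv Q X (Φ.reflectionPerm i i) = v at *
    generalize IsRootRing.inv Q X i = u at *
    rw [← ht]
    linear_combination (sb + p) * hu + sa * hv + u * e
  · intro w
    have hc := hz.add_mem w
    obtain ⟨p, hp, e⟩ := h.exists_smul_sub_eq hc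
    have := Subring.add_mem _ (Subring.mul_mem _ ht' hc) hp
    convert this using 1
    simp only [pushPullFun]
    rw [← mul_assoc, ofIdx_mul_self, one_mul, ← ht]
    rw [smul_add] at e
    generalize weylGroup.ofIdx Φ i • z (weylGroup.ofIdx Φ i * w) = sb at *
    generalize weylGroup.ofIdx Φ i • z w = sa at *
    generalize z (weylGroup.ofIdx Φ i * w) = b at *
    generalize z w = a at *
    generalize algebraMap S Q (X i) = x at *
    generalize IsRootRing.inv Q X (Φ.reflectionPerm i i) = v at *
    generalize IsRootRing.inv Q X i = u at *
    linear_combination u * e + p * hu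

/-- For β different from ±α_i the factors 1/x_{±α_i} have no pole along x_β. The reflection s_i
carries the conditions along s_i β to those along β, because s_i s_β = s_{s_i β} s_i. -/
theorem hasResidues_pushPullFun {z : Φ.weylGroup → Q} (hz : ∀ β, HasResidues X β z) (i β : ι) :
    HasResidues X β (pushPullFun Q X i z) := by
  by_cases h1 : i = β
  · subst h1
    exact hasResidues_pushPullFun_self h (hz i)
  by_cases h2 : i = Φ.reflectionPerm β β
  · have := (hasResidues_pushPullFun_self h (hz i)).neg h
    subst h2
    rwa [neg_neg_index] at this
  have hu := h.inv_mem_primeTo h1 h2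
  have hv := h.inv_mem_primeTo (β := β) (i := Φ.reflectionPerm i i)
    (fun e => h2 (by rw [← e, neg_neg_index]))
    (fun e => h1 (by rw [← neg_neg_index (Φ := Φ) i, e, neg_neg_index]))
  have hmem {q : Q} (hq : q ∈ primeTo Φ Q X (Φ.reflectionPerm i β)) :
      weylGroup.ofIdx Φ i • q ∈ primeTo Φ Q X β := by
    have := h.smul_mem_primeTo (weylGroup.ofIdx Φ i) hq
    rwa [weylGroupToPerm_ofIdx, reflectionPerm_self] at this
  have hconj : weylGroup.ofIdx Φ i * weylGroup.ofIdx Φ β =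
      weylGroup.ofIdx Φ (Φ.reflectionPerm i β) * weylGroup.ofIdx Φ i := by
    rw [← weylGroupToPerm_ofIdx, ← conj_ofIdx, inv_mul_cancel_right]
  constructor
  · intro w
    have hs := hmem ((hz (Φ.reflectionPerm i β)).mul_mem (weylGroup.ofIdx Φ i * w))
    rw [smul_mul', h.smul_algebraMap, h.smul_X, weylGroupToPerm_ofIdx, reflectionPerm_self] at hs
    have := Subring.add_mem _ (Subring.mul_mem _ hv ((hz β).mul_mem w)) (Subring.mul_mem _ hu hs)
    convert this using 1
    simp only [pushPullFun]; ring
  · intro w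
    have hs := hmem ((hz (Φ.reflectionPerm i β)).add_mem (weylGroup.ofIdx Φ i * w))
    rw [← mul_assoc, ← hconj, smul_add, mul_assoc] at hs
    have := Subring.add_mem _ (Subring.mul_mem _ hv ((hz β).add_mem w)) (Subring.mul_mem _ hu hs)
    convert this using 1
    simp only [pushPullFun]; ring

omit h

/-- The coefficients of the product of the push-pull elements of a word. -/
def wordFun {b : Φ.Base} (Q : Type*) [CommRing Q] [Algebra S Q] [MulSemiringAction Φ.weylGroup Q]
    (X : ι → S) : List b.support → Φ.weylGroup → Q
  | [] => Pi.single 1 1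
  | i :: I => pushPullFun Q X i (wordFun Q X I)

include h

theorem hasResidues_wordFun {b : Φ.Base} (I : List b.support) (β : ι) :
    HasResidues X β (wordFun Q X I) := by
  induction I generalizing β with
  | nil =>
    have h1 (w : Φ.weylGroup) : (Pi.single 1 1 : Φ.weylGroup → Q) w ∈ primeTo Φ Q X β := by
      by_cases hw : w = 1
      · subst hw; rw [Pi.single_eq_same]; exact one_mem _
      · rw [Pi.single_eq_of_ne hw]; exact zero_mem _
    exact ⟨fun w => mul_mem (algebraMap_mem_primeTo β _) (h1 w), fun w => add_mem (h1 _) (h1 _)⟩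
  | cons i I ih => exact hasResidues_pushPullFun h ih i β

/-- The integrality of the class of the base point. -/
theorem exists_prod_mul_sum_wordFun_eq [Fintype ι] [Fintype Φ.weylGroup] [Φ.IsReduced] (b : Φ.Base)
    {Θ : Set ι} (hΘ : Θ ⊆ b.support)
    (hcop : ∀ i j f, j ≠ i → j ≠ Φ.reflectionPerm i i → X i ∣ X j * f → X i ∣ f)
    (I : List b.support) :
    ∃ s, algebraMap S Q (∏ i with ¬ b.IsPos i ∧ Φ.root i ∉ Submodule.span ℤ (Φ.root '' Θ), X i) *
      ∑ w with w ∈ Φ.parabolicSubgroup Θ, wordFun Q X I w = algebraMap S Q s := by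
  have hz := hasResidues_wordFun h I
  obtain ⟨s, hs⟩ := h.exists_eq_of_forall_mem_primeTo hcop (q := algebraMap S Q (∏ i with
    ¬ b.IsPos i ∧ Φ.root i ∉ Submodule.span ℤ (Φ.root '' Θ), X i) *
      ∑ w with w ∈ Φ.parabolicSubgroup Θ, wordFun Q X I w) fun β => by
    -- For β in the subsystem, left multiplication by s_β is an involution of the parabolic subgroup
    -- without fixed points, and it pairs terms with opposite residues. Otherwise x_β or x_{-β} is a
    -- factor of the product, which suffices for a simple pole because the two divide each other.
    by_cases hβ : Φ.root β ∈ Submodule.span ℤ (Φ.root '' Θ)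
    · refine mul_mem (algebraMap_mem_primeTo β _) ?_
      have hsβ := b.ofIdx_mem_parabolicSubgroup_of_mem_span hΘ hβ
      refine (QuotientAddGroup.eq_zero_iff (N := (primeTo Φ Q X β).toAddSubgroup) _).1 ?_
      rw [← QuotientAddGroup.mk'_apply, map_sum]
      refine Finset.sum_involution (fun w _ => weylGroup.ofIdx Φ β * w) ?_ ?_ ?_ ?_
      · intro w _
        rw [← map_add]
        exact (QuotientAddGroup.eq_zero_iff _).2 ((hz β).add_mem w)
      · intro w _ _ e
        have : weylGroup.ofIdx Φ β = 1 := mul_eq_right.1 e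
        have h1 := congrArg (fun v => Φ.weylGroupToPerm v β) this
        rw [weylGroupToPerm_ofIdx, weylGroupToPerm_one] at h1
        have h2 := b.isPos_neg (i := β)
        rw [h1] at h2
        exact iff_not_self h2
      · intro w hw
        rw [Finset.mem_filter_univ] at hw ⊢
        exact mul_mem hsβ hw
      · intro w _
        rw [← mul_assoc, ofIdx_mul_self, one_mul]
    · have hfac : X β ∣ ∏ i with ¬ b.IsPos i ∧ Φ.root i ∉ Submodule.span ℤ (Φ.root '' Θ), X i := by
        by_cases hp : b.IsPos β
        · refine (h.dvd_neg β).trans (Finset.dvd_prod_of_mem X ?_)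
          rw [Finset.mem_filter_univ, b.isPos_neg, root_neg, neg_mem_iff]
          exact ⟨not_not.2 hp, hβ⟩
        · exact Finset.dvd_prod_of_mem X ((Finset.mem_filter_univ _).2 ⟨hp, hβ⟩)
      obtain ⟨c, hc⟩ := hfac
      rw [hc, mul_comm (X β), map_mul, mul_assoc, Finset.mul_sum]
      exact mul_mem (algebraMap_mem_primeTo β c) (sum_mem fun w _ => (hz β).mul_mem w)
  exact ⟨s, hs⟩

end PushPull

end RootPairing

end

/-! ### Transport of integrality along equivariant ring maps -/

noncomputable section

namespace FormalGroupAlgebra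

theorem localizationAction_algebraMap {G A : Type*} [Group G] [CommRing A] [MulSemiringAction G A]
    (T : Submonoid A) (hT : ∀ (g : G) (a : A), a ∈ T → g • a ∈ T) (g : G) (a : A) :
    letI := localizationAction T hT
    g • algebraMap A (Localization T) a = algebraMap A (Localization T) (g • a) :=
  IsLocalization.map_eq (S := Localization T) (Q := Localization T)
    (g := MulSemiringAction.toRingHom G A g) (show T ≤ T.comap _ from fun a ha => hT g a ha) a

end FormalGroupAlgebra

namespace RootPairing

open Classical FormalGroupAlgebra

variable {ι M N : Type*} [AddCommGroup M] [AddCommGroup N] {Φ : RootDatum ι M N}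

section Transfer

variable {S S' : Type*} [CommRing S] [CommRing S'] [MulSemiringAction Φ.weylGroup S]
  [MulSemiringAction Φ.weylGroup S'] {X : ι → S} {X' : ι → S'}

theorem smul_mem_closure_range (hX : ∀ (w : Φ.weylGroup) i, w • X i = X (Φ.weylGroupToPerm w i))
    (w : Φ.weylGroup) (a : S) (ha : a ∈ Submonoid.closure (Set.range X)) :
    w • a ∈ Submonoid.closure (Set.range X) := by
  induction ha using Submonoid.closure_induction with
  | mem a ha =>
    obtain ⟨i, rfl⟩ := ha
    rw [hX]
    exact Submonoid.subset_closure ⟨_, rfl⟩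
  | one => rw [smul_one]; exact one_mem _
  | mul a b _ _ ha hb => rw [smul_mul']; exact mul_mem ha hb

theorem isRootRing_localization
    (hX : ∀ (w : Φ.weylGroup) i, w • X i = X (Φ.weylGroupToPerm w i))
    (hneg : ∀ i, ∃ h, X i + X (Φ.reflectionPerm i i) = X i * X (Φ.reflectionPerm i i) * h)
    (hdvd : ∀ (i : ι) (s : S), X i ∣ weylGroup.ofIdx Φ i • s - s)
    (hreg : ∀ i, X i ∈ nonZeroDivisors S) :
    letI := localizationAction (Submonoid.closure (Set.range X)) (smul_mem_closure_range hX)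
    IsRootRing Φ (Localization (Submonoid.closure (Set.range X))) X :=
  letI := localizationAction (Submonoid.closure (Set.range X)) (smul_mem_closure_range hX)
  { smul_X := hX
    exists_add_neg := hneg
    dvd_smul_sub := hdvd
    regular := hreg
    smul_algebraMap := localizationAction_algebraMap _ _
    isLocalization := inferInstance }

variable {Q Q' : Type*} [CommRing Q] [CommRing Q'] [Algebra S Q] [Algebra S' Q']
  [MulSemiringAction Φ.weylGroup Q] [MulSemiringAction Φ.weylGroup Q']

theorem wordFun_map (h : IsRootRing Φ Q X) (h' : IsRootRing Φ Q' X') (θ : S' →+* S) (Θ : Q' →+* Q)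
    (hΘ : ∀ s, Θ (algebraMap S' Q' s) = algebraMap S Q (θ s)) (hθX : ∀ i, θ (X' i) = X i)
    (hΘw : ∀ (w : Φ.weylGroup) q, Θ (w • q) = w • Θ q) {b : Φ.Base} (I : List b.support)
    (w : Φ.weylGroup) : Θ (wordFun Q' X' I w) = wordFun Q X I w := by
  have hinv (i : ι) : Θ (IsRootRing.inv Q' X' i) = IsRootRing.inv Q X i :=
    h.eq_inv (by rw [← hθX, ← hΘ, ← map_mul, h'.inv_mul, map_one])
  induction I generalizing w with
  | nil =>
    simp only [wordFun]
    by_cases hw : w = 1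
    · subst hw; rw [Pi.single_eq_same, Pi.single_eq_same, map_one]
    · rw [Pi.single_eq_of_ne hw, Pi.single_eq_of_ne hw, map_zero]
  | cons i I ih => simp only [wordFun, pushPullFun, map_add, map_mul, hinv, hΘw, ih]

/-- Integrality of the class of the base point over a ring to which an integral domain with
pairwise coprime `x_α` maps. -/
theorem exists_prod_mul_sum_wordFun_eq_of_lift [Fintype ι] [Fintype Φ.weylGroup] [Φ.IsReduced]
    (h : IsRootRing Φ Q X)
    (hX : ∀ (w : Φ.weylGroup) i, w • X' i = X' (Φ.weylGroupToPerm w i))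
    (hneg : ∀ i, ∃ h, X' i + X' (Φ.reflectionPerm i i) = X' i * X' (Φ.reflectionPerm i i) * h)
    (hdvd : ∀ (i : ι) (s : S'), X' i ∣ weylGroup.ofIdx Φ i • s - s)
    (hreg : ∀ i, X' i ∈ nonZeroDivisors S')
    (hcop : ∀ i j f, j ≠ i → j ≠ Φ.reflectionPerm i i → X' i ∣ X' j * f → X' i ∣ f)
    (θ : S' →+* S) (hθX : ∀ i, θ (X' i) = X i) (hθw : ∀ (w : Φ.weylGroup) s, θ (w • s) = w • θ s)
    (b : Φ.Base) {Θ : Set ι} (hΘ : Θ ⊆ b.support) (I : List b.support) :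
    ∃ s, algebraMap S Q (∏ i with ¬ b.IsPos i ∧ Φ.root i ∉ Submodule.span ℤ (Φ.root '' Θ), X i) *
      ∑ w with w ∈ Φ.parabolicSubgroup Θ, wordFun Q X I w = algebraMap S Q s := by
  let _ := localizationAction (Submonoid.closure (Set.range X')) (smul_mem_closure_range hX)
  have h' := isRootRing_localization hX hneg hdvd hreg
  let f : S' →+* Q := (algebraMap S Q).comp θ
  have hf (y : Submonoid.closure (Set.range X')) : IsUnit (f y) := by
    obtain ⟨y, hy⟩ := y
    simp only
    induction hy using Submonoid.closure_induction with
    | mem a ha =>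
      obtain ⟨i, rfl⟩ := ha
      change IsUnit (algebraMap S Q (θ (X' i)))
      rw [hθX]
      exact h.isUnit i
    | one => rw [map_one]; exact isUnit_one
    | mul a b _ _ ha hb => rw [map_mul]; exact ha.mul hb
  -- θ extends to fractions because it sends the denominators to products of the units x_α of Q;
  -- uniqueness of the extension makes it equivariant.
  let T : Localization (Submonoid.closure (Set.range X')) →+* Q := IsLocalization.lift hf
  have hT (s : S') : T (algebraMap S' _ s) = algebraMap S Q (θ s) := IsLocalization.lift_eq hf s
  have hTw (w : Φ.weylGroup) (q) : T (w • q) = w • T q := by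
    have : T.comp (MulSemiringAction.toRingHom Φ.weylGroup _ w) =
        (MulSemiringAction.toRingHom Φ.weylGroup Q w).comp T := by
      refine IsLocalization.ringHom_ext (Submonoid.closure (Set.range X')) (RingHom.ext fun s => ?_)
      simp only [RingHom.comp_apply, MulSemiringAction.toRingHom_apply]
      rw [h'.smul_algebraMap, hT, hT, hθw, h.smul_algebraMap]
    exact congrArg (fun g => g q) this
  obtain ⟨s, hs⟩ := exists_prod_mul_sum_wordFun_eq h' b hΘ hcop I
  refine ⟨θ s, ?_⟩
  have := congrArg T hs
  rw [map_mul, hT, hT, map_sum, map_prod] at this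
  rw [← this]
  congr 1
  · simp only [hθX]
  · exact Finset.sum_congr rfl fun w _ => (wordFun_map h h' θ T hT hθX hTw I w).symm

end Transfer

end RootPairing

end

noncomputable section

/-! ## The power series model -/

open MvPowerSeries

namespace FormalGroup

section Points

variable {R : Type*} [CommRing R] {σ τ : Type*}

/-- The group of power series without constant term under a formal group law. -/
def SeriesPoint (_ : FormalGroup R) (σ : Type*) := {f : MvPowerSeries σ R // f ∈ orderIdeal σ R 1}

theorem hasSubst_of_mem {f : MvPowerSeries σ R} (hf : f ∈ orderIdeal σ R 1) :
    PowerSeries.HasSubst f := by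
  rw [PowerSeries.HasSubst, mem_orderIdeal_one.1 hf]
  exact IsNilpotent.zero

variable (F : FormalGroup R)

instance : Add (F.SeriesPoint σ) := ⟨fun f g => ⟨F.toPowerSeries.subst ![f.1, g.1], subst_mem f.2 g.2⟩⟩

instance : Zero (F.SeriesPoint σ) := ⟨⟨0, Ideal.zero_mem _⟩⟩

instance : Neg (F.SeriesPoint σ) :=
  ⟨fun f => ⟨(exists_neg F f.2).choose, (exists_neg F f.2).choose_spec.1⟩⟩

@[simp] theorem SeriesPoint.coe_add (f g : F.SeriesPoint σ) :
    (f + g).1 = F.toPowerSeries.subst ![f.1, g.1] := rfl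

@[simp] theorem SeriesPoint.coe_zero : (0 : F.SeriesPoint σ).1 = 0 := rfl

instance [F.IsComm] : AddCommGroup (F.SeriesPoint σ) where
  __ := AddGroup.ofLeftAxioms (G := F.SeriesPoint σ)
    (fun f g h => Subtype.ext (F.assoc' (hasSubst_of_mem f.2) (hasSubst_of_mem g.2)
      (hasSubst_of_mem h.2)))
    (fun f => Subtype.ext (F.zero_add (hasSubst_of_mem f.2)))
    (fun f => Subtype.ext (by
      change F.toPowerSeries.subst ![(-f : F.SeriesPoint σ).1, f.1] = 0
      rw [F.comm' (hasSubst_of_mem (-f).2) (hasSubst_of_mem f.2)]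
      exact (exists_neg F f.2).choose_spec.2))
  add_comm f g := Subtype.ext (F.comm' (hasSubst_of_mem f.2) (hasSubst_of_mem g.2))

/-- Substitution of power series without constant term is a homomorphism of points. -/
def SeriesPoint.subst [F.IsComm] [Finite σ] (a : σ → MvPowerSeries τ R)
    (ha : ∀ s, a s ∈ orderIdeal τ R 1) : F.SeriesPoint σ →+ F.SeriesPoint τ :=
  AddMonoidHom.mk' (fun f => ⟨f.1.subst a, subst_mem_orderIdeal ha f.2⟩) fun f g =>
    Subtype.ext (subst_pair_subst f.2 g.2 (hasSubst_of_mem_orderIdeal ha) F.toPowerSeries)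

/-- The variables as points. -/
def SeriesPoint.var (i : σ) : F.SeriesPoint σ := ⟨X i, X_mem_orderIdeal i⟩

/-- F(x, y) and x + y differ by a multiple of x y, which has order 2 here. -/
theorem SeriesPoint.coeff_add (f g : F.SeriesPoint σ) {d : σ →₀ ℕ} (hd : d.degree < 2) :
    coeff d (f + g).1 = coeff d f.1 + coeff d g.1 := by
  rw [coe_add, subst_eq f.2 g.2, map_add, map_add]
  have := Ideal.mul_mem_right (F.mixedPart.subst ![f.1, g.1]) _ (mul_mem_orderIdeal f.2 g.2) d hd
  rw [this, _root_.add_zero]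

end Points

end FormalGroup

namespace MvPowerSeries

variable {σ R : Type*} [CommRing R]

/-- Setting X_i = 0 keeps exactly the monomials that do not involve X_i. -/
theorem coeff_subst_update [Finite σ] [DecidableEq σ] (i : σ) (f : MvPowerSeries σ R) {d : σ →₀ ℕ} (hd : d i = 0) :
    coeff d (f.subst fun k => if k = i then 0 else (X k : MvPowerSeries σ R)) = coeff d f := by
  have hs : HasSubst fun k => if k = i then 0 else (X k : MvPowerSeries σ R) :=
    hasSubst_of_mem_orderIdeal fun k => by
      split_ifs
      · exact Ideal.zero_mem _
      · exact X_mem_orderIdeal k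
  classical
  rw [coeff_subst hs]
  have key (e : σ →₀ ℕ) : (e.prod fun k n => (if k = i then 0 else (X k : MvPowerSeries σ R)) ^ n) =
      if e i = 0 then monomial e 1 else 0 := by
    split_ifs with he
    · rw [monomial_one_eq]
      refine Finsupp.prod_congr fun k hk => ?_
      rw [if_neg]
      rintro rfl
      exact (Finsupp.mem_support_iff.1 hk) he
    · exact Finset.prod_eq_zero (Finsupp.mem_support_iff.2 he) (by simp [he])
  simp only [key]
  rw [finsum_eq_single _ d]
  · simp [hd]
  · intro e he
    split_ifs
    · rw [coeff_monomial, if_neg he.symm, smul_zero]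
    · rw [map_zero, smul_zero]

theorem X_dvd_of_subst_eq_zero [Finite σ] [DecidableEq σ] (i : σ) {f : MvPowerSeries σ R}
    (hf : (f.subst fun k => if k = i then 0 else (X k : MvPowerSeries σ R)) = 0) : X i ∣ f :=
  X_dvd_iff.2 fun d hd => by rw [← coeff_subst_update i f hd, hf, map_zero]

/-- The variables are prime elements. -/
theorem X_dvd_of_dvd_mul [Finite σ] [IsDomain R] (i : σ) {f g : MvPowerSeries σ R}
    (h : X i ∣ f * g) (hf : ¬ X i ∣ f) : X i ∣ g := by
  classical
  have hs : HasSubst fun k => if k = i then 0 else (X k : MvPowerSeries σ R) :=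
    hasSubst_of_mem_orderIdeal fun k => by
      split_ifs
      · exact Ideal.zero_mem _
      · exact X_mem_orderIdeal k
  obtain ⟨c, hc⟩ := h
  have := congrArg (fun f => f.subst fun k => if k = i then 0 else (X k : MvPowerSeries σ R)) hc
  simp only [subst_mul hs, subst_X hs, if_true, zero_mul] at this
  exact (mul_eq_zero.1 this).elim (fun h => absurd (X_dvd_of_subst_eq_zero i h) hf)
    (X_dvd_of_subst_eq_zero i)

end MvPowerSeries

namespace RootPairing

variable {ι M N : Type*} [AddCommGroup M] [AddCommGroup N] {Φ : RootDatum ι M N}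

section RootLattice

theorem smul_mem_rootSpan (w : Φ.weylGroup) {m : M} (hm : m ∈ Φ.rootSpan ℤ) :
    w • m ∈ Φ.rootSpan ℤ := by
  unfold rootSpan at hm
  induction hm using Submodule.span_induction with
  | mem _ h =>
    obtain ⟨i, rfl⟩ := h
    rw [weylGroup_apply_root]
    exact Submodule.subset_span ⟨_, rfl⟩
  | zero => rw [smul_zero]; exact zero_mem _
  | add _ _ _ _ h1 h2 => rw [smul_add]; exact add_mem h1 h2
  | smul n _ _ h => rw [weylGroup_smul_zsmul]; exact Submodule.smul_mem _ n h

/-- The action of the Weyl group on the root lattice. -/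
instance : DistribMulAction Φ.weylGroup (Φ.rootSpan ℤ) where
  smul w m := ⟨w • m.1, smul_mem_rootSpan w m.2⟩
  one_smul m := Subtype.ext (one_smul _ m.1)
  mul_smul v w m := Subtype.ext (mul_smul v w m.1)
  smul_zero w := Subtype.ext (smul_zero w)
  smul_add w m n := Subtype.ext (smul_add w m.1 n.1)

@[simp] theorem coe_smul_rootSpan (w : Φ.weylGroup) (m : Φ.rootSpan ℤ) :
    ((w • m : Φ.rootSpan ℤ) : M) = w • (m : M) := rfl

theorem smul_rootSpanMem (w : Φ.weylGroup) (i : ι) :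
    w • Φ.rootSpanMem ℤ i = Φ.rootSpanMem ℤ (Φ.weylGroupToPerm w i) :=
  Subtype.ext (weylGroup_apply_root Φ w i)

theorem rootSpanMem_neg (i : ι) :
    Φ.rootSpanMem ℤ (Φ.reflectionPerm i i) = -Φ.rootSpanMem ℤ i :=
  Subtype.ext (root_neg i)

end RootLattice

section Model

variable {A : Type*} [CommRing A] (b : Φ.Base) (F : FormalGroup A) [F.IsComm]

/-- The series of an element of the root lattice in the variables given by the simple roots. -/
def Base.series : Φ.rootSpan ℤ →+ F.SeriesPoint b.support :=
  (b.toWeightBasisInt.constr (M' := F.SeriesPoint b.support) ℤ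
    (FormalGroup.SeriesPoint.var F)).toAddMonoidHom

theorem Base.series_simple (i : b.support) :
    b.series F (Φ.rootSpanMem ℤ i) = FormalGroup.SeriesPoint.var F i := by
  have h : b.toWeightBasisInt i = Φ.rootSpanMem ℤ i := Subtype.ext (by simp)
  rw [← h]
  exact b.toWeightBasisInt.constr_basis (M' := F.SeriesPoint b.support) ℤ _ i

theorem Base.series_ext {G : Type*} [AddCommGroup G] {f g : Φ.rootSpan ℤ →+ G}
    (h : ∀ i : b.support, f (Φ.rootSpanMem ℤ i) = g (Φ.rootSpanMem ℤ i)) : f = g := by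
  have : f.toIntLinearMap = g.toIntLinearMap := b.toWeightBasisInt.ext fun i => by
    have hi : b.toWeightBasisInt i = Φ.rootSpanMem ℤ i := Subtype.ext (by simp)
    rw [hi]
    exact h i
  exact AddMonoidHom.toIntLinearMap_injective this

/-- The images of the variables under an element of the Weyl group. -/
def Base.seriesVar (w : Φ.weylGroup) (i : b.support) : MvPowerSeries b.support A :=
  (b.series F (w • Φ.rootSpanMem ℤ i)).1

theorem Base.seriesVar_mem (w : Φ.weylGroup) (i : b.support) :
    b.seriesVar F w i ∈ orderIdeal _ A 1 := (b.series F _).2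

theorem Base.hasSubst_seriesVar (w : Φ.weylGroup) : HasSubst (b.seriesVar F w) :=
  hasSubst_of_mem_orderIdeal (b.seriesVar_mem F w)

theorem Base.series_subst (w : Φ.weylGroup) (m : Φ.rootSpan ℤ) :
    (b.series F m).1.subst (b.seriesVar F w) = (b.series F (w • m)).1 := by
  have : (FormalGroup.SeriesPoint.subst F (b.seriesVar F w) (b.seriesVar_mem F w)).comp
      (b.series F) = (b.series F).comp (DistribSMul.toAddMonoidHom _ w) :=
    b.series_ext fun i => by
      refine Subtype.ext ?_
      change (b.series F (Φ.rootSpanMem ℤ i)).1.subst (b.seriesVar F w) = b.seriesVar F w i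
      rw [b.series_simple]
      exact subst_X (b.hasSubst_seriesVar F w) i
  exact congrArg (fun f => (f m).1) this

/-- The action of the Weyl group on power series in the variables given by the simple roots. -/
@[reducible] def Base.seriesAction : MulSemiringAction Φ.weylGroup (MvPowerSeries b.support A) where
  smul w f := f.subst (b.seriesVar F w)
  one_smul f := by
    change f.subst (b.seriesVar F 1) = f
    have : b.seriesVar F (1 : Φ.weylGroup) = X := by
      funext i
      rw [Base.seriesVar, one_smul, b.series_simple]
      rfl
    rw [this, subst_self]; rfl
  mul_smul v w f := by
    change f.subst (b.seriesVar F (v * w)) = (f.subst (b.seriesVar F w)).subst (b.seriesVar F v)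
    rw [subst_comp_subst_apply (b.hasSubst_seriesVar F w) (b.hasSubst_seriesVar F v)]
    congr 1
    funext i
    rw [Base.seriesVar, Base.seriesVar, b.series_subst, mul_smul]
  smul_zero w := by
    change (0 : MvPowerSeries b.support A).subst (b.seriesVar F w) = 0
    rw [← coe_substAlgHom (b.hasSubst_seriesVar F w), map_zero]
  smul_one w := by
    change (1 : MvPowerSeries b.support A).subst (b.seriesVar F w) = 1
    rw [← coe_substAlgHom (b.hasSubst_seriesVar F w), map_one]
  smul_add w f g := subst_add (b.hasSubst_seriesVar F w) f g
  smul_mul w f g := subst_mul (b.hasSubst_seriesVar F w) f g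

/-- To first order the formal group law is addition, so both sides are additive in `m`; they agree
on the simple roots. -/
theorem Base.coeff_series (m : Φ.rootSpan ℤ) (i : b.support) :
    coeff (Finsupp.single i 1) (b.series F m).1 = (b.toWeightBasisInt.repr m i : A) := by
  classical
  let f : Φ.rootSpan ℤ →+ A := AddMonoidHom.mk'
    (fun m => coeff (Finsupp.single i 1) (b.series F m).1) fun m n => by
      rw [map_add]; exact FormalGroup.SeriesPoint.coeff_add F _ _ (by simp)
  let g : Φ.rootSpan ℤ →+ A := (Int.castAddHom A).comp
    ((b.toWeightBasisInt.coord i).toAddMonoidHom)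
  have : f = g := b.series_ext fun j => by
    have hj : b.toWeightBasisInt j = Φ.rootSpanMem ℤ j := Subtype.ext (by simp)
    change coeff (Finsupp.single i 1) (b.series F (Φ.rootSpanMem ℤ j)).1 =
      (b.toWeightBasisInt.repr (Φ.rootSpanMem ℤ j) i : A)
    rw [b.series_simple, ← hj, Module.Basis.repr_self, Finsupp.single_apply]
    refine (coeff_X _ _).trans ?_
    by_cases h : j = i
    · subst h; simp
    · rw [if_neg h, if_neg]
      · simp
      · intro e; exact h ((Finsupp.single_left_inj one_ne_zero).1 e).symm
  exact congrArg (fun f => f m) this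

variable [Finite ι] [Φ.IsReduced]

omit [Finite ι] in
-- Divisibility by X_i leaves no linear term in any other variable. In characteristic zero the root
-- is then a multiple of α_i, so it is ±α_i because the root system is reduced.
theorem Base.not_X_dvd_series [CharZero A] (i : b.support) {j : ι} (h1 : j ≠ i)
    (h2 : j ≠ Φ.reflectionPerm i i) : ¬ X i ∣ (b.series F (Φ.rootSpanMem ℤ j)).1 := by
  classical
  intro h
  have h0 : ∀ k, k ≠ i → b.toWeightBasisInt.repr (Φ.rootSpanMem ℤ j) k = 0 := by
    intro k hk
    have := X_dvd_iff.1 h (Finsupp.single k 1) (by rw [Finsupp.single_apply, if_neg hk])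
    rw [b.coeff_series] at this
    exact_mod_cast this
  have e : Φ.root j = (b.toWeightBasisInt.repr (Φ.rootSpanMem ℤ j) i) • Φ.root i := by
    have := b.toWeightBasisInt.sum_repr (Φ.rootSpanMem ℤ j)
    rw [Finset.sum_eq_single i (fun k _ hk => by rw [h0 k hk, zero_smul]) (by simp)] at this
    have := congrArg (fun m : Φ.rootSpan ℤ => (m : M)) this
    simp only [Submodule.coe_smul, b.coe_toWeightBasisInt_apply] at this
    exact this.symm
  have hlin : ¬ LinearIndependent ℤ ![Φ.root j, Φ.root i] := by
    rw [LinearIndependent.pair_iff]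
    push Not
    exact ⟨1, -(b.toWeightBasisInt.repr (Φ.rootSpanMem ℤ j) i),
      by rw [one_smul, neg_smul, ← e, add_neg_cancel], fun h => absurd h one_ne_zero⟩
  refine hlin (IsReduced.linearIndependent Φ h1 fun e => h2 ?_)
  exact Φ.root_eq_neg_iff.1 e

end Model

end RootPairing

end

/-! ### Reduction to simple roots; reflections in the power series model -/

noncomputable section

open MvPowerSeries

namespace RootPairing

variable {ι M N : Type*} [AddCommGroup M] [AddCommGroup N] {Φ : RootDatum ι M N}

section Conjugation

variable {S : Type*} [CommRing S] [MulSemiringAction Φ.weylGroup S] {X : ι → S} (b : Φ.Base)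
  [Finite ι] [Φ.IsReduced]

include b

/-- Every root is conjugate to a simple one, and the Weyl group acts by ring automorphisms that
permute the x_α. The next two lemmas transfer properties of simple roots in the same way. -/
theorem Base.coprime_of_simple (hX : ∀ (w : Φ.weylGroup) i, w • X i = X (Φ.weylGroupToPerm w i))
    (h : ∀ k ∈ b.support, ∀ j f, j ≠ k → j ≠ Φ.reflectionPerm k k → X k ∣ X j * f → X k ∣ f)
    (i j : ι) (f : S) (h1 : j ≠ i) (h2 : j ≠ Φ.reflectionPerm i i) (hf : X i ∣ X j * f) :
    X i ∣ f := by
  obtain ⟨w, k, hk, rfl⟩ := b.exists_perm_eq i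
  obtain ⟨c, hc⟩ := hf
  obtain ⟨d, hd⟩ := h k hk (Φ.weylGroupToPerm w⁻¹ j) (w⁻¹ • f)
    (by rintro rfl; exact h1 (weylGroupToPerm_apply_inv w j).symm)
    (fun e => h2 (by rw [← weylGroupToPerm_neg, ← e, weylGroupToPerm_apply_inv]))
    ⟨w⁻¹ • c, by
      rw [← hX, ← smul_mul', hc, smul_mul', hX, weylGroupToPerm_inv_apply]⟩
  exact ⟨w • d, by rw [← hX, ← smul_mul', ← hd, smul_inv_smul]⟩

theorem Base.dvd_smul_sub_of_simple
    (hX : ∀ (w : Φ.weylGroup) i, w • X i = X (Φ.weylGroupToPerm w i))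
    (h : ∀ k ∈ b.support, ∀ f, X k ∣ weylGroup.ofIdx Φ k • f - f) (i : ι) (f : S) :
    X i ∣ weylGroup.ofIdx Φ i • f - f := by
  obtain ⟨w, k, hk, rfl⟩ := b.exists_perm_eq i
  obtain ⟨c, hc⟩ := h k hk (w⁻¹ • f)
  refine ⟨w • c, ?_⟩
  rw [← conj_ofIdx, ← hX, ← smul_mul', ← hc, smul_sub, smul_inv_smul, mul_smul, mul_smul]

theorem Base.regular_of_simple (hX : ∀ (w : Φ.weylGroup) i, w • X i = X (Φ.weylGroupToPerm w i))
    (h : ∀ k ∈ b.support, X k ∈ nonZeroDivisors S) (i : ι) : X i ∈ nonZeroDivisors S := by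
  obtain ⟨w, k, hk, rfl⟩ := b.exists_perm_eq i
  rw [mem_nonZeroDivisors_iff_right]
  intro f hf
  have := (mem_nonZeroDivisors_iff_right.1 (h k hk)) (w⁻¹ • f) (by
    have h1 := congrArg (fun f => w⁻¹ • f) hf
    simp only [smul_mul', smul_zero, hX, weylGroupToPerm_inv_apply] at h1
    exact h1)
  rwa [smul_eq_zero_iff_eq] at this

end Conjugation

section Model

variable {A : Type*} [CommRing A] (b : Φ.Base) (F : FormalGroup A) [F.IsComm]

/-- The series of a root. -/
def Base.rootSeries (i : ι) : MvPowerSeries b.support A := (b.series F (Φ.rootSpanMem ℤ i)).1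

theorem Base.rootSeries_simple (i : b.support) : b.rootSeries F i = X i :=
  congrArg Subtype.val (b.series_simple F i)

theorem Base.smul_rootSeries (w : Φ.weylGroup) (i : ι) :
    letI := b.seriesAction F
    w • b.rootSeries F i = b.rootSeries F (Φ.weylGroupToPerm w i) := by
  change (b.series F _).1.subst (b.seriesVar F w) = _
  rw [b.series_subst, smul_rootSpanMem]
  rfl

theorem Base.exists_rootSeries_add_neg (i : ι) :
    ∃ h, b.rootSeries F i + b.rootSeries F (Φ.reflectionPerm i i) =
      b.rootSeries F i * b.rootSeries F (Φ.reflectionPerm i i) * h := by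
  have e : b.series F (Φ.rootSpanMem ℤ i) + b.series F (Φ.rootSpanMem ℤ (Φ.reflectionPerm i i)) =
      0 := by rw [← map_add, rootSpanMem_neg, add_neg_cancel, map_zero]
  have e' := congrArg Subtype.val e
  rw [FormalGroup.SeriesPoint.coe_add, FormalGroup.subst_eq (b.series F _).2 (b.series F _).2,
    FormalGroup.SeriesPoint.coe_zero] at e'
  exact ⟨_, by rw [Base.rootSeries, Base.rootSeries, eq_neg_of_add_eq_zero_left e', mul_neg]⟩

/-- After setting X_j = 0 the point of α_j is the zero of the formal group. Then s_j α_k = α_k - n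
α_j has the same point as α_k, so s_j acts trivially. -/
theorem Base.X_dvd_smul_sub (j : b.support) (f : MvPowerSeries b.support A) :
    letI := b.seriesAction F
    X j ∣ weylGroup.ofIdx Φ (j : ι) • f - f := by
  classical
  change X j ∣ f.subst (b.seriesVar F (weylGroup.ofIdx Φ (j : ι))) - f
  set κ : b.support → MvPowerSeries b.support A := fun k => if k = j then 0 else X k with hκ
  have hκ1 (k) : κ k ∈ orderIdeal _ A 1 := by
    rw [hκ]
    dsimp only
    split_ifs
    · exact Ideal.zero_mem _
    · exact X_mem_orderIdeal k
  have hκs : HasSubst κ := hasSubst_of_mem_orderIdeal hκ1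
  refine X_dvd_of_subst_eq_zero j ?_
  change subst κ _ = 0
  rw [subst_sub hκs, subst_comp_subst_apply (b.hasSubst_seriesVar F _) hκs, sub_eq_zero]
  congr 1
  funext k
  set φ : Φ.rootSpan ℤ →+ F.SeriesPoint b.support :=
    (FormalGroup.SeriesPoint.subst F κ hκ1).comp (b.series F) with hφ
  have h1 (k : b.support) : (φ (Φ.rootSpanMem ℤ k)).1 = κ k := by
    change (b.series F (Φ.rootSpanMem ℤ k)).1.subst κ = κ k
    rw [b.series_simple]
    exact subst_X hκs k
  have h2 : φ (Φ.rootSpanMem ℤ j) = 0 := Subtype.ext (by rw [h1, hκ]; simp)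
  have h3 : weylGroup.ofIdx Φ (j : ι) • Φ.rootSpanMem ℤ (k : ι) =
      Φ.rootSpanMem ℤ (k : ι) - Φ.pairing k j • Φ.rootSpanMem ℤ (j : ι) := by
    refine Subtype.ext ?_
    rw [coe_smul_rootSpan, ofIdx_smul_eq]
    exact Φ.reflection_apply_root j k
  change (φ (weylGroup.ofIdx Φ (j : ι) • Φ.rootSpanMem ℤ (k : ι))).1 = κ k
  rw [h3, map_sub, map_zsmul, h2, smul_zero, sub_zero, h1]

theorem Base.not_X_dvd_rootSeries [CharZero A] [Φ.IsReduced] (i : b.support) {j : ι} (h1 : j ≠ i)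
    (h2 : j ≠ Φ.reflectionPerm i i) : ¬ X i ∣ b.rootSeries F j := b.not_X_dvd_series F i h1 h2

end Model

end RootPairing

end

noncomputable section

/-! ## Structure of formal group algebras -/

open MvPowerSeries

namespace FormalGroupAlgebra

section Completed

variable {R M σ : Type*} [CommRing R]

theorem mem_completedPolynomials_of_forall {f : MvPowerSeries M R}
    (h : ∀ n, ∃ g ∈ completedPolynomials R M, f - g ∈ orderIdeal M R n) :
    f ∈ completedPolynomials R M := by
  intro n
  obtain ⟨g, hg, hfg⟩ := h n
  refine (hg n).subset ?_
  rintro d ⟨hd, hne⟩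
  refine ⟨hd, ?_⟩
  have := hfg d hd
  rw [map_sub, sub_eq_zero] at this
  rwa [← this]

theorem le_closure (J : Ideal (completedPolynomials R M)) : J ≤ closure J :=
  fun f hf _ => ⟨f, hf, fun _ _ => rfl⟩

theorem mem_closure_of_forall {J : Ideal (completedPolynomials R M)}
    {f : completedPolynomials R M}
    (h : ∀ n, ∃ g ∈ closure J, (f : MvPowerSeries M R) - g ∈ orderIdeal M R n) :
    f ∈ closure J := by
  intro n
  obtain ⟨g, hg, hfg⟩ := h n
  obtain ⟨j, hj, hgj⟩ := hg n
  refine ⟨j, hj, fun d hd => ?_⟩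
  have := hfg d hd
  rw [map_sub, sub_eq_zero] at this
  rw [this, hgj d hd]

/-- Constants as elements of the completed polynomial ring. -/
def const : R →+* completedPolynomials R M :=
  (C (σ := M) (R := R)).codRestrict (completedPolynomials R M) fun r => by
    classical
    intro n
    refine (Set.finite_singleton (0 : M →₀ ℕ)).subset ?_
    rintro d ⟨-, hd⟩
    by_contra h
    rw [Set.mem_singleton_iff] at h
    exact hd (by rw [coeff_C, if_neg h])

@[simp] theorem coe_const (r : R) :
    ((const r : completedPolynomials R M) : MvPowerSeries M R) = C r := rfl

theorem exists_polynomial_sub_mem [Finite σ] (f : MvPowerSeries σ R) (n : ℕ) :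
    ∃ p : MvPolynomial σ R, f - p ∈ orderIdeal σ R n := by
  classical
  refine ⟨truncTotal n f, fun d hd => ?_⟩
  rw [map_sub, MvPolynomial.coeff_coe, coeff_truncTotal _ hd, sub_self]

variable [Finite σ] (a : σ → completedPolynomials R M)

theorem subst_coe_polynomial (ha : ∀ s, (a s : MvPowerSeries M R) ∈ orderIdeal M R 1)
    (p : MvPolynomial σ R) :
    (p : MvPowerSeries σ R).subst (fun s => (a s : MvPowerSeries M R)) =
      (MvPolynomial.eval₂ const a p : completedPolynomials R M) := by
  have hs := hasSubst_of_mem_orderIdeal ha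
  rw [subst_coe, MvPolynomial.aeval_def]
  have := MvPolynomial.hom_eval₂ (f := (const : R →+* completedPolynomials R M)) p
    (completedPolynomials R M).subtype a
  exact this.symm

/-- Evaluation of power series in finitely many variables at elements of the completed polynomial
ring. -/
def evalSeries (ha : ∀ s, (a s : MvPowerSeries M R) ∈ orderIdeal M R 1) :
    MvPowerSeries σ R →+* completedPolynomials R M :=
  (substAlgHom (R := R) (hasSubst_of_mem_orderIdeal ha)).toRingHom.codRestrict _ fun f => by
    refine mem_completedPolynomials_of_forall fun n => ?_
    obtain ⟨p, hp⟩ := exists_polynomial_sub_mem f n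
    refine ⟨_, (MvPolynomial.eval₂ const a p : completedPolynomials R M).2, ?_⟩
    have hs := hasSubst_of_mem_orderIdeal ha
    have := subst_mem_orderIdeal ha hp
    rw [subst_sub hs, subst_coe_polynomial a ha] at this
    change substAlgHom (R := R) hs f - _ ∈ _
    rwa [coe_substAlgHom]

theorem coe_evalSeries (ha : ∀ s, (a s : MvPowerSeries M R) ∈ orderIdeal M R 1)
    (f : MvPowerSeries σ R) : (evalSeries a ha f : MvPowerSeries M R) =
      f.subst fun s => (a s : MvPowerSeries M R) :=
  congrFun (coe_substAlgHom (hasSubst_of_mem_orderIdeal ha)) f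

theorem evalSeries_coe (ha : ∀ s, (a s : MvPowerSeries M R) ∈ orderIdeal M R 1)
    (p : MvPolynomial σ R) : evalSeries a ha p = MvPolynomial.eval₂ const a p :=
  Subtype.ext (by rw [coe_evalSeries, subst_coe_polynomial a ha])

theorem evalSeries_X (ha : ∀ s, (a s : MvPowerSeries M R) ∈ orderIdeal M R 1) (s : σ) :
    evalSeries a ha (X s) = a s :=
  Subtype.ext (by rw [coe_evalSeries, subst_X (hasSubst_of_mem_orderIdeal ha)])

theorem evalSeries_mem (ha : ∀ s, (a s : MvPowerSeries M R) ∈ orderIdeal M R 1) {n : ℕ}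
    {f : MvPowerSeries σ R} (hf : f ∈ orderIdeal σ R n) :
    (evalSeries a ha f : MvPowerSeries M R) ∈ orderIdeal M R n := by
  rw [coe_evalSeries]
  exact subst_mem_orderIdeal ha hf

/-- A continuous additive map that vanishes on polynomials modulo a closed ideal vanishes. -/
theorem mem_closure_of_polynomial {A : Type*} [CommRing A] {J : Ideal (completedPolynomials R M)}
    (φ : MvPowerSeries σ A →+ completedPolynomials R M)
    (hφ : ∀ n f, f ∈ orderIdeal σ A n → (φ f : MvPowerSeries M R) ∈ orderIdeal M R n)
    (hp : ∀ p : MvPolynomial σ A, φ p ∈ closure J) (f : MvPowerSeries σ A) : φ f ∈ closure J := by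
  refine mem_closure_of_forall fun n => ?_
  obtain ⟨p, hp'⟩ := exists_polynomial_sub_mem f n
  refine ⟨φ p, hp p, ?_⟩
  have := hφ n _ hp'
  rwa [map_sub] at this

/-- Clear for polynomials. In general it follows by continuity, as the ideal divided out is closed.
-/
theorem mk_evalSeries_congr {J : Ideal (completedPolynomials R M)}
    {a a' : σ → completedPolynomials R M} (ha : ∀ s, (a s : MvPowerSeries M R) ∈ orderIdeal M R 1)
    (ha' : ∀ s, (a' s : MvPowerSeries M R) ∈ orderIdeal M R 1)
    (h : ∀ s, Ideal.Quotient.mk (closure J) (a s) = Ideal.Quotient.mk (closure J) (a' s))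
    (f : MvPowerSeries σ R) : Ideal.Quotient.mk (closure J) (evalSeries a ha f) =
      Ideal.Quotient.mk (closure J) (evalSeries a' ha' f) := by
  rw [Ideal.Quotient.mk_eq_mk_iff_sub_mem]
  refine mem_closure_of_polynomial
    ((evalSeries a ha).toAddMonoidHom - (evalSeries a' ha').toAddMonoidHom) ?_ ?_ f
  · intro n f hf
    exact Ideal.sub_mem _ (evalSeries_mem a ha hf) (evalSeries_mem a' ha' hf)
  · intro p
    change evalSeries a ha p - evalSeries a' ha' p ∈ _
    rw [← Ideal.Quotient.mk_eq_mk_iff_sub_mem, evalSeries_coe, evalSeries_coe,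
      MvPolynomial.hom_eval₂, MvPolynomial.hom_eval₂]
    congr 1
    funext s
    exact h s

theorem coe_var (l : M) : ((var l : completedPolynomials R M) : MvPowerSeries M R) = X l := rfl

theorem var_mem (l : M) : ((var l : completedPolynomials R M) : MvPowerSeries M R) ∈
    orderIdeal M R 1 := X_mem_orderIdeal l

theorem pair_mem {f g : completedPolynomials R M} (hf : (f : MvPowerSeries M R) ∈ orderIdeal M R 1)
    (hg : (g : MvPowerSeries M R) ∈ orderIdeal M R 1) (s : Fin 2) :
    ((![f, g] : Fin 2 → completedPolynomials R M) s : MvPowerSeries M R) ∈ orderIdeal M R 1 := by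
  fin_cases s
  · exact hf
  · exact hg

theorem coe_pair (f g : completedPolynomials R M) :
    (fun s => ((![f, g] : Fin 2 → completedPolynomials R M) s : MvPowerSeries M R)) =
      ![(f : MvPowerSeries M R), (g : MvPowerSeries M R)] := by
  funext s
  fin_cases s <;> rfl

theorem formalSum_eq (F : FormalGroup R) (l m : M) :
    formalSum F l m = evalSeries ![var l, var m] (pair_mem (var_mem l) (var_mem m))
      F.toPowerSeries :=
  Subtype.ext (by rw [coe_evalSeries, coe_pair]; rfl)

theorem evalSeries_formalGroup (F : FormalGroup R) {f g : completedPolynomials R M}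
    (hf : (f : MvPowerSeries M R) ∈ orderIdeal M R 1)
    (hg : (g : MvPowerSeries M R) ∈ orderIdeal M R 1) :
    evalSeries ![f, g] (pair_mem hf hg) F.toPowerSeries =
      f + g + f * g * evalSeries ![f, g] (pair_mem hf hg) F.mixedPart := by
  conv_lhs => rw [F.toPowerSeries_eq]
  simp only [map_add, map_mul, evalSeries_X, Matrix.cons_val_zero, Matrix.cons_val_one]

end Completed

section Generators

variable {R M : Type*} [CommRing R] [AddCommGroup M] {F : FormalGroup R} (v : Version F)

variable (F M) in
/-- The quotient map onto the completed formal group algebra. -/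
def mkCompleted : completedPolynomials R M →+* FormalGroupAlgebra (.completed : Version F) M :=
  Ideal.Quotient.mk (closure (relations F M))

theorem mkCompleted_surjective : Function.Surjective (mkCompleted M F) :=
  Ideal.Quotient.mk_surjective

theorem mkCompleted_eq_iff {f g : completedPolynomials R M} :
    mkCompleted M F f = mkCompleted M F g ↔ f - g ∈ closure (relations F M) :=
  Ideal.Quotient.eq

theorem mkCompleted_var (l : M) : mkCompleted M F (var l) = x .completed l := rfl

variable (M) in
/-- The quotient map onto the polynomial formal group algebra. -/
def mkPolynomial (β : R) (hF : F.toPowerSeries = MvPowerSeries.X 0 + MvPowerSeries.X 1 -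
    MvPowerSeries.C β * MvPowerSeries.X 0 * MvPowerSeries.X 1) :
    MvPolynomial M R →+* FormalGroupAlgebra (.polynomial β hF : Version F) M :=
  Ideal.Quotient.mk (polynomialRelations β M)

variable {β : R} {hF : F.toPowerSeries = MvPowerSeries.X 0 + MvPowerSeries.X 1 -
    MvPowerSeries.C β * MvPowerSeries.X 0 * MvPowerSeries.X 1}

theorem mkPolynomial_surjective : Function.Surjective (mkPolynomial M β hF) :=
  Ideal.Quotient.mk_surjective

theorem mkPolynomial_eq_iff {f g : MvPolynomial M R} :
    mkPolynomial M β hF f = mkPolynomial M β hF g ↔ f - g ∈ polynomialRelations β M :=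
  Ideal.Quotient.eq

theorem mkPolynomial_X (l : M) :
    mkPolynomial M β hF (MvPolynomial.X l) = x (.polynomial β hF) l := rfl

theorem x_zero : x v (0 : M) = 0 := by
  cases v with
  | completed =>
    exact Ideal.Quotient.eq_zero_iff_mem.2 (le_closure _ (Ideal.subset_span (Or.inl rfl)))
  | polynomial β hF =>
    exact Ideal.Quotient.eq_zero_iff_mem.2 (Ideal.subset_span (Or.inl rfl))

theorem x_completed_add (l m : M) :
    x (.completed : Version F) (l + m) = mkCompleted M F (formalSum F l m) :=
  mkCompleted_eq_iff.2 (le_closure _ (Ideal.subset_span (Or.inr ⟨l, m, rfl⟩)))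

theorem x_polynomial_add (l m : M) :
    x (.polynomial β hF) (l + m) = x (.polynomial β hF) l + x (.polynomial β hF) m -
      mkPolynomial M β hF (MvPolynomial.C β) * x (.polynomial β hF) l * x (.polynomial β hF) m := by
  have : mkPolynomial M β hF (MvPolynomial.X (l + m)) = mkPolynomial M β hF (MvPolynomial.X l +
      MvPolynomial.X m - MvPolynomial.C β * MvPolynomial.X l * MvPolynomial.X m) :=
    mkPolynomial_eq_iff.2 (Ideal.subset_span (Or.inr ⟨l, m, rfl⟩))
  simpa only [map_add, map_sub, map_mul, mkPolynomial_X] using this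

theorem exists_x_add (l m : M) :
    ∃ h, x v (l + m) = x v l + x v m + x v l * x v m * h := by
  cases v with
  | completed =>
    refine ⟨mkCompleted M F
      (evalSeries ![var l, var m] (pair_mem (var_mem l) (var_mem m)) F.mixedPart), ?_⟩
    rw [x_completed_add, formalSum_eq, evalSeries_formalGroup F (var_mem l) (var_mem m)]
    simp only [map_add, map_mul, mkCompleted_var]
  | polynomial β hF =>
    refine ⟨-mkPolynomial M β hF (MvPolynomial.C β), ?_⟩
    rw [x_polynomial_add]
    ring

theorem exists_x_add_neg (l : M) : ∃ h, x v l + x v (-l) = x v l * x v (-l) * h := by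
  obtain ⟨h, e⟩ := exists_x_add v l (-l)
  rw [add_neg_cancel, x_zero] at e
  exact ⟨-h, by linear_combination -e⟩

theorem x_dvd_x_neg (l : M) : x v l ∣ x v (-l) := by
  obtain ⟨h, e⟩ := exists_x_add_neg v l
  exact ⟨x v (-l) * h - 1, by linear_combination e⟩

theorem x_dvd_x_zsmul (n : ℤ) (l : M) : x v l ∣ x v (n • l) := by
  have hnat (n : ℕ) : x v l ∣ x v (n • l) := by
    induction n with
    | zero => rw [zero_smul, x_zero]; exact dvd_zero _
    | succ n ih =>
      obtain ⟨h, e⟩ := exists_x_add v (n • l) l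
      rw [succ_nsmul, e]
      exact dvd_add (dvd_add ih dvd_rfl) (Dvd.dvd.mul_right (Dvd.dvd.mul_right ih _) _)
  rcases n.eq_nat_or_neg with ⟨n, rfl | rfl⟩
  · rw [natCast_zsmul]; exact hnat n
  · rw [neg_smul, natCast_zsmul]; exact (hnat n).trans (x_dvd_x_neg v _)

theorem x_dvd_x_add_zsmul_sub (n : ℤ) (l m : M) : x v l ∣ x v (m + n • l) - x v m := by
  obtain ⟨h, e⟩ := exists_x_add v m (n • l)
  rw [e, add_assoc, add_sub_cancel_left]
  exact dvd_add (x_dvd_x_zsmul v n l)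
    (Dvd.dvd.mul_right (Dvd.dvd.mul_left (x_dvd_x_zsmul v n l) _) _)

end Generators

section Reflections

variable {G R M : Type*} [Group G] [CommRing R] [AddCommGroup M] [DistribMulAction G M]
  {F : FormalGroup R}

theorem smul_mem_orderIdeal (g : G) {f : completedPolynomials R M} {n : ℕ}
    (hf : (f : MvPowerSeries M R) ∈ orderIdeal M R n) :
    ((g • f : completedPolynomials R M) : MvPowerSeries M R) ∈ orderIdeal M R n := by
  intro d hd
  rw [coeff_smul_series]
  exact hf _ (by rwa [Finsupp.degree_mapDomain])

theorem mkCompleted_smul (g : G) (f : completedPolynomials R M) :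
    letI := action G M (.completed : Version F)
    mkCompleted M F (g • f) = g • mkCompleted M F f := rfl

theorem mkPolynomial_smul {β : R} {hF : F.toPowerSeries = MvPowerSeries.X 0 + MvPowerSeries.X 1 -
    MvPowerSeries.C β * MvPowerSeries.X 0 * MvPowerSeries.X 1} (g : G) (f : MvPolynomial M R) :
    letI := action G M (.polynomial β hF : Version F)
    g • mkPolynomial M β hF f = mkPolynomial M β hF (MvPolynomial.rename (fun l => g • l) f) :=
  rfl

theorem smul_const (g : G) (r : R) : g • (const r : completedPolynomials R M) = const r := by
  classical
  refine Subtype.ext (MvPowerSeries.ext fun d => ?_)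
  rw [coeff_smul_series, coe_const, coeff_C, coeff_C]
  congr 1
  rw [eq_iff_iff]
  constructor
  · intro h
    rw [← Finsupp.degree_eq_zero_iff, Finsupp.degree_mapDomain, Finsupp.degree_eq_zero_iff] at h
    exact h
  · rintro rfl
    exact Finsupp.mapDomain_zero

/-- Polynomials as elements of the completed polynomial ring. -/
def ofPolynomial : MvPolynomial M R →+* completedPolynomials R M :=
  MvPolynomial.eval₂Hom const var

omit [AddCommGroup M] in
theorem coe_ofPolynomial (p : MvPolynomial M R) :
    ((ofPolynomial p : completedPolynomials R M) : MvPowerSeries M R) = p := by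
  induction p using MvPolynomial.induction_on with
  | C r => simp [ofPolynomial]
  | add p q hp hq => rw [map_add, Subring.coe_add, hp, hq, MvPolynomial.coe_add]
  | mul_X p i hp =>
    rw [map_mul, Subring.coe_mul, hp, MvPolynomial.coe_mul, MvPolynomial.coe_X]
    simp [ofPolynomial, coe_var]

omit [AddCommGroup M] in
theorem exists_ofPolynomial_sub_mem (f : completedPolynomials R M) (n : ℕ) :
    ∃ p : MvPolynomial M R,
      ((f - ofPolynomial p : completedPolynomials R M) : MvPowerSeries M R) ∈
        orderIdeal M R n := by
  classical
  refine ⟨∑ d ∈ (f.2 n).toFinset, MvPolynomial.monomial d (coeff d (f : MvPowerSeries M R)),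
    fun d hd => ?_⟩
  rw [AddSubgroupClass.coe_sub, coe_ofPolynomial, map_sub, MvPolynomial.coeff_coe, MvPolynomial.coeff_sum]
  simp only [MvPolynomial.coeff_monomial, Finset.sum_ite_eq', Set.Finite.mem_toFinset,
    Set.mem_ofPred_eq, hd, true_and]
  split_ifs with h
  · exact sub_self _
  · rw [not_not.1 h, sub_zero]

variable (F) in
/-- Up to relations, `g • f - f` is a multiple of `x_l` with cofactor of order at least `n - 1`. -/
def SmulSubDvd (g : G) (l : M) (n : ℕ) (f : completedPolynomials R M) : Prop :=
  ∃ h r : completedPolynomials R M, (h : MvPowerSeries M R) ∈ orderIdeal M R (n - 1) ∧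
    r ∈ closure (relations F M) ∧ g • f - f = var l * h + r

theorem SmulSubDvd.add {g : G} {l : M} {n : ℕ} {f f' : completedPolynomials R M}
    (hf : SmulSubDvd F g l n f) (hf' : SmulSubDvd F g l n f') : SmulSubDvd F g l n (f + f') := by
  obtain ⟨h, r, hh, hr, e⟩ := hf
  obtain ⟨h', r', hh', hr', e'⟩ := hf'
  exact ⟨h + h', r + r', add_mem hh hh', add_mem hr hr', by
    rw [smul_add]; linear_combination e + e'⟩

theorem SmulSubDvd.anti {g : G} {l : M} {n m : ℕ} (hmn : m ≤ n) {f : completedPolynomials R M}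
    (hf : SmulSubDvd F g l n f) : SmulSubDvd F g l m f := by
  obtain ⟨h, r, hh, hr, e⟩ := hf
  exact ⟨h, r, orderIdeal_anti (Nat.sub_le_sub_right hmn 1) hh, hr, e⟩

theorem SmulSubDvd.const_mul {g : G} {l : M} {n : ℕ} {f : completedPolynomials R M}
    (hf : SmulSubDvd F g l n f) (c : R) : SmulSubDvd F g l n (const c * f) := by
  obtain ⟨h, r, hh, hr, e⟩ := hf
  refine ⟨const c * h, const c * r, ?_, Ideal.mul_mem_left _ _ hr, ?_⟩
  · exact Ideal.mul_mem_left _ _ hh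
  · rw [smul_mul', smul_const]
    linear_combination const c * e

theorem smulSubDvd_const (g : G) (l : M) (n : ℕ) (c : R) :
    SmulSubDvd F g l n (const c : completedPolynomials R M) :=
  ⟨0, 0, zero_mem _, zero_mem _, by rw [smul_const]; ring⟩

/-- The product rule g(ab) - ab = g(a)(g(b) - b) + (g(a) - a)b. The order of the cofactor is
recorded so that cofactors of infinite sums converge. -/
theorem smulSubDvd_prod {g : G} {l : M} (hg : ∀ m, ∃ n : ℤ, g • m = m + n • l)
    (s : Multiset M) :
    SmulSubDvd F g l s.card ((s.map var).prod : completedPolynomials R M) ∧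
      (((s.map var).prod : completedPolynomials R M) : MvPowerSeries M R) ∈
        orderIdeal M R s.card := by
  induction s using Multiset.induction with
  | empty =>
    refine ⟨?_, ?_⟩
    · simpa using smulSubDvd_const (F := F) (M := M) g l 0 (1 : R)
    · intro d hd
      simp at hd
  | cons a s ih =>
    obtain ⟨⟨h, r, hh, hr, e⟩, hs⟩ := ih
    rw [Multiset.map_cons, Multiset.prod_cons, Multiset.card_cons]
    refine ⟨?_, ?_⟩
    · obtain ⟨n, hn⟩ := hg a
      obtain ⟨k, hk⟩ := x_dvd_x_add_zsmul_sub (.completed : Version F) n l a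
      obtain ⟨k', rfl⟩ := Ideal.Quotient.mk_surjective k
      have hr' : var (a + n • l) - var a - var l * k' ∈ closure (relations F M) := by
        rw [← Ideal.Quotient.eq]
        exact hk
      -- Nothing is known about the order of the cofactor `k'` of a single variable. This is why the
      -- cofactor of a product of n variables is only bounded by n - 1.
      refine ⟨var (g • a) * h + k' * (s.map var).prod, var (g • a) * r +
        (var (a + n • l) - var a - var l * k') * (s.map var).prod, ?_, ?_, ?_⟩
      · refine add_mem ?_ ?_
        · exact orderIdeal_anti (by omega) (mul_mem_orderIdeal (var_mem _) hh)
        · exact Ideal.mul_mem_left _ _ hs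
      · exact add_mem (Ideal.mul_mem_left _ _ hr) (Ideal.mul_mem_right _ _ hr')
      · rw [smul_mul', smul_var, ← hn]
        linear_combination var (g • a) * e
    · exact orderIdeal_anti (by omega) (mul_mem_orderIdeal (var_mem a) hs)

theorem smulSubDvd_ofPolynomial {g : G} {l : M} (hg : ∀ m, ∃ n : ℤ, g • m = m + n • l) {n : ℕ}
    (p : MvPolynomial M R)
    (hp : ((ofPolynomial p : completedPolynomials R M) : MvPowerSeries M R) ∈ orderIdeal M R n) :
    SmulSubDvd F g l n (ofPolynomial p) := by
  rw [p.as_sum, map_sum]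
  have key : ∀ d ∈ p.support, SmulSubDvd F g l n
      (ofPolynomial (MvPolynomial.monomial d (p.coeff d)) : completedPolynomials R M) := by
    intro d hd
    have hdn : n ≤ d.degree := by
      by_contra h
      rw [MvPolynomial.mem_support_iff] at hd
      refine hd ?_
      have := hp d (not_le.1 h)
      rwa [coe_ofPolynomial, MvPolynomial.coeff_coe] at this
    have e : (ofPolynomial (MvPolynomial.monomial d (p.coeff d)) : completedPolynomials R M) =
        const (p.coeff d) * ((Finsupp.toMultiset d).map var).prod := by
      rw [ofPolynomial, MvPolynomial.coe_eval₂Hom, MvPolynomial.eval₂_monomial,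
        Finsupp.toMultiset_map, Finsupp.prod_toMultiset, Finsupp.prod_mapDomain_index]
      · simp
      · simp [pow_add]
    rw [e]
    refine ((smulSubDvd_prod hg _).1.anti ?_).const_mul _
    rw [Finsupp.card_toMultiset]
    exact hdn.trans (by rw [Finsupp.degree_apply, Finsupp.sum]; rfl)
  exact Finset.sum_induction _ _ (fun _ _ => SmulSubDvd.add)
    ⟨0, 0, zero_mem _, zero_mem _, by simp⟩ key

/-- The polynomial version is an induction with the product rule. In the completed version, f is the
limit of polynomial truncations; the difference of consecutive truncations has order n, so its
cofactor has order n - 1, the cofactors sum to a limit, and the error terms stay in the closed ideal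
of relations. -/
theorem x_dvd_smul_sub {g : G} {l : M} (hg : ∀ m, ∃ n : ℤ, g • m = m + n • l) (v : Version F)
    (f : FormalGroupAlgebra v M) :
    let _ := action G M v
    x v l ∣ g • f - f := by
  cases v with
  | completed =>
    let _ := action G M (.completed : Version F)
    obtain ⟨f, rfl⟩ := mkCompleted_surjective f
    choose p hp using exists_ofPolynomial_sub_mem f
    have hq (n : ℕ) : ((ofPolynomial (p (n + 1) - p n) : completedPolynomials R M) :
        MvPowerSeries M R) ∈ orderIdeal M R n := by
      have e : (ofPolynomial (p (n + 1) - p n) : completedPolynomials R M) =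
        (f - ofPolynomial (p n)) - (f - ofPolynomial (p (n + 1))) := by rw [map_sub]; ring
      rw [e]
      exact sub_mem (hp n) (orderIdeal_anti (Nat.le_succ n) (hp (n + 1)))
    choose h r hh hr e using fun n => smulSubDvd_ofPolynomial (F := F) hg _ (hq n)
    obtain ⟨h₀, r₀, -, hr₀, e₀⟩ := smulSubDvd_ofPolynomial (F := F) (n := 0) hg (p 0)
      (fun d hd => absurd hd (Nat.not_lt_zero _))
    have sum (n : ℕ) : g • ofPolynomial (p n) - (ofPolynomial (p n) : completedPolynomials R M) =
        var l * (h₀ + ∑ k ∈ Finset.range n, h k) + (r₀ + ∑ k ∈ Finset.range n, r k) := by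
      induction n with
      | zero => simpa using e₀
      | succ n ih =>
        have := e n
        rw [map_sub, smul_sub] at this
        rw [Finset.sum_range_succ, Finset.sum_range_succ]
        linear_combination ih + this
    -- The partial sums run one step further than their index, to make up for the degree lost in the
    -- cofactors.
    obtain ⟨H, hH⟩ := exists_limit
      (g := fun n => ((h₀ + ∑ k ∈ Finset.range (n + 1), h k : completedPolynomials R M) :
        MvPowerSeries M R)) (fun n => by
        rw [← AddSubgroupClass.coe_sub, Finset.sum_range_succ _ (n + 1), ← add_assoc,
          add_sub_cancel_left]
        exact hh (n + 1))
    have hHm : H ∈ completedPolynomials R M := mem_completedPolynomials_of_forall fun n =>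
      ⟨_, SetLike.coe_mem _, hH n⟩
    refine ⟨mkCompleted M F ⟨H, hHm⟩, ?_⟩
    rw [← mkCompleted_var, ← map_mul, ← mkCompleted_smul, ← map_sub, mkCompleted_eq_iff]
    refine mem_closure_of_forall fun n => ?_
    refine ⟨r₀ + ∑ k ∈ Finset.range (n + 1), r k, add_mem hr₀ (sum_mem fun k _ => hr k), ?_⟩
    have e' : g • f - f - var l * ⟨H, hHm⟩ - (r₀ + ∑ k ∈ Finset.range (n + 1), r k) =
        g • (f - ofPolynomial (p (n + 1))) - (f - ofPolynomial (p (n + 1))) -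
          var l * (⟨H, hHm⟩ - (h₀ + ∑ k ∈ Finset.range (n + 1), h k)) := by
      rw [smul_sub]
      linear_combination sum (n + 1)
    rw [← AddSubgroupClass.coe_sub, e']
    refine sub_mem (sub_mem ?_ ?_) ?_
    · exact smul_mem_orderIdeal g (orderIdeal_anti (Nat.le_succ n) (hp (n + 1)))
    · exact orderIdeal_anti (Nat.le_succ n) (hp (n + 1))
    · exact Ideal.mul_mem_left _ _ (hH n)
  | polynomial β hF =>
    let _ := action G M (.polynomial β hF : Version F)
    obtain ⟨f, rfl⟩ := mkPolynomial_surjective f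
    change x _ l ∣ g • mkPolynomial M β hF f - mkPolynomial M β hF f
    induction f using MvPolynomial.induction_on with
    | C r =>
      rw [mkPolynomial_smul, MvPolynomial.rename_C, sub_self]
      exact dvd_zero _
    | add p q hp hq =>
      rw [map_add, smul_add, add_sub_add_comm]
      exact dvd_add hp hq
    | mul_X p a hp =>
      obtain ⟨n, hn⟩ := hg a
      rw [map_mul, smul_mul', mkPolynomial_X, smul_x, hn]
      obtain ⟨k, hk⟩ := hp
      obtain ⟨k', hk'⟩ := x_dvd_x_add_zsmul_sub (.polynomial β hF : Version F) n l a
      refine ⟨k * x _ (a + n • l) + mkPolynomial M β hF p * k', ?_⟩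
      linear_combination x _ (a + n • l) * hk + mkPolynomial M β hF p * hk'

end Reflections

end FormalGroupAlgebra

end

/-! ### Comparison of the power series model with the completed algebra -/

noncomputable section

open MvPowerSeries

namespace RootPairing

open FormalGroupAlgebra

section

variable {ι R M N : Type*} [CommRing R] [AddCommGroup M] [AddCommGroup N] {F : FormalGroup R}
  {Φ : RootDatum ι M N}

theorem ofIdx_smul_eq_add_zsmul (i : ι) (m : M) :
    ∃ n : ℤ, weylGroup.ofIdx Φ i • m = m + n • Φ.root i :=
  ⟨-Φ.toLinearMap m (Φ.coroot i), by
    rw [ofIdx_smul_eq, Φ.reflection_apply, neg_smul, sub_eq_add_neg]; rfl⟩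

theorem isRootRing_formalGroupAlgebra (v : Version F)
    (hreg : ∀ i, x v (Φ.root i) ∈ nonZeroDivisors (FormalGroupAlgebra v M)) :
    IsRootRing Φ (Φ.RootLocalization v) (fun i => x v (Φ.root i)) where
  smul_X w i := (smul_x v w (Φ.root i)).trans (by rw [weylGroup_apply_root])
  exists_add_neg i := by
    rw [root_neg]
    exact exists_x_add_neg v _
  dvd_smul_sub i s := x_dvd_smul_sub (ofIdx_smul_eq_add_zsmul i) v s
  regular := hreg
  smul_algebraMap := localizationAction_algebraMap _ (Φ.smul_mem_rootElements v)
  isLocalization := inferInstanceAs (IsLocalization (Φ.rootElements v) _)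

end

end RootPairing

namespace FormalGroup

variable {R R' σ : Type*} [CommRing R] [CommRing R']

/-- Change of coefficients for points. -/
def SeriesPoint.map (F : FormalGroup R) [F.IsComm] (π : R →+* R') {F' : FormalGroup R'} [F'.IsComm]
    (h : F.map π = F') : F.SeriesPoint σ →+ F'.SeriesPoint σ :=
  AddMonoidHom.mk' (fun f => ⟨MvPowerSeries.map π f.1, map_mem_orderIdeal π f.2⟩) fun f g =>
    Subtype.ext (by
      subst h
      exact map_subst_pair π f.2 g.2 F.toPowerSeries)

end FormalGroup

namespace FormalGroupAlgebra

variable {R M : Type*} [CommRing R] [AddCommGroup M] {F : FormalGroup R}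

/-- Congruence of points modulo the closure of the relations. -/
def PointRel (p q : F.SeriesPoint M) : Prop :=
  ∃ (hp : p.1 ∈ completedPolynomials R M) (hq : q.1 ∈ completedPolynomials R M),
    mkCompleted M F ⟨p.1, hp⟩ = mkCompleted M F ⟨q.1, hq⟩

theorem PointRel.symm {p q : F.SeriesPoint M} (h : PointRel p q) : PointRel q p := by
  obtain ⟨hp, hq, h⟩ := h
  exact ⟨hq, hp, h.symm⟩

theorem PointRel.trans {p q r : F.SeriesPoint M} (h : PointRel p q) (h' : PointRel q r) :
    PointRel p r := by
  obtain ⟨hp, hq, h⟩ := h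
  obtain ⟨hq', hr, h'⟩ := h'
  exact ⟨hp, hr, h.trans h'⟩

omit [AddCommGroup M] in
theorem SeriesPoint.coe_add_eq {p q : F.SeriesPoint M} (hp : p.1 ∈ completedPolynomials R M)
    (hq : q.1 ∈ completedPolynomials R M) : (p + q).1 =
    evalSeries ![(⟨p.1, hp⟩ : completedPolynomials R M), ⟨q.1, hq⟩] (pair_mem p.2 q.2)
      F.toPowerSeries := by
  rw [coe_evalSeries, coe_pair]
  rfl

theorem PointRel.add {p q p' q' : F.SeriesPoint M} (h : PointRel p q) (h' : PointRel p' q') :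
    PointRel (p + p') (q + q') := by
  obtain ⟨hp, hq, h⟩ := h
  obtain ⟨hp', hq', h'⟩ := h'
  have e1 := SeriesPoint.coe_add_eq hp hp'
  have e2 := SeriesPoint.coe_add_eq hq hq'
  refine ⟨by rw [e1]; exact SetLike.coe_mem _, by rw [e2]; exact SetLike.coe_mem _, ?_⟩
  simp only [e1, e2]
  refine mk_evalSeries_congr (J := relations F M) (pair_mem p.2 p'.2) (pair_mem q.2 q'.2) (fun s => ?_) _
  fin_cases s
  · exact h
  · exact h'

theorem PointRel.refl {p : F.SeriesPoint M} (hp : p.1 ∈ completedPolynomials R M) : PointRel p p :=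
  ⟨hp, hp, rfl⟩

theorem pointRel_zero : PointRel (0 : F.SeriesPoint M) (FormalGroup.SeriesPoint.var F 0) :=
  ⟨zero_mem _, X_mem_completedPolynomials _,
    (map_zero (mkCompleted M F)).trans (x_zero (.completed : Version F)).symm⟩

theorem pointRel_var_add (l m : M) : PointRel (FormalGroup.SeriesPoint.var F (l + m))
    (FormalGroup.SeriesPoint.var F l + FormalGroup.SeriesPoint.var F m) :=
  ⟨X_mem_completedPolynomials _, subst_mem_completedPolynomials _ l m, x_completed_add l m⟩

/-- Modulo relations q = q + x_0 = (q + x_l) + x_{-l} = x_{-l} for the formal sum, because x_l is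
congruent to p. -/
theorem pointRel_var_neg [F.IsComm] {l : M} {p q : F.SeriesPoint M} (hp : q.1 ∈ completedPolynomials R M)
    (h : PointRel p (FormalGroup.SeriesPoint.var F l)) (hpq : q + p = 0) :
    PointRel q (FormalGroup.SeriesPoint.var F (-l)) := by
  have h1 : PointRel q (q + FormalGroup.SeriesPoint.var F 0) := by
    have := (PointRel.refl hp).add (pointRel_zero (F := F) (M := M))
    rwa [add_zero] at this
  have h2 := pointRel_var_add (F := F) l (-l)
  rw [add_neg_cancel] at h2
  have h3 := (PointRel.refl hp).add (h2.trans
    (h.symm.add (PointRel.refl (X_mem_completedPolynomials (-l)))))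
  rw [← add_assoc, hpq, zero_add] at h3
  exact h1.trans h3

end FormalGroupAlgebra

namespace RootPairing

open FormalGroupAlgebra

variable {ι R A M N : Type*} [CommRing R] [CommRing A] [AddCommGroup M] [AddCommGroup N]
  {F : FormalGroup R} [F.IsComm] {Φ : RootDatum ι M N} (b : Φ.Base) (F' : FormalGroup A)
  [F'.IsComm] (π : A →+* R)

theorem var_root_mem (i : b.support) :
    ((var (Φ.root i) : completedPolynomials R M) : MvPowerSeries M R) ∈ orderIdeal M R 1 :=
  var_mem _

/-- The comparison map from power series in the simple roots. -/
def Base.toCompletedAux : MvPowerSeries b.support A →+* completedPolynomials R M :=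
  (evalSeries (fun i : b.support => (var (Φ.root i) : completedPolynomials R M))
    (var_root_mem b)).comp (MvPowerSeries.map π)

theorem Base.toCompletedAux_mem {n : ℕ} {f : MvPowerSeries b.support A}
    (hf : f ∈ orderIdeal _ A n) : (b.toCompletedAux π f : MvPowerSeries M R) ∈ orderIdeal M R n :=
  evalSeries_mem _ (var_root_mem b) (map_mem_orderIdeal π hf)

variable (F) in
/-- The comparison map from power series in the simple roots to the formal group algebra. -/
def Base.toCompleted :
    MvPowerSeries b.support A →+* FormalGroupAlgebra (.completed : Version F) M :=
  (mkCompleted M F).comp (b.toCompletedAux π)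

theorem Base.toCompletedAux_C (a : A) :
    b.toCompletedAux π (C a) = (const (π a) : completedPolynomials R M) := by
  have := evalSeries_coe _ (var_root_mem (R := R) b) (MvPolynomial.C (π a))
  rw [MvPolynomial.coe_C, MvPolynomial.eval₂_C] at this
  rw [Base.toCompletedAux, RingHom.comp_apply, map_C, this]

theorem Base.toCompletedAux_X (i : b.support) :
    b.toCompletedAux π (X i) = (var (Φ.root i) : completedPolynomials R M) := by
  rw [Base.toCompletedAux, RingHom.comp_apply, map_X, evalSeries_X]

variable {π F'}

/-- The series of `m` is additive in `m` for the formal group law, and so is x_m modulo the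
relations; they agree on the simple roots, which span the root lattice. -/
theorem Base.toCompleted_series (hF : F'.map π = F) (m : Φ.rootSpan ℤ) :
    b.toCompleted F π (b.series F' m).1 = x (.completed : Version F) (m : M) := by
  let E : Φ.rootSpan ℤ →+ F.SeriesPoint M :=
    (FormalGroup.SeriesPoint.subst F (fun i : b.support => X (Φ.root i))
      (fun i => X_mem_orderIdeal _)).comp
      ((FormalGroup.SeriesPoint.map F' π hF).comp (b.series F'))
  have hE (m) : (E m).1 = b.toCompletedAux π (b.series F' m).1 :=
    (coe_evalSeries _ (var_root_mem b) _).symm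
  have hEm (m) : (E m).1 ∈ completedPolynomials R M := by rw [hE]; exact SetLike.coe_mem _
  have key : PointRel (E m) (FormalGroup.SeriesPoint.var F (m : M)) := by
    have hm : m ∈ Submodule.span ℤ (Set.range b.toWeightBasisInt) := by
      rw [b.toWeightBasisInt.span_eq]; trivial
    induction hm using Submodule.span_induction with
    | mem m hm =>
      obtain ⟨i, rfl⟩ := hm
      have h : b.toWeightBasisInt i = Φ.rootSpanMem ℤ i := Subtype.ext (by simp)
      refine ⟨hEm _, X_mem_completedPolynomials _, ?_⟩
      congr 1
      refine Subtype.ext ?_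
      simp only [hE, h, b.series_simple]
      exact congrArg Subtype.val (b.toCompletedAux_X π i)
    | zero => rw [map_zero]; exact pointRel_zero
    | add l m _ _ hl hm => rw [map_add]; exact (hl.add hm).trans (pointRel_var_add _ _).symm
    | smul n m _ hm =>
      have hnat (n : ℕ) : PointRel (E (n • m)) (FormalGroup.SeriesPoint.var F (n • (m : M))) := by
        induction n with
        | zero => rw [zero_smul, zero_smul, map_zero]; exact pointRel_zero
        | succ n ih =>
          rw [succ_nsmul, succ_nsmul, map_add]
          exact (ih.add hm).trans (pointRel_var_add _ _).symm
      rcases n.eq_nat_or_neg with ⟨n, rfl | rfl⟩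
      · rw [Submodule.coe_smul, natCast_zsmul, natCast_zsmul]; exact hnat n
      · rw [Submodule.coe_smul, neg_smul, neg_smul, natCast_zsmul, natCast_zsmul]
        exact pointRel_var_neg (hEm _) (hnat n) (by rw [← map_add, neg_add_cancel, map_zero])
  obtain ⟨_, _, h⟩ := key
  simp only [hE] at h
  exact h

/-- The difference of the two sides is additive and continuous, so it may be tested on polynomials.
There both sides are ring homomorphisms that agree on constants and variables. -/
theorem Base.toCompleted_smul (hF : F'.map π = F) (w : Φ.weylGroup)
    (f : MvPowerSeries b.support A) :
    letI := b.seriesAction F'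
    b.toCompleted F π (w • f) = w • b.toCompleted F π f := by
  let _ := b.seriesAction F'
  let φ : MvPowerSeries b.support A →+ completedPolynomials R M :=
    (b.toCompletedAux π).toAddMonoidHom.comp (DistribSMul.toAddMonoidHom _ w) -
      (DistribSMul.toAddMonoidHom _ w).comp (b.toCompletedAux π).toAddMonoidHom
  have h := mem_closure_of_polynomial (J := relations F M) φ ?_ ?_ f
  · exact mkCompleted_eq_iff.2 h
  · intro n f hf
    exact Ideal.sub_mem _ (b.toCompletedAux_mem π (subst_mem_orderIdeal (b.seriesVar_mem F' w) hf))
      (smul_mem_orderIdeal w (b.toCompletedAux_mem π hf))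
  · intro p
    refine mkCompleted_eq_iff.1 ?_
    let ψ : MvPolynomial b.support A →+* FormalGroupAlgebra (.completed : Version F) M :=
      ((b.toCompleted F π).comp (MulSemiringAction.toRingHom Φ.weylGroup _ w)).comp
        MvPolynomial.coeToMvPowerSeries.ringHom
    let ψ' : MvPolynomial b.support A →+* FormalGroupAlgebra (.completed : Version F) M :=
      ((MulSemiringAction.toRingHom Φ.weylGroup _ w).comp (b.toCompleted F π)).comp
        MvPolynomial.coeToMvPowerSeries.ringHom
    have : ψ = ψ' := by
      refine MvPolynomial.ringHom_ext (fun a => ?_) (fun i => ?_)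
      · change b.toCompleted F π (((MvPolynomial.C a : MvPolynomial b.support A) :
          MvPowerSeries b.support A).subst (b.seriesVar F' w)) =
          w • b.toCompleted F π (MvPolynomial.C a : MvPolynomial b.support A)
        have h1 := subst_coe (MvPolynomial.C a) (a := b.seriesVar F' w) (R := A)
        rw [h1, MvPolynomial.aeval_C, MvPolynomial.coe_C]
        change b.toCompleted F π (C a) = w • mkCompleted M F (b.toCompletedAux π (C a))
        rw [← mkCompleted_smul, b.toCompletedAux_C, smul_const, ← b.toCompletedAux_C]
        rfl
      · change b.toCompleted F π (((MvPolynomial.X i : MvPolynomial b.support A) :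
          MvPowerSeries b.support A).subst (b.seriesVar F' w)) =
          w • b.toCompleted F π (MvPolynomial.X i : MvPolynomial b.support A)
        rw [MvPolynomial.coe_X, subst_X (b.hasSubst_seriesVar F' w)]
        have h1 := b.toCompleted_series hF (w • Φ.rootSpanMem ℤ i)
        have h2 := b.toCompleted_series hF (Φ.rootSpanMem ℤ i)
        rw [b.series_simple] at h2
        refine h1.trans ((smul_x (.completed : Version F) w _).symm.trans ?_)
        exact congrArg (fun s => w • s) h2.symm
    exact congrArg (fun g => g p) this

end RootPairing

end

/-! ### The polynomial formal group algebra of the root lattice -/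

noncomputable section

open MvPowerSeries

namespace FormalGroup

variable {A σ : Type*} [CommRing A] (β : A)

theorem subst_multiplicative {f g : MvPowerSeries σ A} (hf : f ∈ orderIdeal σ A 1)
    (hg : g ∈ orderIdeal σ A 1) :
    (X 0 + X 1 - C β * X 0 * X 1 : MvPowerSeries (Fin 2) A).subst ![f, g] =
      f + g - C β * f * g := by
  have h := hasSubst_of_mem_orderIdeal (pair_mem_orderIdeal hf hg)
  have hC : substAlgHom (R := A) h (C β) = C β := (substAlgHom (R := A) h).commutes β
  rw [← coe_substAlgHom h, map_sub, map_add, map_mul, map_mul, hC, coe_substAlgHom h, subst_X h,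
    subst_X h]
  simp

/-- The formal group law `x + y - β x y`. -/
def multiplicative : FormalGroup A :=
  MvPowerSeries.formalGroupOfAssociator (X 0 + X 1 - C β * X 0 * X 1)
    (by
      rw [sub_sub_cancel_left, mul_assoc]
      exact neg_mem (Ideal.mul_mem_left _ _
        (mul_mem_orderIdeal (X_mem_orderIdeal _) (X_mem_orderIdeal _))))
    (by
      have hX (i : Fin 3) : (X i : MvPowerSeries (Fin 3) A) ∈ orderIdeal (Fin 3) A 1 :=
        X_mem_orderIdeal i
      have h (i j : Fin 3) : (X i + X j - C β * X i * X j : MvPowerSeries (Fin 3) A) ∈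
          orderIdeal (Fin 3) A 1 :=
        sub_mem (add_mem (hX i) (hX j)) (Ideal.mul_mem_left _ _ (hX j))
      rw [MvPowerSeries.associator, subst_multiplicative β (hX 0) (hX 1), subst_multiplicative β (hX 1) (hX 2),
        subst_multiplicative β (h 0 1) (hX 2), subst_multiplicative β (hX 0) (h 1 2)]
      ring)

theorem multiplicative_toPowerSeries :
    (multiplicative β).toPowerSeries = X 0 + X 1 - C β * X 0 * X 1 := rfl

instance : (multiplicative β).IsComm := ⟨by
  change (X 0 + X 1 - C β * X 0 * X 1 : MvPowerSeries (Fin 2) A) = 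
    (X 0 + X 1 - C β * X 0 * X 1 : MvPowerSeries (Fin 2) A).subst _
  rw [subst_multiplicative β (X_mem_orderIdeal _) (X_mem_orderIdeal _)]
  ring⟩

theorem SeriesPoint.coe_add_multiplicative (f g : (multiplicative β).SeriesPoint σ) :
    (f + g).1 = f.1 + g.1 - C β * f.1 * g.1 := subst_multiplicative β f.2 g.2

end FormalGroup

namespace FormalGroupAlgebra

open FormalGroup

variable {A B M : Type*} [CommRing A] [CommRing B] [AddCommGroup M] {F : FormalGroup A} {β : A}
  {hF : F.toPowerSeries = MvPowerSeries.X 0 + MvPowerSeries.X 1 -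
    MvPowerSeries.C β * MvPowerSeries.X 0 * MvPowerSeries.X 1}

variable (hF) in
/-- Ring homomorphisms out of the polynomial formal group algebra. -/
def liftPolynomial (f : A →+* B) (g : M → B) (h0 : g 0 = 0)
    (hadd : ∀ l m, g (l + m) = g l + g m - f β * g l * g m) :
    FormalGroupAlgebra (.polynomial β hF : Version F) M →+* B :=
  Ideal.Quotient.lift (polynomialRelations β M) (MvPolynomial.eval₂Hom f g) fun p hp => by
    have : polynomialRelations β M ≤ RingHom.ker (MvPolynomial.eval₂Hom f g) := by
      refine Ideal.span_le.2 ?_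
      rintro _ (h | ⟨l, m, rfl⟩)
      · rw [Set.mem_singleton_iff] at h
        subst h
        simp [h0]
      · simp [hadd]
    exact this hp

section

variable {f : A →+* B} {g : M → B} {h0 : g 0 = 0}
    {hadd : ∀ l m, g (l + m) = g l + g m - f β * g l * g m}

theorem liftPolynomial_mk (p : MvPolynomial M A) :
    liftPolynomial hF f g h0 hadd (mkPolynomial M β hF p) = MvPolynomial.eval₂ f g p := rfl

theorem liftPolynomial_x (l : M) :
    liftPolynomial hF f g h0 hadd (x (.polynomial β hF) l) = g l := by
  rw [← mkPolynomial_X, liftPolynomial_mk, MvPolynomial.eval₂_X]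

end

theorem polynomial_ringHom_ext
    {f g : FormalGroupAlgebra (.polynomial β hF : Version F) M →+* B}
    (hC : ∀ a, f (mkPolynomial M β hF (MvPolynomial.C a)) =
      g (mkPolynomial M β hF (MvPolynomial.C a)))
    (hx : ∀ l, f (x (.polynomial β hF) l) = g (x (.polynomial β hF) l)) : f = g := by
  have : f.comp (mkPolynomial M β hF) = g.comp (mkPolynomial M β hF) :=
    MvPolynomial.ringHom_ext hC hx
  refine RingHom.ext fun s => ?_
  obtain ⟨p, rfl⟩ := mkPolynomial_surjective s
  exact congrArg (fun f => f p) this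

/-- If a subring contains the constants and the generators attached to a generating set of the
lattice, all elements lie in it up to a unit. -/
theorem exists_unit_mul_mem
    (T : Subring (FormalGroupAlgebra (.polynomial β hF : Version F) M))
    (hC : ∀ a, mkPolynomial M β hF (MvPolynomial.C a) ∈ T) {s : Set M}
    (hs : ∀ l ∈ s, x (.polynomial β hF) l ∈ T) (hspan : Submodule.span ℤ s = ⊤)
    (f : FormalGroupAlgebra (.polynomial β hF : Version F) M) :
    ∃ u ∈ T, IsUnit u ∧ u * f ∈ T := by
  have hadd {f g} (hf : ∃ u ∈ T, IsUnit u ∧ u * f ∈ T) (hg : ∃ u ∈ T, IsUnit u ∧ u * g ∈ T) :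
      ∃ u ∈ T, IsUnit u ∧ u * (f + g) ∈ T := by
    obtain ⟨u, hu, hu', huf⟩ := hf
    obtain ⟨w, hw, hw', hwg⟩ := hg
    refine ⟨u * w, mul_mem hu hw, hu'.mul hw', ?_⟩
    rw [show u * w * (f + g) = w * (u * f) + u * (w * g) by ring]
    exact add_mem (mul_mem hw huf) (mul_mem hu hwg)
  have hmul {f g} (hf : ∃ u ∈ T, IsUnit u ∧ u * f ∈ T) (hg : ∃ u ∈ T, IsUnit u ∧ u * g ∈ T) :
      ∃ u ∈ T, IsUnit u ∧ u * (f * g) ∈ T := by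
    obtain ⟨u, hu, hu', huf⟩ := hf
    obtain ⟨w, hw, hw', hwg⟩ := hg
    refine ⟨u * w, mul_mem hu hw, hu'.mul hw', ?_⟩
    rw [show u * w * (f * g) = (u * f) * (w * g) by ring]
    exact mul_mem huf hwg
  have hin {f} (hf : f ∈ T) : ∃ u ∈ T, IsUnit u ∧ u * f ∈ T :=
    ⟨1, one_mem _, isUnit_one, by rwa [one_mul]⟩
  have hxadd (l m : M) (hl : ∃ u ∈ T, IsUnit u ∧ u * x (.polynomial β hF) l ∈ T)
      (hm : ∃ u ∈ T, IsUnit u ∧ u * x (.polynomial β hF) m ∈ T) :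
      ∃ u ∈ T, IsUnit u ∧ u * x (.polynomial β hF) (l + m) ∈ T := by
    rw [x_polynomial_add, sub_eq_add_neg, ← neg_mul, ← neg_mul]
    exact hadd (hadd hl hm) (hmul (hmul (hin (neg_mem (hC β))) hl) hm)
  have hx (l : M) : ∃ u ∈ T, IsUnit u ∧ u * x (.polynomial β hF) l ∈ T := by
    have hl : l ∈ Submodule.span ℤ s := by rw [hspan]; trivial
    induction hl using Submodule.span_induction with
    | mem l hl => exact hin (hs l hl)
    | zero => rw [x_zero]; exact hin (zero_mem _)
    | add l m _ _ hl hm => exact hxadd l m hl hm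
    | smul n l _ hl =>
      have hnat (n : ℕ) : ∃ u ∈ T, IsUnit u ∧ u * x (.polynomial β hF) (n • l) ∈ T := by
        induction n with
        | zero => rw [zero_smul, x_zero]; exact hin (zero_mem _)
        | succ n ih => rw [succ_nsmul]; exact hxadd _ _ ih hl
      rcases n.eq_nat_or_neg with ⟨n, rfl | rfl⟩
      · rw [natCast_zsmul]; exact hnat n
      · rw [neg_smul, natCast_zsmul]
        obtain ⟨u, hu, hu', hul⟩ := hnat n
        set m := n • l
        -- x_{-m} = -x_m / (1 - βx_m), and 1 - βx_m is a unit with inverse 1 - βx_{-m}. Negatives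
        -- are the reason why a unit factor has to be allowed.
        have e := x_polynomial_add (hF := hF) m (-m)
        rw [add_neg_cancel, x_zero] at e
        set c := mkPolynomial M β hF (MvPolynomial.C β)
        set y := x (.polynomial β hF) m
        set z := x (.polynomial β hF) (-m)
        refine ⟨u * (1 - c * y), ?_, hu'.mul ?_, ?_⟩
        · rw [show u * (1 - c * y) = u - c * (u * y) by ring]
          exact sub_mem hu (mul_mem (hC β) hul)
        · exact IsUnit.of_mul_eq_one (1 - c * z) (by linear_combination (-c) * (-e))
        · rw [show u * (1 - c * y) * z = -(u * y) by linear_combination (-u) * e]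
          exact neg_mem hul
  obtain ⟨p, rfl⟩ := mkPolynomial_surjective f
  induction p using MvPolynomial.induction_on with
  | C a => exact hin (hC a)
  | add p q hp hq => rw [map_add]; exact hadd hp hq
  | mul_X p l hp => rw [map_mul]; exact hmul hp (hx l)

end FormalGroupAlgebra

namespace RootPairing

open FormalGroupAlgebra FormalGroup

variable {ι A M N : Type*} [CommRing A] [AddCommGroup M] [AddCommGroup N]
  {Φ : RootDatum ι M N} (b : Φ.Base) (β : A)

/-- The polynomial formal group algebra of the root lattice for the law `x + y - β x y`. -/
abbrev PolynomialModel (Φ : RootDatum ι M N) (β : A) : Type _ :=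
  FormalGroupAlgebra (.polynomial β (multiplicative_toPowerSeries β) :
    Version (multiplicative β)) (Φ.rootSpan ℤ)

instance : MulSemiringAction Φ.weylGroup (PolynomialModel Φ β) :=
  action Φ.weylGroup (Φ.rootSpan ℤ) _

/-- The element attached to a root. -/
def PolynomialModel.root (i : ι) : PolynomialModel Φ β := x _ (Φ.rootSpanMem ℤ i)

/-- The map to power series in the simple roots. -/
def PolynomialModel.toSeries : PolynomialModel Φ β →+* MvPowerSeries b.support A :=
  liftPolynomial _ C (fun l => (b.series (multiplicative β) l).1) (by rw [map_zero]; rfl)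
    fun l m => by rw [map_add, SeriesPoint.coe_add_multiplicative]

theorem PolynomialModel.toSeries_root (i : ι) :
    toSeries b β (root β i) = b.rootSeries (multiplicative β) i := liftPolynomial_x _

/-- The map from polynomials in the simple roots. -/
def PolynomialModel.ofPolynomial : MvPolynomial b.support A →+* PolynomialModel Φ β :=
  MvPolynomial.eval₂Hom ((mkPolynomial _ β _).comp MvPolynomial.C) fun i => root β (i : ι)

theorem PolynomialModel.toSeries_ofPolynomial (p : MvPolynomial b.support A) :
    toSeries b β (ofPolynomial b β p) = p := by
  have : (toSeries b β).comp (ofPolynomial b β) = MvPolynomial.coeToMvPowerSeries.ringHom := by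
    refine MvPolynomial.ringHom_ext (fun a => ?_) fun i => ?_
    · rw [RingHom.comp_apply, ofPolynomial, MvPolynomial.coe_eval₂Hom, MvPolynomial.eval₂_C,
        RingHom.comp_apply, toSeries, liftPolynomial_mk, MvPolynomial.eval₂_C]
      simp
    · rw [RingHom.comp_apply, ofPolynomial, MvPolynomial.coe_eval₂Hom, MvPolynomial.eval₂_X,
        toSeries_root, b.rootSeries_simple]
      simp
  exact congrArg (fun f => f p) this

theorem PolynomialModel.exists_unit_mul_eq (s : PolynomialModel Φ β) :
    ∃ u : PolynomialModel Φ β, IsUnit u ∧ ∃ p, u * s = ofPolynomial b β p := by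
  obtain ⟨u, -, hu, p, hp⟩ := exists_unit_mul_mem (ofPolynomial b β).range
    (fun a => ⟨MvPolynomial.C a, by
      rw [ofPolynomial, MvPolynomial.coe_eval₂Hom, MvPolynomial.eval₂_C]; rfl⟩)
    (s := Set.range b.toWeightBasisInt) (by
      rintro _ ⟨i, rfl⟩
      refine ⟨MvPolynomial.X i, ?_⟩
      have h : b.toWeightBasisInt i = Φ.rootSpanMem ℤ i := Subtype.ext (by simp)
      rw [ofPolynomial, MvPolynomial.coe_eval₂Hom, MvPolynomial.eval₂_X, h]; rfl)
    b.toWeightBasisInt.span_eq s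
  exact ⟨u, hu, p, hp.symm⟩

/-- Up to a unit every element is a polynomial in the simple roots, and on those the map is the
inclusion of polynomials into power series. -/
theorem PolynomialModel.toSeries_injective : Function.Injective (toSeries (Φ := Φ) b β) := by
  rw [injective_iff_map_eq_zero]
  intro s hs
  obtain ⟨u, hu, p, hp⟩ := exists_unit_mul_eq b β s
  have h0 : (p : MvPowerSeries b.support A) = 0 := by
    rw [← toSeries_ofPolynomial, ← hp, map_mul, hs, mul_zero]
  rw [MvPolynomial.coe_eq_zero_iff] at h0
  rw [h0, map_zero] at hp
  exact (hu.mul_right_eq_zero).1 hp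

theorem _root_.MvPolynomial.X_dvd_of_X_dvd_coe {σ : Type*} {i : σ} {p : MvPolynomial σ A}
    (h : (X i : MvPowerSeries σ A) ∣ p) : MvPolynomial.X i ∣ p := by
  classical
  rw [MvPolynomial.X_dvd_iff_modMonomial_eq_zero]
  ext d
  by_cases hd : Finsupp.single i 1 ≤ d
  · rw [MvPolynomial.coeff_modMonomial_of_le _ hd, MvPolynomial.coeff_zero]
  · rw [MvPolynomial.coeff_modMonomial_of_not_le _ hd, ← MvPolynomial.coeff_coe,
      X_dvd_iff.1 h d, MvPolynomial.coeff_zero]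
    simpa [Finsupp.single_le_iff, Nat.lt_one_iff] using hd

/-- Up to a unit `s` is a polynomial in the simple roots, and for polynomials divisibility by a
variable can be checked among power series. -/
theorem PolynomialModel.dvd_of_dvd_toSeries {i : b.support} {s : PolynomialModel Φ β}
    (h : X i ∣ toSeries b β s) : root β (i : ι) ∣ s := by
  obtain ⟨u, hu, p, hp⟩ := exists_unit_mul_eq b β s
  have h1 : X i ∣ (p : MvPowerSeries b.support A) := by
    rw [← toSeries_ofPolynomial, ← hp, map_mul]
    exact h.mul_left _
  have h2 := map_dvd (ofPolynomial (Φ := Φ) b β) (MvPolynomial.X_dvd_of_X_dvd_coe h1)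
  rw [← hp, hu.dvd_mul_left] at h2
  rwa [ofPolynomial, MvPolynomial.coe_eval₂Hom, MvPolynomial.eval₂_X] at h2

theorem PolynomialModel.smul_root (w : Φ.weylGroup) (i : ι) :
    w • (root β i : PolynomialModel Φ β) = root β (Φ.weylGroupToPerm w i) :=
  (smul_x _ w _).trans (by rw [smul_rootSpanMem]; rfl)

end RootPairing

end

/-! ### Regularity and coprimality in the models; integrality of the point class -/

noncomputable section

open MvPowerSeries

namespace RootPairing

open FormalGroupAlgebra FormalGroup

variable {ι R A M N : Type*} [CommRing R] [CommRing A] [AddCommGroup M] [AddCommGroup N]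
  {F : FormalGroup R} {Φ : RootDatum ι M N} (b : Φ.Base)

namespace PolynomialModel

section

variable {β : A} {β' : R} (π : A →+* R) (hπ : π β = β')
  (hF : F.toPowerSeries = X 0 + X 1 - C β' * X 0 * X 1)

/-- The map to the formal group algebra of a lattice containing the root lattice. -/
def toFormalGroupAlgebra :
    PolynomialModel Φ β →+* FormalGroupAlgebra (.polynomial β' hF : Version F) M :=
  liftPolynomial _ ((mkPolynomial M β' hF).comp (MvPolynomial.C.comp π))
    (fun l => x (.polynomial β' hF) (l : M)) (x_zero _)
    fun l m => by
      rw [Submodule.coe_add, x_polynomial_add]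
      simp [hπ]

theorem toFormalGroupAlgebra_x (l : Φ.rootSpan ℤ) :
    toFormalGroupAlgebra π hπ hF (x _ l : PolynomialModel Φ β) = x (.polynomial β' hF) (l : M) :=
  liftPolynomial_x l

theorem toFormalGroupAlgebra_smul (w : Φ.weylGroup) (s : PolynomialModel Φ β) :
    toFormalGroupAlgebra π hπ hF (w • s) = w • toFormalGroupAlgebra π hπ hF s := by
  have : (toFormalGroupAlgebra π hπ hF).comp
      (MulSemiringAction.toRingHom Φ.weylGroup (PolynomialModel Φ β) w) =
      (MulSemiringAction.toRingHom Φ.weylGroup _ w).comp (toFormalGroupAlgebra π hπ hF) := by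
    refine polynomial_ringHom_ext (fun a => ?_) fun l => ?_
    · change toFormalGroupAlgebra π hπ hF (mkPolynomial _ β _ (MvPolynomial.rename
        (fun l : Φ.rootSpan ℤ => w • l) (MvPolynomial.C a))) =
        w • toFormalGroupAlgebra π hπ hF (mkPolynomial _ β _ (MvPolynomial.C a))
      rw [MvPolynomial.rename_C, toFormalGroupAlgebra, liftPolynomial_mk, MvPolynomial.eval₂_C]
      change _ = mkPolynomial M β' hF (MvPolynomial.rename
        (fun l => w • l) (MvPolynomial.C (π a)))
      rw [MvPolynomial.rename_C]
      rfl
    · change toFormalGroupAlgebra π hπ hF (w • x _ l) = w • toFormalGroupAlgebra π hπ hF (x _ l)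
      have h := smul_x (.polynomial β (multiplicative_toPowerSeries β)) w l
      refine (congrArg (toFormalGroupAlgebra π hπ hF) h).trans ?_
      rw [toFormalGroupAlgebra_x, toFormalGroupAlgebra_x]
      exact (smul_x (.polynomial β' hF : Version F) w (l : M)).symm
  exact congrArg (fun f => f s) this

end

variable (β : A)

theorem exists_root_add_neg (i : ι) : ∃ h : PolynomialModel Φ β,
    root β i + root β (Φ.reflectionPerm i i) = root β i * root β (Φ.reflectionPerm i i) * h := by
  rw [root, root, rootSpanMem_neg]
  exact exists_x_add_neg _ _

theorem root_dvd_smul_sub (i : ι) (s : PolynomialModel Φ β) :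
    root β i ∣ weylGroup.ofIdx Φ i • s - s :=
  x_dvd_smul_sub (fun m => by
    obtain ⟨n, hn⟩ := ofIdx_smul_eq_add_zsmul (Φ := Φ) i (m : M)
    exact ⟨n, Subtype.ext hn⟩) _ s

variable [IsDomain A] [Finite ι] [Φ.IsReduced]

omit [IsDomain A] in
theorem _root_.MvPowerSeries.X_ne_zero_of_nontrivial {σ : Type*} [Nontrivial A] (i : σ) :
    (X i : MvPowerSeries σ A) ≠ 0 := fun h => by
  have := congrArg (coeff (Finsupp.single i 1)) h
  rw [coeff_index_single_self_X, map_zero] at this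
  exact one_ne_zero this

include b in
-- The model embeds into power series over a domain, and the simple roots go to variables.
theorem root_regular (i : ι) : (root β i : PolynomialModel Φ β) ∈ nonZeroDivisors _ := by
  have := NoZeroDivisors.to_isDomain (MvPowerSeries b.support A)
  have := (toSeries_injective (Φ := Φ) b β).isDomain (toSeries b β)
  refine b.regular_of_simple (smul_root β) (fun k hk => ?_) i
  refine mem_nonZeroDivisors_of_ne_zero fun h => ?_
  have := congrArg (toSeries b β) h
  rw [toSeries_root, map_zero, b.rootSeries_simple _ ⟨k, hk⟩] at this
  exact X_ne_zero_of_nontrivial _ this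

include b in
theorem root_coprime [CharZero A] (i j : ι) (f : PolynomialModel Φ β) (h1 : j ≠ i)
    (h2 : j ≠ Φ.reflectionPerm i i) (hf : root β i ∣ root β j * f) : root β i ∣ f := by
  refine b.coprime_of_simple (smul_root β) (fun k hk j f h1 h2 hf => ?_) i j f h1 h2 hf
  have := map_dvd (toSeries b β) hf
  rw [map_mul, toSeries_root, toSeries_root, b.rootSeries_simple _ ⟨k, hk⟩] at this
  refine dvd_of_dvd_toSeries b β (i := ⟨k, hk⟩) ?_
  exact X_dvd_of_dvd_mul _ this (b.not_X_dvd_rootSeries _ ⟨k, hk⟩ h1 h2)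

end PolynomialModel

section Series

variable (F' : FormalGroup A) [F'.IsComm] [IsDomain A] [Finite ι] [Φ.IsReduced]

theorem Base.rootSeries_regular (i : ι) : b.rootSeries F' i ∈ nonZeroDivisors _ := by
  let _ := b.seriesAction F'
  refine b.regular_of_simple (b.smul_rootSeries F') (fun k hk => ?_) i
  rw [b.rootSeries_simple _ ⟨k, hk⟩]
  exact mem_nonZeroDivisors_of_ne_zero (X_ne_zero_of_nontrivial _)

omit [IsDomain A] in
theorem Base.rootSeries_dvd_smul_sub (i : ι) (f : MvPowerSeries b.support A) :
    letI := b.seriesAction F'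
    b.rootSeries F' i ∣ weylGroup.ofIdx Φ i • f - f := by
  let _ := b.seriesAction F'
  refine b.dvd_smul_sub_of_simple (b.smul_rootSeries F') (fun k hk f => ?_) i f
  rw [b.rootSeries_simple _ ⟨k, hk⟩]
  exact b.X_dvd_smul_sub F' ⟨k, hk⟩ f

theorem Base.rootSeries_coprime [CharZero A] (i j : ι) (f : MvPowerSeries b.support A) (h1 : j ≠ i)
    (h2 : j ≠ Φ.reflectionPerm i i) (hf : b.rootSeries F' i ∣ b.rootSeries F' j * f) :
    b.rootSeries F' i ∣ f := by
  let _ := b.seriesAction F'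
  refine b.coprime_of_simple (b.smul_rootSeries F') (fun k hk j f h1 h2 hf => ?_) i j f h1 h2 hf
  rw [b.rootSeries_simple _ ⟨k, hk⟩] at hf ⊢
  exact X_dvd_of_dvd_mul _ hf (b.not_X_dvd_rootSeries _ ⟨k, hk⟩ h1 h2)

end Series

open Classical in
/-- The integrality that puts the class of the base point of a flag variety into the dual of the
formal affine Demazure algebra. -/
theorem exists_pointFactor_mul_sum_wordFun_eq [Fintype ι] [Fintype Φ.weylGroup] [Φ.IsReduced]
    [F.IsComm] (v : Version F)
    (hreg : ∀ i, x v (Φ.root i) ∈ nonZeroDivisors (FormalGroupAlgebra v M)) {Θ : Set ι}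
    (hΘ : Θ ⊆ b.support) (I : List b.support) :
    ∃ s : FormalGroupAlgebra v M, algebraMap _ (Φ.RootLocalization v) (b.pointFactor v Θ) *
      ∑ w with w ∈ Φ.parabolicSubgroup Θ,
        wordFun (Φ.RootLocalization v) (fun i => x v (Φ.root i)) I w = algebraMap _ _ s := by
  have h := isRootRing_formalGroupAlgebra v hreg
  -- A polynomial ring with one variable for each element of R maps onto R. It is a domain of
  -- characteristic zero and embeds into a ℚ-algebra.
  let π : MvPolynomial R ℤ →+* R := MvPolynomial.eval₂Hom (Int.castRingHom R) id
  have hπ (r : R) : π (MvPolynomial.X r) = r := MvPolynomial.eval₂_X _ _ _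
  cases v with
  | completed =>
    obtain ⟨F', hF', hF⟩ := exists_formalGroup_map_eq
      (j := MvPolynomial.map (σ := R) (Int.castRingHom ℚ))
      (MvPolynomial.map_injective _ Int.cast_injective) (π := π) (fun r => ⟨_, hπ r⟩) F
    let _ := b.seriesAction F'
    exact exists_prod_mul_sum_wordFun_eq_of_lift h (b.smul_rootSeries F')
      (b.exists_rootSeries_add_neg F') (b.rootSeries_dvd_smul_sub F') (b.rootSeries_regular F')
      (b.rootSeries_coprime F') (b.toCompleted F π) (fun i => b.toCompleted_series hF _)
      (b.toCompleted_smul hF) b hΘ I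
  | polynomial β hF =>
    -- Here the law lifts at once: it is enough to lift β, to the variable attached to it.
    exact exists_prod_mul_sum_wordFun_eq_of_lift h
      (PolynomialModel.smul_root (MvPolynomial.X β : MvPolynomial R ℤ))
      (PolynomialModel.exists_root_add_neg _) (PolynomialModel.root_dvd_smul_sub _)
      (PolynomialModel.root_regular b _) (PolynomialModel.root_coprime b _)
      (PolynomialModel.toFormalGroupAlgebra π (hπ β) hF)
      (fun i => PolynomialModel.toFormalGroupAlgebra_x π (hπ β) hF _)
      (PolynomialModel.toFormalGroupAlgebra_smul π (hπ β) hF) b hΘ I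

end RootPairing

end

/-! ### Integral functions on the Weyl group -/

noncomputable section

namespace RootPairing

open Classical

variable {ι M N : Type*} [AddCommGroup M] [AddCommGroup N] {Φ : RootDatum ι M N}
  {S Q : Type*} [CommRing S] [CommRing Q] [Algebra S Q]
  [MulSemiringAction Φ.weylGroup S] [MulSemiringAction Φ.weylGroup Q] {X : ι → S}
  {b : Φ.Base}

section Elementary

variable (h : IsRootRing Φ Q X)

include h

theorem IsRootRing.range_smul (w : Φ.weylGroup) {q : Q} (hq : q ∈ (algebraMap S Q).range) :
    w • q ∈ (algebraMap S Q).range := by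
  obtain ⟨s, rfl⟩ := hq
  exact ⟨w • s, (h.smul_algebraMap w s).symm⟩

theorem IsRootRing.inv_add_inv_mem (i : ι) :
    IsRootRing.inv Q X i + IsRootRing.inv Q X (Φ.reflectionPerm i i) ∈ (algebraMap S Q).range := by
  obtain ⟨s, hs⟩ := h.exists_inv_add_inv i
  exact ⟨s, hs.symm⟩

theorem IsRootRing.inv_mul_mem_of_dvd {i : ι} {s : S} (hs : X i ∣ s) :
    IsRootRing.inv Q X i * algebraMap S Q s ∈ (algebraMap S Q).range := by
  obtain ⟨t, rfl⟩ := hs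
  exact ⟨t, by rw [map_mul, ← mul_assoc, h.inv_mul, one_mul]⟩

theorem IsRootRing.inv_neg_mul_smul_sub_mem (i : ι) {a : Q} (ha : a ∈ (algebraMap S Q).range) :
    IsRootRing.inv Q X (Φ.reflectionPerm i i) * (weylGroup.ofIdx Φ i • a - a) ∈
      (algebraMap S Q).range := by
  obtain ⟨s, rfl⟩ := ha
  rw [h.smul_algebraMap, ← map_sub]
  exact h.inv_mul_mem_of_dvd ((h.neg_dvd i).trans (h.dvd_smul_sub i s))

/-- Rewrite it as (1/x_α + 1/x_{-α}) s_α(a) - (s_α(a) - a)/x_{-α}; both terms lie in S. So the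
push-pull operators preserve S. -/
theorem IsRootRing.inv_mul_add_mem (i : ι) {a : Q} (ha : a ∈ (algebraMap S Q).range) :
    IsRootRing.inv Q X (Φ.reflectionPerm i i) * a +
      IsRootRing.inv Q X i * weylGroup.ofIdx Φ i • a ∈ (algebraMap S Q).range := by
  have h1 := mul_mem (h.inv_add_inv_mem i) (h.range_smul (weylGroup.ofIdx Φ i) ha)
  have h2 := h.inv_neg_mul_smul_sub_mem i ha
  have := sub_mem h1 h2
  convert this using 1
  ring

end Elementary

section Right

/-- Right multiplication by `p + q δ_u`, on coefficients. -/
def rightMulFun (p q : Q) (u : Φ.weylGroup) (z : Φ.weylGroup → Q) : Φ.weylGroup → Q := fun w =>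
  z w * w • p + z (w * u⁻¹) * (w * u⁻¹) • q

omit [MulSemiringAction Φ.weylGroup S] in
theorem pushPullFun_rightMulFun (i : ι) (p q : Q) (u : Φ.weylGroup) (z : Φ.weylGroup → Q) :
    pushPullFun Q X i (rightMulFun p q u z) = rightMulFun p q u (pushPullFun Q X i z) := by
  funext w
  simp only [pushPullFun, rightMulFun, smul_add, smul_mul', ← mul_smul, ← mul_assoc, ofIdx_mul_self,
    one_mul]
  ring

omit [MulSemiringAction Φ.weylGroup S] in
variable (X) in
theorem wordFun_append_singleton (I : List b.support) (i : b.support) :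
    wordFun Q X (I ++ [i]) = rightMulFun (IsRootRing.inv Q X (Φ.reflectionPerm (i : ι) (i : ι)))
      (IsRootRing.inv Q X (i : ι)) (weylGroup.ofIdx Φ (i : ι)) (wordFun Q X I) := by
  induction I with
  | nil =>
    funext w
    simp only [List.nil_append, wordFun, pushPullFun, rightMulFun, ofIdx_inv]
    by_cases h1 : w = 1
    · subst h1
      simp only [Pi.single_eq_same, mul_one, one_mul, one_smul]
      by_cases h2 : weylGroup.ofIdx Φ (i : ι) = 1
      · rw [h2]; simp
      · rw [Pi.single_eq_of_ne h2]; simp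
    · rw [Pi.single_eq_of_ne h1]
      by_cases h2 : w = weylGroup.ofIdx Φ (i : ι)
      · subst h2; simp
      · have h3 : w * weylGroup.ofIdx Φ (i : ι) ≠ 1 := fun e =>
          h2 (by rw [← ofIdx_inv]; exact eq_inv_of_mul_eq_one_left e)
        have h4 : weylGroup.ofIdx Φ (i : ι) * w ≠ 1 := fun e =>
          h2 (by rw [← ofIdx_inv]; exact eq_inv_of_mul_eq_one_right e)
        rw [Pi.single_eq_of_ne h3, Pi.single_eq_of_ne h4]; simp
  | cons j I ih => rw [List.cons_append, wordFun, ih, pushPullFun_rightMulFun]; rfl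

variable (Q X) in
/-- The transpose of right multiplication by a push-pull element. -/
def divided (i : ι) (g : Φ.weylGroup → Q) : Φ.weylGroup → Q := fun w =>
  w • IsRootRing.inv Q X (Φ.reflectionPerm i i) * g w +
    w • IsRootRing.inv Q X i * g (w * weylGroup.ofIdx Φ i)

variable [Fintype Φ.weylGroup]

omit [MulSemiringAction Φ.weylGroup S] in
theorem sum_wordFun_append_singleton (I : List b.support) (i : b.support) (g : Φ.weylGroup → Q) :
    ∑ w, wordFun Q X (I ++ [i]) w * g w = ∑ w, wordFun Q X I w * divided Q X i g w := by
  simp only [wordFun_append_singleton, rightMulFun, divided, add_mul, mul_add,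
    Finset.sum_add_distrib]
  congr 1
  · exact Finset.sum_congr rfl fun w _ => by ring
  · refine Fintype.sum_equiv (Equiv.mulRight (weylGroup.ofIdx Φ (i : ι))⁻¹) _ _ fun w => ?_
    simp only [Equiv.coe_mulRight, mul_assoc]
    rw [inv_mul_cancel, mul_one]

variable (Q X b) in
/-- The functions that pair integrally with all words in push-pull elements. -/
def integralFunctions : AddSubgroup (Φ.weylGroup → Q) where
  carrier := {g | ∀ I : List b.support, ∑ w, wordFun Q X I w * g w ∈ (algebraMap S Q).range}
  zero_mem' I := by simp
  add_mem' hf hg I := by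
    simp only [Pi.add_apply, mul_add, Finset.sum_add_distrib]
    exact add_mem (hf I) (hg I)
  neg_mem' hf I := by
    simp only [Pi.neg_apply, mul_neg, Finset.sum_neg_distrib]
    exact neg_mem (hf I)

omit [MulSemiringAction Φ.weylGroup S] in
theorem divided_mem {g : Φ.weylGroup → Q} (hg : g ∈ integralFunctions Q X b) (i : b.support) :
    divided Q X i g ∈ integralFunctions Q X b := fun I => by
  rw [← sum_wordFun_append_singleton]
  exact hg _

omit [MulSemiringAction Φ.weylGroup S] in
/-- Induction on words from the right. -/
theorem sum_wordFun_mem_of {P : (Φ.weylGroup → Q) → Prop}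
    (h1 : ∀ g, P g → g 1 ∈ (algebraMap S Q).range)
    (h2 : ∀ g, P g → ∀ i : b.support, divided Q X i g ∈ AddSubgroup.closure {g | P g})
    {g : Φ.weylGroup → Q} (hg : P g) : g ∈ integralFunctions Q X b := by
  intro I
  induction I using List.reverseRecOn generalizing g with
  | nil =>
    rw [Finset.sum_eq_single 1]
    · simp only [wordFun, Pi.single_eq_same, one_mul]
      exact h1 g hg
    · intro w _ hw
      simp only [wordFun]
      rw [Pi.single_eq_of_ne hw, zero_mul]
    · simp
  | append_singleton I i ih =>
    rw [sum_wordFun_append_singleton]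
    have := h2 g hg i
    generalize divided Q X (i : ι) g = g' at this
    induction this using AddSubgroup.closure_induction with
    | mem f hf => exact ih hf
    | zero => simp
    | add f g _ _ hf hg =>
      simp only [Pi.add_apply, mul_add, Finset.sum_add_distrib]
      exact add_mem hf hg
    | neg f _ hf =>
      simp only [Pi.neg_apply, mul_neg, Finset.sum_neg_distrib]
      exact neg_mem hf

omit [MulSemiringAction Φ.weylGroup S] in
theorem apply_one_mem {g : Φ.weylGroup → Q} (hg : g ∈ integralFunctions Q X b) :
    g 1 ∈ (algebraMap S Q).range := by
  have := hg []
  rw [Finset.sum_eq_single 1] at this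
  · simpa only [wordFun, Pi.single_eq_same, one_mul] using this
  · intro w _ hw
    simp only [wordFun]
    rw [Pi.single_eq_of_ne hw, zero_mul]
  · simp

variable (h : IsRootRing Φ Q X)

include h

/-- On functions w ↦ w(q), `divided` is the push-pull operator applied to q, which preserves S. -/
theorem IsRootRing.smul_mem_integral {q : Q} (hq : q ∈ (algebraMap S Q).range) :
    (fun w : Φ.weylGroup => w • q) ∈ integralFunctions Q X b := by
  refine sum_wordFun_mem_of
    (P := fun g => ∃ q ∈ (algebraMap S Q).range, g = fun w : Φ.weylGroup => w • q) ?_ ?_ ⟨q, hq, rfl⟩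
  · rintro _ ⟨q, hq, rfl⟩
    simpa only [one_smul] using hq
  · rintro _ ⟨q, hq, rfl⟩ i
    refine AddSubgroup.subset_closure ⟨_, h.inv_mul_add_mem (i : ι) hq, ?_⟩
    funext w
    simp only [divided, smul_add, smul_mul', mul_smul]

/-- A twisted Leibniz rule: `divided` of the product is w(s_i q) times `divided` of g, minus w((s_i
q - q)/x_{-α_i}) times g. Both coefficients again come from S. -/
theorem IsRootRing.smul_mul_mem_integral {q : Q} (hq : q ∈ (algebraMap S Q).range)
    {g : Φ.weylGroup → Q} (hg : g ∈ integralFunctions Q X b) :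
    (fun w : Φ.weylGroup => w • q * g w) ∈ integralFunctions Q X b := by
  refine sum_wordFun_mem_of
    (P := fun f => ∃ q ∈ (algebraMap S Q).range, ∃ g ∈ integralFunctions Q X b,
      f = fun w : Φ.weylGroup => w • q * g w) ?_ ?_ ⟨q, hq, g, hg, rfl⟩
  · rintro _ ⟨q, hq, g, hg, rfl⟩
    simp only [one_smul]
    exact mul_mem hq (apply_one_mem hg)
  · rintro _ ⟨q, hq, g, hg, rfl⟩ i
    have h1 : (fun w : Φ.weylGroup => w • (weylGroup.ofIdx Φ (i : ι) • q) * divided Q X i g w) ∈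
        AddSubgroup.closure {f | ∃ q ∈ (algebraMap S Q).range, ∃ g ∈ integralFunctions Q X b,
      f = fun w : Φ.weylGroup => w • q * g w} :=
      AddSubgroup.subset_closure ⟨_, h.range_smul _ hq, _, divided_mem hg i, rfl⟩
    have h2 : (fun w : Φ.weylGroup => w • (IsRootRing.inv Q X (Φ.reflectionPerm (i : ι) (i : ι)) *
        (weylGroup.ofIdx Φ (i : ι) • q - q)) * g w) ∈
        AddSubgroup.closure {f | ∃ q ∈ (algebraMap S Q).range, ∃ g ∈ integralFunctions Q X b,
      f = fun w : Φ.weylGroup => w • q * g w} :=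
      AddSubgroup.subset_closure ⟨_, h.inv_neg_mul_smul_sub_mem (i : ι) hq, _, hg, rfl⟩
    convert sub_mem h1 h2 using 1
    funext w
    simp only [divided, Pi.sub_apply, smul_sub, smul_mul', mul_smul]
    ring

/-- Write ∂ for `divided`, x for x_α and u for 1/x_{-α}. Eliminating the values at w s_α gives ∂(fg)
= x ∂f ∂g - xu(f ∂g + ∂f g) + xu(1/x + u) fg, with coefficients twisted by w. All of them lie in S,
since 1/x + u and hence xu do. -/
theorem IsRootRing.mul_mem_integral {f g : Φ.weylGroup → Q} (hf : f ∈ integralFunctions Q X b)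
    (hg : g ∈ integralFunctions Q X b) : f * g ∈ integralFunctions Q X b := by
  refine sum_wordFun_mem_of (P := fun k => ∃ f ∈ integralFunctions Q X b,
    ∃ g ∈ integralFunctions Q X b, k = f * g) ?_ ?_ ⟨f, hf, g, hg, rfl⟩
  · rintro _ ⟨f, hf, g, hg, rfl⟩
    exact mul_mem (apply_one_mem hf) (apply_one_mem hg)
  · rintro _ ⟨f, hf, g, hg, rfl⟩ i
    set x := algebraMap S Q (X i) with hx
    set u := IsRootRing.inv Q X (Φ.reflectionPerm (i : ι) (i : ι)) with hu
    set k := IsRootRing.inv Q X (i : ι) + u with hk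
    have hkm : k ∈ (algebraMap S Q).range := h.inv_add_inv_mem i
    have hxm : x ∈ (algebraMap S Q).range := ⟨_, rfl⟩
    have hxv : x * IsRootRing.inv Q X (i : ι) = 1 := h.mul_inv i
    have hxu : x * u = x * k - 1 := by rw [hk, mul_add, hxv]; ring
    have hxum : x * u ∈ (algebraMap S Q).range := by
      rw [hxu]; exact sub_mem (mul_mem hxm hkm) (one_mem _)
    set T := AddSubgroup.closure {k | ∃ f ∈ integralFunctions Q X b,
      ∃ g ∈ integralFunctions Q X b, k = f * g} with hT
    have mem {q : Q} (hq : q ∈ (algebraMap S Q).range) {f g : Φ.weylGroup → Q}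
        (hf : f ∈ integralFunctions Q X b) (hg : g ∈ integralFunctions Q X b) :
        (fun w : Φ.weylGroup => w • q * f w * g w) ∈ T :=
      AddSubgroup.subset_closure ⟨_, h.smul_mul_mem_integral hq hf, g, hg, rfl⟩
    have hdf := divided_mem hf i
    have hdg := divided_mem hg i
    have key := add_mem (sub_mem (sub_mem (mem hxm hdf hdg) (mem hxum hf hdg)) (mem hxum hdf hg))
      (mem (mul_mem hxum hkm) hf hg)
    convert key using 1
    funext w
    have e1 : w • x * w • IsRootRing.inv Q X (i : ι) = 1 := by rw [← smul_mul', hxv, smul_one]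
    simp only [Pi.add_apply, Pi.sub_apply, smul_mul', divided, ← hu, hk, smul_add, Pi.mul_apply]
    generalize w • IsRootRing.inv Q X (i : ι) = v at *
    linear_combination -(w • u * f w * g w + v * f (w * weylGroup.ofIdx Φ i) *
      g (w * weylGroup.ofIdx Φ i)) * e1

theorem IsRootRing.one_mem_integral : (1 : Φ.weylGroup → Q) ∈ integralFunctions Q X b := by
  convert h.smul_mem_integral (b := b) (one_mem (algebraMap S Q).range) using 1
  funext w
  rw [smul_one]; rfl

end Right

section Left

variable [Fintype Φ.weylGroup] (h : IsRootRing Φ Q X)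

omit [MulSemiringAction Φ.weylGroup S] in
theorem mul_mem_integral_of_mem_range {q : Q} (hq : q ∈ (algebraMap S Q).range)
    {g : Φ.weylGroup → Q} (hg : g ∈ integralFunctions Q X b) :
    (fun w => q * g w) ∈ integralFunctions Q X b := fun I => by
  have : ∑ w, wordFun Q X I w * (q * g w) = q * ∑ w, wordFun Q X I w * g w := by
    rw [Finset.mul_sum]
    exact Finset.sum_congr rfl fun w _ => by ring
  rw [this]
  exact mul_mem hq (hg I)

include h

/-- The pairing of the word I with the transformed function can be expressed through the pairings a
and a' of g with I and with i :: I. Solving for the sum twisted by s_i turns it into the push-pull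
of a plus combinations of s_i(a) and s_i(a') with coefficients in S, because x_{-α}/x_α lies in S.
-/
theorem IsRootRing.pushPullFun_mem {g : Φ.weylGroup → Q} (hg : g ∈ integralFunctions Q X b)
    (i : b.support) : pushPullFun Q X i g ∈ integralFunctions Q X b := by
  intro I
  have h1 := hg I
  have h2 := hg (i :: I)
  set s := weylGroup.ofIdx Φ (i : ι) with hs
  set a := ∑ w, wordFun Q X I w * g w with ha
  set a' := ∑ w, wordFun Q X (i :: I) w * g w with ha'
  have e1 : ∑ w, wordFun Q X I (s * w) * s • g w = s • ∑ w, (s • wordFun Q X I (s * w)) * g w := by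
    rw [Finset.smul_sum]
    refine Finset.sum_congr rfl fun w _ => ?_
    rw [smul_mul', ← mul_smul, ofIdx_mul_self, one_smul]
  have e2 : a' = IsRootRing.inv Q X (Φ.reflectionPerm (i : ι) (i : ι)) * a +
      IsRootRing.inv Q X (i : ι) * ∑ w, (s • wordFun Q X I (s * w)) * g w := by
    rw [ha', ha, Finset.mul_sum, Finset.mul_sum, ← Finset.sum_add_distrib]
    refine Finset.sum_congr rfl fun w _ => ?_
    simp only [wordFun, pushPullFun]
    ring
  have e3 : ∑ w, wordFun Q X I w * pushPullFun Q X i g w =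
      IsRootRing.inv Q X (Φ.reflectionPerm (i : ι) (i : ι)) * a +
      IsRootRing.inv Q X (i : ι) * ∑ w, wordFun Q X I (s * w) * s • g w := by
    have : ∑ w, wordFun Q X I (s * w) * s • g w = ∑ w, wordFun Q X I w * s • g (s * w) := by
      refine Fintype.sum_equiv (Equiv.mulLeft s) _ _ fun w => ?_
      simp only [Equiv.coe_mulLeft, ← mul_assoc, hs, ofIdx_mul_self, one_mul]
    rw [this, ha, Finset.mul_sum, Finset.mul_sum, ← Finset.sum_add_distrib]
    refine Finset.sum_congr rfl fun w _ => ?_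
    simp only [pushPullFun]
    ring
  rw [e3, e1]
  set c := ∑ w, (s • wordFun Q X I (s * w)) * g w
  set x := algebraMap S Q (X i) with hx
  set y := algebraMap S Q (X (Φ.reflectionPerm (i : ι) (i : ι))) with hy
  set p := IsRootRing.inv Q X (i : ι) with hp
  set u := IsRootRing.inv Q X (Φ.reflectionPerm (i : ι) (i : ι)) with hu
  have hc : c = x * (a' - u * a) := by
    rw [e2, add_sub_cancel_left, ← mul_assoc, h.mul_inv, one_mul]
  have hsx : s • x = y := by rw [hs, hx, h.smul_algebraMap, h.smul_X, weylGroupToPerm_ofIdx]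
  have hsu : s • u = p := by
    rw [hs, hu, h.smul_inv, weylGroupToPerm_ofIdx, reflectionPerm_self]
  have hyu : y * u = 1 := h.mul_inv _
  have hk : p + u ∈ (algebraMap S Q).range := h.inv_add_inv_mem i
  have hym : y ∈ (algebraMap S Q).range := ⟨_, rfl⟩
  have hpy : p * y = (p + u) * y - 1 := by linear_combination -hyu
  have hpym : p * y ∈ (algebraMap S Q).range := by
    rw [hpy]; exact sub_mem (mul_mem hk hym) (one_mem _)
  have hsa := h.range_smul s h1
  have key := add_mem (sub_mem (h.inv_mul_add_mem (i : ι) h1) (mul_mem (mul_mem hk hpym) hsa))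
    (mul_mem hpym (h.range_smul s h2))
  convert key using 1
  rw [hc, smul_mul', smul_sub, smul_mul', hsx, hsu]
  linear_combination (p * s • a) * hyu

end Left

end RootPairing

end

/-! ### Triangularity, and generation by the class of the base point -/

noncomputable section

namespace RootPairing

open Classical

variable {ι M N : Type*} [Fintype ι] [AddCommGroup M] [AddCommGroup N] {Φ : RootDatum ι M N}
  [Φ.IsReduced] {S Q : Type*} [CommRing S] [CommRing Q] [Algebra S Q]
  [MulSemiringAction Φ.weylGroup S] [MulSemiringAction Φ.weylGroup Q] {X : ι → S}
  {b : Φ.Base} (h : IsRootRing Φ Q X)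

section LeadingTerm

theorem length_wordProd_le (I : List b.support) : b.length (b.wordProd I) ≤ I.length := by
  induction I with
  | nil => rw [b.wordProd_nil, b.length_eq_card]; simp
  | cons i I ih =>
    rw [b.wordProd_cons, List.length_cons]
    exact (b.length_ofIdx_mul_le _ i.2).trans (by omega)

include h

/-- The coefficients of a reduced word in push-pull elements are triangular. -/
theorem IsRootRing.wordFun_reduced {I : List b.support}
    (hI : I.length = b.length (b.wordProd I)) :
    wordFun Q X I (b.wordProd I) = ∏ i ∈ b.inversions (b.wordProd I), IsRootRing.inv Q X i ∧
      ∀ w, wordFun Q X I w ≠ 0 → w = b.wordProd I ∨ b.length w < b.length (b.wordProd I) := by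
  induction I with
  | nil =>
    refine ⟨?_, fun w hw => ?_⟩
    · have : b.inversions (1 : Φ.weylGroup) = ∅ := by
        rw [← Finset.card_eq_zero]
        exact Nat.le_zero.1 (length_wordProd_le ([] : List b.support))
      rw [b.wordProd_nil, this, Finset.prod_empty]
      simp only [wordFun, Pi.single_eq_same]
    · left
      by_contra h
      exact hw (by simp only [wordFun]; exact Pi.single_eq_of_ne h _)
  | cons i I ih =>
    rw [b.wordProd_cons, List.length_cons] at hI
    have h1 := length_wordProd_le I
    have h2 := b.length_ofIdx_mul_le (b.wordProd I) i.2
    have hI' : I.length = b.length (b.wordProd I) := by omega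
    obtain ⟨ihv, ihs⟩ := ih hI'
    have hpos : b.IsPos (Φ.weylGroupToPerm (b.wordProd I)⁻¹ i) := by
      by_contra hn
      have := b.length_ofIdx_mul_of_not i.2 hn
      omega
    have hlen := b.length_ofIdx_mul i.2 hpos
    refine ⟨?_, fun w hw => ?_⟩
    -- At the top element s_i w only the term with the reflection survives: s_i w is longer than w,
    -- hence outside of the support of the shorter word.
    · have h0 : wordFun Q X I (weylGroup.ofIdx Φ (i : ι) * b.wordProd I) = 0 := by
        by_contra hn
        rcases ihs _ hn with h | h
        · rw [h] at hlen; omega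
        · omega
      rw [b.wordProd_cons]
      simp only [wordFun, pushPullFun]
      rw [h0, mul_zero, zero_add, ← mul_assoc, ofIdx_mul_self, one_mul, ihv, Finset.smul_prod',
        b.inversions_ofIdx_mul i.2 hpos, Finset.prod_insert (b.notMem_map_inversions i.2),
        Finset.prod_map]
      congr 1
      refine Finset.prod_congr rfl fun k _ => ?_
      rw [h.smul_inv, weylGroupToPerm_ofIdx]
      rfl
    · rw [b.wordProd_cons]
      simp only [wordFun, pushPullFun] at hw
      by_cases hz : wordFun Q X I w = 0
      · have hz' : wordFun Q X I (weylGroup.ofIdx Φ (i : ι) * w) ≠ 0 := by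
          intro hz'
          exact hw (by rw [hz, hz', smul_zero, mul_zero, mul_zero, add_zero])
        rcases ihs _ hz' with h | h
        · left
          rw [← h, ← mul_assoc, ofIdx_mul_self, one_mul]
        · right
          have := b.length_ofIdx_mul_le (weylGroup.ofIdx Φ (i : ι) * w) i.2
          rw [← mul_assoc, ofIdx_mul_self, one_mul] at this
          omega
      · right
        rcases ihs _ hz with h | h
        · rw [h]; omega
        · omega

end LeadingTerm

section Operators

variable (Q X) in
/-- The operator on functions given by a word in push-pull elements. -/
def wordOp : List b.support → (Φ.weylGroup → Q) → Φ.weylGroup → Q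
  | [], g => g
  | i :: I, g => pushPullFun Q X i (wordOp I g)

omit [Fintype ι] [Φ.IsReduced] [MulSemiringAction Φ.weylGroup S] in
theorem wordOp_apply [Fintype Φ.weylGroup] (I : List b.support) (g : Φ.weylGroup → Q)
    (w : Φ.weylGroup) : wordOp Q X I g w = ∑ u, wordFun Q X I u * u • g (u⁻¹ * w) := by
  induction I generalizing w with
  | nil =>
    rw [Finset.sum_eq_single 1]
    · simp [wordOp, wordFun]
    · intro u _ hu
      simp only [wordFun]
      rw [Pi.single_eq_of_ne hu, zero_mul]
    · simp
  | cons i I ih =>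
    change pushPullFun Q X (i : ι) (wordOp Q X I g) w = _
    simp only [pushPullFun, wordFun, ih, add_mul, Finset.sum_add_distrib]
    rw [Finset.mul_sum, Finset.smul_sum, Finset.mul_sum]
    congr 1
    · exact Finset.sum_congr rfl fun u _ => by ring
    · refine Fintype.sum_equiv (Equiv.mulLeft (weylGroup.ofIdx Φ (i : ι))) _ _ fun u => ?_
      simp only [Equiv.coe_mulLeft, mul_inv_rev, ofIdx_inv, ← mul_assoc, ofIdx_mul_self, one_mul,
        smul_mul', mul_smul]

omit [Fintype ι] [Φ.IsReduced] [MulSemiringAction Φ.weylGroup S] in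
theorem pushPullFun_mul_right (i : ι) {g : Φ.weylGroup → Q} {u : Φ.weylGroup}
    (hg : ∀ w, g (w * u) = g w) (w : Φ.weylGroup) :
    pushPullFun Q X i g (w * u) = pushPullFun Q X i g w := by
  simp only [pushPullFun, hg, ← mul_assoc]

omit [Fintype ι] [Φ.IsReduced] in
include h in
-- Right translation by a simple reflection is a combination of `divided` and the identity: g(w s_α)
-- = w(x_α) ∂g(w) - w(x_α/x_{-α}) g(w), with ∂ standing for `divided`.
theorem IsRootRing.translate_mem_integral [Fintype Φ.weylGroup] {g : Φ.weylGroup → Q}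
    (hg : g ∈ integralFunctions Q X b) (I : List b.support) :
    (fun w => g (w * b.wordProd I)) ∈ integralFunctions Q X b := by
  induction I with
  | nil => simpa using hg
  | cons i I ih =>
    have hxv := h.mul_inv (i : ι)
    have hx : algebraMap S Q (X i) ∈ (algebraMap S Q).range := ⟨_, rfl⟩
    have hxu : algebraMap S Q (X i) * IsRootRing.inv Q X (Φ.reflectionPerm (i : ι) (i : ι)) ∈
        (algebraMap S Q).range := by
      have := sub_mem (mul_mem hx (h.inv_add_inv_mem (i : ι))) (one_mem _)
      rw [mul_add, hxv, add_sub_cancel_left] at this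
      exact this
    have := sub_mem (h.smul_mul_mem_integral hx (divided_mem ih i))
      (h.smul_mul_mem_integral hxu ih)
    convert this using 1
    funext w
    have e := congrArg (fun q => w • q) hxv
    simp only [smul_mul', smul_one] at e
    simp only [divided, b.wordProd_cons, Pi.sub_apply, smul_mul', mul_assoc]
    linear_combination (-g (w * (weylGroup.ofIdx Φ (i : ι) * b.wordProd I))) * e

end Operators

section Generation

variable {Θ : Set ι} (hΘ : Θ ⊆ b.support)

variable (Q X b) in
/-- The class of the base point, as a function on the Weyl group. -/
def pointFun (Θ : Set ι) : Φ.weylGroup → Q := fun w =>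
  if w ∈ Φ.parabolicSubgroup Θ then
    algebraMap S Q (∏ i with ¬ b.IsPos i ∧ Φ.root i ∉ Submodule.span ℤ (Φ.root '' Θ), X i) else 0

include h hΘ

/-- The value of a reduced word at the class of the base point. -/
theorem IsRootRing.wordOp_pointFun [Fintype Φ.weylGroup] {y : Φ.weylGroup}
    (hy : ∀ i, b.IsPos i → Φ.root i ∈ Submodule.span ℤ (Φ.root '' Θ) →
      b.IsPos (Φ.weylGroupToPerm y i)) :
    ∃ J : List b.support, (wordOp Q X J (pointFun Q X b Θ) y = algebraMap S Q
        (∏ j with ¬ b.IsPos j ∧ ¬ b.IsPos (Φ.weylGroupToPerm y⁻¹ j) ∧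
          Φ.root (Φ.weylGroupToPerm y⁻¹ j) ∉ Submodule.span ℤ (Φ.root '' Θ), X j)) ∧
      ∀ w, wordOp Q X J (pointFun Q X b Θ) w ≠ 0 → y⁻¹ * w ∈ Φ.parabolicSubgroup Θ ∨
        b.cosetLength Θ w < b.cosetLength Θ y := by
  obtain ⟨J, rfl, hJ⟩ := b.exists_reduced_word y
  obtain ⟨hv, hs⟩ := h.wordFun_reduced hJ
  have hlen := b.length_eq_cosetLength hy
  have hcl (u w) (hu : u⁻¹ * w ∈ Φ.parabolicSubgroup Θ) :
      b.cosetLength Θ w = b.cosetLength Θ u := by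
    have := b.cosetLength_mul hΘ u hu
    rwa [mul_inv_cancel_left] at this
  refine ⟨J, ?_, fun w hw => ?_⟩
  · set y := b.wordProd J
    -- Only u = y contributes. Every other u in the support of the word is shorter than y, but if u
    -- lies in the coset of y it has the coset length of y, which is the length of y because y is
    -- minimal in its coset.
    rw [wordOp_apply, Finset.sum_eq_single y]
    · rw [inv_mul_cancel, pointFun, if_pos (one_mem _), hv, h.smul_algebraMap, Finset.smul_prod']
      simp only [h.smul_X]
      rw [Finset.prod_equiv (Φ.weylGroupToPerm y)
        (t := ({j | ¬ b.IsPos (Φ.weylGroupToPerm y⁻¹ j) ∧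
          Φ.root (Φ.weylGroupToPerm y⁻¹ j) ∉ Submodule.span ℤ (Φ.root '' Θ)} : Finset ι))
        (g := X) (fun i => by
          simp only [Finset.mem_filter_univ, weylGroupToPerm_inv_apply]) (fun i _ => rfl)]
      -- The positive roots among the translates by y of the roots in the base point factor are
      -- exactly the inversions of y. Their x cancel against the leading coefficient of the word,
      -- and the negative ones remain.
      rw [← Finset.prod_filter_mul_prod_filter_not (f := X) _ (fun j => b.IsPos j), map_mul,
        ← mul_assoc]
      have e1 : ({j | ¬ b.IsPos (Φ.weylGroupToPerm y⁻¹ j) ∧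
          Φ.root (Φ.weylGroupToPerm y⁻¹ j) ∉ Submodule.span ℤ (Φ.root '' Θ)} : Finset ι).filter
          (fun j => b.IsPos j) = b.inversions y := by
        ext j
        simp only [Finset.mem_filter, Finset.mem_univ, true_and, b.mem_inversions]
        refine ⟨fun h => ⟨h.2, h.1.1⟩, fun h => ⟨⟨h.2, fun hj => ?_⟩, h.1⟩⟩
        have := hy (Φ.reflectionPerm (Φ.weylGroupToPerm y⁻¹ j) (Φ.weylGroupToPerm y⁻¹ j))
          (b.isPos_neg.2 h.2) (by rw [root_neg]; exact neg_mem hj)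
        rw [b.isPos_perm_neg, weylGroupToPerm_apply_inv] at this
        exact this h.1
      rw [e1, map_prod, ← Finset.prod_mul_distrib, Finset.prod_congr rfl
        (fun i _ => h.inv_mul i), Finset.prod_const_one, one_mul]
      congr 2
      ext j
      simp only [Finset.mem_filter, Finset.mem_univ, true_and]
      tauto
    · intro u _ hu
      by_cases hm : u⁻¹ * y ∈ Φ.parabolicSubgroup Θ
      · have : wordFun Q X J u = 0 := by
          by_contra hn
          have h1 := (hs u hn).resolve_left hu
          have h2 := b.cosetLength_le Θ u
          have h3 := hcl u y hm
          omega
        rw [this, zero_mul]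
      · rw [pointFun, if_neg hm, smul_zero, mul_zero]
    · simp
  · rw [wordOp_apply] at hw
    obtain ⟨u, -, hu⟩ := Finset.exists_ne_zero_of_sum_ne_zero hw
    have hm : u⁻¹ * w ∈ Φ.parabolicSubgroup Θ := by
      by_contra hm
      exact hu (by rw [pointFun, if_neg hm, smul_zero, mul_zero])
    rcases hs u (left_ne_zero_of_mul hu) with rfl | hlt
    · exact Or.inl hm
    · right
      have := b.cosetLength_le Θ u
      rw [hcl u w hm]
      omega

/-- The value of an invariant integral function at an element that is maximal in its support. -/
theorem IsRootRing.exists_apply_eq [Fintype Φ.weylGroup] {f : Φ.weylGroup → Q}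
    (hf : f ∈ integralFunctions Q X b)
    (hfr : ∀ w, ∀ u ∈ Φ.parabolicSubgroup Θ, f (w * u) = f w) {y : Φ.weylGroup}
    (hfy : ∀ w, f w ≠ 0 → b.cosetLength Θ w ≤ b.cosetLength Θ y) :
    ∃ c ∈ (algebraMap S Q).range, f y = c * algebraMap S Q
        (∏ j with ¬ b.IsPos j ∧ ¬ b.IsPos (Φ.weylGroupToPerm y⁻¹ j) ∧
          Φ.root (Φ.weylGroupToPerm y⁻¹ j) ∉ Submodule.span ℤ (Φ.root '' Θ), X j) := by
  -- Pass to the longest element t of the coset and pair f, translated by w₀, with a reduced word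
  -- for t w₀⁻¹. Any other w in the support of this word is shorter than t w₀⁻¹, so w w₀ is longer
  -- than t, and there f vanishes. The pairing is thus f(y) times the leading coefficient, the
  -- inverse of the product of x over the inversions.
  obtain ⟨u, hu, ht⟩ := b.exists_mul_mem_isNeg hΘ y
  set t := y * u with ht'
  obtain ⟨w₀, hw₀⟩ := b.exists_longest
  obtain ⟨K, hK⟩ := b.exists_wordProd_eq w₀
  obtain ⟨I, hI, hIl⟩ := b.exists_reduced_word (t * w₀⁻¹)
  rw [← hI] at hIl
  obtain ⟨hv, hs⟩ := h.wordFun_reduced hIl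
  have hmem : ∑ w, wordFun Q X I w * f (w * w₀) ∈ (algebraMap S Q).range := by
    have := h.translate_mem_integral hf K I
    rwa [hK] at this
  have hfy' (w) (hw : f w ≠ 0) : b.length w ≤ b.length t := by
    refine b.length_le_of_cosetLength_le ht ((hfy w hw).trans ?_)
    rw [ht', b.cosetLength_mul hΘ y hu]
  have hl := b.length_mul_longest hw₀
  rw [Finset.sum_eq_single (t * w₀⁻¹)] at hmem
  · rw [inv_mul_cancel_right, ht', hfr y u hu, ← ht', ← hI, hv, hI] at hmem
    obtain ⟨c, hc⟩ := hmem
    have hfc : f y = algebraMap S Q c * algebraMap S Q (∏ i ∈ b.inversions (t * w₀⁻¹), X i) := by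
      rw [hc, map_prod, mul_right_comm, ← Finset.prod_mul_distrib, Finset.prod_congr rfl
        (fun i _ => h.inv_mul i), Finset.prod_const_one, one_mul]
    -- The negatives of the roots in the left product are inversions of t w₀⁻¹, and x_α and x_{-α}
    -- divide each other.
    have hdvd : (∏ j with ¬ b.IsPos j ∧ ¬ b.IsPos (Φ.weylGroupToPerm y⁻¹ j) ∧
          Φ.root (Φ.weylGroupToPerm y⁻¹ j) ∉ Submodule.span ℤ (Φ.root '' Θ), X j) ∣
        ∏ i ∈ b.inversions (t * w₀⁻¹), X i := by
      have hinj : Function.Injective fun i => Φ.reflectionPerm i i := fun i j hij => by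
        have := congrArg (fun i => Φ.reflectionPerm i i) hij
        simpa only [neg_neg_index] using this
      refine (Finset.prod_dvd_prod_of_dvd _ _ fun j _ => h.dvd_neg j).trans ?_
      rw [← Finset.prod_image (g := fun i => Φ.reflectionPerm i i) (f := X) hinj.injOn]
      refine Finset.prod_dvd_prod_of_subset _ _ _ fun k hk => ?_
      obtain ⟨j, hj, rfl⟩ := Finset.mem_image.1 hk
      obtain ⟨h1, h2, h3⟩ := (Finset.mem_filter_univ _).1 hj
      rw [b.mem_inversions, b.isPos_neg, b.isPos_perm_neg, not_not]
      refine ⟨h1, ?_⟩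
      rw [mul_inv_rev, inv_inv, map_mul, Equiv.Perm.mul_apply, hw₀, ht', mul_inv_rev, map_mul,
        Equiv.Perm.mul_apply, b.perm_isPos_of_notMem_span hΘ (inv_mem hu) h3]
      exact h2
    obtain ⟨d, hd⟩ := hdvd
    exact ⟨algebraMap S Q c * algebraMap S Q d, ⟨c * d, map_mul _ _ _⟩, by
      rw [hfc, hd, map_mul]; ring⟩
  · intro w _ hw
    by_contra hn
    have h1 := hs w (left_ne_zero_of_mul hn)
    rw [hI] at h1
    have h2 := h1.resolve_left hw
    have h3 := hfy' _ (right_ne_zero_of_mul hn)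
    have h4 := hl w
    have h5 := hl (t * w₀⁻¹)
    rw [inv_mul_cancel_right] at h5
    omega
  · simp

/-- The invariant integral functions are generated by the class of the base point. -/
theorem IsRootRing.mem_of_pointFun_mem [Fintype Φ.weylGroup]
    (hpt : pointFun Q X b Θ ∈ integralFunctions Q X b)
    {T : AddSubgroup (Φ.weylGroup → Q)} (hT : pointFun Q X b Θ ∈ T)
    (hTs : ∀ q ∈ (algebraMap S Q).range, ∀ f ∈ T, (fun w => q * f w) ∈ T)
    (hTi : ∀ i : b.support, ∀ f ∈ T, pushPullFun Q X i f ∈ T) {f : Φ.weylGroup → Q}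
    (hf : f ∈ integralFunctions Q X b)
    (hfr : ∀ w, ∀ u ∈ Φ.parabolicSubgroup Θ, f (w * u) = f w) : f ∈ T := by
  have hop (J : List b.support) : wordOp Q X J (pointFun Q X b Θ) ∈ T ∧
      wordOp Q X J (pointFun Q X b Θ) ∈ integralFunctions Q X b ∧
      ∀ w, ∀ u ∈ Φ.parabolicSubgroup Θ, wordOp Q X J (pointFun Q X b Θ) (w * u) =
        wordOp Q X J (pointFun Q X b Θ) w := by
    induction J with
    | nil =>
      refine ⟨hT, hpt, fun w u hu => ?_⟩
      simp only [wordOp, pointFun, Subgroup.mul_mem_cancel_right _ hu]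
    | cons i J ih =>
      exact ⟨hTi i _ ih.1, h.pushPullFun_mem ih.2.1 i, fun w u hu =>
        pushPullFun_mul_right (i : ι) (fun w => ih.2.2 w u hu) w⟩
  -- Double induction: `n` bounds the coset lengths in the support, and `k` the number of group
  -- elements in the support at the top level. Subtracting an S-multiple of a word applied to the
  -- class of the base point removes one coset from that level and otherwise changes f only at
  -- smaller coset length.
  have key : ∀ n k : ℕ, ∀ f ∈ integralFunctions Q X b,
      (∀ w, ∀ u ∈ Φ.parabolicSubgroup Θ, f (w * u) = f w) →
      (∀ w, f w ≠ 0 → b.cosetLength Θ w < n) →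
      ({w | f w ≠ 0 ∧ b.cosetLength Θ w + 1 = n} : Finset Φ.weylGroup).card ≤ k → f ∈ T := by
    intro n
    induction n with
    | zero =>
      intro k f _ _ h0 _
      have : f = 0 := by
        funext w
        by_contra hw
        exact absurd (h0 w hw) (Nat.not_lt_zero _)
      rw [this]
      exact zero_mem _
    | succ n ihn =>
      intro k
      induction k with
      | zero =>
        intro f hf hfr hfn hfk
        refine ihn _ f hf hfr (fun w hw => ?_) le_rfl
        have h1 := hfn w hw
        have h2 : b.cosetLength Θ w + 1 ≠ n + 1 := by
          intro e
          rw [Nat.le_zero, Finset.card_eq_zero, Finset.filter_eq_empty_iff] at hfk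
          exact hfk (Finset.mem_univ w) ⟨hw, e⟩
        omega
      | succ k ihk =>
        intro f hf hfr hfn hfk
        by_cases hex : ∃ w, f w ≠ 0 ∧ b.cosetLength Θ w + 1 = n + 1
        swap
        · refine ihk f hf hfr hfn ?_
          rw [Finset.card_eq_zero.2]
          · exact Nat.zero_le _
          · rw [Finset.filter_eq_empty_iff]
            exact fun w _ hw => hex ⟨w, hw⟩
        obtain ⟨w, hw, hwn⟩ := hex
        obtain ⟨u, hu, hy⟩ := b.exists_mul_mem_isPos hΘ w
        set y := w * u with hyw
        have hyn : b.cosetLength Θ y = n := by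
          rw [hyw, b.cosetLength_mul hΘ w hu]; omega
        have hfy : f y ≠ 0 := by rw [hyw, hfr w u hu]; exact hw
        obtain ⟨J, hJ1, hJ2⟩ := h.wordOp_pointFun hΘ hy
        obtain ⟨c, hc, hfc⟩ := h.exists_apply_eq hΘ hf hfr (y := y) (fun w hw => by
          have := hfn w hw; omega)
        obtain ⟨o1, o2, o3⟩ := hop J
        set g : Φ.weylGroup → Q := fun w => c * wordOp Q X J (pointFun Q X b Θ) w with hg
        have hgT : g ∈ T := hTs c hc _ o1
        have hgi : g ∈ integralFunctions Q X b := mul_mem_integral_of_mem_range hc o2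
        have hgr : ∀ w, ∀ u ∈ Φ.parabolicSubgroup Θ, g (w * u) = g w := fun w u hu => by
          simp only [hg, o3 w u hu]
        have hgy : g y = f y := by rw [hfc, hg]; simp only [hJ1]
        have hgs (w) (hw : g w ≠ 0) : y⁻¹ * w ∈ Φ.parabolicSubgroup Θ ∨ b.cosetLength Θ w < n := by
          rw [← hyn]
          exact hJ2 w (right_ne_zero_of_mul hw)
        have hfg (w) (hw : y⁻¹ * w ∈ Φ.parabolicSubgroup Θ) : f w - g w = 0 := by
          have e : w = y * (y⁻¹ * w) := by group
          rw [e, hfr _ _ hw, hgr _ _ hw, hgy, sub_self]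
        have := ihk (f - g) (sub_mem hf hgi) (fun w u hu => by
            rw [Pi.sub_apply, Pi.sub_apply, hfr w u hu, hgr w u hu])
          (fun w hw => by
            by_cases hfw : f w = 0
            · have hgw : g w ≠ 0 := by
                intro h0; exact hw (by rw [Pi.sub_apply, hfw, h0, sub_self])
              rcases hgs w hgw with h1 | h1
              · exact absurd (hfg w h1) hw
              · omega
            · exact hfn w hfw) (by
            refine Nat.le_of_lt_succ (lt_of_lt_of_le (Finset.card_lt_card ?_) hfk)
            refine (Finset.ssubset_iff_of_subset fun w hw => ?_).2 ⟨y, ?_, ?_⟩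
            · simp only [Finset.mem_filter, Finset.mem_univ, true_and] at hw ⊢
              refine ⟨fun hfw => ?_, hw.2⟩
              have hgw : g w ≠ 0 := by
                intro h0; exact hw.1 (by rw [Pi.sub_apply, hfw, h0, sub_self])
              rcases hgs w hgw with h1 | h1
              · exact hw.1 (hfg w h1)
              · omega
            · simp only [Finset.mem_filter, Finset.mem_univ, true_and]
              exact ⟨hfy, by omega⟩
            · simp only [Finset.mem_filter, Finset.mem_univ, true_and]
              exact fun hh => hh.1 (hfg y (by rw [inv_mul_cancel]; exact one_mem _)))
        have := add_mem this hgT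
        rwa [sub_add_cancel] at this
  exact key (Finset.univ.sup (b.cosetLength Θ) + 1) _ f hf hfr
    (fun w _ => Nat.lt_succ_of_le (Finset.le_sup (f := b.cosetLength Θ) (Finset.mem_univ w))) le_rfl

end Generation

end RootPairing

end

/-! ### The duals as integral functions; the class of the base point in them -/

noncomputable section

namespace TwistedGroupAlgebra

open SkewMonoidAlgebra

variable {W Q Y : Type*} [Group W] [CommRing Q] [MulSemiringAction W Q] [MulAction W Y]

theorem zero_odot (f : Y → Q) : (0 : SkewMonoidAlgebra Q W) • f = 0 := by
  have := sub_smul (1 : SkewMonoidAlgebra Q W) 1 f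
  rw [sub_self] at this
  rw [← sub_self ((1 : SkewMonoidAlgebra Q W) • f), ← this]

/-- The pairing of the twisted group algebra with functions on the group. -/
def groupPair [Fintype W] (g : W → Q) : SkewMonoidAlgebra Q W →+ Q :=
  AddMonoidHom.mk' (fun z => ∑ w, z.coeff w * g w) fun y z => by
    simp only [coeff_add, Finsupp.add_apply, add_mul, Finset.sum_add_distrib]

omit [Group W] [MulSemiringAction W Q] in
theorem groupPair_apply [Fintype W] (g : W → Q) (z : SkewMonoidAlgebra Q W) :
    groupPair g z = ∑ w, z.coeff w * g w := rfl

omit [Group W] [MulSemiringAction W Q] in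
theorem groupPair_single [Fintype W] (g : W → Q) (w : W) (q : Q) :
    groupPair g (single w q) = q * g w := by
  classical
  rw [groupPair_apply, Finset.sum_eq_single w]
  · rw [coeff_single, Finsupp.single_eq_same]
  · intro u _ hu
    rw [coeff_single, Finsupp.single_eq_of_ne hu, zero_mul]
  · simp

theorem groupPair_mul_single [Fintype W] (g : W → Q) (z : SkewMonoidAlgebra Q W) (u : W) (q : Q) :
    groupPair g (z * single u q) = groupPair (fun w => w • q * g (w * u)) z := by
  have : (groupPair g).comp (AddMonoidHom.mulRight (single u q)) =
      groupPair (fun w => w • q * g (w * u)) :=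
    SkewMonoidAlgebra.addHom_ext fun w p => by
      change groupPair g (single w p * single u q) = _
      rw [single_mul_single, groupPair_single, groupPair_single, mul_assoc]
  exact congrArg (fun f => f z) this

omit [MulSemiringAction W Q] in
theorem pair_project [Fintype W] (f : Y → Q) (o : Y) (z : SkewMonoidAlgebra Q W) :
    pair f (project o z) = groupPair (fun w => f (w • o)) z := by
  have : (pair f).toAddMonoidHom.comp (project (W := W) o).toAddMonoidHom =
      groupPair (fun w => f (w • o)) :=
    SkewMonoidAlgebra.addHom_ext fun w p => by
      change pair f (project o (single w p)) = _
      rw [groupPair_single]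
      simp [project, pair, coeffLinearEquiv, coeffAddEquiv]
  exact congrArg (fun f => f z) this

variable {S : Type*} [CommRing S] [Algebra S Q]

/-- As S embeds into Q, a functional with values in S is determined by its values in Q. It therefore
exists as soon as the pairing is integral, and its linearity is inherited. -/
theorem mem_dual_iff (hS : Function.Injective (algebraMap S Q))
    (D : Subring (SkewMonoidAlgebra Q W)) (o : Y) (f : Y → Q) :
    f ∈ dual S D o ↔ ∀ d ∈ D, pair f (project o d) ∈ (algebraMap S Q).range := by
  constructor
  · rintro ⟨ψ, hψ⟩ d hd
    exact ⟨_, hψ ⟨project o d, Submodule.subset_span ⟨d, hd, rfl⟩⟩⟩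
  · intro h
    have hs (s : S) (m : Y →₀ Q) : pair f (s • m) = algebraMap S Q s * pair f m := by
      rw [← algebraMap_smul Q s m, map_smul, smul_eq_mul]
    have h' (m : imageModule S D o) : ∃ s, algebraMap S Q s = pair f (m : Y →₀ Q) := by
      obtain ⟨m, hm⟩ := m
      simp only
      unfold imageModule at hm
      induction hm using Submodule.span_induction with
      | mem m hm => obtain ⟨d, hd, rfl⟩ := hm; exact h d hd
      | zero => exact ⟨0, by rw [map_zero, map_zero]⟩
      | add m n _ _ hm hn =>
        obtain ⟨s, hs⟩ := hm
        obtain ⟨t, ht⟩ := hn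
        exact ⟨s + t, by rw [map_add, map_add, hs, ht]⟩
      | smul c m _ hm =>
        obtain ⟨s, hs'⟩ := hm
        exact ⟨c * s, by rw [map_mul, hs, hs']⟩
    choose ψ hψ using h'
    exact ⟨{ toFun := ψ
             map_add' := fun m n => hS (by
               rw [map_add, hψ, hψ, hψ, Submodule.coe_add, map_add])
             map_smul' := fun c m => hS (by
               rw [RingHom.id_apply, smul_eq_mul, map_mul, hψ, hψ, Submodule.coe_smul, hs]) }, hψ⟩

end TwistedGroupAlgebra

namespace RootPairing

open FormalGroupAlgebra SkewMonoidAlgebra TwistedGroupAlgebra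

variable {ι R M N : Type*} [CommRing R] [AddCommGroup M] [AddCommGroup N] {F : FormalGroup R}
  {Φ : RootDatum ι M N} {v : Version F}

/-- The elements attached to the roots. -/
abbrev xRoot (Φ : RootDatum ι M N) (v : Version F) (i : ι) : FormalGroupAlgebra v M :=
  x v (Φ.root i)

variable (h : IsRootRing Φ (Φ.RootLocalization v) (xRoot Φ v)) (b : Φ.Base)

section

include h

theorem IsRootRing.invX_eq (i : ι) :
    Φ.invX v i = IsRootRing.inv (Φ.RootLocalization v) (xRoot Φ v) i := by
  refine h.eq_inv ?_
  rw [invX, ← Localization.mk_one_eq_algebraMap, Localization.mk_mul, one_mul, mul_one]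
  exact Localization.mk_self ⟨x v (Φ.root i), Φ.x_root_mem v i⟩

theorem IsRootRing.pushPull_eq (i : ι) : Φ.pushPull v i =
    single 1 (IsRootRing.inv (Φ.RootLocalization v) (xRoot Φ v) (Φ.reflectionPerm i i)) +
      single (weylGroup.ofIdx Φ i) (IsRootRing.inv (Φ.RootLocalization v) (xRoot Φ v) i) := by
  rw [pushPull, h.invX_eq, h.invX_eq]

end

theorem single_algebraMap_mem (s : FormalGroupAlgebra v M) :
    (single 1 (algebraMap _ (Φ.RootLocalization v) s) : Φ.TwistedAlgebra v) ∈
      b.demazureAlgebra v := Subring.subset_closure (Or.inl ⟨s, rfl⟩)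

theorem pushPull_mem {i : ι} (hi : i ∈ b.support) : Φ.pushPull v i ∈ b.demazureAlgebra v :=
  Subring.subset_closure (Or.inr ⟨i, hi, rfl⟩)

section

include h

/-- δ_s is x_α times the push-pull element minus x_α/x_{-α}, and the latter lies in S. -/
theorem IsRootRing.single_ofIdx_mem {i : ι} (hi : i ∈ b.support) :
    (single (weylGroup.ofIdx Φ i) 1 : Φ.TwistedAlgebra v) ∈ b.demazureAlgebra v := by
  have hxu : algebraMap _ (Φ.RootLocalization v) (xRoot Φ v i) *
      IsRootRing.inv (Φ.RootLocalization v) (xRoot Φ v) (Φ.reflectionPerm i i) ∈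
        (algebraMap (FormalGroupAlgebra v M) (Φ.RootLocalization v)).range := by
    have := sub_mem (mul_mem (RingHom.mem_range_self _ (xRoot Φ v i)) (h.inv_add_inv_mem i)) (one_mem _)
    rw [mul_add, h.mul_inv, add_sub_cancel_left] at this
    exact this
  obtain ⟨s, hs⟩ := hxu
  have key := sub_mem (mul_mem (single_algebraMap_mem b (xRoot Φ v i)) (pushPull_mem b hi))
    (single_algebraMap_mem b s)
  convert key using 1
  rw [h.pushPull_eq, mul_add, single_mul_single, single_mul_single, hs, one_smul, one_smul,
    one_mul, one_mul, add_sub_cancel_left, h.mul_inv]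

variable [Finite ι] [Φ.IsReduced]

theorem IsRootRing.single_mem (w : Φ.weylGroup) :
    (single w 1 : Φ.TwistedAlgebra v) ∈ b.demazureAlgebra v := by
  have := Fintype.ofFinite ι
  obtain ⟨I, rfl⟩ := b.exists_wordProd_eq w
  induction I with
  | nil => rw [b.wordProd_nil, ← SkewMonoidAlgebra.one_def]; exact one_mem _
  | cons i I ih =>
    have := mul_mem (h.single_ofIdx_mem b i.2) ih
    rwa [single_mul_single, smul_one, one_mul, ← b.wordProd_cons] at this

end

variable (v) in
/-- The product of the push-pull elements of a word. -/
def wordElement {b : Φ.Base} (I : List b.support) : Φ.TwistedAlgebra v :=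
  (I.map fun i : b.support => Φ.pushPull v (i : ι)).prod

theorem wordElement_mem {b : Φ.Base} (I : List b.support) : wordElement v I ∈ b.demazureAlgebra v :=
  list_prod_mem fun z hz => by
    obtain ⟨i, -, rfl⟩ := List.mem_map.1 hz
    exact pushPull_mem b i.2

include h in
theorem IsRootRing.coeff_wordElement {b : Φ.Base} (I : List b.support) (w : Φ.weylGroup) :
    (wordElement v I).coeff w = wordFun (Φ.RootLocalization v) (xRoot Φ v) I w := by
  classical
  induction I generalizing w with
  | nil =>
    change (1 : Φ.TwistedAlgebra v).coeff w = _
    simp only [wordFun, coeff_one, Finsupp.single_apply, Pi.single_apply, eq_comm]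
  | cons i I ih =>
    change (Φ.pushPull v i * wordElement v I).coeff w = _
    rw [h.pushPull_eq, add_mul, coeff_add, Finsupp.add_apply, coeff_single_mul, coeff_single_mul, ih,
      ih]
    simp only [wordFun, pushPullFun, inv_one, one_mul, one_smul, ofIdx_inv]

section Dual

variable [Fintype Φ.weylGroup]

include h

/-- Right multiplication by the generators of the algebra is transposed to `divided` and to
multiplication by w ↦ w(s). Both preserve the integral functions, so words in push-pull elements
alone suffice as test elements. -/
theorem IsRootRing.groupPair_mem_iff (g : Φ.weylGroup → Φ.RootLocalization v) :
    (∀ d ∈ b.demazureAlgebra v, groupPair g d ∈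
      (algebraMap (FormalGroupAlgebra v M) (Φ.RootLocalization v)).range) ↔
      g ∈ integralFunctions (Φ.RootLocalization v) (xRoot Φ v) b := by
  constructor
  · intro hg I
    have := hg _ (wordElement_mem I)
    rw [groupPair_apply] at this
    simpa only [h.coeff_wordElement] using this
  · intro hg d hd
    -- The left factor `z` and the function are kept general, so that the statement is closed under
    -- products in `d`.
    have key : ∀ z : Φ.TwistedAlgebra v, (∀ g ∈ integralFunctions (Φ.RootLocalization v)
        (xRoot Φ v) b, groupPair g z ∈
          (algebraMap (FormalGroupAlgebra v M) (Φ.RootLocalization v)).range) →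
        ∀ g ∈ integralFunctions (Φ.RootLocalization v) (xRoot Φ v) b, groupPair g (z * d) ∈
          (algebraMap (FormalGroupAlgebra v M) (Φ.RootLocalization v)).range := by
      unfold Base.demazureAlgebra at hd
      induction hd using Subring.closure_induction with
      | mem d hd =>
        intro z hz g hg
        rcases hd with ⟨s, rfl⟩ | ⟨i, hi, rfl⟩
        · dsimp only
          rw [groupPair_mul_single]
          simp only [mul_one]
          exact hz _ (h.smul_mul_mem_integral ⟨s, rfl⟩ hg)
        · rw [h.pushPull_eq, mul_add, map_add, groupPair_mul_single, groupPair_mul_single]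
          have := hz _ (divided_mem hg ⟨i, hi⟩)
          convert this using 1
          rw [groupPair_apply, groupPair_apply, groupPair_apply, ← Finset.sum_add_distrib]
          refine Finset.sum_congr rfl fun w _ => ?_
          simp only [divided, mul_one, mul_add]
      | zero => intro z _ g _; rw [mul_zero, map_zero]; exact zero_mem _
      | one => intro z hz g hg; rw [mul_one]; exact hz g hg
      | add d e _ _ hd he =>
        intro z hz g hg
        rw [mul_add, map_add]
        exact add_mem (hd z hz g hg) (he z hz g hg)
      | neg d _ hd =>
        intro z hz g hg
        have e : z * -d = -(z * d) := mul_neg z d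
        rw [e, map_neg]
        exact neg_mem (hd z hz g hg)
      | mul d e _ _ hd he =>
        intro z hz g hg
        rw [← mul_assoc]
        exact he _ (hd z hz) g hg
    have := key 1 (fun g hg => by
      rw [SkewMonoidAlgebra.one_def, groupPair_single, one_mul]; exact apply_one_mem hg) g hg
    rwa [one_mul] at this

theorem IsRootRing.mem_dualParabolic_iff {Θ : Set ι}
    (f : Φ.weylGroup ⧸ Φ.parabolicSubgroup Θ → Φ.RootLocalization v) :
    f ∈ b.dualParabolic v Θ ↔ (fun w : Φ.weylGroup => f w) ∈
      integralFunctions (Φ.RootLocalization v) (xRoot Φ v) b := by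
  rw [Base.dualParabolic, mem_dual_iff h.injective, ← h.groupPair_mem_iff b]
  refine forall₂_congr fun d _ => ?_
  rw [pair_project]
  simp only [MulAction.Quotient.smul_coe, smul_eq_mul, mul_one]

theorem IsRootRing.mem_dualFull_iff (f : Φ.weylGroup → Φ.RootLocalization v) :
    f ∈ b.dualFull v ↔ f ∈ integralFunctions (Φ.RootLocalization v) (xRoot Φ v) b := by
  rw [Base.dualFull, mem_dual_iff h.injective, ← h.groupPair_mem_iff b]
  refine forall₂_congr fun d _ => ?_
  rw [pair_project]
  simp only [smul_eq_mul, mul_one]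

omit [Fintype Φ.weylGroup] in
theorem IsRootRing.pushPull_smul_apply {Θ : Set ι} (i : ι)
    (f : Φ.weylGroup ⧸ Φ.parabolicSubgroup Θ → Φ.RootLocalization v) (w : Φ.weylGroup) :
    (Φ.pushPull v i • f) (w : Φ.weylGroup ⧸ Φ.parabolicSubgroup Θ) =
      pushPullFun (Φ.RootLocalization v) (xRoot Φ v) i (fun w : Φ.weylGroup => f w) w := by
  rw [h.pushPull_eq, add_smul, Pi.add_apply, odot_single, odot_single]
  simp only [pushPullFun, inv_one, one_smul, ofIdx_inv, MulAction.Quotient.smul_coe, smul_eq_mul]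

theorem IsRootRing.smul_mem_dualParabolic {Θ : Set ι} {d : Φ.TwistedAlgebra v}
    (hd : d ∈ b.demazureAlgebra v)
    {f : Φ.weylGroup ⧸ Φ.parabolicSubgroup Θ → Φ.RootLocalization v}
    (hf : f ∈ b.dualParabolic v Θ) : d • f ∈ b.dualParabolic v Θ := by
  unfold Base.demazureAlgebra at hd
  induction hd using Subring.closure_induction generalizing f with
  | mem d hd =>
    rw [h.mem_dualParabolic_iff] at hf ⊢
    rcases hd with ⟨s, rfl⟩ | ⟨i, hi, rfl⟩
    · convert mul_mem_integral_of_mem_range (b := b) (X := xRoot Φ v) ⟨s, rfl⟩ hf using 1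
      funext w
      simp only [odot_single, inv_one, one_smul]
    · convert h.pushPullFun_mem hf ⟨i, hi⟩ using 1
      funext w
      exact h.pushPull_smul_apply i f w
  | zero =>
    have e : (0 : Φ.TwistedAlgebra v) • f = 0 := zero_odot f
    rw [h.mem_dualParabolic_iff, e]
    exact zero_mem _
  | one => rwa [one_smul]
  | add d e _ _ hd he =>
    have h1 := hd hf
    have h2 := he hf
    rw [h.mem_dualParabolic_iff] at h1 h2 ⊢
    rw [add_smul]
    exact add_mem h1 h2
  | neg d _ hd =>
    have h1 := hd hf
    rw [h.mem_dualParabolic_iff] at h1 ⊢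
    have e : (-d) • f = -(d • f) := neg_smul d f
    rw [e]
    exact neg_mem h1
  | mul d e _ _ hd he =>
    rw [mul_smul]
    exact hd (he hf)

end Dual

section PointClass

variable [Fintype ι] [Φ.IsReduced] {b} {Θ : Set ι} (hΘ : Θ ⊆ b.support)

omit [Φ.IsReduced] in
theorem pointClass_apply (w : Φ.weylGroup) :
    b.pointClass v Θ (w : Φ.weylGroup ⧸ Φ.parabolicSubgroup Θ) =
      pointFun (Φ.RootLocalization v) (xRoot Φ v) b Θ w := by
  classical
  rw [Base.pointClass, Pi.single_apply, pointFun]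
  congr 1
  rw [QuotientGroup.eq, mul_one, inv_mem_iff]

include hΘ in
-- The parabolic subgroup permutes the negative roots outside of its subsystem.
theorem smul_pointFactor {w : Φ.weylGroup} (hw : w ∈ Φ.parabolicSubgroup Θ) :
    w • b.pointFactor v Θ = b.pointFactor v Θ := by
  classical
  rw [Base.pointFactor, Finset.smul_prod']
  refine Finset.prod_equiv (Φ.weylGroupToPerm w) (fun i => ?_) fun i _ =>
    (smul_x v w (Φ.root i)).trans (by rw [weylGroup_apply_root])
  simp only [Finset.mem_filter, Finset.mem_univ, true_and, Base.perm_mem_span_iff hw]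
  by_cases hs : Φ.root i ∈ Submodule.span ℤ (Φ.root '' Θ)
  · exact iff_of_false (fun h => h.2 hs) (fun h => h.2 hs)
  · rw [b.perm_isPos_of_notMem_span hΘ hw hs]

omit [Φ.IsReduced] in
theorem single_smul_pointClass_apply (w u : Φ.weylGroup) :
    ((single w 1 : Φ.TwistedAlgebra v) • b.pointClass v Θ)
      (u : Φ.weylGroup ⧸ Φ.parabolicSubgroup Θ) =
      w • pointFun (Φ.RootLocalization v) (xRoot Φ v) b Θ (w⁻¹ * u) := by
  rw [odot_single, one_mul, ← pointClass_apply]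
  rfl

include h hΘ

theorem IsRootRing.single_smul_pointClass_of_mem {w : Φ.weylGroup}
    (hw : w ∈ Φ.parabolicSubgroup Θ) :
    (single w 1 : Φ.TwistedAlgebra v) • b.pointClass v Θ = b.pointClass v Θ := by
  funext u
  obtain ⟨u, rfl⟩ := QuotientGroup.mk_surjective u
  rw [single_smul_pointClass_apply, pointClass_apply, pointFun, pointFun,
    Subgroup.mul_mem_cancel_left _ (inv_mem hw)]
  split_ifs with hu
  · rw [h.smul_algebraMap]
    exact congrArg _ (smul_pointFactor hΘ hw)
  · exact smul_zero w

theorem IsRootRing.pointFun_mem [F.IsComm] [Fintype Φ.weylGroup] :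
    pointFun (Φ.RootLocalization v) (xRoot Φ v) b Θ ∈
      integralFunctions (Φ.RootLocalization v) (xRoot Φ v) b := by
  classical
  intro I
  obtain ⟨s, hs⟩ := exists_pointFactor_mul_sum_wordFun_eq b v h.regular hΘ I
  refine ⟨s, ?_⟩
  rw [← hs, Finset.mul_sum, Finset.sum_filter]
  refine Finset.sum_congr rfl fun w _ => ?_
  rw [pointFun]
  split_ifs
  · rw [mul_comm]; rfl
  · rw [mul_zero]

theorem IsRootRing.pointClass_mem [F.IsComm] [Fintype Φ.weylGroup] :
    b.pointClass v Θ ∈ b.dualParabolic v Θ := by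
  rw [h.mem_dualParabolic_iff]
  simp only [pointClass_apply]
  exact h.pointFun_mem hΘ

/-- The multiples of the class by elements of the algebra, pulled back to W, form a group stable
under S and the push-pull operators. So `mem_of_pointFun_mem` applies to it. -/
theorem IsRootRing.exists_smul_pointClass_eq [F.IsComm] [Fintype Φ.weylGroup]
    {f : Φ.weylGroup ⧸ Φ.parabolicSubgroup Θ → Φ.RootLocalization v}
    (hf : f ∈ b.dualParabolic v Θ) : ∃ d ∈ b.demazureAlgebra v, f = d • b.pointClass v Θ := by
  let T : AddSubgroup (Φ.weylGroup → Φ.RootLocalization v) :=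
    { carrier := {g | ∃ d ∈ b.demazureAlgebra v, ∀ w : Φ.weylGroup,
        g w = (d • b.pointClass v Θ) (w : Φ.weylGroup ⧸ Φ.parabolicSubgroup Θ)}
      zero_mem' := ⟨0, zero_mem _, fun w => by
        have e : (0 : Φ.TwistedAlgebra v) • b.pointClass v Θ = 0 := zero_odot _
        rw [e]; rfl⟩
      add_mem' := by
        rintro f g ⟨d, hd, hf⟩ ⟨e, he, hg⟩
        exact ⟨d + e, add_mem hd he, fun w => by rw [add_smul, Pi.add_apply, Pi.add_apply, hf, hg]⟩
      neg_mem' := by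
        rintro f ⟨d, hd, hf⟩
        have e : (-d) • b.pointClass v Θ = -(d • b.pointClass v Θ) := neg_smul _ _
        exact ⟨-d, neg_mem hd, fun w => by rw [e, Pi.neg_apply, Pi.neg_apply, hf]⟩ }
  have hfT := h.mem_of_pointFun_mem hΘ (T := T) (h.pointFun_mem hΘ)
    ⟨1, one_mem _, fun w => by rw [one_smul, pointClass_apply]⟩
    (by
      rintro _ ⟨s, rfl⟩ g ⟨d, hd, hg⟩
      refine ⟨single 1 (algebraMap _ _ s) * d, mul_mem (single_algebraMap_mem b s) hd,
        fun w => ?_⟩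
      change algebraMap _ _ s * g w = _
      rw [mul_smul, odot_single, hg, inv_one, one_smul, one_smul])
    (by
      rintro i g ⟨d, hd, hg⟩
      refine ⟨Φ.pushPull v i * d, mul_mem (pushPull_mem b i.2) hd, fun w => ?_⟩
      rw [mul_smul, h.pushPull_smul_apply]
      congr 1
      exact funext hg)
    ((h.mem_dualParabolic_iff b f).1 hf)
    (fun w u hu => congrArg f (QuotientGroup.mk_mul_of_mem w hu))
  obtain ⟨d, hd, hfd⟩ := hfT
  refine ⟨d, hd, ?_⟩
  funext u
  obtain ⟨u, rfl⟩ := QuotientGroup.mk_surjective u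
  exact hfd u

end PointClass

end RootPairing

end

/-! ### Homomorphisms as correspondences -/

noncomputable section

namespace TwistedGroupAlgebra

open SkewMonoidAlgebra

variable {W Q Y : Type*} [Group W] [CommRing Q] [MulSemiringAction W Q] [MulAction W Y]

theorem single_odot_mul (w : W) (f g : Y → Q) :
    (single w 1 : SkewMonoidAlgebra Q W) • (f * g) =
      (single w 1 : SkewMonoidAlgebra Q W) • f * (single w 1 : SkewMonoidAlgebra Q W) • g := by
  funext y
  simp only [odot_single, Pi.mul_apply, one_mul, smul_mul']

theorem single_odot_one (w : W) : (single w 1 : SkewMonoidAlgebra Q W) • (1 : Y → Q) = 1 := by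
  funext y
  rw [odot_single, Pi.one_apply, smul_one, one_mul, Pi.one_apply]

variable {H : Subgroup W}

/-- The translates of a function, indexed by the representatives of the left cosets of `H`. -/
def cosetTranslate (f : Y → Q) (u : W ⧸ H) : Y → Q := (single u.out 1 : SkewMonoidAlgebra Q W) • f

/-- Invariance under `H` makes the translate independent of the chosen representative of the coset.
This is why the classes of the fixed points are well defined. -/
theorem cosetTranslate_mk {f : Y → Q}
    (hf : ∀ w ∈ H, (single w 1 : SkewMonoidAlgebra Q W) • f = f) (w : W) :
    cosetTranslate f (w : W ⧸ H) = (single w 1 : SkewMonoidAlgebra Q W) • f := by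
  obtain ⟨k, hk⟩ := QuotientGroup.mk_out_eq_mul H w
  rw [cosetTranslate, hk]
  conv_rhs => rw [← hf k k.2, ← mul_smul, single_mul_single, smul_one, one_mul]

theorem cosetTranslate_one {f : Y → Q}
    (hf : ∀ w ∈ H, (single w 1 : SkewMonoidAlgebra Q W) • f = f) :
    cosetTranslate f ((1 : W) : W ⧸ H) = f := by
  rw [cosetTranslate_mk hf, ← SkewMonoidAlgebra.one_def, one_smul]

/-- The action on an `H`-invariant function is determined by the action on an `H`-invariant function
supported at the base point of `W / H`. -/
theorem odot_eq_sum [Fintype (W ⧸ H)] {f : Y → Q} {p : W ⧸ H → Q}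
    (hf : ∀ w ∈ H, (single w 1 : SkewMonoidAlgebra Q W) • f = f)
    (hp : ∀ w ∈ H, (single w 1 : SkewMonoidAlgebra Q W) • p = p)
    (hp1 : IsUnit (p (1 : W))) (hp0 : ∀ u, u ≠ ((1 : W) : W ⧸ H) → p u = 0)
    (z : SkewMonoidAlgebra Q W) (y : Y) :
    (z • f) y = ∑ u : W ⧸ H, cosetTranslate f u y * (z • p) u *
      Ring.inverse (cosetTranslate p u u) := by
  let E : SkewMonoidAlgebra Q W →+ Q := AddMonoidHom.mk' (fun z => (z • f) y) fun a b => by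
    rw [add_smul, Pi.add_apply]
  let E' : SkewMonoidAlgebra Q W →+ Q := AddMonoidHom.mk' (fun z => ∑ u : W ⧸ H,
      cosetTranslate f u y * (z • p) u * Ring.inverse (cosetTranslate p u u))
    fun a b => by
      simp only [add_smul, Pi.add_apply, mul_add, add_mul, Finset.sum_add_distrib]
  have hw (w : W) : w⁻¹ • (w : W ⧸ H) = ((1 : W) : W ⧸ H) := by
    rw [MulAction.Quotient.smul_coe, smul_eq_mul, inv_mul_cancel]
  -- Both sides are additive in z, so let z = q δ_w. Then z ⊙ p is supported at the coset of w, and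
  -- in the one remaining term w(p(ē)) cancels.
  have : E = E' := SkewMonoidAlgebra.addHom_ext fun w q => by
    change ((single w q : SkewMonoidAlgebra Q W) • f) y = ∑ u : W ⧸ H, _
    have hwp : IsUnit (w • p (1 : W)) := hp1.map (MulSemiringAction.toRingHom W Q w)
    rw [Finset.sum_eq_single (w : W ⧸ H)]
    · rw [cosetTranslate_mk hf, cosetTranslate_mk hp, odot_single w q p, odot_single w 1 p, hw,
        one_mul, mul_assoc, mul_assoc,
        Ring.mul_inverse_cancel _ hwp,
        odot_single, odot_single, one_mul, mul_one, mul_comm]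
    · intro u _ hu
      rw [odot_single w q p, hp0 _ fun e => hu ?_, smul_zero, mul_zero, mul_zero, zero_mul]
      rw [inv_smul_eq_iff] at e
      rw [e, MulAction.Quotient.smul_coe, smul_eq_mul, mul_one]
    · simp
  exact congrArg (fun T => T z) this

theorem hecke_single (w u : W) (f : W → Q) :
    hecke (single w 1 : SkewMonoidAlgebra Q W) f u = f (u * w) := by
  rw [hecke, SkewMonoidAlgebra.sum_single_index]
  · rw [smul_one, one_mul]
  · rw [smul_zero, zero_mul]

theorem odot_comp_mk (z : SkewMonoidAlgebra Q W) (f : W ⧸ H → Q) (u : W) :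
    (z • fun w : W => f w) u = (z • f) (u : W ⧸ H) := by
  let E : SkewMonoidAlgebra Q W →+ Q := AddMonoidHom.mk' (fun z => (z • fun w : W => f w) u)
    fun a b => by rw [add_smul, Pi.add_apply]
  let E' : SkewMonoidAlgebra Q W →+ Q := AddMonoidHom.mk' (fun z => (z • f) (u : W ⧸ H))
    fun a b => by rw [add_smul, Pi.add_apply]
  have : E = E' := SkewMonoidAlgebra.addHom_ext fun w q => by
    change ((single w q : SkewMonoidAlgebra Q W) • fun w : W => f w) u = _
    rw [odot_single]
    exact (odot_single w q f (u : W ⧸ H)).symm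
  exact congrArg (fun T => T z) this

section Correspondence

variable {D : Subring (SkewMonoidAlgebra Q W)} {DQ : Submodule D (W ⧸ H → Q)}
  {DP : Submodule D (Y → Q)} {p : W ⧸ H → Q} {A : Subring (Y → Q)}

/-- An `H`-invariant function supported at the base point of `W / H`, with a unit as its value, that
generates a module over a subring of the twisted group algebra. -/
structure IsGenerator (DQ : Submodule D (W ⧸ H → Q)) (p : W ⧸ H → Q) : Prop where
  single_mem (w : W) : single w 1 ∈ D
  mem : p ∈ DQ
  exists_smul_eq : ∀ f ∈ DQ, ∃ d ∈ D, f = d • p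
  single_smul : ∀ w ∈ H, (single w 1 : SkewMonoidAlgebra Q W) • p = p
  isUnit : IsUnit (p (1 : W))
  eq_zero : ∀ u, u ≠ ((1 : W) : W ⧸ H) → p u = 0

namespace IsGenerator

variable (h : IsGenerator DQ p)

/-- The translates of the generator. -/
def point (u : W ⧸ H) : DQ :=
  ⟨cosetTranslate p u, DQ.smul_mem ⟨_, h.single_mem u.out⟩ h.mem⟩

theorem coe_point (w : W) :
    (h.point w : W ⧸ H → Q) = (single w 1 : SkewMonoidAlgebra Q W) • p :=
  cosetTranslate_mk h.single_smul w

theorem coe_point_one : (h.point (1 : W) : W ⧸ H → Q) = p :=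
  cosetTranslate_one h.single_smul

instance {X : Type*} [MulAction W X] (E : Submodule D (X → Q)) : SMul D E := Submodule.smul E

theorem exists_smul_point_eq (f : DQ) : ∃ d : D, f = d • h.point (1 : W) := by
  obtain ⟨d, hd, hf⟩ := h.exists_smul_eq f f.2
  refine ⟨⟨d, hd⟩, Subtype.ext ?_⟩
  rw [hf, Submodule.coe_smul, h.coe_point_one]
  rfl

theorem point_eq_smul (w : W) :
    h.point w = (⟨single w 1, h.single_mem w⟩ : D) • h.point (1 : W) :=
  Subtype.ext (by rw [h.coe_point, Submodule.coe_smul, h.coe_point_one]; rfl)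

theorem map_point (φ : DQ →ₗ[D] DP) (w : W) :
    (φ (h.point w) : Y → Q) =
      (single w 1 : SkewMonoidAlgebra Q W) • (φ (h.point (1 : W)) : Y → Q) := by
  rw [h.point_eq_smul, map_smul]
  rfl

theorem single_smul_map_point_one (φ : DQ →ₗ[D] DP) (w : W) (hw : w ∈ H) :
    (single w 1 : SkewMonoidAlgebra Q W) • (φ (h.point (1 : W)) : Y → Q) =
      φ (h.point (1 : W)) := by
  rw [← h.map_point]
  congr 2
  refine Subtype.ext ?_
  rw [h.coe_point, h.coe_point_one, h.single_smul w hw]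

theorem map_point_eq_cosetTranslate (φ : DQ →ₗ[D] DP) (u : W ⧸ H) :
    (φ (h.point u) : Y → Q) = cosetTranslate (φ (h.point (1 : W)) : Y → Q) u := by
  obtain ⟨w, rfl⟩ := QuotientGroup.mk_surjective u
  rw [h.map_point, cosetTranslate_mk (h.single_smul_map_point_one φ)]

variable [Finite (W ⧸ H)]

include h in
theorem odot_eq_finsum {f : Y → Q} (hf : ∀ w ∈ H, (single w 1 : SkewMonoidAlgebra Q W) • f = f)
    (z : SkewMonoidAlgebra Q W) (y : Y) :
    (z • f) y = ∑ᶠ u : W ⧸ H, cosetTranslate f u y * (z • p) u *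
      Ring.inverse (cosetTranslate p u u) := by
  have := Fintype.ofFinite (W ⧸ H)
  rw [finsum_eq_sum_of_fintype]
  exact odot_eq_sum hf h.single_smul h.isUnit h.eq_zero z y

/-- Writing f as d ⊙ p gives φ(f) = d ⊙ φ(p), and φ(p) is `H`-invariant, so the fixed point formula
`odot_eq_sum` applies. -/
theorem map_apply (φ : DQ →ₗ[D] DP) (f : DQ) (y : Y) :
    (φ f : Y → Q) y = ∑ᶠ u : W ⧸ H, (φ (h.point u) : Y → Q) y * (f : W ⧸ H → Q) u *
      Ring.inverse ((h.point u : W ⧸ H → Q) u) := by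
  obtain ⟨d, rfl⟩ := h.exists_smul_point_eq f
  rw [map_smul]
  refine (h.odot_eq_finsum (h.single_smul_map_point_one φ) d y).trans (finsum_congr fun u => ?_)
  rw [h.map_point_eq_cosetTranslate φ u, Submodule.coe_smul, h.coe_point_one]
  rfl

variable (hA : ∀ a, a ∈ A ↔ a ∈ DP ∧ ∀ w ∈ H, (single w 1 : SkewMonoidAlgebra Q W) • a = a)

include h hA in
-- The left side depends only on the function d ⊙ p and not on d. Both the integrality and the
-- linearity of the correspondence are read off the right side.
theorem finsum_eq_smul (a : A) (d : D) : (fun y => ∑ᶠ u : W ⧸ H, cosetTranslate (a : Y → Q) u y *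
    ((d • h.point (1 : W) : DQ) : W ⧸ H → Q) u * Ring.inverse (cosetTranslate p u u)) =
      (d : SkewMonoidAlgebra Q W) • (a : Y → Q) := by
  funext y
  rw [h.odot_eq_finsum ((hA a).1 a.2).2, Submodule.coe_smul, h.coe_point_one]
  rfl

/-- The correspondence whose kernel consists of the translates of an invariant function. -/
def correspondence (a : A) : DQ →ₗ[D] DP where
  toFun f := ⟨fun y => ∑ᶠ u : W ⧸ H, cosetTranslate (a : Y → Q) u y * (f : W ⧸ H → Q) u *
      Ring.inverse (cosetTranslate p u u), by
    obtain ⟨d, rfl⟩ := h.exists_smul_point_eq f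
    rw [h.finsum_eq_smul hA]
    exact DP.smul_mem d ((hA a).1 a.2).1⟩
  map_add' f g := Subtype.ext <| funext fun y => by
    have := Fintype.ofFinite (W ⧸ H)
    simp only [finsum_eq_sum_of_fintype, Submodule.coe_add, Pi.add_apply, mul_add, add_mul,
      Finset.sum_add_distrib]
  map_smul' c f := Subtype.ext <| by
    obtain ⟨d, rfl⟩ := h.exists_smul_point_eq f
    have := h.finsum_eq_smul hA a (c * d)
    rw [mul_smul] at this
    refine (this.trans (mul_smul (c : SkewMonoidAlgebra Q W) (d : SkewMonoidAlgebra Q W) _)).trans ?_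
    exact congrArg (fun g : Y → Q => (c : SkewMonoidAlgebra Q W) • g) (h.finsum_eq_smul hA a d).symm

theorem correspondence_point_one (a : A) :
    (h.correspondence hA a (h.point (1 : W)) : Y → Q) = a := by
  have := h.finsum_eq_smul hA a 1
  rw [one_smul, Subring.coe_one, one_smul] at this
  exact this

/-- Homomorphisms are determined by the image of the generator, which can be any invariant
function. -/
def homEquiv : (DQ →ₗ[D] DP) ≃ A where
  toFun φ := ⟨φ (h.point (1 : W)), (hA _).2 ⟨(φ _).2, h.single_smul_map_point_one φ⟩⟩
  invFun := h.correspondence hA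
  left_inv φ := LinearMap.ext fun f => by
    obtain ⟨d, rfl⟩ := h.exists_smul_point_eq f
    rw [map_smul, map_smul]
    exact congrArg _ (Subtype.ext (h.correspondence_point_one hA _))
  right_inv a := Subtype.ext (h.correspondence_point_one hA a)

end IsGenerator

variable (H A) in
/-- The ring homomorphism from a ring of functions to the kernels of correspondences. -/
def kernel : A →+* (W ⧸ H → Y → Q) where
  toFun a := cosetTranslate (a : Y → Q)
  map_zero' := funext fun _ => smul_zero _
  map_one' := funext fun _ => single_odot_one _
  map_add' _ _ := funext fun _ => smul_add _ _ _
  map_mul' _ _ := funext fun _ => single_odot_mul _ _ _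

/-- The ring structure is transported from `A` along evaluation at the generator. Translation acts
by ring automorphisms on functions, so passing to the kernel is a ring homomorphism; it is injective
because the coordinate at the base point gives back the element of `A`. -/
theorem IsGenerator.exists_ringEquiv (h : IsGenerator DQ p) [Finite (W ⧸ H)]
    (hA : ∀ a, a ∈ A ↔ a ∈ DP ∧ ∀ w ∈ H, (single w 1 : SkewMonoidAlgebra Q W) • a = a) :
    ∃ (_ : CommRing (DQ →ₗ[D] DP)) (κ : (DQ →ₗ[D] DP) →+* (W ⧸ H → Y → Q))
      (e : (DQ →ₗ[D] DP) ≃+* A), Function.Injective κ ∧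
      (∀ φ u y, κ φ u y = (φ (h.point u) : Y → Q) y) ∧
      (∀ (φ : DQ →ₗ[D] DP) (f : DQ) (y : Y), (φ f : Y → Q) y =
        ∑ᶠ u : W ⧸ H, κ φ u y * (f : W ⧸ H → Q) u *
          Ring.inverse ((h.point u : W ⧸ H → Q) u)) ∧
      ∀ φ, (e φ : Y → Q) = φ (h.point (1 : W)) := by
  let E : (DQ →ₗ[D] DP) ≃ A := h.homEquiv hA
  have hE (φ) (u) : kernel H A (E φ) u = φ (h.point u) := (h.map_point_eq_cosetTranslate φ u).symm
  let _ := E.commRing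
  let k : (DQ →ₗ[D] DP) →+* A :=
    { toFun := E
      map_one' := E.apply_symm_apply _
      map_zero' := E.apply_symm_apply _
      map_mul' := fun _ _ => E.apply_symm_apply _
      map_add' := fun _ _ => E.apply_symm_apply _ }
  refine ⟨E.commRing, (kernel H A).comp k,
    { E with map_mul' := k.map_mul, map_add' := fun _ _ => rfl },
    fun φ ψ hφ => E.injective ?_, fun φ u y => congrFun (hE φ u) y, fun φ f y => ?_, fun φ => rfl⟩
  · have := congrFun hφ (1 : W)
    exact Subtype.ext ((hE φ _).symm.trans (this.trans (hE ψ _)))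
  · refine (h.map_apply φ f y).trans (finsum_congr fun u => ?_)
    rw [← hE φ u]
    rfl

end Correspondence

end TwistedGroupAlgebra

/-! ### Demazure modules, their invariants, and the main isomorphism -/

namespace RootPairing

open FormalGroupAlgebra SkewMonoidAlgebra TwistedGroupAlgebra

variable {ι R M N : Type*} [CommRing R] [AddCommGroup M] [AddCommGroup N] {F : FormalGroup R}
  {Φ : RootDatum ι M N} {v : Version F}

theorem isUnit_pointFactor [Fintype ι] (b : Φ.Base) (Θ : Set ι) :
    IsUnit (algebraMap _ (Φ.RootLocalization v) (b.pointFactor v Θ)) := by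
  classical
  refine IsLocalization.map_units (Φ.RootLocalization v)
    (⟨_, prod_mem fun i _ => Φ.x_root_mem v i⟩ : Φ.rootElements v)

variable (h : IsRootRing Φ (Φ.RootLocalization v) (xRoot Φ v)) (b : Φ.Base)
  [Fintype Φ.weylGroup]

/-- The dual of the image of the formal affine Demazure algebra in `Q_{W/W_Θ}`, as a submodule for
the `⊙`-action. -/
def IsRootRing.dualSubmodule (Θ : Set ι) : Submodule (b.demazureAlgebra v)
    (Φ.weylGroup ⧸ Φ.parabolicSubgroup Θ → Φ.RootLocalization v) where
  carrier := b.dualParabolic v Θ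
  zero_mem' := (h.mem_dualParabolic_iff b _).2 (zero_mem _)
  add_mem' hf hg := (h.mem_dualParabolic_iff b _).2
    (add_mem ((h.mem_dualParabolic_iff b _).1 hf) ((h.mem_dualParabolic_iff b _).1 hg))
  smul_mem' d _ hf := h.smul_mem_dualParabolic b d.2 hf

/-- The ring of the elements of the dual that are invariant under a parabolic subgroup. -/
def IsRootRing.invariants (ΘQ ΘP : Set ι) :
    Subring (Φ.weylGroup ⧸ Φ.parabolicSubgroup ΘP → Φ.RootLocalization v) where
  carrier := {f | f ∈ b.dualParabolic v ΘP ∧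
    ∀ w ∈ Φ.parabolicSubgroup ΘQ, (single w 1 : Φ.TwistedAlgebra v) • f = f}
  zero_mem' := ⟨(h.dualSubmodule b ΘP).zero_mem, fun w _ => smul_zero _⟩
  one_mem' := ⟨(h.mem_dualParabolic_iff b _).2 h.one_mem_integral, fun w _ => single_odot_one w⟩
  add_mem' hf hg := ⟨(h.dualSubmodule b ΘP).add_mem hf.1 hg.1, fun w hw => by
    rw [smul_add, hf.2 w hw, hg.2 w hw]⟩
  neg_mem' hf := ⟨(h.dualSubmodule b ΘP).neg_mem hf.1, fun w hw => by
    rw [smul_neg, hf.2 w hw]⟩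
  mul_mem' hf hg := ⟨(h.mem_dualParabolic_iff b _).2 (h.mul_mem_integral
    ((h.mem_dualParabolic_iff b _).1 hf.1) ((h.mem_dualParabolic_iff b _).1 hg.1)), fun w hw => by
      rw [single_odot_mul, hf.2 w hw, hg.2 w hw]⟩

/-- The Hecke action of δ_w is right translation of the argument by w. Invariance under W_P
therefore means that the function factors through W/W_P, and pull-back respects integrality and ⊙.
-/
theorem IsRootRing.image_invariants (ΘQ ΘP : Set ι) :
    (fun (f : Φ.weylGroup ⧸ Φ.parabolicSubgroup ΘP → Φ.RootLocalization v)
        (u : Φ.weylGroup) => f (u : Φ.weylGroup ⧸ Φ.parabolicSubgroup ΘP)) ''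
          (h.invariants b ΘQ ΘP : Set _) =
      {g | g ∈ b.dualFull v ∧
        (∀ w ∈ Φ.parabolicSubgroup ΘQ, (single w 1 : Φ.TwistedAlgebra v) • g = g) ∧
        ∀ w ∈ Φ.parabolicSubgroup ΘP, hecke (single w 1 : Φ.TwistedAlgebra v) g = g} := by
  ext g
  constructor
  · rintro ⟨f, ⟨hf, hw⟩, rfl⟩
    refine ⟨(h.mem_dualFull_iff b _).2 ((h.mem_dualParabolic_iff b f).1 hf), fun w hwQ => ?_,
      fun w hwP => ?_⟩
    · funext u
      rw [odot_comp_mk, hw w hwQ]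
    · funext u
      rw [hecke_single]
      exact congrArg f (QuotientGroup.mk_mul_of_mem u hwP)
  · rintro ⟨hg, hQ, hP⟩
    let f : Φ.weylGroup ⧸ Φ.parabolicSubgroup ΘP → Φ.RootLocalization v :=
      Quotient.lift g fun u w huw => by
        have := congrFun (hP _ (QuotientGroup.leftRel_apply.1 huw)) u
        rw [hecke_single, mul_inv_cancel_left] at this
        exact this.symm
    have hf : (fun u : Φ.weylGroup => f u) = g := rfl
    refine ⟨f, ⟨(h.mem_dualParabolic_iff b f).2 ((h.mem_dualFull_iff b g).1 hg), fun w hw => ?_⟩,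
      hf⟩
    funext u
    obtain ⟨u, rfl⟩ := QuotientGroup.mk_surjective u
    rw [← odot_comp_mk, hf, hQ w hw]
    rfl

theorem IsRootRing.isGenerator_pointClass [Fintype ι] [Φ.IsReduced] [F.IsComm] {b : Φ.Base}
    {Θ : Set ι} (hΘ : Θ ⊆ b.support) :
    IsGenerator (h.dualSubmodule b Θ) (b.pointClass v Θ) where
  single_mem := h.single_mem b
  mem := h.pointClass_mem hΘ
  exists_smul_eq _ hf := h.exists_smul_pointClass_eq hΘ hf
  single_smul _ hw := h.single_smul_pointClass_of_mem hΘ hw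
  isUnit := by
    classical
    rw [Base.pointClass, Pi.single_eq_same]
    exact isUnit_pointFactor b Θ
  eq_zero u hu := by
    classical
    rw [Base.pointClass, Pi.single_eq_of_ne hu]

end RootPairing

end

open FormalGroupAlgebra RootPairing SkewMonoidAlgebra TwistedGroupAlgebra in
theorem mainTheorem11 {ι R M N : Type*} [Fintype ι] [CommRing R] [AddCommGroup M] [AddCommGroup N]
    [Module.Finite ℤ M] [Module.Finite ℤ N]
    (Φ : RootDatum ι M N) [Φ.IsReduced]
    (hss : ∀ m : M, ∃ n : ℤ, n ≠ 0 ∧ n • m ∈ Submodule.span ℤ (Set.range Φ.root))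
    (b : Φ.Base) (ΘP ΘQ : Set ι) (hP : ΘP ⊆ b.support) (hQ : ΘQ ⊆ b.support)
    (F : FormalGroup R) [F.IsComm] (v : Version F)
    (hreg : ∀ i, x v (Φ.root i) ∈ nonZeroDivisors (FormalGroupAlgebra v M)) :
    ∃ (DQ : Submodule (b.demazureAlgebra v)
          (Φ.weylGroup ⧸ Φ.parabolicSubgroup ΘQ → Φ.RootLocalization v))
      (DP : Submodule (b.demazureAlgebra v)
          (Φ.weylGroup ⧸ Φ.parabolicSubgroup ΘP → Φ.RootLocalization v))
      (A : Subring (Φ.weylGroup ⧸ Φ.parabolicSubgroup ΘP → Φ.RootLocalization v))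
      (pt : Φ.weylGroup ⧸ Φ.parabolicSubgroup ΘQ → DQ),
      -- `DQ`, `DP` are the duals, with the `⊙`-action
      (DQ : Set _) = b.dualParabolic v ΘQ ∧
      (DP : Set _) = b.dualParabolic v ΘP ∧
      -- `A` is the ring of `W_Q`-invariants of `DP`
      (A : Set _) = {f | f ∈ b.dualParabolic v ΘP ∧
        ∀ w ∈ Φ.parabolicSubgroup ΘQ, (single w 1 : Φ.TwistedAlgebra v) • f = f} ∧
      (fun (f : Φ.weylGroup ⧸ Φ.parabolicSubgroup ΘP → Φ.RootLocalization v)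
          (u : Φ.weylGroup) => f (u : Φ.weylGroup ⧸ Φ.parabolicSubgroup ΘP)) '' (A : Set _) =
        {g | g ∈ b.dualFull v ∧
          (∀ w ∈ Φ.parabolicSubgroup ΘQ, (single w 1 : Φ.TwistedAlgebra v) • g = g) ∧
          ∀ w ∈ Φ.parabolicSubgroup ΘP, hecke (single w 1 : Φ.TwistedAlgebra v) g = g} ∧
      -- the classes of the fixed points of the flag variety of `Q`
      (∀ w : Φ.weylGroup, ((pt w : DQ) : Φ.weylGroup ⧸ Φ.parabolicSubgroup ΘQ → Φ.RootLocalization v) =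
        (single w 1 : Φ.TwistedAlgebra v) • b.pointClass v ΘQ) ∧
      -- the additive group `Hom(DQ, DP)` is a ring for the coordinatewise product (its addition
      -- is the usual one, because `κ` is injective and additive)
      ∃ (_ : CommRing (DQ →ₗ[b.demazureAlgebra v] DP))
        (κ : (DQ →ₗ[b.demazureAlgebra v] DP) →+*
          (Φ.weylGroup ⧸ Φ.parabolicSubgroup ΘQ → Φ.weylGroup ⧸ Φ.parabolicSubgroup ΘP →
            Φ.RootLocalization v))
        (e : (DQ →ₗ[b.demazureAlgebra v] DP) ≃+* A),
        Function.Injective κ ∧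
        (∀ φ u y, κ φ u y =
          (φ (pt u) : Φ.weylGroup ⧸ Φ.parabolicSubgroup ΘP → Φ.RootLocalization v) y) ∧
        -- `φ` is the correspondence with kernel `κ φ` (integration over the fixed points)
        (∀ (φ : DQ →ₗ[b.demazureAlgebra v] DP) (f : DQ) (y : Φ.weylGroup ⧸ Φ.parabolicSubgroup ΘP),
          (φ f : Φ.weylGroup ⧸ Φ.parabolicSubgroup ΘP → Φ.RootLocalization v) y =
            ∑ᶠ u : Φ.weylGroup ⧸ Φ.parabolicSubgroup ΘQ, κ φ u y *
              (f : Φ.weylGroup ⧸ Φ.parabolicSubgroup ΘQ → Φ.RootLocalization v) u *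
              Ring.inverse ((pt u :
                Φ.weylGroup ⧸ Φ.parabolicSubgroup ΘQ → Φ.RootLocalization v) u)) ∧
        -- the isomorphism is evaluation at the class of the base point
        ∀ φ, (e φ : Φ.weylGroup ⧸ Φ.parabolicSubgroup ΘP → Φ.RootLocalization v) =
          φ (pt ((1 : Φ.weylGroup) : Φ.weylGroup ⧸ Φ.parabolicSubgroup ΘQ)) := by
  have := b.finite_weylGroup
  have := Fintype.ofFinite Φ.weylGroup
  have h : IsRootRing Φ (Φ.RootLocalization v) (xRoot Φ v) := isRootRing_formalGroupAlgebra v hreg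
  have hp := h.isGenerator_pointClass hQ
  exact ⟨h.dualSubmodule b ΘQ, h.dualSubmodule b ΘP, h.invariants b ΘQ ΘP, hp.point, rfl, rfl,
    rfl, h.image_invariants b ΘQ ΘP, hp.coe_point, hp.exists_ringEquiv fun _ => Iff.rfl⟩
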